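/- **Setting.** Let $f_a,f_b$ be probability densities on $(0,1)$ with $0<m\le f_a,f_b\le M<\infty$, and let $F_a,F_b$ be their distribution functions. Bids and asks arrive as independent Poisson processes of unit rate (that is, orders arrive at rate $2$ and are bids or asks with probability $1/2$ each); bid prices are i.i.d. with density $f_b$, ask prices are i.i.d. with density $f_a$, everything independent. Given a nondecreasing $\mathcal P:[0,1]\to[0,1]$ with finite image (its level sets are the *bins*; $[x]$ denotes the bin containing $x$), a bid at $p$ and an ask at $q$ are compatible if $\mathcal P(q)\le\mathcal P(p)$. An arriving bid removes the lowest ask from the book if some queued ask is compatible with it, and joins the book otherwise; an arriving ask removes the highest bid if some queued bid is compatible with it, and joins the book otherwise. The initial book is finite, deterministic, with prices in $[0,1]$, and has no compatible bid–ask pair. The thresholds of the binned book are $$\kappa_b=\sup\{x\in[0,1]:\text{a.s. only finitely many bids depart from prices}\le x\},\qquad \kappa_a=\inf\{x\in[0,1]:\text{a.s. only finitely many asks depart from prices}\ge x\}.$$ Consider a sequence (indexed by $N$) of such binned books, driven by the same arrivals, for which the maximal bin length tends to $0$ (so the number of bins tends to infinity), with thresholds $\kappa_b(N),\kappa_a(N)$.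 For each $N$ and $\varepsilon>0$ let $T_n=T_n(N,\varepsilon)\to\infty$ be a sequence of times at which there are no bids above $\sup[\kappa_b(N)]+\varepsilon$ and at most $2(M+1)\varepsilon T_n$ asks below $\inf[\kappa_a(N)]-\varepsilon$. Put $$\pi_b(n,N,\varepsilon,x)=\frac{\text{time up to }T_n\text{ that the highest bid is in }[x]}{T_n\cdot\text{length of }[x]},$$ and define $\pi_a(n,N,\varepsilon,x)$ in the same way with the lowest ask. **Proposition (weak distribution of the highest bid).** There are numbers $0<\kappa_b<\kappa_a<1$ and probability densities $\pi_b,\pi_a$ vanishing outside $(\kappa_b,\kappa_a)$, depending only on $f_a,f_b$, such that, with $\varpi_b=\pi_b/f_b$ and $\varpi_a=\pi_a/f_a$, the following hold for every sequence of binned books as above. 1. $\kappa_b(N)\to\kappa_b$ and $\kappa_a(N)\to\kappa_a$. Almost surely, times $T_n(N,\varepsilon)$ as above exist for all $N$ and all $\varepsilon>0$, and for every choice of them $\pi_b(n,N,\varepsilon)\to\pi_b$ and $\pi_a(n,N,\varepsilon)\to\pi_a$ in $L^1(0,1)$ as $n\to\infty$ and then $N\to\infty$, $\varepsilon\downarrow0$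 jointly in any manner: for every $\eta>0$ there are $N_0,\varepsilon_0$ such that for all $N\ge N_0$ and $0<\varepsilon<\varepsilon_0$ the $L^1$ distance is less than $\eta$ for all sufficiently large $n$. The limits are unique almost everywhere. 2. For $x\in(\kappa_b,\kappa_a)$, $$F_a(x)\varpi_b(x)=\int_x^1\varpi_a f_a\,dy,\quad \int_{\kappa_b}^{\kappa_a}\varpi_b f_b\,dx=1,\qquad (1-F_b(x))\varpi_a(x)=\int_0^x\varpi_b f_b\,dy,\quad \int_{\kappa_b}^{\kappa_a}\varpi_a f_a\,dx=1.$$ 3. On $(\kappa_b,\kappa_a)$ the function $\varpi_b$ satisfies $$\Big(-\frac{1-F_b}{f_a}(F_a\varpi_b)'\Big)'=\varpi_b f_b \qquad(\ast)$$ in the Carathéodory sense ($F_a\varpi_b$ has an a.e. derivative, $-\frac{1-F_b}{f_a}(F_a\varpi_b)'$ agrees a.e. with a function $v$, both $F_a\varpi_b$ and $v$ are locally absolutely continuous, and $v'=\varpi_bf_b$ a.e.), with initial conditions $F_a\varpi_b|_{x=\kappa_b}=1$, $(F_a\varpi_b)'|_{x=\kappa_b}=0$ (one-sided limit and derivative from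 the right) and with $\varpi_b(x)\to0$ as $x\uparrow\kappa_a$. It satisfies $(\ast)$ classically at every $x\in(\kappa_b,\kappa_a)$ such that $F_a'=f_a$ in a neighbourhood of $x$ and $F_b'(x)=f_b(x)$, and $\varpi_b$ is then differentiable near $x$. Symmetrically, $\varpi_a$ satisfies $\big(\frac{F_a}{f_b}((1-F_b)\varpi_a)'\big)'=-\varpi_a f_a$ with $(1-F_b)\varpi_a|_{x=\kappa_a}=1$, $((1-F_b)\varpi_a)'|_{x=\kappa_a}=0$ (from the left), $\varpi_a(x)\to0$ as $x\downarrow\kappa_b$, and the same classical statement with the roles of $a$ and $b$ exchanged. 4. Uniqueness: if $0\le\kappa_b'<\kappa_a'\le1$ and $w$ satisfies $(\ast)$ on $(\kappa_b',\kappa_a')$ in the Carathéodory sense, with $F_aw|_{\kappa_b'}=1$, $(F_aw)'|_{\kappa_b'}=0$, $w(x)\to0$ as $x\uparrow\kappa_a'$ and $\int_{\kappa_b'}^{\kappa_a'}wf_b\,dx=1$, then $\kappa_b'=\kappa_b$, $\kappa_a'=\kappa_a$ and $w=\varpi_b$ on $(\kappa_b,\kappa_a)$. The corresponding uniqueness holds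 for the ask equation, with normalization $\int wf_a=1$. -/

import Mathlib

open Set Filter Topology MeasureTheory ProbabilityTheory
open scoped ENNReal

namespace LOB

noncomputable section

/-! ### Order prices and arrivals -/

/-- A density on `(0,1)` (values elsewhere are irrelevant) which is bounded below by `m` and
above by `M`. -/
structure IsPriceDensity (f : ℝ → ℝ) (m M : ℝ) : Prop where
  measurable : Measurable f
  lower : ∀ x ∈ Ioo (0 : ℝ) 1, m ≤ f x
  upper : ∀ x ∈ Ioo (0 : ℝ) 1, f x ≤ M
  integral_eq_one : ∫ x in (0 : ℝ)..1, f x = 1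

/-- The distribution function on `[0,1]` of the density `f`. -/
def cdf (f : ℝ → ℝ) (x : ℝ) : ℝ := ∫ y in (0 : ℝ)..x, f y

/-- The law on `(0,1)` with density `f`. -/
def priceLaw (f : ℝ → ℝ) : Measure ℝ :=
  (volume.restrict (Ioo (0 : ℝ) 1)).withDensity (fun x => ENNReal.ofReal (f x))

/-- An order is a pair (type, price), where `true` is the type of bids and `false` that of asks. -/
abbrev Order := Bool × ℝ

/-- The law of an arriving order: a bid or an ask with probability `1/2` each, whose price has
density `fb` if it is a bid and `fa` if it is an ask. -/
def orderLaw (fa fb : ℝ → ℝ) : Measure Order :=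
  (2⁻¹ : ℝ≥0∞) • (Measure.dirac true).prod (priceLaw fb) +
    (2⁻¹ : ℝ≥0∞) • (Measure.dirac false).prod (priceLaw fa)

/-- Orders arrive as a Poisson process of rate `2` (unit rate for bids and unit rate for asks) with
i.i.d. labels: `gap n` is the time between the arrivals of the orders `n - 1` and `n`
(the waiting time for the first order if `n = 0`), and `order n` is the `n`-th order. -/
structure IsOrderFlow {Ω : Type*} [MeasurableSpace Ω] (μ : Measure Ω) (fa fb : ℝ → ℝ)
    (gap : ℕ → Ω → ℝ) (order : ℕ → Ω → Order) : Prop where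
  measurable_gap : ∀ n, Measurable (gap n)
  measurable_order : ∀ n, Measurable (order n)
  indep : iIndepFun (fun n ω => (gap n ω, order n ω)) μ
  law : ∀ n, μ.map (fun ω => (gap n ω, order n ω)) = (expMeasure 2).prod (orderLaw fa fb)

/-! ### The limit order book -/

/-- A finite limit order book: the prices, with multiplicity, of the queued bids and asks. -/
structure Book where
  bids : Multiset ℝ
  asks : Multiset ℝ

/-- The highest bid (meaningful if there are bids). -/
def Book.bestBid (b : Book) : ℝ := sSup {p | p ∈ b.bids}

/-- The lowest ask (meaningful if there are asks). -/
def Book.bestAsk (b : Book) : ℝ := sInf {q | q ∈ b.asks}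

/-- An admissible initial state for the price equivalence function `P`: prices in `[0,1]`, and no
compatible bid-ask pair. -/
def Book.Admissible (P : ℝ → ℝ) (b : Book) : Prop :=
  (∀ p ∈ b.bids, p ∈ Icc (0 : ℝ) 1) ∧ (∀ q ∈ b.asks, q ∈ Icc (0 : ℝ) 1) ∧
    ∀ p ∈ b.bids, ∀ q ∈ b.asks, ¬ P q ≤ P p

/-- The change of the book when the order `o` arrives. A bid removes the lowest ask if there is a
compatible ask, and joins the book otherwise; an ask removes the highest bid if there is a
compatible bid, and joins the book otherwise. -/
def Book.step (P : ℝ → ℝ) (b : Book) (o : Order) : Book :=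
  open Classical in
  if o.1 = true then
    if ∃ q ∈ b.asks, P q ≤ P o.2 then ⟨b.bids, b.asks.erase b.bestAsk⟩
    else ⟨o.2 ::ₘ b.bids, b.asks⟩
  else
    if ∃ p ∈ b.bids, P o.2 ≤ P p then ⟨b.bids.erase b.bestBid, b.asks⟩
    else ⟨b.bids, o.2 ::ₘ b.asks⟩

/-- The book after the first `n` arrivals of the sequence `o` of orders. -/
def bookAfter (P : ℝ → ℝ) (init : Book) (o : ℕ → Order) : ℕ → Book
  | 0 => init
  | n + 1 => (bookAfter P init o n).step P (o n)

/-- The arrival time of the `n`-th order. -/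
def arrivalTime (g : ℕ → ℝ) (n : ℕ) : ℝ := ∑ i ∈ Finset.range (n + 1), g i

/-- The number of orders which have arrived up to and including time `t`. -/
def arrivalCount (g : ℕ → ℝ) (t : ℝ) : ℕ := {n : ℕ | arrivalTime g n ≤ t}.ncard

/-- The book at time `t`. -/
def bookAt (P : ℝ → ℝ) (init : Book) (g : ℕ → ℝ) (o : ℕ → Order) (t : ℝ) : Book :=
  bookAfter P init o (arrivalCount g t)

/-- The order `n` removes from the book a bid whose price is at most `x`. -/
def BidDeparts (P : ℝ → ℝ) (init : Book) (o : ℕ → Order) (x : ℝ) (n : ℕ) : Prop :=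
  (o n).1 = false ∧ (∃ p ∈ (bookAfter P init o n).bids, P (o n).2 ≤ P p) ∧
    (bookAfter P init o n).bestBid ≤ x

/-- The order `n` removes from the book an ask whose price is at least `x`. -/
def AskDeparts (P : ℝ → ℝ) (init : Book) (o : ℕ → Order) (x : ℝ) (n : ℕ) : Prop :=
  (o n).1 = true ∧ (∃ q ∈ (bookAfter P init o n).asks, P q ≤ P (o n).2) ∧
    x ≤ (bookAfter P init o n).bestAsk

/-- The bid threshold: the supremum of the prices `x` such that almost surely only finitely many
bids ever depart from prices at most `x`. -/
def bidThreshold {Ω : Type*} [MeasurableSpace Ω] (μ : Measure Ω) (P : ℝ → ℝ) (init : Book)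
    (order : ℕ → Ω → Order) : ℝ :=
  sSup {x ∈ Icc (0 : ℝ) 1 | ∀ᵐ ω ∂μ, {n | BidDeparts P init (fun i => order i ω) x n}.Finite}

/-- The ask threshold: the infimum of the prices `x` such that almost surely only finitely many
asks ever depart from prices at least `x`. -/
def askThreshold {Ω : Type*} [MeasurableSpace Ω] (μ : Measure Ω) (P : ℝ → ℝ) (init : Book)
    (order : ℕ → Ω → Order) : ℝ :=
  sInf {x ∈ Icc (0 : ℝ) 1 | ∀ᵐ ω ∂μ, {n | AskDeparts P init (fun i => order i ω) x n}.Finite}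

/-! ### Binned books and empirical densities -/

/-- A binned price equivalence function: nondecreasing from `[0,1]` to `[0,1]` with finite image. -/
structure IsBinned (P : ℝ → ℝ) : Prop where
  monotoneOn : MonotoneOn P (Icc 0 1)
  mapsTo : MapsTo P (Icc 0 1) (Icc 0 1)
  finite_image : (P '' Icc 0 1).Finite

/-- The bin containing the price `x`. -/
def bin (P : ℝ → ℝ) (x : ℝ) : Set ℝ := {y ∈ Icc (0 : ℝ) 1 | P y = P x}

/-- A sequence of price equivalence functions all of whose bins become short (so that, in
particular, the number of bins tends to infinity). -/
def BinsShrink (P : ℕ → ℝ → ℝ) : Prop :=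
  ∀ η > 0, ∀ᶠ N in atTop, ∀ x ∈ Icc (0 : ℝ) 1, volume.real (bin (P N) x) < η

/-- The normalized empirical density at `x` of the highest bid over the time interval `[0,t]`. -/
def bidDensity (P : ℝ → ℝ) (init : Book) (g : ℕ → ℝ) (o : ℕ → Order) (t x : ℝ) : ℝ :=
  volume.real {s ∈ Icc 0 t | (bookAt P init g o s).bids ≠ 0 ∧
      (bookAt P init g o s).bestBid ∈ bin P x} / (t * volume.real (bin P x))

/-- The normalized empirical density at `x` of the lowest ask over the time interval `[0,t]`. -/
def askDensity (P : ℝ → ℝ) (init : Book) (g : ℕ → ℝ) (o : ℕ → Order) (t x : ℝ) : ℝ :=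
  volume.real {s ∈ Icc 0 t | (bookAt P init g o s).asks ≠ 0 ∧
      (bookAt P init g o s).bestAsk ∈ bin P x} / (t * volume.real (bin P x))

/-- `T` is a sequence of times, tending to infinity, at which there are no bids more than `ε` above
the bin of the threshold `κb`, and at most `2 (M + 1) ε T n` asks more than `ε` below the bin of the
threshold `κa`. -/
def IsGoodTimes (P : ℝ → ℝ) (init : Book) (g : ℕ → ℝ) (o : ℕ → Order) (κb κa M ε : ℝ)
    (T : ℕ → ℝ) : Prop :=
  Tendsto T atTop atTop ∧
    ∀ n, (∀ p ∈ (bookAt P init g o (T n)).bids, p ≤ sSup (bin P κb) + ε) ∧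
      (((bookAt P init g o (T n)).asks.filter (fun q => q < sInf (bin P κa) - ε)).card : ℝ)
        ≤ 2 * (M + 1) * ε * T n

/-- Convergence in `L¹(0,1)` of the family `d N ε n` of densities to `ρ`, as `n → ∞` and then
`N → ∞`, `ε ↓ 0` jointly (in any manner). -/
def ConvergesTo (d : ℕ → ℝ → ℕ → ℝ → ℝ) (ρ : ℝ → ℝ) : Prop :=
  ∀ η > 0, ∀ᶠ p : ℕ × ℝ in atTop ×ˢ 𝓝[>] (0 : ℝ), ∀ᶠ n in atTop,
    ∫⁻ x in Ioo (0 : ℝ) 1, ENNReal.ofReal |d p.1 p.2 n x - ρ x| < ENNReal.ofReal η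

/-! ### The limiting equations -/

/-- `ρ` is a probability density carried by `(κb, κa)`. -/
structure IsDensityOn (κb κa : ℝ) (ρ : ℝ → ℝ) : Prop where
  nonneg : ∀ x, 0 ≤ ρ x
  support : ∀ x, x ∉ Ioo κb κa → ρ x = 0
  integrable : Integrable ρ
  integral_eq_one : ∫ x, ρ x = 1

/-- The balance integral equations, for `wb = πb / fb` and `wa = πa / fa`. -/
structure BalanceEquations (fa fb : ℝ → ℝ) (κb κa : ℝ) (wb wa : ℝ → ℝ) : Prop where
  integrable_bid : IntegrableOn (fun y => wb y * fb y) (Ioo 0 1)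
  integrable_ask : IntegrableOn (fun y => wa y * fa y) (Ioo 0 1)
  bid : ∀ x ∈ Ioo κb κa, cdf fa x * wb x = ∫ y in x..1, wa y * fa y
  bid_norm : ∫ x in κb..κa, wb x * fb x = 1
  ask : ∀ x ∈ Ioo κb κa, (1 - cdf fb x) * wa x = ∫ y in (0 : ℝ)..x, wb y * fb y
  ask_norm : ∫ x in κb..κa, wa x * fa x = 1

/-- `w` is a (Carathéodory) solution of the bid equation
`(-((1 - F_b) / f_a) (F_a w)')' = w f_b` on `(κb, κa)`: the function `F_a w` and the quasi-derivative
`v = -((1 - F_b) / f_a) (F_a w)'` are locally absolutely continuous, and the equations hold almost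
everywhere. -/
def SolvesBidODE (fa fb : ℝ → ℝ) (κb κa : ℝ) (w : ℝ → ℝ) : Prop :=
  ∃ v : ℝ → ℝ,
    (∀ x ∈ Ioo κb κa, ∀ y ∈ Ioo κb κa,
      AbsolutelyContinuousOnInterval (fun z => cdf fa z * w z) x y ∧
      AbsolutelyContinuousOnInterval v x y) ∧
    ∀ᵐ x, x ∈ Ioo κb κa →
      v x = -((1 - cdf fb x) / fa x) * deriv (fun z => cdf fa z * w z) x ∧
      HasDerivAt v (w x * fb x) x

/-- `w` is a (Carathéodory) solution of the ask equation
`((F_a / f_b) ((1 - F_b) w)')' = - w f_a` on `(κb, κa)`. -/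
def SolvesAskODE (fa fb : ℝ → ℝ) (κb κa : ℝ) (w : ℝ → ℝ) : Prop :=
  ∃ v : ℝ → ℝ,
    (∀ x ∈ Ioo κb κa, ∀ y ∈ Ioo κb κa,
      AbsolutelyContinuousOnInterval (fun z => (1 - cdf fb z) * w z) x y ∧
      AbsolutelyContinuousOnInterval v x y) ∧
    ∀ᵐ x, x ∈ Ioo κb κa →
      v x = (cdf fa x / fb x) * deriv (fun z => (1 - cdf fb z) * w z) x ∧
      HasDerivAt v (-(w x * fa x)) x

/-- The bid equation holds classically at `x`. -/
def BidODEAt (fa fb w : ℝ → ℝ) (x : ℝ) : Prop :=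
  (∀ᶠ y in 𝓝 x, DifferentiableAt ℝ w y) ∧
  (∀ᶠ y in 𝓝 x, DifferentiableAt ℝ (fun z => cdf fa z * w z) y) ∧
  HasDerivAt (fun y => -((1 - cdf fb y) / fa y) * deriv (fun z => cdf fa z * w z) y)
    (w x * fb x) x

/-- The ask equation holds classically at `x`. -/
def AskODEAt (fa fb w : ℝ → ℝ) (x : ℝ) : Prop :=
  (∀ᶠ y in 𝓝 x, DifferentiableAt ℝ w y) ∧
  (∀ᶠ y in 𝓝 x, DifferentiableAt ℝ (fun z => (1 - cdf fb z) * w z) y) ∧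
  HasDerivAt (fun y => (cdf fa y / fb y) * deriv (fun z => (1 - cdf fb z) * w z) y)
    (-(w x * fa x)) x

/-- The bid problem: the bid equation on `(κb, κa)`, the initial conditions `F_a w = 1` and
`(F_a w)' = 0` at `κb` (as one-sided limit and one-sided derivative), the constraint `w x → 0` as
`x ↑ κa`, and the normalization `∫ w f_b = 1` over `(κb, κa)`. -/
structure IsBidSolution (fa fb : ℝ → ℝ) (κb κa : ℝ) (w : ℝ → ℝ) : Prop where
  ode : SolvesBidODE fa fb κb κa w
  initial_value : Tendsto (fun x => cdf fa x * w x) (𝓝[>] κb) (𝓝 1)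
  initial_deriv : Tendsto (fun x => (cdf fa x * w x - 1) / (x - κb)) (𝓝[>] κb) (𝓝 0)
  terminal : Tendsto w (𝓝[<] κa) (𝓝 0)
  integrable : IntegrableOn (fun x => w x * fb x) (Ioo κb κa)
  norm : ∫ x in κb..κa, w x * fb x = 1

/-- The ask problem: the ask equation on `(κb, κa)`, the conditions `(1 - F_b) w = 1` and
`((1 - F_b) w)' = 0` at `κa`, the constraint `w x → 0` as `x ↓ κb`, and the normalization
`∫ w f_a = 1` over `(κb, κa)`. -/
structure IsAskSolution (fa fb : ℝ → ℝ) (κb κa : ℝ) (w : ℝ → ℝ) : Prop where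
  ode : SolvesAskODE fa fb κb κa w
  initial_value : Tendsto (fun x => (1 - cdf fb x) * w x) (𝓝[<] κa) (𝓝 1)
  initial_deriv : Tendsto (fun x => ((1 - cdf fb x) * w x - 1) / (x - κa)) (𝓝[<] κa) (𝓝 0)
  terminal : Tendsto w (𝓝[>] κb) (𝓝 0)
  integrable : IntegrableOn (fun x => w x * fa x) (Ioo κb κa)
  norm : ∫ x in κb..κa, w x * fa x = 1

end

end LOB

namespace LOB

set_option linter.unusedSectionVars false

noncomputable section

/-! ### Distribution functions -/

/-! Let `A x` be the long-run fraction of time during which no ask lies at or below `x`, and `B x`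
the fraction of time during which no bid lies at or above `x`. Bids join a short block of prices
near `x` at rate `f_b dx`, and only while no ask is compatible with them; the block loses bids only
when the best bid is in it and an ask at or below it arrives. If the number of bids waiting in the
block is negligible compared with time, both flows agree: `F_a dB = f_b A dx`, and symmetrically
`-(1 - F_b) dA = f_a B dx`. Below the bid threshold bids are always present, so `B = 0` and `A = 1`
there; above the ask threshold `A = 0` and `B = 1`. The numbers of queued bids and asks differ by a
random walk, hence by `o(n)`, which yields the balance `F_b(κb) = 1 - F_a(κa)` of the orders that
stay forever (`cdf_bidThreshold`).

The limiting boundary problem is explicit. The quantity `F_a B + (1 - F_b) A` is conserved, so the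
system reduces to the quadrature `(B / (1 - F_b))' = c f_b / (F_a (1 - F_b)^2)`
(`quotient_formula`). The boundary values leave two equations for the two thresholds; a monotonicity
argument gives uniqueness (`thresholds_unique`), and the divergence of the kernel's integral at `0`
gives existence (`exists_thresholds`). The second-order equations are this system with one unknown
eliminated, the other one being the quasi-derivative; the vanishing initial derivative is exactly
what fixes its constant of integration.

For a fixed binned book, two deterministic counting inequalities compare the flows through a block
of bins (`bidCount_add_count_le`, `le_bidCount_add_count`). A law of large numbers for predictable
events (`tendsto_average_predictable`) replaces each count by an arrival probability times a
fraction of arrivals, and the independent waiting times turn these into fractions of time. One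
inequality always holds; the converse costs the number of bids left in the block at the final time,
and good times are those at which this number is small. They exist by a zero-one law (the book
forgets its initial state up to a bounded error), a conditional Borel-Cantelli lemma and the balance
of the thresholds (`frequently_good`). Every statement about asks is the statement about bids for
the book reflected by `x ↦ 1 - x`.

As the bins shrink and `ε` tends to `0`, the thresholds and the two fractions stay in a compact set,
and each limit point satisfies exact inequalities (`LimitInequalities`) which force the boundary
problem. Its solution is unique, so everything converges (`ApproxInequalities.tendsto`). The
empirical density obeys an asymptotic pointwise upper bound by the limit density away from `0`, and
has almost full mass; as in Scheffé's lemma this upgrades to convergence in `L¹`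
(`tendsto_mean_of_upper_bound`). -/

/-- The standing assumption on the two price densities. -/
structure DensityPair (fa fb : ℝ → ℝ) (m M : ℝ) : Prop where
  pos : 0 < m
  ask : IsPriceDensity fa m M
  bid : IsPriceDensity fb m M

namespace IsPriceDensity

variable {f : ℝ → ℝ} {m M : ℝ}

lemma integrableOn_Ioo (hf : IsPriceDensity f m M) (hm : 0 < m) :
    IntegrableOn f (Ioo 0 1) := by
  refine Measure.integrableOn_of_bounded (M := M) (by simp) hf.measurable.aestronglyMeasurable ?_
  filter_upwards [ae_restrict_mem measurableSet_Ioo] with x hx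
  rw [Real.norm_eq_abs, abs_of_nonneg (hm.le.trans (hf.lower x hx))]
  exact hf.upper x hx

lemma intervalIntegrable (hf : IsPriceDensity f m M) (hm : 0 < m) {x y : ℝ}
    (hx : x ∈ Icc (0 : ℝ) 1) (hy : y ∈ Icc (0 : ℝ) 1) : IntervalIntegrable f volume x y := by
  have h : IntervalIntegrable f volume 0 1 := by
    rw [intervalIntegrable_iff_integrableOn_Ioo_of_le zero_le_one]
    exact hf.integrableOn_Ioo hm
  refine h.mono_set ?_
  rw [uIcc_of_le (zero_le_one' ℝ)]
  exact uIcc_subset_Icc hx hy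

lemma le_bound (hf : IsPriceDensity f m M) : m ≤ M :=
  (hf.lower 2⁻¹ (by norm_num)).trans (hf.upper 2⁻¹ (by norm_num))

lemma cdf_sub (hf : IsPriceDensity f m M) (hm : 0 < m) {x y : ℝ}
    (hx : x ∈ Icc (0 : ℝ) 1) (hy : y ∈ Icc (0 : ℝ) 1) : cdf f y - cdf f x = ∫ z in x..y, f z := by
  unfold cdf
  have h0 : (0 : ℝ) ∈ Icc (0 : ℝ) 1 := by simp
  exact intervalIntegral.integral_interval_sub_left (hf.intervalIntegrable hm h0 hy)
    (hf.intervalIntegrable hm h0 hx)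

lemma cdf_zero : cdf f 0 = 0 := by simp [cdf]

lemma cdf_one (hf : IsPriceDensity f m M) : cdf f 1 = 1 := hf.integral_eq_one

lemma le_cdf_sub (hf : IsPriceDensity f m M) (hm : 0 < m) {x y : ℝ}
    (hx : 0 ≤ x) (hxy : x ≤ y) (hy : y ≤ 1) : m * (y - x) ≤ cdf f y - cdf f x := by
  rw [hf.cdf_sub hm ⟨hx, hxy.trans hy⟩ ⟨hx.trans hxy, hy⟩]
  have : ∫ z in x..y, m = m * (y - x) := by simp [mul_comm]
  rw [← this]
  refine intervalIntegral.integral_mono_on_of_le_Ioo hxy (by simp)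
    (hf.intervalIntegrable hm ⟨hx, hxy.trans hy⟩ ⟨hx.trans hxy, hy⟩) fun z hz => ?_
  exact hf.lower z ⟨hx.trans_lt hz.1, hz.2.trans_le hy⟩

lemma cdf_sub_le (hf : IsPriceDensity f m M) (hm : 0 < m) {x y : ℝ}
    (hx : 0 ≤ x) (hxy : x ≤ y) (hy : y ≤ 1) : cdf f y - cdf f x ≤ M * (y - x) := by
  rw [hf.cdf_sub hm ⟨hx, hxy.trans hy⟩ ⟨hx.trans hxy, hy⟩]
  have : ∫ z in x..y, M = M * (y - x) := by simp [mul_comm]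
  rw [← this]
  refine intervalIntegral.integral_mono_on_of_le_Ioo hxy
    (hf.intervalIntegrable hm ⟨hx, hxy.trans hy⟩ ⟨hx.trans hxy, hy⟩) (by simp) fun z hz => ?_
  exact hf.upper z ⟨hx.trans_lt hz.1, hz.2.trans_le hy⟩

lemma strictMonoOn_cdf (hf : IsPriceDensity f m M) (hm : 0 < m) :
    StrictMonoOn (cdf f) (Icc 0 1) := by
  intro x hx y hy hxy
  have := hf.le_cdf_sub hm hx.1 hxy.le hy.2
  nlinarith

lemma lipschitzOnWith_cdf (hf : IsPriceDensity f m M) (hm : 0 < m) :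
    LipschitzOnWith M.toNNReal (cdf f) (Icc 0 1) := by
  have hM : 0 ≤ M := hm.le.trans hf.le_bound
  refine LipschitzOnWith.of_dist_le_mul fun x hx y hy => ?_
  rw [Real.coe_toNNReal _ hM, Real.dist_eq, Real.dist_eq]
  wlog hxy : x ≤ y generalizing x y
  · rw [abs_sub_comm, abs_sub_comm x]
    exact this y hy x hx (le_of_not_ge hxy)
  rw [abs_sub_comm, abs_sub_comm x, abs_of_nonneg (sub_nonneg.2 hxy), abs_of_nonneg]
  · exact hf.cdf_sub_le hm hx.1 hxy hy.2
  · have := hf.le_cdf_sub hm hx.1 hxy hy.2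
    have := mul_nonneg hm.le (sub_nonneg.2 hxy)
    linarith

lemma continuousOn_cdf (hf : IsPriceDensity f m M) (hm : 0 < m) :
    ContinuousOn (cdf f) (Icc 0 1) := (hf.lipschitzOnWith_cdf hm).continuousOn

lemma cdf_mem_Icc (hf : IsPriceDensity f m M) (hm : 0 < m) {x : ℝ} (hx : x ∈ Icc (0 : ℝ) 1) :
    cdf f x ∈ Icc (0 : ℝ) 1 := by
  have h := (hf.strictMonoOn_cdf hm).monotoneOn
  constructor
  · simpa [cdf_zero] using h (by simp) hx hx.1
  · simpa [hf.cdf_one] using h hx (by simp) hx.2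

lemma cdf_pos (hf : IsPriceDensity f m M) (hm : 0 < m) {x : ℝ} (hx : 0 < x) (hx' : x ≤ 1) :
    0 < cdf f x := by
  simpa [cdf_zero] using hf.strictMonoOn_cdf hm (by simp) ⟨hx.le, hx'⟩ hx

lemma cdf_lt_one (hf : IsPriceDensity f m M) (hm : 0 < m) {x : ℝ} (hx : 0 ≤ x) (hx' : x < 1) :
    cdf f x < 1 := by
  simpa [hf.cdf_one] using hf.strictMonoOn_cdf hm ⟨hx, hx'.le⟩ (by simp) hx'

lemma absolutelyContinuous_cdf (hf : IsPriceDensity f m M) (hm : 0 < m) {x y : ℝ}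
    (hx : x ∈ Icc (0 : ℝ) 1) (hy : y ∈ Icc (0 : ℝ) 1) :
    AbsolutelyContinuousOnInterval (cdf f) x y :=
  ((hf.lipschitzOnWith_cdf hm).mono (uIcc_subset_Icc hx hy)).absolutelyContinuousOnInterval

lemma ae_hasDerivAt_cdf (hf : IsPriceDensity f m M) (hm : 0 < m) :
    ∀ᵐ x, x ∈ Ioo (0 : ℝ) 1 → HasDerivAt (cdf f) (f x) x := by
  have h := (hf.intervalIntegrable hm (x := 0) (y := 1) (by simp)
    (by simp)).ae_hasDerivAt_integral
  filter_upwards [h] with x hx hx'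
  refine hx ?_ 0 (by simp)
  rw [uIcc_of_le zero_le_one]
  exact Ioo_subset_Icc_self hx'

lemma reflect (hf : IsPriceDensity f m M) : IsPriceDensity (fun x => f (1 - x)) m M where
  measurable := hf.measurable.comp (measurable_const.sub measurable_id)
  lower x hx := hf.lower _ ⟨by linarith [hx.2], by linarith [hx.1]⟩
  upper x hx := hf.upper _ ⟨by linarith [hx.2], by linarith [hx.1]⟩
  integral_eq_one := by simpa using hf.integral_eq_one

lemma cdf_reflect (hf : IsPriceDensity f m M) (hm : 0 < m) {x : ℝ} (hx : x ∈ Icc (0 : ℝ) 1) :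
    cdf (fun x => f (1 - x)) x = 1 - cdf f (1 - x) := by
  have h := hf.cdf_sub hm (x := 1 - x) (y := 1) ⟨by linarith [hx.2], by linarith [hx.1]⟩ (by simp)
  rw [hf.cdf_one] at h
  rw [h]
  simp [cdf]

end IsPriceDensity

/-! ### Absolute continuity -/

/-- Since `1/u - 1/v = (v - u)/(uv)`, inversion multiplies increments between values at least `δ` by
at most `δ⁻²`. It serves `1 / (1 - F_b)` on compact subintervals of `(0,1)`. -/
lemma _root_.AbsolutelyContinuousOnInterval.inv_of_lower_bound {f : ℝ → ℝ} {a b δ : ℝ}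
    (hf : AbsolutelyContinuousOnInterval f a b) (hδ : 0 < δ) (h : ∀ x ∈ uIcc a b, δ ≤ f x) :
    AbsolutelyContinuousOnInterval (fun x => (f x)⁻¹) a b := by
  rw [absolutelyContinuousOnInterval_iff] at hf ⊢
  intro ε hε
  obtain ⟨η, hη, H⟩ := hf (ε * δ ^ 2) (by positivity)
  refine ⟨η, hη, fun E hE hlt => ?_⟩
  have h1 := H E hE hlt
  have h2 : ∀ i ∈ Finset.range E.1,
      dist ((f (E.2 i).1)⁻¹) ((f (E.2 i).2)⁻¹) ≤
        dist (f (E.2 i).1) (f (E.2 i).2) * (δ ^ 2)⁻¹ := by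
    intro i hi
    have ha := h _ (hE.1 i hi).1
    have hb := h _ (hE.1 i hi).2
    have ha' : 0 < f (E.2 i).1 := hδ.trans_le ha
    have hb' : 0 < f (E.2 i).2 := hδ.trans_le hb
    rw [Real.dist_eq, Real.dist_eq, inv_sub_inv ha'.ne' hb'.ne', abs_div, abs_sub_comm,
      abs_of_pos (mul_pos ha' hb'), div_eq_mul_inv]
    gcongr
    nlinarith
  calc _ ≤ ∑ i ∈ Finset.range E.1, dist (f (E.2 i).1) (f (E.2 i).2) * (δ ^ 2)⁻¹ :=
        Finset.sum_le_sum h2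
    _ = (∑ i ∈ Finset.range E.1, dist (f (E.2 i).1) (f (E.2 i).2)) * (δ ^ 2)⁻¹ := by
        rw [Finset.sum_mul]
    _ < (ε * δ ^ 2) * (δ ^ 2)⁻¹ := by gcongr
    _ = ε := by field_simp

/-- An absolutely continuous function is the integral of any a.e. derivative. -/
lemma _root_.AbsolutelyContinuousOnInterval.sub_eq_integral {f g : ℝ → ℝ} {a b : ℝ}
    (hf : AbsolutelyContinuousOnInterval f a b)
    (h : ∀ᵐ x, x ∈ uIoo a b → HasDerivAt f (g x) x) : f b - f a = ∫ x in a..b, g x := by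
  rw [← hf.integral_deriv_eq_sub]
  refine intervalIntegral.integral_congr_ae ?_
  -- The derivative is known on the open interval while the integral runs over a half-open one; the
  -- additional endpoint is a null set.
  have h1 : ∀ᵐ x : ℝ, x ≠ max a b := by simp [ae_iff]
  filter_upwards [h, h1] with x hx hx1 hx2
  refine (hx ⟨hx2.1, lt_of_le_of_ne hx2.2 hx1⟩).deriv

end

noncomputable section

/-! ### The limiting first-order system -/

/-- The first-order system `B' = f_b A / F_a`, `A' = -f_a B / (1 - F_b)` on `(l, r)`, in the
Carathéodory sense. -/
structure BalanceSystem (fa fb A B : ℝ → ℝ) (l r : ℝ) : Prop where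
  acA : ∀ x ∈ Ioo l r, ∀ y ∈ Ioo l r, AbsolutelyContinuousOnInterval A x y
  acB : ∀ x ∈ Ioo l r, ∀ y ∈ Ioo l r, AbsolutelyContinuousOnInterval B x y
  derivA : ∀ᵐ x, x ∈ Ioo l r → HasDerivAt A (-(fa x * B x / (1 - cdf fb x))) x
  derivB : ∀ᵐ x, x ∈ Ioo l r → HasDerivAt B (fb x * A x / cdf fa x) x

/-- The kernel `f_b / (F_a (1 - F_b) ^ 2)`. -/
def kernel (fa fb : ℝ → ℝ) (x : ℝ) : ℝ := fb x / (cdf fa x * (1 - cdf fb x) ^ 2)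

variable {fa fb : ℝ → ℝ} {m M : ℝ}

lemma DensityPair.cdf_ask_pos (h : DensityPair fa fb m M) {x : ℝ} (hx : x ∈ Ioo (0 : ℝ) 1) :
    0 < cdf fa x := h.ask.cdf_pos h.pos hx.1 hx.2.le

lemma DensityPair.cdf_bid_lt (h : DensityPair fa fb m M) {x : ℝ} (hx : x ∈ Ioo (0 : ℝ) 1) :
    0 < 1 - cdf fb x := sub_pos.2 (h.bid.cdf_lt_one h.pos hx.1.le hx.2)

lemma DensityPair.reflect (h : DensityPair fa fb m M) :
    DensityPair (fun x => fb (1 - x)) (fun x => fa (1 - x)) m M :=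
  ⟨h.pos, h.bid.reflect, h.ask.reflect⟩

lemma uIcc_subset_Ioo_unit {x y : ℝ} (hx : x ∈ Ioo (0 : ℝ) 1) (hy : y ∈ Ioo (0 : ℝ) 1) :
    uIcc x y ⊆ Ioo 0 1 := (ordConnected_Ioo.uIcc_subset hx hy)

lemma DensityPair.ac_survival (h : DensityPair fa fb m M) {x y : ℝ} (hx : x ∈ Icc (0 : ℝ) 1)
    (hy : y ∈ Icc (0 : ℝ) 1) : AbsolutelyContinuousOnInterval (fun z => 1 - cdf fb z) x y := by
  have h1 : AbsolutelyContinuousOnInterval (fun _ : ℝ => (1 : ℝ)) x y :=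
    (LipschitzWith.const (1 : ℝ)).lipschitzOnWith.absolutelyContinuousOnInterval
  exact h1.sub (h.bid.absolutelyContinuous_cdf h.pos hx hy)

lemma DensityPair.ac_survival_inv (h : DensityPair fa fb m M) {x y : ℝ} (hx : x ∈ Ioo (0 : ℝ) 1)
    (hy : y ∈ Ioo (0 : ℝ) 1) :
    AbsolutelyContinuousOnInterval (fun z => (1 - cdf fb z)⁻¹) x y := by
  have hx' := Ioo_subset_Icc_self hx
  have hy' := Ioo_subset_Icc_self hy
  have hmax : max x y ∈ Ioo (0 : ℝ) 1 := by
    rcases max_cases x y with ⟨e, _⟩ | ⟨e, _⟩ <;> rw [e] <;> assumption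
  -- `1 - F_b` is decreasing, so its minimum over the interval is its value at the right endpoint.
  refine (h.ac_survival hx' hy').inv_of_lower_bound (δ := 1 - cdf fb (max x y))
    (h.cdf_bid_lt hmax) fun z hz => ?_
  have hz' := Ioo_subset_Icc_self (uIcc_subset_Ioo_unit hx hy hz)
  have := (h.bid.strictMonoOn_cdf h.pos).monotoneOn hz' (Ioo_subset_Icc_self hmax) hz.2
  linarith

lemma DensityPair.continuousOn_survival (h : DensityPair fa fb m M) :
    ContinuousOn (fun z => 1 - cdf fb z) (Icc 0 1) :=
  continuousOn_const.sub (h.bid.continuousOn_cdf h.pos)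

lemma DensityPair.intervalIntegrable_mul_bid (h : DensityPair fa fb m M) {g : ℝ → ℝ} {x y : ℝ}
    (hx : x ∈ Icc (0 : ℝ) 1) (hy : y ∈ Icc (0 : ℝ) 1) (hg : ContinuousOn g (uIcc x y)) :
    IntervalIntegrable (fun z => fb z * g z) volume x y :=
  (h.bid.intervalIntegrable h.pos hx hy).mul_continuousOn hg

lemma DensityPair.intervalIntegrable_kernel (h : DensityPair fa fb m M) {x y : ℝ}
    (hx : x ∈ Ioo (0 : ℝ) 1) (hy : y ∈ Ioo (0 : ℝ) 1) :
    IntervalIntegrable (kernel fa fb) volume x y := by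
  have hs := uIcc_subset_Ioo_unit hx hy
  have hs' := hs.trans Ioo_subset_Icc_self
  refine h.intervalIntegrable_mul_bid (Ioo_subset_Icc_self hx) (Ioo_subset_Icc_self hy)
    (g := fun z => (cdf fa z * (1 - cdf fb z) ^ 2)⁻¹) ?_
  refine ContinuousOn.inv₀ (((h.ask.continuousOn_cdf h.pos).mono hs').mul
    ((h.continuousOn_survival.mono hs').pow 2)) fun z hz => ?_
  have h1 := h.cdf_ask_pos (hs hz)
  have h2 := h.cdf_bid_lt (hs hz)
  positivity

lemma DensityPair.kernel_pos (h : DensityPair fa fb m M) {x : ℝ} (hx : x ∈ Ioo (0 : ℝ) 1) :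
    0 < kernel fa fb x := by
  have h1 := h.cdf_ask_pos hx
  have h2 := h.cdf_bid_lt hx
  have h3 := h.pos.trans_le (h.bid.lower x hx)
  unfold kernel
  positivity

lemma DensityPair.integral_kernel_pos (h : DensityPair fa fb m M) {x y : ℝ}
    (hx : x ∈ Ioo (0 : ℝ) 1) (hy : y ∈ Ioo (0 : ℝ) 1) (hxy : x < y) :
    0 < ∫ z in x..y, kernel fa fb z := by
  refine intervalIntegral.intervalIntegral_pos_of_pos_on (h.intervalIntegrable_kernel hx hy)
    (fun z hz => h.kernel_pos ⟨hx.1.trans hz.1, hz.2.trans hy.2⟩) hxy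

/-- The kernel is not integrable at `0`. -/
lemma DensityPair.kernel_unbounded (h : DensityPair fa fb m M) {x₀ : ℝ} (hx₀ : x₀ ∈ Ioo (0 : ℝ) 1)
    (C : ℝ) : ∀ᶠ x in 𝓝[>] 0, C < ∫ z in x..x₀, kernel fa fb z := by
  have hm := h.pos
  have hM : 0 < M := hm.trans_le h.bid.le_bound
  -- From `F_a z ≤ M z`, `f_b ≥ m` and `(1 - F_b)^2 ≤ 1` the kernel is at least `m / (M z)`, whose
  -- integral diverges logarithmically.
  have hlog : Tendsto (fun x => m / M * (Real.log x₀ - Real.log x)) (𝓝[>] 0) atTop := by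
    refine Tendsto.const_mul_atTop (by positivity) ?_
    have := Real.tendsto_log_nhdsGT_zero
    simpa [sub_eq_add_neg] using
      tendsto_atTop_add_const_left _ (Real.log x₀) (tendsto_neg_atBot_atTop.comp this)
  filter_upwards [hlog.eventually_gt_atTop C, Ioo_mem_nhdsGT hx₀.1] with x hx hx0
  refine hx.trans_le ?_
  have hx1 : x ∈ Ioo (0 : ℝ) 1 := ⟨hx0.1, hx0.2.trans hx₀.2⟩
  have e : m / M * (Real.log x₀ - Real.log x) = ∫ z in x..x₀, m / M * z⁻¹ := by
    rw [intervalIntegral.integral_const_mul, integral_inv_of_pos hx0.1 hx₀.1,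
      Real.log_div hx₀.1.ne' hx0.1.ne']
  rw [e]
  refine intervalIntegral.integral_mono_on hx0.2.le ?_ (h.intervalIntegrable_kernel hx1 hx₀) ?_
  · refine (ContinuousOn.intervalIntegrable ?_)
    refine continuousOn_const.mul (continuousOn_id.inv₀ fun z hz => ?_)
    exact (uIcc_subset_Ioo_unit hx1 hx₀ hz).1.ne'
  · intro z hz
    have hz1 : z ∈ Ioo (0 : ℝ) 1 := ⟨hx0.1.trans_le hz.1, hz.2.trans_lt hx₀.2⟩
    have h1 := h.cdf_ask_pos hz1
    have h2 := h.cdf_bid_lt hz1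
    have h3 := h.bid.lower z hz1
    have h4 : cdf fa z ≤ M * z := by
      simpa [IsPriceDensity.cdf_zero] using h.ask.cdf_sub_le hm le_rfl hz1.1.le hz1.2.le
    have h5 : 1 - cdf fb z ≤ 1 := by
      linarith [(h.bid.cdf_mem_Icc hm (Ioo_subset_Icc_self hz1)).1]
    have h6 : (1 - cdf fb z) ^ 2 ≤ 1 := pow_le_one₀ h2.le h5
    unfold kernel
    have hz0 := hz1.1
    rw [show m / M * z⁻¹ = m / (M * z) by field_simp]
    have : cdf fa z * (1 - cdf fb z) ^ 2 ≤ M * z := by nlinarith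
    gcongr
    exact hm.le.trans h3

namespace BalanceSystem

variable {A B : ℝ → ℝ} {l r : ℝ}

lemma Ioo_subset (hl : 0 ≤ l) (hr : r ≤ 1) : Ioo l r ⊆ Ioo 0 1 := Ioo_subset_Ioo hl hr

/-- In the derivative of `F_a B + (1 - F_b) A` the four terms cancel in pairs: `f_a B` against `(1 -
F_b) A'`, and `F_a B'` against `-f_b A`. -/
lemma conserved (hs : BalanceSystem fa fb A B l r) (h : DensityPair fa fb m M) (hl : 0 ≤ l)
    (hr : r ≤ 1) {x y : ℝ} (hx : x ∈ Ioo l r) (hy : y ∈ Ioo l r) :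
    cdf fa x * B x + (1 - cdf fb x) * A x = cdf fa y * B y + (1 - cdf fb y) * A y := by
  have hx1 := Ioo_subset hl hr hx
  have hy1 := Ioo_subset hl hr hy
  have hac := ((h.ask.absolutelyContinuous_cdf h.pos (Ioo_subset_Icc_self hx1)
    (Ioo_subset_Icc_self hy1)).fun_mul (hs.acB x hx y hy)).fun_add
    ((h.ac_survival (Ioo_subset_Icc_self hx1) (Ioo_subset_Icc_self hy1)).fun_mul (hs.acA x hx y hy))
  obtain ⟨C, hC⟩ := hac.const_of_ae_hasDerivAt_zero (by
    filter_upwards [hs.derivA, hs.derivB, h.ask.ae_hasDerivAt_cdf h.pos,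
      h.bid.ae_hasDerivAt_cdf h.pos] with z h1 h2 h3 h4 hz
    have hz1 := ordConnected_Ioo.uIcc_subset hx hy hz
    have hz2 := Ioo_subset hl hr hz1
    have ha := (h.cdf_ask_pos hz2).ne'
    have hb := (h.cdf_bid_lt hz2).ne'
    have := ((h3 hz2).mul (h2 hz1)).add (((h4 hz2).const_sub 1).mul (h1 hz1))
    refine this.congr_deriv ?_
    field_simp
    ring)
  rw [hC x left_mem_uIcc, hC y right_mem_uIcc]

/-- The derivative of `B / (1 - F_b)` is `f_b / (F_a (1 - F_b)^2)` times the conserved quantity.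
This decouples the system: `B` is found by one integration, and `A` then by conservation. -/
lemma quotient_formula (hs : BalanceSystem fa fb A B l r) (h : DensityPair fa fb m M) (hl : 0 ≤ l)
    (hr : r ≤ 1) {x y c : ℝ} (hx : x ∈ Ioo l r) (hy : y ∈ Ioo l r)
    (hc : cdf fa x * B x + (1 - cdf fb x) * A x = c) :
    B y * (1 - cdf fb y)⁻¹ - B x * (1 - cdf fb x)⁻¹ = c * ∫ z in x..y, kernel fa fb z := by
  have hx1 := Ioo_subset hl hr hx
  have hy1 := Ioo_subset hl hr hy
  have hac := (hs.acB x hx y hy).fun_mul (h.ac_survival_inv hx1 hy1)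
  rw [← intervalIntegral.integral_const_mul]
  refine hac.sub_eq_integral ?_
  filter_upwards [hs.derivB, h.bid.ae_hasDerivAt_cdf h.pos] with z h2 h4 hz
  have hz1 := ordConnected_Ioo.uIcc_subset hx hy (Ioo_subset_Icc_self hz)
  have hz2 := Ioo_subset hl hr hz1
  have ha := (h.cdf_ask_pos hz2).ne'
  have hb := (h.cdf_bid_lt hz2).ne'
  have := (h2 hz1).mul (((h4 hz2).const_sub 1).inv hb)
  refine this.congr_deriv ?_
  rw [← hc, hs.conserved h hl hr hx hz1, kernel, Pi.inv_apply]
  field_simp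
  ring

end BalanceSystem

end

/-! ### The boundary value problem for the first-order system. -/

noncomputable section

variable {fa fb : ℝ → ℝ} {m M : ℝ}

namespace BalanceSystem

variable {A B : ℝ → ℝ} {l r : ℝ}

/-- The system has no solution reaching the origin with `B` bounded below. -/
lemma false_of_left_zero (hs : BalanceSystem fa fb A B 0 r) (h : DensityPair fa fb m M)
    (hr0 : 0 < r) (hr : r ≤ 1) {c : ℝ} (hc0 : 0 < c)
    (hc : ∀ x ∈ Ioo 0 r, cdf fa x * B x + (1 - cdf fb x) * A x = c)
    (hB : ∀ᶠ x in 𝓝[>] 0, -1 ≤ B x) : False := by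
  obtain ⟨y, hy⟩ : (Ioo 0 r).Nonempty := nonempty_Ioo.2 hr0
  have hy1 := Ioo_subset le_rfl hr hy
  set K := B y * (1 - cdf fb y)⁻¹
  have hcont : Tendsto (fun x => (1 - cdf fb x)⁻¹) (𝓝[>] 0) (𝓝 1) := by
    have h1 : ContinuousWithinAt (fun z => 1 - cdf fb z) (Icc 0 1) 0 :=
      h.continuousOn_survival 0 (by simp)
    have h2 : Tendsto (fun z => 1 - cdf fb z) (𝓝[>] 0) (𝓝 1) := by
      have := h1.tendsto
      simp only [IsPriceDensity.cdf_zero, sub_zero] at this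
      refine this.mono_left ?_
      rw [← nhdsWithin_Ioo_eq_nhdsGT (zero_lt_one' ℝ)]
      exact nhdsWithin_mono _ Ioo_subset_Icc_self
    simpa using h2.inv₀ one_ne_zero
  -- With the integral above `(K + 2) / c` the quotient formula makes `B x / (1 - F_b x)` less than
  -- `-2`, whereas `B x ≥ -1` and a factor below `2` keep it above `-2`.
  obtain ⟨x, hx1, hx2, hx3, hx4⟩ := ((h.kernel_unbounded hy1 ((K + 2) / c)).and
    (hB.and ((hcont.eventually (gt_mem_nhds (show (1 : ℝ) < 2 by norm_num))).and
      (Ioo_mem_nhdsGT hr0)))).exists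
  have hx5 := Ioo_subset le_rfl hr hx4
  have := hs.quotient_formula h le_rfl hr hx4 hy (hc x hx4)
  rw [div_lt_iff₀ hc0] at hx1
  have h6 : 0 < (1 - cdf fb x)⁻¹ := inv_pos.2 (h.cdf_bid_lt hx5)
  nlinarith

end BalanceSystem

lemma tendsto_nhdsGT_of_continuousOn {f : ℝ → ℝ} {a b l : ℝ} (hf : ContinuousOn f (Icc a b))
    (hl : l ∈ Ico a b) : Tendsto f (𝓝[>] l) (𝓝 (f l)) := by
  refine ((hf l (Ico_subset_Icc_self hl)).tendsto).mono_left ?_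
  rw [← nhdsWithin_Ioo_eq_nhdsGT hl.2]
  exact nhdsWithin_mono _ fun x hx => ⟨hl.1.trans hx.1.le, hx.2.le⟩

lemma tendsto_nhdsLT_of_continuousOn {f : ℝ → ℝ} {a b r : ℝ} (hf : ContinuousOn f (Icc a b))
    (hr : r ∈ Ioc a b) : Tendsto f (𝓝[<] r) (𝓝 (f r)) := by
  refine ((hf r (Ioc_subset_Icc_self hr)).tendsto).mono_left ?_
  rw [← nhdsWithin_Ioo_eq_nhdsLT hr.1]
  exact nhdsWithin_mono _ fun x hx => ⟨hx.1.le, hx.2.le.trans hr.2⟩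

/-- Solutions of the balance system on `(l, r)` with the boundary values of the limiting
distributions of the best prices. -/
structure BoundarySolution (fa fb A B : ℝ → ℝ) (l r : ℝ) : Prop extends
    BalanceSystem fa fb A B l r where
  left_nonneg : 0 ≤ l
  lt : l < r
  right_le_one : r ≤ 1
  A_left : Tendsto A (𝓝[>] l) (𝓝 1)
  B_left : Tendsto B (𝓝[>] l) (𝓝 0)
  A_right : Tendsto A (𝓝[<] r) (𝓝 0)
  B_right : Tendsto B (𝓝[<] r) (𝓝 1)

namespace BoundarySolution

variable {A B : ℝ → ℝ} {l r : ℝ}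

/-- The conserved quantity is evaluated by letting the other point tend to `l`, where `A = 1` and `B
= 0`. -/
lemma conserved_eq_left (hs : BoundarySolution fa fb A B l r) (h : DensityPair fa fb m M)
    {x : ℝ} (hx : x ∈ Ioo l r) :
    cdf fa x * B x + (1 - cdf fb x) * A x = 1 - cdf fb l := by
  have hl : l ∈ Ico (0 : ℝ) 1 := ⟨hs.left_nonneg, hs.lt.trans_le hs.right_le_one⟩
  have h1 : Tendsto (fun y => cdf fa y * B y + (1 - cdf fb y) * A y) (𝓝[>] l)
      (𝓝 (cdf fa l * 0 + (1 - cdf fb l) * 1)) :=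
    ((tendsto_nhdsGT_of_continuousOn (h.ask.continuousOn_cdf h.pos) hl).mul hs.B_left).add
      ((tendsto_nhdsGT_of_continuousOn h.continuousOn_survival hl).mul hs.A_left)
  have h2 : Tendsto (fun y => cdf fa y * B y + (1 - cdf fb y) * A y) (𝓝[>] l)
      (𝓝 (cdf fa x * B x + (1 - cdf fb x) * A x)) := by
    refine tendsto_const_nhds.congr' ?_
    filter_upwards [Ioo_mem_nhdsGT hs.lt] with y hy
    exact hs.conserved h hs.left_nonneg hs.right_le_one hx hy
  simpa using tendsto_nhds_unique h2 h1

/-- The same constant read off at `r`, where `A = 0` and `B = 1`. This is the first equation linking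
the two thresholds. -/
lemma cdf_right (hs : BoundarySolution fa fb A B l r) (h : DensityPair fa fb m M) :
    cdf fa r = 1 - cdf fb l := by
  have hr : r ∈ Ioc (0 : ℝ) 1 := ⟨hs.left_nonneg.trans_lt hs.lt, hs.right_le_one⟩
  have h1 : Tendsto (fun y => cdf fa y * B y + (1 - cdf fb y) * A y) (𝓝[<] r)
      (𝓝 (cdf fa r * 1 + (1 - cdf fb r) * 0)) :=
    ((tendsto_nhdsLT_of_continuousOn (h.ask.continuousOn_cdf h.pos) hr).mul hs.B_right).add
      ((tendsto_nhdsLT_of_continuousOn h.continuousOn_survival hr).mul hs.A_right)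
  have h2 : Tendsto (fun y => cdf fa y * B y + (1 - cdf fb y) * A y) (𝓝[<] r)
      (𝓝 (1 - cdf fb l)) := by
    refine tendsto_const_nhds.congr' ?_
    filter_upwards [Ioo_mem_nhdsLT hs.lt] with y hy
    exact (hs.conserved_eq_left h hy).symm
  simpa using tendsto_nhds_unique h1 h2

/-- At `l = 0` the conserved quantity would be `1`, and the divergence of the kernel's integral
would drive `B` to minus infinity instead of `0`. -/
lemma left_pos (hs : BoundarySolution fa fb A B l r) (h : DensityPair fa fb m M) : 0 < l := by
  refine hs.left_nonneg.lt_of_ne ?_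
  rintro rfl
  refine hs.toBalanceSystem.false_of_left_zero h hs.lt hs.right_le_one zero_lt_one
    (fun x hx => by simpa [IsPriceDensity.cdf_zero] using hs.conserved_eq_left h hx) ?_
  exact hs.B_left.eventually (lt_mem_nhds (by norm_num : (-1 : ℝ) < 0)) |>.mono fun x hx => hx.le

lemma right_lt_one (hs : BoundarySolution fa fb A B l r) (h : DensityPair fa fb m M) : r < 1 := by
  refine hs.right_le_one.lt_of_ne ?_
  rintro rfl
  have := hs.cdf_right h
  rw [h.ask.cdf_one] at this
  have := h.bid.cdf_pos h.pos (hs.left_pos h) hs.lt.le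
  linarith

lemma left_mem (hs : BoundarySolution fa fb A B l r) (h : DensityPair fa fb m M) :
    l ∈ Ioo (0 : ℝ) 1 := ⟨hs.left_pos h, hs.lt.trans_le hs.right_le_one⟩

lemma right_mem (hs : BoundarySolution fa fb A B l r) (h : DensityPair fa fb m M) :
    r ∈ Ioo (0 : ℝ) 1 := ⟨hs.left_nonneg.trans_lt hs.lt, hs.right_lt_one h⟩

lemma continuousAt_integral_kernel (h : DensityPair fa fb m M) {x₀ y : ℝ}
    (hx : x₀ ∈ Ioo (0 : ℝ) 1) (hy : y ∈ Ioo (0 : ℝ) 1) :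
    ContinuousAt (fun x => ∫ z in x₀..x, kernel fa fb z) y := by
  obtain ⟨a, ha⟩ : (Ioo 0 (min x₀ y)).Nonempty := nonempty_Ioo.2 (lt_min hx.1 hy.1)
  obtain ⟨b, hb⟩ : (Ioo (max x₀ y) 1).Nonempty := nonempty_Ioo.2 (max_lt hx.2 hy.2)
  have ha1 : a < x₀ := ha.2.trans_le (min_le_left _ _)
  have ha2 : a < y := ha.2.trans_le (min_le_right _ _)
  have hb1 : x₀ < b := (le_max_left _ _).trans_lt hb.1
  have hb2 : y < b := (le_max_right _ _).trans_lt hb.1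
  have := intervalIntegral.continuousOn_primitive_interval' (a := x₀)
    (h.intervalIntegrable_kernel (x := a) (y := b) ⟨ha.1, by linarith [hx.2]⟩
      ⟨by linarith [hx.1], hb.2⟩) (by rw [uIcc_of_le (by linarith)]; constructor <;> linarith)
  refine this.continuousAt ?_
  rw [uIcc_of_le (by linarith)]
  exact Icc_mem_nhds ha2 hb2

lemma formula (hs : BoundarySolution fa fb A B l r) (h : DensityPair fa fb m M) {y : ℝ}
    (hy : y ∈ Ioo l r) :
    B y * (1 - cdf fb y)⁻¹ = (1 - cdf fb l) * ∫ z in l..y, kernel fa fb z := by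
  have hl := hs.left_mem h
  have hr := hs.right_mem h
  have hy1 : y ∈ Ioo (0 : ℝ) 1 := ⟨hl.1.trans hy.1, hy.2.trans hr.2⟩
  have h1 : Tendsto (fun x => B y * (1 - cdf fb y)⁻¹ - B x * (1 - cdf fb x)⁻¹) (𝓝[>] l)
      (𝓝 (B y * (1 - cdf fb y)⁻¹ - 0 * (1 - cdf fb l)⁻¹)) := by
    refine tendsto_const_nhds.sub (hs.B_left.mul (Tendsto.inv₀ ?_ (h.cdf_bid_lt hl).ne'))
    exact tendsto_nhdsGT_of_continuousOn h.continuousOn_survival (Ioo_subset_Ico_self hl)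
  have h2 : Tendsto (fun x => (1 - cdf fb l) *
      ((∫ z in l..y, kernel fa fb z) - ∫ z in l..x, kernel fa fb z)) (𝓝[>] l)
      (𝓝 ((1 - cdf fb l) * ((∫ z in l..y, kernel fa fb z) - ∫ z in l..l, kernel fa fb z))) :=
    ((tendsto_const_nhds.sub ((continuousAt_integral_kernel h hl hl).tendsto.mono_left
      nhdsWithin_le_nhds)).const_mul _)
  simp only [zero_mul, sub_zero, intervalIntegral.integral_same] at h1 h2
  refine tendsto_nhds_unique (h1.congr' ?_) h2
  filter_upwards [Ioo_mem_nhdsGT hs.lt] with x hx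
  have hx1 : x ∈ Ioo (0 : ℝ) 1 := ⟨hl.1.trans hx.1, hx.2.trans hr.2⟩
  rw [hs.quotient_formula h hs.left_nonneg hs.right_le_one hx hy (hs.conserved_eq_left h hx),
    intervalIntegral.integral_interval_sub_left (h.intervalIntegrable_kernel hl hy1)
      (h.intervalIntegrable_kernel hl hx1)]

/-- The boundary value `B = 1` at `r` inserted into `formula`, with `1 - F_b(l)` rewritten as
`F_a(r)`. This is the second equation for the thresholds. -/
lemma root_equation (hs : BoundarySolution fa fb A B l r) (h : DensityPair fa fb m M) :
    (cdf fa r * (1 - cdf fb r))⁻¹ = ∫ z in l..r, kernel fa fb z := by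
  have hl := hs.left_mem h
  have hr := hs.right_mem h
  have h1 : Tendsto (fun y => B y * (1 - cdf fb y)⁻¹) (𝓝[<] r) (𝓝 (1 * (1 - cdf fb r)⁻¹)) := by
    refine hs.B_right.mul (Tendsto.inv₀ ?_ (h.cdf_bid_lt hr).ne')
    exact tendsto_nhdsLT_of_continuousOn h.continuousOn_survival (Ioo_subset_Ioc_self hr)
  have h2 : Tendsto (fun y => (1 - cdf fb l) * ∫ z in l..y, kernel fa fb z) (𝓝[<] r)
      (𝓝 ((1 - cdf fb l) * ∫ z in l..r, kernel fa fb z)) :=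
    ((continuousAt_integral_kernel h hl hr).tendsto.mono_left nhdsWithin_le_nhds).const_mul _
  have h3 := tendsto_nhds_unique (h1.congr' (by
    filter_upwards [Ioo_mem_nhdsLT hs.lt] with y hy using hs.formula h hy)) h2
  rw [hs.cdf_right h] at *
  have := h.cdf_bid_lt hl
  rw [mul_inv, ← one_mul (1 - cdf fb r)⁻¹, h3]
  field_simp

end BoundarySolution

/-! ### Uniqueness and existence of the thresholds -/

/-- Formally the derivative of `1 / (F_a (1 - F_b))` is the kernel minus the positive term `f_a /
(F_a^2 (1 - F_b))`. The proof avoids the product rule: on `[x, y]` the kernel is at least `1 /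
F_a(y)` times the derivative of `1 / (1 - F_b)`, and `1 / F_a` strictly decreases. This strictness
drives both uniqueness and existence of the thresholds. -/
lemma DensityPair.integral_kernel_gt (h : DensityPair fa fb m M) {x y : ℝ}
    (hx : x ∈ Ioo (0 : ℝ) 1) (hy : y ∈ Ioo (0 : ℝ) 1) (hxy : x < y) :
    (cdf fa y * (1 - cdf fb y))⁻¹ - (cdf fa x * (1 - cdf fb x))⁻¹ <
      ∫ z in x..y, kernel fa fb z := by
  have hax := h.cdf_ask_pos hx
  have hay := h.cdf_ask_pos hy
  have hbx := h.cdf_bid_lt hx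
  have hby := h.cdf_bid_lt hy
  have hcont : ContinuousOn (fun z => ((1 - cdf fb z) ^ 2)⁻¹) (uIcc x y) :=
    ContinuousOn.inv₀ ((h.continuousOn_survival.mono
      ((uIcc_subset_Ioo_unit hx hy).trans Ioo_subset_Icc_self)).pow 2) fun z hz =>
        (pow_pos (h.cdf_bid_lt (uIcc_subset_Ioo_unit hx hy hz)) 2).ne'
  have hint := h.intervalIntegrable_mul_bid (Ioo_subset_Icc_self hx) (Ioo_subset_Icc_self hy) hcont
  have h1 : (1 - cdf fb y)⁻¹ - (1 - cdf fb x)⁻¹ = ∫ z in x..y, fb z * ((1 - cdf fb z) ^ 2)⁻¹ := by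
    refine (h.ac_survival_inv hx hy).sub_eq_integral ?_
    filter_upwards [h.bid.ae_hasDerivAt_cdf h.pos] with z hz hz'
    have hz1 := uIcc_subset_Ioo_unit hx hy (Ioo_subset_Icc_self hz')
    refine (((hz hz1).const_sub 1).inv (h.cdf_bid_lt hz1).ne').congr_deriv ?_
    rw [neg_neg, div_eq_mul_inv]
  have h2 : (cdf fa y)⁻¹ * ((1 - cdf fb y)⁻¹ - (1 - cdf fb x)⁻¹) ≤ ∫ z in x..y, kernel fa fb z := by
    rw [h1, ← intervalIntegral.integral_const_mul]
    refine intervalIntegral.integral_mono_on hxy.le (hint.const_mul _)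
      (h.intervalIntegrable_kernel hx hy) fun z hz => ?_
    have hz1 : z ∈ Ioo (0 : ℝ) 1 := ⟨hx.1.trans_le hz.1, hz.2.trans_lt hy.2⟩
    have haz := h.cdf_ask_pos hz1
    have hbz := h.cdf_bid_lt hz1
    have hle : cdf fa z ≤ cdf fa y := (h.ask.strictMonoOn_cdf h.pos).monotoneOn
      (Ioo_subset_Icc_self hz1) (Ioo_subset_Icc_self hy) hz.2
    have hf := h.pos.trans_le (h.bid.lower z hz1)
    rw [kernel, div_eq_mul_inv, mul_inv, mul_left_comm]
    gcongr
  have h3 : (cdf fa y)⁻¹ < (cdf fa x)⁻¹ := by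
    gcongr
    exact h.ask.strictMonoOn_cdf h.pos (Ioo_subset_Icc_self hx) (Ioo_subset_Icc_self hy) hxy
  have h4 : 0 < (1 - cdf fb x)⁻¹ := inv_pos.2 hbx
  refine lt_of_lt_of_le ?_ h2
  rw [mul_inv, mul_inv]
  nlinarith

/-- The equations for the thresholds have at most one solution. -/
lemma DensityPair.thresholds_unique (h : DensityPair fa fb m M) {l r l' r' : ℝ}
    (hl : l ∈ Ioo (0 : ℝ) 1) (hr : r ∈ Ioo (0 : ℝ) 1) (hl' : l' ∈ Ioo (0 : ℝ) 1)
    (hr' : r' ∈ Ioo (0 : ℝ) 1) (e : cdf fa r = 1 - cdf fb l) (e' : cdf fa r' = 1 - cdf fb l')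
    (k : (cdf fa r * (1 - cdf fb r))⁻¹ = ∫ z in l..r, kernel fa fb z)
    (k' : (cdf fa r' * (1 - cdf fb r'))⁻¹ = ∫ z in l'..r', kernel fa fb z) : l = l' := by
  wlog hlt : l < l' generalizing l r l' r'
  · rcases eq_or_lt_of_le (not_lt.1 hlt) with h1 | h1
    · exact h1.symm
    · exact (this hl' hr' hl hr e' e k' k h1).symm
  exfalso
  have h1 : cdf fa r' < cdf fa r := by
    have := h.bid.strictMonoOn_cdf h.pos (Ioo_subset_Icc_self hl) (Ioo_subset_Icc_self hl') hlt
    linarith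
  have h2 : r' < r := by
    by_contra hn
    have := (h.ask.strictMonoOn_cdf h.pos).monotoneOn (Ioo_subset_Icc_self hr)
      (Ioo_subset_Icc_self hr') (not_lt.1 hn)
    linarith
  -- Lowering `l'` to `l` raises `r'` to `r`. The integral over `[l, r]` exceeds the one over `[l',
  -- r']` by a positive piece on the left and, on the right, by more than the change of `1 / (F_a (1
  -- - F_b))`, so both root equations cannot hold.
  have h3 := h.integral_kernel_gt hr' hr h2
  rw [k, k'] at h3
  have i1 := intervalIntegral.integral_add_adjacent_intervals
    (h.intervalIntegrable_kernel hl hl') (h.intervalIntegrable_kernel hl' hr')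
  have i2 := intervalIntegral.integral_add_adjacent_intervals
    (h.intervalIntegrable_kernel hl hr') (h.intervalIntegrable_kernel hr' hr)
  have i3 := h.integral_kernel_pos hl hl' hlt
  linarith

/-- The threshold equations determine `l`, then `r`; the quadrature determines `B`, and conservation
then determines `A`. -/
lemma BoundarySolution.unique (h : DensityPair fa fb m M) {A B A' B' : ℝ → ℝ} {l r l' r' : ℝ}
    (hs : BoundarySolution fa fb A B l r) (hs' : BoundarySolution fa fb A' B' l' r') :
    l' = l ∧ r' = r ∧ EqOn A' A (Ioo l r) ∧ EqOn B' B (Ioo l r) := by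
  have hl : l' = l := h.thresholds_unique (hs'.left_mem h) (hs'.right_mem h) (hs.left_mem h)
    (hs.right_mem h) (hs'.cdf_right h) (hs.cdf_right h) (hs'.root_equation h) (hs.root_equation h)
  subst hl
  have hr : r' = r := by
    refine (h.ask.strictMonoOn_cdf h.pos).injOn (Ioo_subset_Icc_self (hs'.right_mem h))
      (Ioo_subset_Icc_self (hs.right_mem h)) ?_
    rw [hs.cdf_right h, hs'.cdf_right h]
  subst hr
  have hB : EqOn B' B (Ioo l' r') := fun x hx => by
    have hx1 : x ∈ Ioo (0 : ℝ) 1 := ⟨(hs.left_mem h).1.trans hx.1, hx.2.trans (hs.right_mem h).2⟩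
    have := (hs'.formula h hx).trans (hs.formula h hx).symm
    exact mul_right_cancel₀ (inv_pos.2 (h.cdf_bid_lt hx1)).ne' this
  refine ⟨rfl, rfl, fun x hx => ?_, hB⟩
  have hx1 : x ∈ Ioo (0 : ℝ) 1 := ⟨(hs.left_mem h).1.trans hx.1, hx.2.trans (hs.right_mem h).2⟩
  have := (hs'.conserved_eq_left h hx).trans (hs.conserved_eq_left h hx).symm
  rw [hB hx] at this
  exact mul_left_cancel₀ (h.cdf_bid_lt hx1).ne' (add_left_cancel this)

end

/-! ### Existence of the thresholds and of the limiting distributions. -/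

noncomputable section

variable {fa fb : ℝ → ℝ} {m M : ℝ}

/-- The equation `F_a(s t) = 1 - F_b(t)` defines a decreasing continuous `s`, which has the fixed
point `c` where `F_a + F_b = 1`. On the left of `c` one seeks a zero of the root equation for the
pair `(t, s t)`: its defect is negative at `t = c`, where the interval degenerates, and nonnegative
near `t = 0`, where the integral of the kernel diverges. -/
lemma DensityPair.exists_thresholds (h : DensityPair fa fb m M) :
    ∃ l r : ℝ, 0 < l ∧ l < r ∧ r < 1 ∧ cdf fa r = 1 - cdf fb l ∧
      (cdf fa r * (1 - cdf fb r))⁻¹ = ∫ z in l..r, kernel fa fb z := by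
  have hca := h.ask.continuousOn_cdf h.pos
  have hcb := h.bid.continuousOn_cdf h.pos
  have ma := h.ask.strictMonoOn_cdf h.pos
  have mb := h.bid.strictMonoOn_cdf h.pos
  -- The value outside `[0,1]` is irrelevant; placing the condition under the existential makes `s`
  -- a total function.
  have hsol : ∀ t : ℝ, ∃ s, t ∈ Icc (0 : ℝ) 1 → s ∈ Icc (0 : ℝ) 1 ∧ cdf fa s = 1 - cdf fb t := by
    intro t
    by_cases ht : t ∈ Icc (0 : ℝ) 1
    · have := intermediate_value_Icc (zero_le_one' ℝ) hca
      rw [h.ask.cdf_one, IsPriceDensity.cdf_zero] at this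
      have hb := h.bid.cdf_mem_Icc h.pos ht
      obtain ⟨s, hs, e⟩ := this ⟨sub_nonneg.2 hb.2, sub_le_self _ hb.1⟩
      exact ⟨s, fun _ => ⟨hs, e⟩⟩
    · exact ⟨0, fun hh => absurd hh ht⟩
  choose s hs using hsol
  have hs0 : ∀ t ∈ Ioo (0 : ℝ) 1, s t ∈ Ioo (0 : ℝ) 1 := by
    intro t ht
    obtain ⟨h1, h2⟩ := hs t (Ioo_subset_Icc_self ht)
    have h3 := h.bid.cdf_pos h.pos ht.1 ht.2.le
    have h4 := h.bid.cdf_lt_one h.pos ht.1.le ht.2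
    refine ⟨h1.1.lt_of_ne ?_, h1.2.lt_of_ne ?_⟩
    · intro e
      rw [← e, IsPriceDensity.cdf_zero] at h2
      linarith
    · intro e
      rw [e, h.ask.cdf_one] at h2
      linarith
  have hanti : ∀ t ∈ Icc (0 : ℝ) 1, ∀ t' ∈ Icc (0 : ℝ) 1, t < t' → s t' < s t := by
    intro t ht t' ht' hlt
    have h1 := mb ht ht' hlt
    by_contra hn
    have := ma.monotoneOn (hs t ht).1 (hs t' ht').1 (not_lt.1 hn)
    rw [(hs t ht).2, (hs t' ht').2] at this
    linarith
  have hcs : ContinuousOn s (Ioo 0 1) := by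
    have hM : 0 ≤ M := h.pos.le.trans h.bid.le_bound
    -- Over `[t, t']` the increment of `F_b` is at most `M (t' - t)` and equals that of `F_a` over
    -- `[s t', s t]`, which is at least `m (s t - s t')`.
    have : LipschitzOnWith (M / m).toNNReal s (Ioo 0 1) := by
      refine LipschitzOnWith.of_dist_le_mul fun t ht t' ht' => ?_
      rw [Real.coe_toNNReal _ (div_nonneg hM h.pos.le), Real.dist_eq, Real.dist_eq]
      wlog hlt : t < t' generalizing t t'
      · rcases eq_or_lt_of_le (not_lt.1 hlt) with e | e
        · simp [e]
        · rw [abs_sub_comm, abs_sub_comm t]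
          exact this t' ht' t ht e
      have i1 := hanti t (Ioo_subset_Icc_self ht) t' (Ioo_subset_Icc_self ht') hlt
      have i2 := h.ask.le_cdf_sub h.pos (hs0 t' ht').1.le i1.le (hs0 t ht).2.le
      have i3 := h.bid.cdf_sub_le h.pos ht.1.le hlt.le ht'.2.le
      rw [(hs t (Ioo_subset_Icc_self ht)).2, (hs t' (Ioo_subset_Icc_self ht')).2] at i2
      rw [abs_of_pos (sub_pos.2 i1), abs_sub_comm, abs_of_pos (sub_pos.2 hlt), div_mul_eq_mul_div,
        le_div_iff₀ h.pos]
      linarith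
    exact this.continuousOn
  obtain ⟨c, hc, ec⟩ : ∃ c ∈ Icc (0 : ℝ) 1, cdf fa c + cdf fb c = 1 := by
    have hcab : ContinuousOn (fun x => cdf fa x + cdf fb x) (Icc 0 1) := hca.add hcb
    have := intermediate_value_Icc (zero_le_one' ℝ) hcab
    simp only [h.ask.cdf_one, h.bid.cdf_one, IsPriceDensity.cdf_zero] at this
    exact this (by norm_num)
  have hc0 : c ∈ Ioo (0 : ℝ) 1 := by
    refine ⟨hc.1.lt_of_ne ?_, hc.2.lt_of_ne ?_⟩
    · rintro rfl
      simp [IsPriceDensity.cdf_zero] at ec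
    · rintro rfl
      rw [h.ask.cdf_one, h.bid.cdf_one] at ec
      norm_num at ec
  have hsc : s c = c := ma.injOn (hs c hc).1 hc (by rw [(hs c hc).2]; linarith)
  -- The root equation for `(t, s t)` becomes `W (s t) = ∫ z in c..t, kernel fa fb z`, with all
  -- integrals based at `c`. By `integral_kernel_gt`, `W` increases to the right of `c`.
  set W : ℝ → ℝ := fun x => (∫ z in c..x, kernel fa fb z) - (cdf fa x * (1 - cdf fb x))⁻¹ with hW
  have hWlt : ∀ x ∈ Ioo (0 : ℝ) 1, c < x → W c < W x := by
    intro x hx hlt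
    have := h.integral_kernel_gt hc0 hx hlt
    simp only [hW, intervalIntegral.integral_same]
    linarith
  -- Since `W (s t₀) > W c`, it suffices that the integral over `[t₀, c]` exceed `-W c`.
  obtain ⟨t₀, ht1, ht2⟩ := ((h.kernel_unbounded hc0 (-W c)).and (Ioo_mem_nhdsGT hc0.1)).exists
  have hcontU : ContinuousOn (fun x => ∫ z in c..x, kernel fa fb z) (Ioo 0 1) := fun x hx =>
    (BoundarySolution.continuousAt_integral_kernel h hc0 hx).continuousWithinAt
  have hcontW : ContinuousOn W (Ioo 0 1) := by
    refine hcontU.sub (ContinuousOn.inv₀ ((hca.mono Ioo_subset_Icc_self).mul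
      (h.continuousOn_survival.mono Ioo_subset_Icc_self)) fun x hx => ?_)
    exact (mul_pos (h.cdf_ask_pos hx) (h.cdf_bid_lt hx)).ne'
  have hcontg : ContinuousOn (fun t => W (s t) - ∫ z in c..t, kernel fa fb z) (Icc t₀ c) := by
    have hsub : Icc t₀ c ⊆ Ioo 0 1 := fun x hx => ⟨ht2.1.trans_le hx.1, hx.2.trans_lt hc0.2⟩
    exact ((hcontW.comp hcs hs0).sub hcontU).mono hsub
  have ht0 : t₀ ∈ Ioo (0 : ℝ) 1 := ⟨ht2.1, ht2.2.trans hc0.2⟩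
  have hpos : 0 ≤ W (s t₀) - ∫ z in c..t₀, kernel fa fb z := by
    have i1 := hanti t₀ (Ioo_subset_Icc_self ht0) c hc ht2.2
    rw [hsc] at i1
    have i2 := hWlt _ (hs0 t₀ ht0) i1
    rw [intervalIntegral.integral_symm] at ht1
    linarith
  have hWc : W c < 0 := by
    simp only [hW, intervalIntegral.integral_same, zero_sub, neg_lt_zero, inv_pos]
    exact mul_pos (h.cdf_ask_pos hc0) (h.cdf_bid_lt hc0)
  obtain ⟨l, hl, el⟩ := intermediate_value_Icc' ht2.2.le hcontg
    (show (0 : ℝ) ∈ Icc _ _ from ⟨by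
      simp only [hsc, intervalIntegral.integral_same, sub_zero]; exact hWc.le, hpos⟩)
  have hlc : l < c := by
    refine hl.2.lt_of_ne ?_
    rintro rfl
    simp only [hsc, intervalIntegral.integral_same, sub_zero] at el
    linarith
  have hl0 : l ∈ Ioo (0 : ℝ) 1 := ⟨ht2.1.trans_le hl.1, hlc.trans hc0.2⟩
  have hr0 := hs0 l hl0
  have hcr := hanti l (Ioo_subset_Icc_self hl0) c hc hlc
  rw [hsc] at hcr
  refine ⟨l, s l, hl0.1, hlc.trans hcr, hr0.2, (hs l (Ioo_subset_Icc_self hl0)).2, ?_⟩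
  have i2 := intervalIntegral.integral_interval_sub_left (h.intervalIntegrable_kernel hc0 hr0)
    (h.intervalIntegrable_kernel hc0 hl0)
  rw [← i2]
  simp only [hW] at el
  linarith

/-- The limiting distributions: `A x` is the limiting fraction of time that the lowest ask is above
`x`, and `B x` the limiting fraction of time that the highest bid is below `x`. -/
structure LimitPair (fa fb : ℝ → ℝ) (κb κa : ℝ) (A B : ℝ → ℝ) : Prop where
  sol : BoundarySolution fa fb A B κb κa
  contA : Continuous A
  contB : Continuous B
  A_of_le : ∀ x ≤ κb, A x = 1
  A_of_ge : ∀ x, κa ≤ x → A x = 0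
  B_of_le : ∀ x ≤ κb, B x = 0
  B_of_ge : ∀ x, κa ≤ x → B x = 1
  A_nonneg : ∀ x, 0 ≤ A x
  B_nonneg : ∀ x, 0 ≤ B x

/-- The quadrature and the conserved quantity are taken as definitions of `B₀` and `A₀`; the
threshold equations give the values at `r`. Composition with the clamping map `p` onto `[l, r]`
freezes both functions outside, which makes them continuous on the whole line. -/
lemma DensityPair.exists_limitPair (h : DensityPair fa fb m M) :
    ∃ κb κa A B, LimitPair fa fb κb κa A B := by
  obtain ⟨l, r, hl, hlr, hr, e, k⟩ := h.exists_thresholds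
  have hl0 : l ∈ Ioo (0 : ℝ) 1 := ⟨hl, hlr.trans hr⟩
  have hr0 : r ∈ Ioo (0 : ℝ) 1 := ⟨hl.trans hlr, hr⟩
  have hsub : Icc l r ⊆ Ioo 0 1 := fun x hx => ⟨hl.trans_le hx.1, hx.2.trans_lt hr⟩
  set c := 1 - cdf fb l with hc
  have hc0 : 0 < c := h.cdf_bid_lt hl0
  set U : ℝ → ℝ := fun x => ∫ z in l..x, kernel fa fb z with hU
  set B₀ : ℝ → ℝ := fun x => (1 - cdf fb x) * (c * U x) with hB₀
  set A₀ : ℝ → ℝ := fun x => (c - cdf fa x * B₀ x) * (1 - cdf fb x)⁻¹ with hA₀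
  set p : ℝ → ℝ := fun x => max l (min x r) with hp
  have hpc : Continuous p := continuous_const.max (continuous_id.min continuous_const)
  have hpm : ∀ x, p x ∈ Icc l r := fun x => ⟨le_max_left _ _, max_le hlr.le (min_le_right _ _)⟩
  have hpl : ∀ x ≤ l, p x = l := fun x hx => by
    simp only [hp]; rw [min_eq_left (hx.trans hlr.le), max_eq_left hx]
  have hpr : ∀ x, r ≤ x → p x = r := fun x hx => by
    simp only [hp]; rw [min_eq_right hx, max_eq_right hlr.le]
  have hpi : ∀ x ∈ Icc l r, p x = x := fun x hx => by
    simp only [hp]; rw [min_eq_left hx.2, max_eq_right hx.1]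
  have hUl : U l = 0 := by simp [hU]
  have hBl : B₀ l = 0 := by simp [hB₀, hUl]
  have hAl : A₀ l = 1 := by simp only [hA₀, hBl, mul_zero, sub_zero]; exact mul_inv_cancel₀ hc0.ne'
  have hBr : B₀ r = 1 := by
    have h1 := (h.cdf_bid_lt hr0).ne'
    simp only [hB₀, hU]
    rw [← k, e]
    field_simp
  have hAr : A₀ r = 0 := by simp only [hA₀, hBr, e]; simp
  have hUc : ContinuousOn U (Icc l r) := fun x hx =>
    (BoundarySolution.continuousAt_integral_kernel h hl0 (hsub hx)).continuousWithinAt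
  have hsc := h.continuousOn_survival.mono (hsub.trans Ioo_subset_Icc_self)
  have hBc : ContinuousOn B₀ (Icc l r) := hsc.mul (hUc.const_mul c)
  have hAc : ContinuousOn A₀ (Icc l r) := (continuousOn_const.sub (((h.ask.continuousOn_cdf
    h.pos).mono (hsub.trans Ioo_subset_Icc_self)).mul hBc)).mul
      (hsc.inv₀ fun x hx => (h.cdf_bid_lt (hsub hx)).ne')
  have hcA : Continuous (A₀ ∘ p) := hAc.comp_continuous hpc hpm
  have hcB : Continuous (B₀ ∘ p) := hBc.comp_continuous hpc hpm
  have acU : AbsolutelyContinuousOnInterval U l r :=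
    (h.intervalIntegrable_kernel hl0 hr0).absolutelyContinuousOnInterval_intervalIntegral (by simp)
  have acS := h.ac_survival (Ioo_subset_Icc_self hl0) (Ioo_subset_Icc_self hr0)
  have acB : AbsolutelyContinuousOnInterval B₀ l r := acS.fun_mul (acU.const_mul c)
  have acA : AbsolutelyContinuousOnInterval A₀ l r := by
    have h1 : AbsolutelyContinuousOnInterval (fun _ : ℝ => c) l r :=
      (LipschitzWith.const c).lipschitzOnWith.absolutelyContinuousOnInterval
    exact (h1.fun_sub ((h.ask.absolutelyContinuous_cdf h.pos (Ioo_subset_Icc_self hl0)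
      (Ioo_subset_Icc_self hr0)).fun_mul acB)).fun_mul (h.ac_survival_inv hl0 hr0)
  have lip : ∀ {f : ℝ → ℝ}, AbsolutelyContinuousOnInterval f l r → ∀ x ∈ Ioo l r, ∀ y ∈ Ioo l r,
      AbsolutelyContinuousOnInterval (f ∘ p) x y := by
    intro f hf x hx y hy
    have hs : uIcc x y ⊆ Icc l r :=
      uIcc_subset_Icc (Ioo_subset_Icc_self hx) (Ioo_subset_Icc_self hy)
    have h1 := hf.mono (hs.trans (uIcc_of_le hlr.le).ge)
    rw [absolutelyContinuousOnInterval_iff] at h1 ⊢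
    intro ε hε
    obtain ⟨δ, hδ, H⟩ := h1 ε hε
    refine ⟨δ, hδ, fun E hE hlt => ?_⟩
    refine lt_of_eq_of_lt (Finset.sum_congr rfl fun i hi => ?_) (H E hE hlt)
    simp only [Function.comp]
    rw [hpi _ (hs (hE.1 i hi).1), hpi _ (hs (hE.1 i hi).2)]
  have hev : ∀ x ∈ Ioo l r, ∀ f : ℝ → ℝ, f ∘ p =ᶠ[𝓝 x] f := by
    intro x hx f
    filter_upwards [isOpen_Ioo.mem_nhds hx] with y hy
    simp only [Function.comp, hpi y (Ioo_subset_Icc_self hy)]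
  have hdU : ∀ᵐ x, x ∈ Ioo l r → HasDerivAt U (kernel fa fb x) x := by
    filter_upwards [(h.intervalIntegrable_kernel hl0 hr0).ae_hasDerivAt_integral] with x hx hx'
    exact hx (by rw [uIcc_of_le hlr.le]; exact Ioo_subset_Icc_self hx') l (by simp)
  have hdB : ∀ᵐ x, x ∈ Ioo l r → HasDerivAt B₀ (fb x * A₀ x / cdf fa x) x := by
    filter_upwards [hdU, h.bid.ae_hasDerivAt_cdf h.pos] with x h1 h2 hx
    have hx1 := hsub (Ioo_subset_Icc_self hx)
    have ha := (h.cdf_ask_pos hx1).ne'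
    have hb := (h.cdf_bid_lt hx1).ne'
    refine (((h2 hx1).const_sub 1).mul ((h1 hx).const_mul c)).congr_deriv ?_
    simp only [hA₀, hB₀, kernel]
    field_simp
    ring
  have hdA : ∀ᵐ x, x ∈ Ioo l r → HasDerivAt A₀ (-(fa x * B₀ x / (1 - cdf fb x))) x := by
    filter_upwards [hdB, h.bid.ae_hasDerivAt_cdf h.pos, h.ask.ae_hasDerivAt_cdf h.pos]
      with x h1 h2 h3 hx
    have hx1 := hsub (Ioo_subset_Icc_self hx)
    have ha := (h.cdf_ask_pos hx1).ne'
    have hb := (h.cdf_bid_lt hx1).ne'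
    refine ((((h3 hx1).mul (h1 hx)).const_sub c).mul (((h2 hx1).const_sub 1).inv hb)).congr_deriv ?_
    simp only [hA₀, Pi.inv_apply, Pi.mul_apply]
    field_simp
    ring
  have hsys : BalanceSystem fa fb (A₀ ∘ p) (B₀ ∘ p) l r := by
    refine ⟨lip acA, lip acB, ?_, ?_⟩
    · filter_upwards [hdA] with x hx hx'
      simp only [Function.comp, hpi x (Ioo_subset_Icc_self hx')]
      exact (hx hx').congr_of_eventuallyEq (hev x hx' A₀)
    · filter_upwards [hdB] with x hx hx'
      simp only [Function.comp, hpi x (Ioo_subset_Icc_self hx')]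
      exact (hx hx').congr_of_eventuallyEq (hev x hx' B₀)
  have hBnn : ∀ x, 0 ≤ (B₀ ∘ p) x := by
    intro x
    have hx1 := hpm x
    have h1 : 0 ≤ U (p x) := by
      rcases eq_or_lt_of_le hx1.1 with e1 | e1
      · rw [← e1, hUl]
      · exact (h.integral_kernel_pos hl0 (hsub hx1) e1).le
    have := h.cdf_bid_lt (hsub hx1)
    simp only [Function.comp, hB₀]
    positivity
  have hAnn : ∀ x, 0 ≤ (A₀ ∘ p) x := by
    intro x
    have hx1 := hpm x
    -- Nonnegativity comes from the right end: `A₀` vanishes at `r` and has nonpositive derivative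
    -- since `B₀` is nonnegative.
    have h0 : (A₀ ∘ p) r - (A₀ ∘ p) (p x) = ∫ z in (p x)..r, -(fa z * B₀ (p z) / (1 - cdf fb z)) := by
      simp only [Function.comp, hpi r ⟨hlr.le, le_rfl⟩, hpi _ hx1]
      refine (acA.mono (c := p x) (d := r) ?_).sub_eq_integral ?_
      · rw [uIcc_of_le hlr.le]
        exact uIcc_subset_Icc hx1 ⟨hlr.le, le_rfl⟩
      · filter_upwards [hdA] with z hz hz'
        rw [uIoo_of_le hx1.2] at hz'
        have hz2 : z ∈ Ioo l r := ⟨hx1.1.trans_lt hz'.1, hz'.2⟩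
        rw [hpi z (Ioo_subset_Icc_self hz2)]
        exact hz hz2
    have h1 : ∫ z in (p x)..r, -(fa z * B₀ (p z) / (1 - cdf fb z)) ≤ 0 := by
      rw [intervalIntegral.integral_neg, Left.neg_nonpos_iff]
      refine intervalIntegral.integral_nonneg hx1.2 fun z hz => ?_
      have hz1 := hsub ⟨hx1.1.trans hz.1, hz.2⟩
      have h3 := (h.pos.trans_le (h.ask.lower z hz1)).le
      have h4 := hBnn z
      have h5 := h.cdf_bid_lt hz1
      simp only [Function.comp] at h4
      positivity
    simp only [Function.comp, hpi r ⟨hlr.le, le_rfl⟩, hpi _ hx1, hAr] at h0 ⊢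
    linarith
  have vals : (A₀ ∘ p) l = 1 ∧ (B₀ ∘ p) l = 0 ∧ (A₀ ∘ p) r = 0 ∧ (B₀ ∘ p) r = 1 := by
    simp only [Function.comp, hpl l le_rfl, hpr r le_rfl]
    exact ⟨hAl, hBl, hAr, hBr⟩
  have tl : ∀ {f : ℝ → ℝ} {a v : ℝ} {s : Set ℝ}, Continuous f → f a = v →
      Tendsto f (𝓝[s] a) (𝓝 v) := by
    rintro f a v s hf rfl
    exact hf.continuousAt.tendsto.mono_left nhdsWithin_le_nhds
  refine ⟨l, r, A₀ ∘ p, B₀ ∘ p, ⟨hsys, hl.le, hlr, hr.le, tl hcA vals.1, tl hcB vals.2.1,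
    tl hcA vals.2.2.1, tl hcB vals.2.2.2⟩, hcA, hcB, ?_, ?_, ?_, ?_, hAnn, hBnn⟩
  · intro x hx
    simp only [Function.comp, hpl x hx, hAl]
  · intro x hx
    simp only [Function.comp, hpr x hx, hAr]
  · intro x hx
    simp only [Function.comp, hpl x hx, hBl]
  · intro x hx
    simp only [Function.comp, hpr x hx, hBr]

end

noncomputable section

variable {fa fb : ℝ → ℝ} {m M : ℝ}

/-! ### Uniqueness for the second-order problems -/

/-- The intervals with rational endpoints are countably many and exhaust the open interval, so the
exceptional null sets can be merged. -/
lemma ae_of_forall_uIcc {p : ℝ → Prop} {l r : ℝ}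
    (h : ∀ x ∈ Ioo l r, ∀ y ∈ Ioo l r, ∀ᵐ z, z ∈ uIcc x y → p z) :
    ∀ᵐ z, z ∈ Ioo l r → p z := by
  have : ∀ᵐ z, ∀ q q' : ℚ, (q : ℝ) ∈ Ioo l r → (q' : ℝ) ∈ Ioo l r → z ∈ uIcc (q : ℝ) q' → p z := by
    rw [ae_all_iff]; intro q
    rw [ae_all_iff]; intro q'
    by_cases hq : (q : ℝ) ∈ Ioo l r ∧ (q' : ℝ) ∈ Ioo l r
    · filter_upwards [h q hq.1 q' hq.2] with z hz _ _ using hz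
    · exact Eventually.of_forall fun z h1 h2 => absurd ⟨h1, h2⟩ hq
  filter_upwards [this] with z hz hz'
  obtain ⟨q, h1, h2⟩ := exists_rat_btwn hz'.1
  obtain ⟨q', h3, h4⟩ := exists_rat_btwn hz'.2
  refine hz q q' ⟨h1, h2.trans hz'.2⟩ ⟨hz'.1.trans h3, h4⟩ ?_
  rw [uIcc_of_le (h2.trans h3).le]
  exact ⟨h2.le, h3.le⟩

lemma tendsto_primitive_left {g : ℝ → ℝ} {l r : ℝ} (hlr : l < r) (hg : IntegrableOn g (Ioo l r)) :
    Tendsto (fun x => ∫ z in l..x, g z) (𝓝[>] l) (𝓝 0) := by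
  have hi : IntervalIntegrable g volume l r := by
    rwa [intervalIntegrable_iff_integrableOn_Ioo_of_le hlr.le]
  have hc := intervalIntegral.continuousOn_primitive_interval' (a := l) hi (by simp)
  rw [uIcc_of_le hlr.le] at hc
  simpa using tendsto_nhdsGT_of_continuousOn hc ⟨le_rfl, hlr⟩

lemma tendsto_primitive_right {g : ℝ → ℝ} {l r : ℝ} (hlr : l < r) (hg : IntegrableOn g (Ioo l r)) :
    Tendsto (fun x => ∫ z in l..x, g z) (𝓝[<] r) (𝓝 (∫ z in l..r, g z)) := by
  have hi : IntervalIntegrable g volume l r := by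
    rwa [intervalIntegrable_iff_integrableOn_Ioo_of_le hlr.le]
  have hc := intervalIntegral.continuousOn_primitive_interval' (a := l) hi (by simp)
  rw [uIcc_of_le hlr.le] at hc
  exact tendsto_nhdsLT_of_continuousOn hc ⟨hlr, le_rfl⟩

/-- A function with a.e. derivative an integrable `g` is a primitive of `g` up to a constant. -/
lemma exists_eq_const_add_primitive {f g : ℝ → ℝ} {l r : ℝ} (hlr : l < r)
    (hg : IntegrableOn g (Ioo l r))
    (hf : ∀ x ∈ Ioo l r, ∀ y ∈ Ioo l r, AbsolutelyContinuousOnInterval f x y)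
    (hd : ∀ᵐ x, x ∈ Ioo l r → HasDerivAt f (g x) x) :
    ∃ c, ∀ x ∈ Ioo l r, f x = c + ∫ z in l..x, g z := by
  have hi : IntervalIntegrable g volume l r := by
    rwa [intervalIntegrable_iff_integrableOn_Ioo_of_le hlr.le]
  have hi' : ∀ x ∈ Ioo l r, IntervalIntegrable g volume l x := fun x hx =>
    hi.mono_set (by
      rw [uIcc_of_le hlr.le, uIcc_of_le hx.1.le]
      exact Icc_subset_Icc le_rfl hx.2.le)
  obtain ⟨x₀, hx₀⟩ : (Ioo l r).Nonempty := nonempty_Ioo.2 hlr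
  refine ⟨f x₀ - ∫ z in l..x₀, g z, fun x hx => ?_⟩
  have h1 : f x - f x₀ = ∫ z in x₀..x, g z := (hf x₀ hx₀ x hx).sub_eq_integral (by
    filter_upwards [hd] with z hz hz'
    exact hz (ordConnected_Ioo.uIcc_subset hx₀ hx (Ioo_subset_Icc_self hz')))
  rw [← intervalIntegral.integral_interval_sub_left (hi' x hx) (hi' x₀ hx₀)] at h1
  linarith

/-- A solution of the bid problem solves the boundary problem for the first-order system. -/
lemma IsBidSolution.boundarySolution (h : DensityPair fa fb m M) {l r : ℝ} {w : ℝ → ℝ}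
    (hl : 0 ≤ l) (hlr : l < r) (hr : r ≤ 1) (hw : IsBidSolution fa fb l r w) :
    ∃ B, BoundarySolution fa fb (fun x => cdf fa x * w x) B l r := by
  obtain ⟨B, hac, hae⟩ := hw.ode
  have hsub : Ioo l r ⊆ Ioo 0 1 := Ioo_subset_Ioo hl hr
  set A : ℝ → ℝ := fun x => cdf fa x * w x with hA
  have hdiff : ∀ᵐ x, x ∈ Ioo l r → DifferentiableAt ℝ A x :=
    ae_of_forall_uIcc fun x hx y hy => (hac x hx y hy).1.ae_differentiableAt
  have hsys : BalanceSystem fa fb A B l r := by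
    refine ⟨fun x hx y hy => (hac x hx y hy).1, fun x hx y hy => (hac x hx y hy).2, ?_, ?_⟩
    · filter_upwards [hdiff, hae] with x h1 h2 hx
      refine (h1 hx).hasDerivAt.congr_deriv ?_
      have hb := (h.cdf_bid_lt (hsub hx)).ne'
      have hf := (h.pos.trans_le (h.ask.lower x (hsub hx))).ne'
      rw [(h2 hx).1]
      field_simp
    · filter_upwards [hae] with x h2 hx
      refine (h2 hx).2.congr_deriv ?_
      have ha := (h.cdf_ask_pos (hsub hx)).ne'
      simp only [hA]
      field_simp
  -- The quasi-derivative is known up to its value `b` at the left end. The normalization says that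
  -- it increases by exactly `1` across the interval.
  obtain ⟨b, hb⟩ := exists_eq_const_add_primitive hlr hw.integrable hsys.acB
    (hae.mono fun x hx hx' => (hx hx').2)
  have hB0 : Tendsto B (𝓝[>] l) (𝓝 b) := by
    have := (tendsto_primitive_left hlr hw.integrable).const_add b
    rw [add_zero] at this
    refine this.congr' ?_
    filter_upwards [Ioo_mem_nhdsGT hlr] with x hx using (hb x hx).symm
  have hB1 : Tendsto B (𝓝[<] r) (𝓝 (b + 1)) := by
    have := (tendsto_primitive_right hlr hw.integrable).const_add b
    rw [hw.norm] at this
    refine this.congr' ?_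
    filter_upwards [Ioo_mem_nhdsLT hlr] with x hx using (hb x hx).symm
  have hA1 : Tendsto A (𝓝[<] r) (𝓝 0) := by
    simpa using (tendsto_nhdsLT_of_continuousOn (h.ask.continuousOn_cdf h.pos)
      ⟨hl.trans_lt hlr, hr⟩).mul hw.terminal
  -- Near `l` one has `A' ≈ -f_a b / (1 - F_b)` with `f_a ≥ m`. If `b ≠ 0`, then `b (A - 1)` is at
  -- most `-(m b^2 / 2) (y - l)`, against the vanishing one-sided derivative of `A` at `l`.
  -- Multiplying by `b` treats both signs at once.
  have hb0 : b = 0 := by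
    by_contra hne
    have hb2 : 0 < b ^ 2 := by positivity
    have hev : ∀ᶠ x in 𝓝[>] l, b ^ 2 / 2 ≤ b * B x :=
      (hB0.const_mul b).eventually (le_mem_nhds (by nlinarith))
    obtain ⟨u, hu, hu'⟩ := mem_nhdsGT_iff_exists_Ioo_subset.1 (inter_mem hev (Ioo_mem_nhdsGT hlr))
    have key : ∀ y ∈ Ioo l u, b * (A y - 1) ≤ -(m * b ^ 2 / 2) * (y - l) := by
      intro y hy
      have hstep : ∀ x ∈ Ioo l y, b * (A y - A x) ≤ -(m * b ^ 2 / 2) * (y - x) := by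
        intro x hx
        have hx' : x ∈ Ioo l r := (hu' ⟨hx.1, hx.2.trans hy.2⟩).2
        have hy' : y ∈ Ioo l r := (hu' hy).2
        have e := (hsys.acA x hx' y hy').sub_eq_integral (by
          filter_upwards [hsys.derivA] with z hz hz'
          exact hz (ordConnected_Ioo.uIcc_subset hx' hy' (Ioo_subset_Icc_self hz')))
        have hint : IntervalIntegrable (fun z => -(fa z * B z / (1 - cdf fb z))) volume x y := by
          have hs := uIcc_subset_Ioo_unit (hsub hx') (hsub hy')
          have : ContinuousOn (fun z => -(B z / (1 - cdf fb z))) (uIcc x y) :=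
            ((hsys.acB x hx' y hy').continuousOn.div (h.continuousOn_survival.mono
              (hs.trans Ioo_subset_Icc_self)) fun z hz => (h.cdf_bid_lt (hs hz)).ne').neg
          refine ((h.ask.intervalIntegrable h.pos (Ioo_subset_Icc_self (hsub hx'))
            (Ioo_subset_Icc_self (hsub hy'))).mul_continuousOn this).congr fun z hz => ?_
          ring
        rw [e, ← intervalIntegral.integral_const_mul]
        have : -(m * b ^ 2 / 2) * (y - x) = ∫ z in x..y, -(m * b ^ 2 / 2) := by
          rw [intervalIntegral.integral_const, smul_eq_mul, mul_comm]
        rw [this]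
        refine intervalIntegral.integral_mono_on hx.2.le (hint.const_mul b) (by simp) fun z hz => ?_
        have hz' := hu' ⟨hx.1.trans_le hz.1, hz.2.trans_lt hy.2⟩
        have h1 : b ^ 2 / 2 ≤ b * B z := hz'.1
        have h2 := h.cdf_bid_lt (hsub hz'.2)
        have h3 := h.ask.lower z (hsub hz'.2)
        have h4 := (h.bid.cdf_mem_Icc h.pos (Ioo_subset_Icc_self (hsub hz'.2))).1
        have h5 : m * b ^ 2 / 2 ≤ fa z * (b * B z) := by
          rw [mul_div_assoc]
          exact mul_le_mul h3 h1 (by positivity) (h.pos.le.trans h3)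
        have h6 : fa z * (b * B z) ≤ fa z * (b * B z) / (1 - cdf fb z) := by
          rw [le_div_iff₀ h2]
          have : 0 ≤ fa z * (b * B z) := (by have := h.pos; positivity : 0 ≤ m * b ^ 2 / 2).trans h5
          nlinarith
        have h7 : b * -(fa z * B z / (1 - cdf fb z)) = -(fa z * (b * B z) / (1 - cdf fb z)) := by
          ring
        rw [h7]
        linarith
      have t1 : Tendsto (fun x => b * (A y - A x)) (𝓝[>] l) (𝓝 (b * (A y - 1))) :=
        (tendsto_const_nhds.sub hw.initial_value).const_mul b
      have t2 : Tendsto (fun x => -(m * b ^ 2 / 2) * (y - x)) (𝓝[>] l)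
          (𝓝 (-(m * b ^ 2 / 2) * (y - l))) :=
        ((tendsto_const_nhds.sub (tendsto_id.mono_left nhdsWithin_le_nhds))).const_mul _
      refine le_of_tendsto_of_tendsto t1 t2 ?_
      filter_upwards [Ioo_mem_nhdsGT hy.1] with x hx using hstep x hx
    have t := hw.initial_deriv.const_mul b
    have hle : b * 0 ≤ -(m * b ^ 2 / 2) := by
      refine le_of_tendsto t ?_
      filter_upwards [Ioo_mem_nhdsGT hu] with y hy
      have := key y hy
      have hyl : 0 < y - l := sub_pos.2 hy.1
      rw [← mul_div_assoc, div_le_iff₀ hyl]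
      exact this
    have := h.pos
    have : 0 < m * b ^ 2 / 2 := by positivity
    linarith
  rw [hb0] at hB0 hB1
  rw [zero_add] at hB1
  exact ⟨B, hsys, hl, hlr, hr, hw.initial_value, hB0, hA1, hB1⟩

/-- A solution of the ask problem solves the boundary problem for the first-order system. -/
lemma IsAskSolution.boundarySolution (h : DensityPair fa fb m M) {l r : ℝ} {w : ℝ → ℝ}
    (hl : 0 ≤ l) (hlr : l < r) (hr : r ≤ 1) (hw : IsAskSolution fa fb l r w) :
    ∃ A, BoundarySolution fa fb A (fun x => (1 - cdf fb x) * w x) l r := by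
  obtain ⟨A, hac, hae⟩ := hw.ode
  have hsub : Ioo l r ⊆ Ioo 0 1 := Ioo_subset_Ioo hl hr
  set B : ℝ → ℝ := fun x => (1 - cdf fb x) * w x with hB
  have hdiff : ∀ᵐ x, x ∈ Ioo l r → DifferentiableAt ℝ B x :=
    ae_of_forall_uIcc fun x hx y hy => (hac x hx y hy).1.ae_differentiableAt
  have hsys : BalanceSystem fa fb A B l r := by
    refine ⟨fun x hx y hy => (hac x hx y hy).2, fun x hx y hy => (hac x hx y hy).1, ?_, ?_⟩
    · filter_upwards [hae] with x h2 hx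
      refine (h2 hx).2.congr_deriv ?_
      have hb := (h.cdf_bid_lt (hsub hx)).ne'
      simp only [hB]
      field_simp
    · filter_upwards [hdiff, hae] with x h1 h2 hx
      refine (h1 hx).hasDerivAt.congr_deriv ?_
      have ha := (h.cdf_ask_pos (hsub hx)).ne'
      have hf := (h.pos.trans_le (h.bid.lower x (hsub hx))).ne'
      rw [(h2 hx).1]
      field_simp
  -- Here the quasi-derivative is `A`, which decreases by `1`, and the condition to be recovered is
  -- its value `b - 1 = 0` at the right end.
  obtain ⟨b, hb⟩ := exists_eq_const_add_primitive hlr hw.integrable.neg hsys.acA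
    (hae.mono fun x hx hx' => (hx hx').2)
  have hA0 : Tendsto A (𝓝[>] l) (𝓝 b) := by
    have := (tendsto_primitive_left hlr hw.integrable.neg).const_add b
    rw [add_zero] at this
    refine this.congr' ?_
    filter_upwards [Ioo_mem_nhdsGT hlr] with x hx using (hb x hx).symm
  have hA1 : Tendsto A (𝓝[<] r) (𝓝 (b - 1)) := by
    have := (tendsto_primitive_right hlr hw.integrable.neg).const_add b
    simp only [Pi.neg_apply, intervalIntegral.integral_neg, hw.norm, ← sub_eq_add_neg] at this
    refine this.congr' ?_
    filter_upwards [Ioo_mem_nhdsLT hlr] with x hx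
    rw [hb x hx]
    simp [sub_eq_add_neg]
  have hB1 : Tendsto B (𝓝[>] l) (𝓝 0) := by
    simpa using (tendsto_nhdsGT_of_continuousOn h.continuousOn_survival
      ⟨hl, hlr.trans_le hr⟩).mul hw.terminal
  -- Mirror image of the bid case: a nonzero value `a` of `A` at `r` would force `B` to have slope
  -- at least `m |a| / 2` in absolute value near `r`, against its vanishing derivative there.
  have hb0 : b - 1 = 0 := by
    set a := b - 1
    by_contra hne
    have hb2 : 0 < a ^ 2 := by positivity
    have hev : ∀ᶠ x in 𝓝[<] r, a ^ 2 / 2 ≤ a * A x :=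
      (hA1.const_mul a).eventually (le_mem_nhds (by nlinarith))
    obtain ⟨u, hu, hu'⟩ := mem_nhdsLT_iff_exists_Ioo_subset.1 (inter_mem hev (Ioo_mem_nhdsLT hlr))
    have key : ∀ x ∈ Ioo u r, m * a ^ 2 / 2 * (r - x) ≤ a * (1 - B x) := by
      intro x hx
      have hstep : ∀ y ∈ Ioo x r, m * a ^ 2 / 2 * (y - x) ≤ a * (B y - B x) := by
        intro y hy
        have hx' : x ∈ Ioo l r := (hu' hx).2
        have hy' : y ∈ Ioo l r := (hu' ⟨hx.1.trans hy.1, hy.2⟩).2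
        have e := (hsys.acB x hx' y hy').sub_eq_integral (by
          filter_upwards [hsys.derivB] with z hz hz'
          exact hz (ordConnected_Ioo.uIcc_subset hx' hy' (Ioo_subset_Icc_self hz')))
        have hint : IntervalIntegrable (fun z => fb z * A z / cdf fa z) volume x y := by
          have hs := uIcc_subset_Ioo_unit (hsub hx') (hsub hy')
          have : ContinuousOn (fun z => A z / cdf fa z) (uIcc x y) :=
            (hsys.acA x hx' y hy').continuousOn.div ((h.ask.continuousOn_cdf h.pos).mono
              (hs.trans Ioo_subset_Icc_self)) fun z hz => (h.cdf_ask_pos (hs hz)).ne'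
          refine ((h.bid.intervalIntegrable h.pos (Ioo_subset_Icc_self (hsub hx'))
            (Ioo_subset_Icc_self (hsub hy'))).mul_continuousOn this).congr fun z hz => ?_
          ring
        rw [e, ← intervalIntegral.integral_const_mul]
        have : m * a ^ 2 / 2 * (y - x) = ∫ z in x..y, m * a ^ 2 / 2 := by
          rw [intervalIntegral.integral_const, smul_eq_mul, mul_comm]
        rw [this]
        refine intervalIntegral.integral_mono_on hy.1.le (by simp) (hint.const_mul a) fun z hz => ?_
        have hz' := hu' ⟨hx.1.trans_le hz.1, hz.2.trans_lt hy.2⟩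
        have h1 : a ^ 2 / 2 ≤ a * A z := hz'.1
        have h2 := h.cdf_ask_pos (hsub hz'.2)
        have h3 := h.bid.lower z (hsub hz'.2)
        have h4 := (h.ask.cdf_mem_Icc h.pos (Ioo_subset_Icc_self (hsub hz'.2))).2
        have h5 : m * a ^ 2 / 2 ≤ fb z * (a * A z) := by
          rw [mul_div_assoc]
          exact mul_le_mul h3 h1 (by positivity) (h.pos.le.trans h3)
        have h6 : fb z * (a * A z) ≤ fb z * (a * A z) / cdf fa z := by
          rw [le_div_iff₀ h2]
          have : 0 ≤ fb z * (a * A z) := (by have := h.pos; positivity : 0 ≤ m * a ^ 2 / 2).trans h5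
          nlinarith
        have h7 : a * (fb z * A z / cdf fa z) = fb z * (a * A z) / cdf fa z := by ring
        rw [h7]
        linarith
      have t1 : Tendsto (fun y => a * (B y - B x)) (𝓝[<] r) (𝓝 (a * (1 - B x))) :=
        (hw.initial_value.sub tendsto_const_nhds).const_mul a
      have t2 : Tendsto (fun y => m * a ^ 2 / 2 * (y - x)) (𝓝[<] r)
          (𝓝 (m * a ^ 2 / 2 * (r - x))) :=
        (((tendsto_id.mono_left nhdsWithin_le_nhds).sub tendsto_const_nhds)).const_mul _
      refine le_of_tendsto_of_tendsto t2 t1 ?_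
      filter_upwards [Ioo_mem_nhdsLT hx.2] with y hy using hstep y hy
    have t := hw.initial_deriv.const_mul a
    have hle : m * a ^ 2 / 2 ≤ a * 0 := by
      refine ge_of_tendsto t ?_
      filter_upwards [Ioo_mem_nhdsLT hu] with y hy
      have := key y hy
      have hyl : 0 < r - y := sub_pos.2 hy.2
      have e : (B y - 1) / (y - r) = (1 - B y) / (r - y) := by
        rw [← neg_div_neg_eq, neg_sub, neg_sub]
      change _ ≤ a * ((B y - 1) / (y - r))
      rw [e, ← mul_div_assoc, le_div_iff₀ hyl]
      exact this
    have := h.pos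
    have : 0 < m * a ^ 2 / 2 := by positivity
    linarith
  rw [hb0] at hA1
  rw [sub_eq_zero.1 hb0] at hA0
  exact ⟨A, hsys, hl, hlr, hr, hA0, hB1, hA1, hw.initial_value⟩

end

noncomputable section

variable {fa fb : ℝ → ℝ} {m M : ℝ}

/-! ### Properties of the limits -/

/-- The limiting density of the highest bid. -/
def limitBid (fa fb : ℝ → ℝ) (κb κa : ℝ) (A : ℝ → ℝ) : ℝ → ℝ :=
  (Ioo κb κa).indicator fun x => fb x * A x / cdf fa x

/-- The limiting density of the lowest ask. -/
def limitAsk (fa fb : ℝ → ℝ) (κb κa : ℝ) (B : ℝ → ℝ) : ℝ → ℝ :=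
  (Ioo κb κa).indicator fun x => fa x * B x / (1 - cdf fb x)

/-- If the primitive of a locally bounded function `f` is differentiable at `x` with derivative
`f x`, then so is the primitive of `f * g` for `g` continuous. -/
lemma hasDerivAt_of_integral_mul {f g F G : ℝ → ℝ} {x C : ℝ} {s : Set ℝ} (hs : s ∈ 𝓝 x)
    (hf : ∀ y ∈ s, ∀ z ∈ s, IntervalIntegrable f volume y z) (hfC : ∀ y ∈ s, |f y| ≤ C)
    (hF : ∀ y ∈ s, F y - F x = ∫ z in x..y, f z) (hFd : HasDerivAt F (f x) x)
    (hg : ContinuousOn g s)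
    (hG : ∀ y ∈ s, G y - G x = ∫ z in x..y, f z * g z) : HasDerivAt G (f x * g x) x := by
  have hC : 0 ≤ C := (abs_nonneg _).trans (hfC x (mem_of_mem_nhds hs))
  rw [hasDerivAt_iff_isLittleO] at hFd ⊢
  -- The difference is the integral of `f (g - g x)`, which is small relative to the length of the
  -- interval because `f` is bounded and `g` continuous. The remaining part is `g x` times the
  -- differentiability of `F`.
  have h1 : (fun y => (G y - G x) - (F y - F x) * g x) =o[𝓝 x] fun y => y - x := by
    rw [Asymptotics.isLittleO_iff]
    intro c hc
    have hgc := (hg.continuousAt hs).tendsto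
    -- The denominator `C + 1` instead of `C` covers the case `C = 0`.
    have hev : ∀ᶠ y in 𝓝 x, |g y - g x| ≤ c / (C + 1) := by
      have := Metric.tendsto_nhds.1 hgc (c / (C + 1)) (by positivity)
      filter_upwards [this] with y hy
      rw [← Real.dist_eq]; exact hy.le
    obtain ⟨δ, hδ, hball⟩ := Metric.mem_nhds_iff.1 (inter_mem hev hs)
    filter_upwards [Metric.ball_mem_nhds x hδ] with y hy
    have hsub : uIcc x y ⊆ Metric.ball x δ := by
      rw [Real.ball_eq_Ioo] at hy ⊢
      exact ordConnected_Ioo.uIcc_subset ⟨by linarith, by linarith⟩ hy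
    have hxs := mem_of_mem_nhds hs
    have hys : y ∈ s := (hball hy).2
    have hus : uIcc x y ⊆ s := fun z hz => (hball (hsub hz)).2
    have e : (G y - G x) - (F y - F x) * g x = ∫ z in x..y, f z * (g z - g x) := by
      rw [hG y hys, hF y hys, ← intervalIntegral.integral_mul_const,
        ← intervalIntegral.integral_sub ((hf x hxs y hys).mul_continuousOn (hg.mono hus))
          ((hf x hxs y hys).mul_const _)]
      simp only [mul_sub]
    rw [e]
    have := intervalIntegral.norm_integral_le_of_norm_le_const (C := C * (c / (C + 1)))
      (f := fun z => f z * (g z - g x)) (a := x) (b := y) fun z hz => by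
        have hz' := uIoc_subset_uIcc hz
        rw [Real.norm_eq_abs, abs_mul]
        have h1 : |g z - g x| ≤ c / (C + 1) := (hball (hsub hz')).1
        exact mul_le_mul (hfC z (hus hz')) h1 (abs_nonneg _) hC
    refine this.trans ?_
    rw [Real.norm_eq_abs]
    gcongr
    rw [mul_div_assoc', div_le_iff₀ (by positivity)]
    nlinarith
  have h2 : (fun y => (F y - F x - (y - x) • f x) * g x) =o[𝓝 x] fun y => y - x := by
    simpa [mul_comm] using hFd.const_mul_left (g x)
  refine (h1.add h2).congr_left fun y => ?_
  simp only [smul_eq_mul]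
  ring

namespace LimitPair

variable {κb κa : ℝ} {A B : ℝ → ℝ}

lemma Icc_subset (hp : LimitPair fa fb κb κa A B) (h : DensityPair fa fb m M) :
    Icc κb κa ⊆ Ioo 0 1 := fun _ hx =>
  ⟨(hp.sol.left_pos h).trans_le hx.1, hx.2.trans_lt (hp.sol.right_lt_one h)⟩

lemma Ioo_subset (hp : LimitPair fa fb κb κa A B) (h : DensityPair fa fb m M) :
    Ioo κb κa ⊆ Ioo 0 1 := Ioo_subset_Icc_self.trans (hp.Icc_subset h)

lemma continuousOn_A_div (hp : LimitPair fa fb κb κa A B) (h : DensityPair fa fb m M) :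
    ContinuousOn (fun x => A x / cdf fa x) (Icc κb κa) :=
  hp.contA.continuousOn.div ((h.ask.continuousOn_cdf h.pos).mono
    ((hp.Icc_subset h).trans Ioo_subset_Icc_self)) fun _ hx =>
      (h.cdf_ask_pos (hp.Icc_subset h hx)).ne'

lemma continuousOn_B_div (hp : LimitPair fa fb κb κa A B) (h : DensityPair fa fb m M) :
    ContinuousOn (fun x => B x / (1 - cdf fb x)) (Icc κb κa) :=
  hp.contB.continuousOn.div (h.continuousOn_survival.mono
    ((hp.Icc_subset h).trans Ioo_subset_Icc_self)) fun _ hx =>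
      (h.cdf_bid_lt (hp.Icc_subset h hx)).ne'

lemma lt (hp : LimitPair fa fb κb κa A B) : κb < κa := hp.sol.lt

lemma intervalIntegrable_bid (hp : LimitPair fa fb κb κa A B) (h : DensityPair fa fb m M)
    {x y : ℝ} (hx : x ∈ Icc κb κa) (hy : y ∈ Icc κb κa) :
    IntervalIntegrable (fun x => fb x * A x / cdf fa x) volume x y := by
  have hs : uIcc x y ⊆ Icc κb κa := uIcc_subset_Icc hx hy
  refine (h.intervalIntegrable_mul_bid (Ioo_subset_Icc_self (hp.Icc_subset h hx))
    (Ioo_subset_Icc_self (hp.Icc_subset h hy)) ((hp.continuousOn_A_div h).mono hs)).congr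
      fun _ _ => ?_
  rw [mul_div_assoc]

lemma intervalIntegrable_ask (hp : LimitPair fa fb κb κa A B) (h : DensityPair fa fb m M)
    {x y : ℝ} (hx : x ∈ Icc κb κa) (hy : y ∈ Icc κb κa) :
    IntervalIntegrable (fun x => fa x * B x / (1 - cdf fb x)) volume x y := by
  have hs : uIcc x y ⊆ Icc κb κa := uIcc_subset_Icc hx hy
  refine ((h.ask.intervalIntegrable h.pos (Ioo_subset_Icc_self (hp.Icc_subset h hx))
    (Ioo_subset_Icc_self (hp.Icc_subset h hy))).mul_continuousOn
      ((hp.continuousOn_B_div h).mono hs)).congr fun _ _ => ?_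
  rw [mul_div_assoc]

lemma left_mem (hp : LimitPair fa fb κb κa A B) : κb ∈ Icc κb κa := ⟨le_rfl, hp.lt.le⟩

lemma right_mem (hp : LimitPair fa fb κb κa A B) : κa ∈ Icc κb κa := ⟨hp.lt.le, le_rfl⟩

lemma integrableOn_bid (hp : LimitPair fa fb κb κa A B) (h : DensityPair fa fb m M) :
    IntegrableOn (fun x => fb x * A x / cdf fa x) (Ioo κb κa) := by
  rw [← intervalIntegrable_iff_integrableOn_Ioo_of_le hp.lt.le]
  exact hp.intervalIntegrable_bid h hp.left_mem hp.right_mem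

lemma integrableOn_ask (hp : LimitPair fa fb κb κa A B) (h : DensityPair fa fb m M) :
    IntegrableOn (fun x => fa x * B x / (1 - cdf fb x)) (Ioo κb κa) := by
  rw [← intervalIntegrable_iff_integrableOn_Ioo_of_le hp.lt.le]
  exact hp.intervalIntegrable_ask h hp.left_mem hp.right_mem

/-- Extending an identity from the open to the closed interval. -/
lemma eqOn_Icc_of_Ioo (hp : LimitPair fa fb κb κa A B) {f g : ℝ → ℝ} (hf : Continuous f)
    (hg : ContinuousOn g (Icc κb κa)) (he : EqOn f g (Ioo κb κa)) : EqOn f g (Icc κb κa) := by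
  refine he.of_subset_closure hf.continuousOn hg Ioo_subset_Icc_self ?_
  rw [closure_Ioo hp.lt.ne]

lemma continuousOn_primitive (hp : LimitPair fa fb κb κa A B) {g : ℝ → ℝ}
    (hg : IntervalIntegrable g volume κb κa) :
    ContinuousOn (fun x => ∫ z in κb..x, g z) (Icc κb κa) := by
  have := intervalIntegral.continuousOn_primitive_interval' (a := κb) hg (by simp)
  rwa [uIcc_of_le hp.lt.le] at this

lemma B_eq_integral (hp : LimitPair fa fb κb κa A B) (h : DensityPair fa fb m M) :
    ∀ x ∈ Icc κb κa, B x = ∫ z in κb..x, fb z * A z / cdf fa z := by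
  obtain ⟨c, hc⟩ := exists_eq_const_add_primitive hp.lt (hp.integrableOn_bid h) hp.sol.acB
    hp.sol.derivB
  have hI := hp.continuousOn_primitive (hp.intervalIntegrable_bid h hp.left_mem hp.right_mem)
  have h1 := hp.eqOn_Icc_of_Ioo hp.contB (hI.const_add c) hc
  have h2 := h1 hp.left_mem
  simp only [hp.B_of_le κb le_rfl, intervalIntegral.integral_same, add_zero] at h2
  intro x hx
  exact (h1 hx).trans (by simp [← h2])

lemma A_eq_integral (hp : LimitPair fa fb κb κa A B) (h : DensityPair fa fb m M) :
    ∀ x ∈ Icc κb κa, A x = 1 - ∫ z in κb..x, fa z * B z / (1 - cdf fb z) := by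
  obtain ⟨c, hc⟩ := exists_eq_const_add_primitive hp.lt (hp.integrableOn_ask h).neg hp.sol.acA
    hp.sol.derivA
  have hI := hp.continuousOn_primitive (hp.intervalIntegrable_ask h hp.left_mem hp.right_mem).neg
  have h1 := hp.eqOn_Icc_of_Ioo hp.contA (hI.const_add c) hc
  have h2 := h1 hp.left_mem
  simp only [hp.A_of_le κb le_rfl, intervalIntegral.integral_same, add_zero] at h2
  intro x hx
  rw [h1 hx, ← h2]
  simp [sub_eq_add_neg]

lemma integral_bid (hp : LimitPair fa fb κb κa A B) (h : DensityPair fa fb m M) :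
    ∫ z in κb..κa, fb z * A z / cdf fa z = 1 := by
  rw [← hp.B_eq_integral h κa hp.right_mem, hp.B_of_ge κa le_rfl]

lemma integral_ask (hp : LimitPair fa fb κb κa A B) (h : DensityPair fa fb m M) :
    ∫ z in κb..κa, fa z * B z / (1 - cdf fb z) = 1 := by
  have := hp.A_eq_integral h κa hp.right_mem
  rw [hp.A_of_ge κa le_rfl] at this
  linarith

lemma isDensityOn_bid (hp : LimitPair fa fb κb κa A B) (h : DensityPair fa fb m M) :
    IsDensityOn κb κa (limitBid fa fb κb κa A) where
  nonneg x := indicator_nonneg (fun z hz => by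
    have h1 := h.cdf_ask_pos (hp.Ioo_subset h hz)
    have h2 := h.pos.trans_le (h.bid.lower z (hp.Ioo_subset h hz))
    have h3 := hp.A_nonneg z
    positivity) x
  support x hx := indicator_of_notMem hx _
  integrable := (integrable_indicator_iff measurableSet_Ioo).2 (hp.integrableOn_bid h)
  integral_eq_one := by
    rw [limitBid, integral_indicator measurableSet_Ioo, ← integral_Ioc_eq_integral_Ioo,
      ← intervalIntegral.integral_of_le hp.lt.le, hp.integral_bid h]

lemma isDensityOn_ask (hp : LimitPair fa fb κb κa A B) (h : DensityPair fa fb m M) :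
    IsDensityOn κb κa (limitAsk fa fb κb κa B) where
  nonneg x := indicator_nonneg (fun z hz => by
    have h1 := h.cdf_bid_lt (hp.Ioo_subset h hz)
    have h2 := h.pos.trans_le (h.ask.lower z (hp.Ioo_subset h hz))
    have h3 := hp.B_nonneg z
    positivity) x
  support x hx := indicator_of_notMem hx _
  integrable := (integrable_indicator_iff measurableSet_Ioo).2 (hp.integrableOn_ask h)
  integral_eq_one := by
    rw [limitAsk, integral_indicator measurableSet_Ioo, ← integral_Ioc_eq_integral_Ioo,
      ← intervalIntegral.integral_of_le hp.lt.le, hp.integral_ask h]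

lemma bid_mul (_hp : LimitPair fa fb κb κa A B) (h : DensityPair fa fb m M) {x : ℝ}
    (hx : x ∈ Ioo (0 : ℝ) 1) :
    limitBid fa fb κb κa A x / fb x * fb x = limitBid fa fb κb κa A x :=
  div_mul_cancel₀ _ (h.pos.trans_le (h.bid.lower x hx)).ne'

lemma ask_mul (_hp : LimitPair fa fb κb κa A B) (h : DensityPair fa fb m M) {x : ℝ}
    (hx : x ∈ Ioo (0 : ℝ) 1) :
    limitAsk fa fb κb κa B x / fa x * fa x = limitAsk fa fb κb κa B x :=
  div_mul_cancel₀ _ (h.pos.trans_le (h.ask.lower x hx)).ne'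

lemma cdf_mul_bid (hp : LimitPair fa fb κb κa A B) (h : DensityPair fa fb m M) {x : ℝ}
    (hx : x ∈ Ioo κb κa) : cdf fa x * (limitBid fa fb κb κa A x / fb x) = A x := by
  have hx1 := hp.Ioo_subset h hx
  have h1 := (h.cdf_ask_pos hx1).ne'
  have h2 := (h.pos.trans_le (h.bid.lower x hx1)).ne'
  rw [limitBid, indicator_of_mem hx]
  field_simp

lemma cdf_mul_ask (hp : LimitPair fa fb κb κa A B) (h : DensityPair fa fb m M) {x : ℝ}
    (hx : x ∈ Ioo κb κa) : (1 - cdf fb x) * (limitAsk fa fb κb κa B x / fa x) = B x := by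
  have hx1 := hp.Ioo_subset h hx
  have h1 := (h.cdf_bid_lt hx1).ne'
  have h2 := (h.pos.trans_le (h.ask.lower x hx1)).ne'
  rw [limitAsk, indicator_of_mem hx]
  field_simp

lemma integral_congr_bid (hp : LimitPair fa fb κb κa A B) (h : DensityPair fa fb m M) {x y : ℝ}
    (hx : x ∈ Icc κb κa) (hy : y ∈ Icc κb κa) (hxy : x ≤ y) :
    ∫ z in x..y, limitBid fa fb κb κa A z / fb z * fb z =
      ∫ z in x..y, fb z * A z / cdf fa z := by
  rw [intervalIntegral.integral_of_le hxy, intervalIntegral.integral_of_le hxy,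
    integral_Ioc_eq_integral_Ioo, integral_Ioc_eq_integral_Ioo]
  refine setIntegral_congr_fun measurableSet_Ioo fun z hz => ?_
  have hz' : z ∈ Ioo κb κa := ⟨hx.1.trans_lt hz.1, hz.2.trans_le hy.2⟩
  rw [hp.bid_mul h (hp.Ioo_subset h hz'), limitBid, indicator_of_mem hz']

lemma integral_congr_ask (hp : LimitPair fa fb κb κa A B) (h : DensityPair fa fb m M) {x y : ℝ}
    (hx : x ∈ Icc κb κa) (hy : y ∈ Icc κb κa) (hxy : x ≤ y) :
    ∫ z in x..y, limitAsk fa fb κb κa B z / fa z * fa z =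
      ∫ z in x..y, fa z * B z / (1 - cdf fb z) := by
  rw [intervalIntegral.integral_of_le hxy, intervalIntegral.integral_of_le hxy,
    integral_Ioc_eq_integral_Ioo, integral_Ioc_eq_integral_Ioo]
  refine setIntegral_congr_fun measurableSet_Ioo fun z hz => ?_
  have hz' : z ∈ Ioo κb κa := ⟨hx.1.trans_lt hz.1, hz.2.trans_le hy.2⟩
  rw [hp.ask_mul h (hp.Ioo_subset h hz'), limitAsk, indicator_of_mem hz']

lemma integrableOn_bid_mul (hp : LimitPair fa fb κb κa A B) (h : DensityPair fa fb m M) :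
    IntegrableOn (fun z => limitBid fa fb κb κa A z / fb z * fb z) (Ioo 0 1) :=
  (integrableOn_congr_fun (fun _ hx => hp.bid_mul h hx) measurableSet_Ioo).2
    (hp.isDensityOn_bid h).integrable.integrableOn

lemma integrableOn_ask_mul (hp : LimitPair fa fb κb κa A B) (h : DensityPair fa fb m M) :
    IntegrableOn (fun z => limitAsk fa fb κb κa B z / fa z * fa z) (Ioo 0 1) :=
  (integrableOn_congr_fun (fun _ hx => hp.ask_mul h hx) measurableSet_Ioo).2
    (hp.isDensityOn_ask h).integrable.integrableOn

lemma intervalIntegrable_of_integrableOn_unit {g : ℝ → ℝ} (hg : IntegrableOn g (Ioo 0 1)) {x y : ℝ}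
    (hx : x ∈ Icc (0 : ℝ) 1) (hy : y ∈ Icc (0 : ℝ) 1) : IntervalIntegrable g volume x y := by
  rw [← intervalIntegrable_iff_integrableOn_Ioo_of_le zero_le_one] at hg
  refine hg.mono_set ?_
  rw [uIcc_of_le (zero_le_one' ℝ)]
  exact uIcc_subset_Icc hx hy

/-- These are the integrated forms of the first-order system: `A` and `B` are the tail integral of
`πa` and the initial integral of `πb`, and the left sides are `A` and `B` by construction of the
densities. -/
lemma balanceEquations (hp : LimitPair fa fb κb κa A B) (h : DensityPair fa fb m M) :
    BalanceEquations fa fb κb κa (fun x => limitBid fa fb κb κa A x / fb x)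
      (fun x => limitAsk fa fb κb κa B x / fa x) where
  integrable_bid := hp.integrableOn_bid_mul h
  integrable_ask := hp.integrableOn_ask_mul h
  bid_norm := by
    rw [hp.integral_congr_bid h hp.left_mem hp.right_mem hp.lt.le, hp.integral_bid h]
  ask_norm := by
    rw [hp.integral_congr_ask h hp.left_mem hp.right_mem hp.lt.le, hp.integral_ask h]
  bid x hx := by
    have hx' := Ioo_subset_Icc_self hx
    have hi := fun {y z : ℝ} => intervalIntegrable_of_integrableOn_unit (x := y) (y := z)
      (hp.integrableOn_ask_mul h)
    have hκ := hp.Icc_subset h hp.right_mem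
    rw [hp.cdf_mul_bid h hx, ← intervalIntegral.integral_add_adjacent_intervals
      (hi (Ioo_subset_Icc_self (hp.Ioo_subset h hx)) (Ioo_subset_Icc_self hκ))
      (hi (Ioo_subset_Icc_self hκ) (by simp)), hp.integral_congr_ask h hx' hp.right_mem hx.2.le]
    -- The density vanishes to the right of `κa`, so the integral up to `1` is the integral up to
    -- `κa`.
    have h1 : ∫ z in κa..1, limitAsk fa fb κb κa B z / fa z * fa z = 0 := by
      rw [intervalIntegral.integral_of_le hκ.2.le]
      refine setIntegral_eq_zero_of_forall_eq_zero fun z hz => ?_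
      rw [limitAsk, indicator_of_notMem (fun hh => absurd hh.2 hz.1.not_gt)]
      simp
    have h2 := intervalIntegral.integral_add_adjacent_intervals
      (hp.intervalIntegrable_ask h hp.left_mem hx') (hp.intervalIntegrable_ask h hx' hp.right_mem)
    rw [hp.integral_ask h] at h2
    rw [h1, hp.A_eq_integral h x hx']
    linarith
  ask x hx := by
    have hx' := Ioo_subset_Icc_self hx
    have hi := fun {y z : ℝ} => intervalIntegrable_of_integrableOn_unit (x := y) (y := z)
      (hp.integrableOn_bid_mul h)
    have hκ := hp.Icc_subset h hp.left_mem
    rw [hp.cdf_mul_ask h hx, ← intervalIntegral.integral_add_adjacent_intervals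
      (hi (by simp) (Ioo_subset_Icc_self hκ)) (hi (Ioo_subset_Icc_self hκ)
        (Ioo_subset_Icc_self (hp.Ioo_subset h hx))),
      hp.integral_congr_bid h hp.left_mem hx' hx.1.le]
    have h1 : ∫ z in (0 : ℝ)..κb, limitBid fa fb κb κa A z / fb z * fb z = 0 := by
      rw [intervalIntegral.integral_of_le hκ.1.le]
      refine setIntegral_eq_zero_of_forall_eq_zero fun z hz => ?_
      rw [limitBid, indicator_of_notMem (fun hh => absurd hh.1 hz.2.not_gt)]
      simp
    rw [h1, zero_add, hp.B_eq_integral h x hx']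

lemma ac_congr {f g : ℝ → ℝ} {x y : ℝ} (hf : AbsolutelyContinuousOnInterval f x y)
    (he : EqOn f g (uIcc x y)) : AbsolutelyContinuousOnInterval g x y := by
  rw [absolutelyContinuousOnInterval_iff] at hf ⊢
  intro ε hε
  obtain ⟨δ, hδ, H⟩ := hf ε hε
  refine ⟨δ, hδ, fun E hE hlt => lt_of_eq_of_lt (Finset.sum_congr rfl fun i hi => ?_) (H E hE hlt)⟩
  rw [he (hE.1 i hi).1, he (hE.1 i hi).2]

lemma eventuallyEq_of_eqOn {f g : ℝ → ℝ} {l r x : ℝ} (he : EqOn f g (Ioo l r)) (hx : x ∈ Ioo l r) :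
    f =ᶠ[𝓝 x] g := by
  filter_upwards [isOpen_Ioo.mem_nhds hx] with y hy using he hy

/-- The witness for the quasi-derivative is `B`: dividing `A' = -f_a B / (1 - F_b)` by its
coefficient gives back `B`, whose derivative is `πb`. -/
lemma isBidSolution (hp : LimitPair fa fb κb κa A B) (h : DensityPair fa fb m M) :
    IsBidSolution fa fb κb κa (fun x => limitBid fa fb κb κa A x / fb x) := by
  have he : EqOn A (fun x => cdf fa x * (limitBid fa fb κb κa A x / fb x)) (Ioo κb κa) :=
    fun x hx => (hp.cdf_mul_bid h hx).symm
  refine ⟨⟨B, fun x hx y hy => ⟨ac_congr (hp.sol.acA x hx y hy)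
    (he.mono (ordConnected_Ioo.uIcc_subset hx hy)), hp.sol.acB x hx y hy⟩, ?_⟩, ?_, ?_, ?_, ?_, ?_⟩
  · filter_upwards [hp.sol.derivA, hp.sol.derivB] with x h1 h2 hx
    have hx1 := hp.Ioo_subset h hx
    have ha := (h.cdf_ask_pos hx1).ne'
    have hb := (h.cdf_bid_lt hx1).ne'
    have hf := (h.pos.trans_le (h.ask.lower x hx1)).ne'
    constructor
    · rw [← (eventuallyEq_of_eqOn he hx).deriv_eq, (h1 hx).deriv]
      field_simp
    · rw [hp.bid_mul h hx1, limitBid, indicator_of_mem hx]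
      exact h2 hx
  · refine hp.sol.A_left.congr' ?_
    filter_upwards [Ioo_mem_nhdsGT hp.lt] with x hx using he hx
  -- Here `A - 1` is minus the integral of `f_a B / (1 - F_b)`. The integrand is at most `M` times a
  -- quantity tending to `0` at `κb`, hence the one-sided derivative vanishes even if `f_a` has no
  -- limit there.
  · have hcB : Tendsto (fun x => B x / (1 - cdf fb x)) (𝓝[>] κb) (𝓝 0) := by
      have := tendsto_nhdsGT_of_continuousOn (hp.continuousOn_B_div h) ⟨le_rfl, hp.lt⟩
      simpa [hp.B_of_le κb le_rfl] using this
    rw [Metric.tendsto_nhds]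
    intro ε hε
    have hM := h.pos.trans_le h.ask.le_bound
    have hev := (Metric.tendsto_nhds.1 hcB (ε / (2 * M)) (by positivity))
    obtain ⟨u, hu, hu'⟩ := mem_nhdsGT_iff_exists_Ioo_subset.1 (inter_mem hev (Ioo_mem_nhdsGT hp.lt))
    filter_upwards [Ioo_mem_nhdsGT hu] with y hy
    have hy' : y ∈ Ioo κb κa := (hu' hy).2
    have hpos : 0 < y - κb := sub_pos.2 hy.1
    rw [hp.cdf_mul_bid h hy', hp.A_eq_integral h y (Ioo_subset_Icc_self hy'), Real.dist_eq, sub_zero,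
      abs_div, abs_of_pos hpos, div_lt_iff₀ hpos, sub_sub_cancel_left, abs_neg, ← Real.norm_eq_abs]
    have := intervalIntegral.norm_integral_le_of_norm_le_const (C := ε / 2)
      (f := fun z => fa z * B z / (1 - cdf fb z)) (a := κb) (b := y) fun z hz => by
        rw [uIoc_of_le hy.1.le] at hz
        have hz' := hu' ⟨hz.1, hz.2.trans_lt hy.2⟩
        have hz1 := hp.Ioo_subset h hz'.2
        have i1 := hz'.1
        simp only [mem_ofPred_eq, Real.dist_eq, sub_zero] at i1
        have i2 := h.pos.trans_le (h.ask.lower z hz1)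
        rw [Real.norm_eq_abs, mul_div_assoc, abs_mul, abs_of_pos i2]
        calc fa z * |B z / (1 - cdf fb z)| ≤ M * (ε / (2 * M)) :=
              mul_le_mul (h.ask.upper z hz1) i1.le (abs_nonneg _) hM.le
          _ = ε / 2 := by field_simp
    rw [abs_of_pos hpos] at this
    nlinarith
  · have hc : Tendsto (fun x => A x / cdf fa x) (𝓝[<] κa) (𝓝 0) := by
      have := tendsto_nhdsLT_of_continuousOn (hp.continuousOn_A_div h) ⟨hp.lt, le_rfl⟩
      simpa [hp.A_of_ge κa le_rfl] using this
    refine hc.congr' ?_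
    filter_upwards [Ioo_mem_nhdsLT hp.lt] with x hx
    have ha := (h.cdf_ask_pos (hp.Ioo_subset h hx)).ne'
    rw [← hp.cdf_mul_bid h hx]
    field_simp
  · exact (hp.integrableOn_bid_mul h).mono_set (hp.Ioo_subset h)
  · rw [hp.integral_congr_bid h hp.left_mem hp.right_mem hp.lt.le, hp.integral_bid h]

lemma isAskSolution (hp : LimitPair fa fb κb κa A B) (h : DensityPair fa fb m M) :
    IsAskSolution fa fb κb κa (fun x => limitAsk fa fb κb κa B x / fa x) := by
  have he : EqOn B (fun x => (1 - cdf fb x) * (limitAsk fa fb κb κa B x / fa x)) (Ioo κb κa) :=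
    fun x hx => (hp.cdf_mul_ask h hx).symm
  refine ⟨⟨A, fun x hx y hy => ⟨ac_congr (hp.sol.acB x hx y hy)
    (he.mono (ordConnected_Ioo.uIcc_subset hx hy)), hp.sol.acA x hx y hy⟩, ?_⟩, ?_, ?_, ?_, ?_, ?_⟩
  · filter_upwards [hp.sol.derivA, hp.sol.derivB] with x h1 h2 hx
    have hx1 := hp.Ioo_subset h hx
    have ha := (h.cdf_ask_pos hx1).ne'
    have hb := (h.cdf_bid_lt hx1).ne'
    have hf := (h.pos.trans_le (h.bid.lower x hx1)).ne'
    constructor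
    · rw [← (eventuallyEq_of_eqOn he hx).deriv_eq, (h2 hx).deriv]
      field_simp
    · rw [hp.ask_mul h hx1, limitAsk, indicator_of_mem hx]
      exact h1 hx
  · refine hp.sol.B_right.congr' ?_
    filter_upwards [Ioo_mem_nhdsLT hp.lt] with x hx using he hx
  · have hcA : Tendsto (fun x => A x / cdf fa x) (𝓝[<] κa) (𝓝 0) := by
      have := tendsto_nhdsLT_of_continuousOn (hp.continuousOn_A_div h) ⟨hp.lt, le_rfl⟩
      simpa [hp.A_of_ge κa le_rfl] using this
    rw [Metric.tendsto_nhds]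
    intro ε hε
    have hM := h.pos.trans_le h.ask.le_bound
    have hev := (Metric.tendsto_nhds.1 hcA (ε / (2 * M)) (by positivity))
    obtain ⟨u, hu, hu'⟩ := mem_nhdsLT_iff_exists_Ioo_subset.1 (inter_mem hev (Ioo_mem_nhdsLT hp.lt))
    filter_upwards [Ioo_mem_nhdsLT hu] with y hy
    have hy' : y ∈ Ioo κb κa := (hu' hy).2
    have hpos : 0 < κa - y := sub_pos.2 hy.2
    have e : B y - 1 = -∫ z in y..κa, fb z * A z / cdf fa z := by
      have h2 := intervalIntegral.integral_add_adjacent_intervals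
        (hp.intervalIntegrable_bid h hp.left_mem (Ioo_subset_Icc_self hy'))
        (hp.intervalIntegrable_bid h (Ioo_subset_Icc_self hy') hp.right_mem)
      rw [hp.integral_bid h, ← hp.B_eq_integral h y (Ioo_subset_Icc_self hy')] at h2
      linarith
    rw [hp.cdf_mul_ask h hy', e, Real.dist_eq, sub_zero, ← neg_div_neg_eq, neg_neg, neg_sub,
      abs_div, abs_of_pos hpos, div_lt_iff₀ hpos, ← Real.norm_eq_abs]
    have := intervalIntegral.norm_integral_le_of_norm_le_const (C := ε / 2)
      (f := fun z => fb z * A z / cdf fa z) (a := y) (b := κa) fun z hz => by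
        rw [uIoc_of_le hy.2.le] at hz
        -- The half-open domain of integration contains `κa`, where the one-sided bound says
        -- nothing; there `A = 0`.
        rcases eq_or_lt_of_le hz.2 with rfl | hlt
        · simp [hp.A_of_ge z le_rfl]
          positivity
        have hz' := hu' ⟨hy.1.trans hz.1, hlt⟩
        have hz1 := hp.Ioo_subset h hz'.2
        have i1 := hz'.1
        simp only [mem_ofPred_eq, Real.dist_eq, sub_zero] at i1
        have i2 := h.pos.trans_le (h.bid.lower z hz1)
        rw [Real.norm_eq_abs, mul_div_assoc, abs_mul, abs_of_pos i2]
        calc fb z * |A z / cdf fa z| ≤ M * (ε / (2 * M)) :=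
              mul_le_mul (h.bid.upper z hz1) i1.le (abs_nonneg _) hM.le
          _ = ε / 2 := by field_simp
    rw [abs_of_pos hpos] at this
    nlinarith
  · have hc : Tendsto (fun x => B x / (1 - cdf fb x)) (𝓝[>] κb) (𝓝 0) := by
      have := tendsto_nhdsGT_of_continuousOn (hp.continuousOn_B_div h) ⟨le_rfl, hp.lt⟩
      simpa [hp.B_of_le κb le_rfl] using this
    refine hc.congr' ?_
    filter_upwards [Ioo_mem_nhdsGT hp.lt] with x hx
    have hb := (h.cdf_bid_lt (hp.Ioo_subset h hx)).ne'
    rw [← hp.cdf_mul_ask h hx]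
    field_simp
  · exact (hp.integrableOn_ask_mul h).mono_set (hp.Ioo_subset h)
  · rw [hp.integral_congr_ask h hp.left_mem hp.right_mem hp.lt.le, hp.integral_ask h]

/-- The almost everywhere equation improves to every point at which `F_a` has derivative `f_a`,
since the cofactor `B / (1 - F_b)` in the integrand is continuous. -/
lemma hasDerivAt_A (hp : LimitPair fa fb κb κa A B) (h : DensityPair fa fb m M) {x : ℝ}
    (hx : x ∈ Ioo κb κa) (hd : HasDerivAt (cdf fa) (fa x) x) :
    HasDerivAt A (-(fa x * (B x / (1 - cdf fb x)))) x := by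
  have hsub : Ioo κb κa ⊆ Icc 0 1 := (hp.Ioo_subset h).trans Ioo_subset_Icc_self
  have := hasDerivAt_of_integral_mul (f := fa) (g := fun y => B y / (1 - cdf fb y)) (C := M)
    (G := fun y => -A y) (isOpen_Ioo.mem_nhds hx)
    (fun y hy z hz => h.ask.intervalIntegrable h.pos (hsub hy) (hsub hz))
    (fun y hy => by
      rw [abs_of_pos (h.pos.trans_le (h.ask.lower y (hp.Ioo_subset h hy)))]
      exact h.ask.upper y (hp.Ioo_subset h hy))
    (fun y hy => h.ask.cdf_sub h.pos (hsub hx) (hsub hy)) hd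
    ((hp.continuousOn_B_div h).mono Ioo_subset_Icc_self)
    (fun y hy => by
      have h1 := intervalIntegral.integral_interval_sub_left
        (hp.intervalIntegrable_ask h hp.left_mem (Ioo_subset_Icc_self hy))
        (hp.intervalIntegrable_ask h hp.left_mem (Ioo_subset_Icc_self hx))
      simp only [← mul_div_assoc]
      rw [← h1, hp.A_eq_integral h y (Ioo_subset_Icc_self hy),
        hp.A_eq_integral h x (Ioo_subset_Icc_self hx)]
      ring)
  simpa using this.fun_neg

lemma hasDerivAt_B (hp : LimitPair fa fb κb κa A B) (h : DensityPair fa fb m M) {x : ℝ}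
    (hx : x ∈ Ioo κb κa) (hd : HasDerivAt (cdf fb) (fb x) x) :
    HasDerivAt B (fb x * (A x / cdf fa x)) x := by
  have hsub : Ioo κb κa ⊆ Icc 0 1 := (hp.Ioo_subset h).trans Ioo_subset_Icc_self
  exact hasDerivAt_of_integral_mul (f := fb) (g := fun y => A y / cdf fa y) (C := M)
    (isOpen_Ioo.mem_nhds hx)
    (fun y hy z hz => h.bid.intervalIntegrable h.pos (hsub hy) (hsub hz))
    (fun y hy => by
      rw [abs_of_pos (h.pos.trans_le (h.bid.lower y (hp.Ioo_subset h hy)))]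
      exact h.bid.upper y (hp.Ioo_subset h hy))
    (fun y hy => h.bid.cdf_sub h.pos (hsub hx) (hsub hy)) hd
    ((hp.continuousOn_A_div h).mono Ioo_subset_Icc_self)
    (fun y hy => by
      have h1 := intervalIntegral.integral_interval_sub_left
        (hp.intervalIntegrable_bid h hp.left_mem (Ioo_subset_Icc_self hy))
        (hp.intervalIntegrable_bid h hp.left_mem (Ioo_subset_Icc_self hx))
      simp only [← mul_div_assoc]
      rw [← h1, hp.B_eq_integral h y (Ioo_subset_Icc_self hy),
        hp.B_eq_integral h x (Ioo_subset_Icc_self hx)])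

/-- The asymmetry of the hypotheses is natural: `F_a' = f_a` is needed on a neighbourhood in order
to identify the quasi-derivative with `B` near `x`, and then `F_b' = f_b` only at the point where
`B` is differentiated. -/
lemma bidODEAt (hp : LimitPair fa fb κb κa A B) (h : DensityPair fa fb m M) {x : ℝ}
    (hx : x ∈ Ioo κb κa) (hda : ∀ᶠ y in 𝓝 x, HasDerivAt (cdf fa) (fa y) y)
    (hdb : HasDerivAt (cdf fb) (fb x) x) :
    BidODEAt fa fb (fun x => limitBid fa fb κb κa A x / fb x) x := by
  have he : EqOn A (fun x => cdf fa x * (limitBid fa fb κb κa A x / fb x)) (Ioo κb κa) :=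
    fun x hx => (hp.cdf_mul_bid h hx).symm
  have hw : EqOn (fun x => A x / cdf fa x) (fun x => limitBid fa fb κb κa A x / fb x)
      (Ioo κb κa) := fun x hx => by
    have ha := (h.cdf_ask_pos (hp.Ioo_subset h hx)).ne'
    simp only
    rw [← hp.cdf_mul_bid h hx]
    field_simp
  have hev := hda.and (isOpen_Ioo.mem_nhds hx)
  refine ⟨?_, ?_, ?_⟩
  · filter_upwards [hev] with y hy
    refine DifferentiableAt.congr_of_eventuallyEq ?_ (eventuallyEq_of_eqOn hw.symm hy.2)
    exact (hp.hasDerivAt_A h hy.2 hy.1).differentiableAt.div hy.1.differentiableAt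
      (h.cdf_ask_pos (hp.Ioo_subset h hy.2)).ne'
  · filter_upwards [hev] with y hy
    exact (hp.hasDerivAt_A h hy.2 hy.1).differentiableAt.congr_of_eventuallyEq
      (eventuallyEq_of_eqOn he.symm hy.2)
  · have hB := hp.hasDerivAt_B h hx hdb
    rw [← hp.cdf_mul_bid h hx] at hB
    have ha := (h.cdf_ask_pos (hp.Ioo_subset h hx)).ne'
    rw [mul_div_cancel_left₀ _ ha, mul_comm] at hB
    refine hB.congr_of_eventuallyEq ?_
    filter_upwards [hev] with y hy
    have hy1 := hp.Ioo_subset h hy.2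
    have hb := (h.cdf_bid_lt hy1).ne'
    have hf := (h.pos.trans_le (h.ask.lower y hy1)).ne'
    rw [← (eventuallyEq_of_eqOn he hy.2).deriv_eq, (hp.hasDerivAt_A h hy.2 hy.1).deriv]
    field_simp

lemma askODEAt (hp : LimitPair fa fb κb κa A B) (h : DensityPair fa fb m M) {x : ℝ}
    (hx : x ∈ Ioo κb κa) (hdb : ∀ᶠ y in 𝓝 x, HasDerivAt (cdf fb) (fb y) y)
    (hda : HasDerivAt (cdf fa) (fa x) x) :
    AskODEAt fa fb (fun x => limitAsk fa fb κb κa B x / fa x) x := by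
  have he : EqOn B (fun x => (1 - cdf fb x) * (limitAsk fa fb κb κa B x / fa x)) (Ioo κb κa) :=
    fun x hx => (hp.cdf_mul_ask h hx).symm
  have hw : EqOn (fun x => B x / (1 - cdf fb x)) (fun x => limitAsk fa fb κb κa B x / fa x)
      (Ioo κb κa) := fun x hx => by
    have ha := (h.cdf_bid_lt (hp.Ioo_subset h hx)).ne'
    simp only
    rw [← hp.cdf_mul_ask h hx]
    field_simp
  have hev := hdb.and (isOpen_Ioo.mem_nhds hx)
  refine ⟨?_, ?_, ?_⟩
  · filter_upwards [hev] with y hy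
    refine DifferentiableAt.congr_of_eventuallyEq ?_ (eventuallyEq_of_eqOn hw.symm hy.2)
    exact (hp.hasDerivAt_B h hy.2 hy.1).differentiableAt.div (hy.1.differentiableAt.const_sub 1)
      (h.cdf_bid_lt (hp.Ioo_subset h hy.2)).ne'
  · filter_upwards [hev] with y hy
    exact (hp.hasDerivAt_B h hy.2 hy.1).differentiableAt.congr_of_eventuallyEq
      (eventuallyEq_of_eqOn he.symm hy.2)
  · have hA := hp.hasDerivAt_A h hx hda
    rw [← hp.cdf_mul_ask h hx] at hA
    have ha := (h.cdf_bid_lt (hp.Ioo_subset h hx)).ne'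
    rw [mul_div_cancel_left₀ _ ha, mul_comm (fa x)] at hA
    refine hA.congr_of_eventuallyEq ?_
    filter_upwards [hev] with y hy
    have hy1 := hp.Ioo_subset h hy.2
    have hb := (h.cdf_ask_pos hy1).ne'
    have hf := (h.pos.trans_le (h.bid.lower y hy1)).ne'
    rw [← (eventuallyEq_of_eqOn he hy.2).deriv_eq, (hp.hasDerivAt_B h hy.2 hy.1).deriv]
    field_simp

/-- Any solution of the second-order problem produces a solution of the first-order boundary
problem, which is unique. -/
lemma bid_unique (hp : LimitPair fa fb κb κa A B) (h : DensityPair fa fb m M) {κb' κa' : ℝ}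
    {w : ℝ → ℝ} (hl : 0 ≤ κb') (hlr : κb' < κa') (hr : κa' ≤ 1)
    (hw : IsBidSolution fa fb κb' κa' w) :
    κb' = κb ∧ κa' = κa ∧ EqOn w (fun x => limitBid fa fb κb κa A x / fb x) (Ioo κb κa) := by
  obtain ⟨B', hB'⟩ := hw.boundarySolution h hl hlr hr
  obtain ⟨e1, e2, eA, -⟩ := hp.sol.unique h hB'
  refine ⟨e1, e2, fun x hx => ?_⟩
  have := (eA hx).trans (hp.cdf_mul_bid h hx).symm
  exact mul_left_cancel₀ (h.cdf_ask_pos (hp.Ioo_subset h hx)).ne' this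

lemma ask_unique (hp : LimitPair fa fb κb κa A B) (h : DensityPair fa fb m M) {κb' κa' : ℝ}
    {w : ℝ → ℝ} (hl : 0 ≤ κb') (hlr : κb' < κa') (hr : κa' ≤ 1)
    (hw : IsAskSolution fa fb κb' κa' w) :
    κb' = κb ∧ κa' = κa ∧ EqOn w (fun x => limitAsk fa fb κb κa B x / fa x) (Ioo κb κa) := by
  obtain ⟨A', hA'⟩ := hw.boundarySolution h hl hlr hr
  obtain ⟨e1, e2, -, eB⟩ := hp.sol.unique h hA'
  refine ⟨e1, e2, fun x hx => ?_⟩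
  have := (eB hx).trans (hp.cdf_mul_ask h hx).symm
  exact mul_left_cancel₀ (h.cdf_bid_lt (hp.Ioo_subset h hx)).ne' this

end LimitPair

end

noncomputable section

variable {fa fb : ℝ → ℝ} {m M : ℝ}

/-! ### Identification of the limits -/

/-- The error is at most `|F y - F x| |q y - q x|`, a product of `O(y - x)` and `o(1)`. In the
application, the upper and lower balance inequalities trap the increment of `b` between `q x` and `q
y` times the increment of `F`. -/
lemma hasDerivAt_of_sandwich {b F q : ℝ → ℝ} {x F' : ℝ} (hF : HasDerivAt F F' x)
    (hq : ContinuousAt q x)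
    (h : ∀ᶠ y in 𝓝 x, |b y - b x - (F y - F x) * q x| ≤ |F y - F x| * |q y - q x|) :
    HasDerivAt b (F' * q x) x := by
  have h1 : (fun y => b y - b x - (F y - F x) * q x) =o[𝓝 x] fun y => y - x := by
    have hF1 : (fun y => F y - F x) =O[𝓝 x] fun y => y - x := hF.isBigO_sub
    have hq1 : (fun y => q y - q x) =o[𝓝 x] fun _ => (1 : ℝ) := by
      rw [Asymptotics.isLittleO_one_iff]
      simpa using hq.tendsto.sub_const (q x)
    refine Asymptotics.IsBigO.trans_isLittleO (g := fun y => (F y - F x) * (q y - q x)) ?_ ?_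
    · refine Asymptotics.IsBigO.of_bound 1 ?_
      filter_upwards [h] with y hy
      simpa [abs_mul] using hy
    · simpa using hF1.mul_isLittleO hq1
  rw [hasDerivAt_iff_isLittleO] at hF ⊢
  have h2 := hF.const_mul_left (q x)
  refine (h1.add h2).congr_left fun y => ?_
  simp only [smul_eq_mul]
  ring

/-- The exact inequalities which characterize the limiting distributions of the best prices. -/
structure LimitInequalities (fa fb : ℝ → ℝ) (k c : ℝ) (a b : ℝ → ℝ) : Prop where
  k_mem : k ∈ Icc (0 : ℝ) 1
  c_mem : c ∈ Icc (0 : ℝ) 1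
  balance : cdf fb k = 1 - cdf fa c
  a_mem : ∀ x, a x ∈ Icc (0 : ℝ) 1
  b_mem : ∀ x, b x ∈ Icc (0 : ℝ) 1
  one_le : ∀ x ∈ Ioo (0 : ℝ) 1, 1 ≤ a x + b x
  anti : ∀ x y, 0 < x → x < y → y < 1 → a y ≤ a x
  mono : ∀ x y, 0 < x → x < y → y < 1 → b x ≤ b y
  upB : ∀ x y, 0 < x → x < y → y < 1 → cdf fa x * (b y - b x) ≤ (cdf fb y - cdf fb x) * a x
  loB : ∀ x y, 0 < x → x < y → y < 1 → k < x →
    (cdf fb y - cdf fb x) * a y ≤ cdf fa y * (b y - b x)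
  upA : ∀ x y, 0 < x → x < y → y < 1 →
    (1 - cdf fb y) * (a x - a y) ≤ (cdf fa y - cdf fa x) * b y
  loA : ∀ x y, 0 < x → x < y → y < 1 → y < c →
    (cdf fa y - cdf fa x) * b x ≤ (1 - cdf fb x) * (a x - a y)
  zeroB : ∀ x ∈ Ioo (0 : ℝ) 1, x < k → b x = 0
  zeroA : ∀ x ∈ Ioo (0 : ℝ) 1, c < x → a x = 0

namespace LimitInequalities

variable {k c : ℝ} {a b : ℝ → ℝ}

/-- Only the upper balance inequality with `a ≤ 1` is needed. The constant degenerates at `0`, where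
`F_a` vanishes, so the bound is local. -/
lemma lipschitzB (hh : LimitInequalities fa fb k c a b) (h : DensityPair fa fb m M) {s t : ℝ}
    (hs : 0 < s) (ht : t < 1) : LipschitzOnWith (M / cdf fa s).toNNReal b (Icc s t) := by
  refine LipschitzOnWith.of_dist_le_mul fun x hx y hy => ?_
  have hs1 : s ∈ Ioo (0 : ℝ) 1 := ⟨hs, (hx.1.trans hx.2).trans_lt ht⟩
  have hM := h.pos.trans_le h.ask.le_bound
  have hFs := h.cdf_ask_pos hs1
  rw [Real.coe_toNNReal _ (by positivity), Real.dist_eq, Real.dist_eq]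
  wlog hlt : x < y generalizing x y
  · rcases eq_or_lt_of_le (not_lt.1 hlt) with e | e
    · simp [e]
    · rw [abs_sub_comm, abs_sub_comm x]
      exact this y hy x hx e
  have hx0 := hs.trans_le hx.1
  have hy1 := hy.2.trans_lt ht
  have h1 := hh.upB x y hx0 hlt hy1
  have h2 := hh.mono x y hx0 hlt hy1
  have h3 := h.bid.cdf_sub_le h.pos hx0.le hlt.le hy1.le
  have h3' := h.bid.le_cdf_sub h.pos hx0.le hlt.le hy1.le
  have h4 := (hh.a_mem x).2
  have h5 : cdf fa s ≤ cdf fa x := (h.ask.strictMonoOn_cdf h.pos).monotoneOn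
    (Ioo_subset_Icc_self hs1) ⟨hx0.le, (hlt.trans hy1).le⟩ hx.1
  have h6 : 0 ≤ cdf fb y - cdf fb x :=
    le_trans (mul_nonneg h.pos.le (sub_nonneg.2 hlt.le)) h3'
  rw [abs_sub_comm, abs_of_nonneg (sub_nonneg.2 h2), abs_sub_comm, abs_of_pos (sub_pos.2 hlt),
    div_mul_eq_mul_div, le_div_iff₀ hFs]
  have h7 : (b y - b x) * cdf fa s ≤ (b y - b x) * cdf fa x :=
    mul_le_mul_of_nonneg_left h5 (sub_nonneg.2 h2)
  have h8 : (cdf fb y - cdf fb x) * a x ≤ cdf fb y - cdf fb x := mul_le_of_le_one_right h6 h4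
  linarith

lemma lipschitzA (hh : LimitInequalities fa fb k c a b) (h : DensityPair fa fb m M) {s t : ℝ}
    (hs : 0 < s) (ht : t < 1) : LipschitzOnWith (M / (1 - cdf fb t)).toNNReal a (Icc s t) := by
  refine LipschitzOnWith.of_dist_le_mul fun x hx y hy => ?_
  have hs1 : t ∈ Ioo (0 : ℝ) 1 := ⟨hs.trans_le (hx.1.trans hx.2), ht⟩
  have hM := h.pos.trans_le h.ask.le_bound
  have hFs := h.cdf_bid_lt hs1
  rw [Real.coe_toNNReal _ (by positivity), Real.dist_eq, Real.dist_eq]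
  wlog hlt : x < y generalizing x y
  · rcases eq_or_lt_of_le (not_lt.1 hlt) with e | e
    · simp [e]
    · rw [abs_sub_comm, abs_sub_comm x]
      exact this y hy x hx e
  have hx0 := hs.trans_le hx.1
  have hy1 := hy.2.trans_lt ht
  have h1 := hh.upA x y hx0 hlt hy1
  have h2 := hh.anti x y hx0 hlt hy1
  have h3 := h.ask.cdf_sub_le h.pos hx0.le hlt.le hy1.le
  have h3' := h.ask.le_cdf_sub h.pos hx0.le hlt.le hy1.le
  have h4 := (hh.b_mem y).2
  have h5 : cdf fb y ≤ cdf fb t := (h.bid.strictMonoOn_cdf h.pos).monotoneOn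
    ⟨(hx0.trans hlt).le, hy1.le⟩ (Ioo_subset_Icc_self hs1) hy.2
  have h6 : 0 ≤ cdf fa y - cdf fa x :=
    le_trans (mul_nonneg h.pos.le (sub_nonneg.2 hlt.le)) h3'
  rw [abs_of_nonneg (sub_nonneg.2 h2), abs_sub_comm, abs_of_pos (sub_pos.2 hlt),
    div_mul_eq_mul_div, le_div_iff₀ hFs]
  have h7 : (a x - a y) * (1 - cdf fb t) ≤ (a x - a y) * (1 - cdf fb y) :=
    mul_le_mul_of_nonneg_left (by linarith) (sub_nonneg.2 h2)
  have h8 : (cdf fa y - cdf fa x) * b y ≤ cdf fa y - cdf fa x := mul_le_of_le_one_right h6 h4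
  linarith

lemma continuousAtB (hh : LimitInequalities fa fb k c a b) (h : DensityPair fa fb m M) {x : ℝ}
    (hx : x ∈ Ioo (0 : ℝ) 1) : ContinuousAt b x := by
  obtain ⟨s, hs⟩ := exists_between hx.1
  obtain ⟨t, ht⟩ := exists_between hx.2
  exact (hh.lipschitzB h hs.1 ht.2).continuousOn.continuousAt (Icc_mem_nhds hs.2 ht.1)

lemma continuousAtA (hh : LimitInequalities fa fb k c a b) (h : DensityPair fa fb m M) {x : ℝ}
    (hx : x ∈ Ioo (0 : ℝ) 1) : ContinuousAt a x := by
  obtain ⟨s, hs⟩ := exists_between hx.1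
  obtain ⟨t, ht⟩ := exists_between hx.2
  exact (hh.lipschitzA h hs.1 ht.2).continuousOn.continuousAt (Icc_mem_nhds hs.2 ht.1)

/-- Continuity, which the upper inequality provides across the threshold, carries the value `0` from
the left of `k` to `k`. -/
lemma b_left (hh : LimitInequalities fa fb k c a b) (h : DensityPair fa fb m M)
    (hk : k ∈ Ioo (0 : ℝ) 1) : b k = 0 := by
  have h1 : Tendsto b (𝓝[<] k) (𝓝 (b k)) :=
    (hh.continuousAtB h hk).tendsto.mono_left nhdsWithin_le_nhds
  refine tendsto_nhds_unique (h1.congr' ?_) tendsto_const_nhds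
  filter_upwards [Ioo_mem_nhdsLT hk.1] with x hx
  exact hh.zeroB x ⟨hx.1, hx.2.trans hk.2⟩ hx.2

lemma a_right (hh : LimitInequalities fa fb k c a b) (h : DensityPair fa fb m M)
    (hc : c ∈ Ioo (0 : ℝ) 1) : a c = 0 := by
  have h1 : Tendsto a (𝓝[>] c) (𝓝 (a c)) :=
    (hh.continuousAtA h hc).tendsto.mono_left nhdsWithin_le_nhds
  refine tendsto_nhds_unique (h1.congr' ?_) tendsto_const_nhds
  filter_upwards [Ioo_mem_nhdsGT hc.2] with x hx
  exact hh.zeroA x ⟨hc.1.trans hx.1, hx.2⟩ hx.1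

/-- Between `c` and `k`, or by continuity at `c = k`, both `a` and `b` would vanish, against `a + b
≥ 1`. The balance relation excludes a common threshold at `0` or `1`, where continuity is not
available. -/
lemma lt (hh : LimitInequalities fa fb k c a b) (h : DensityPair fa fb m M) : k < c := by
  by_contra hn
  rcases eq_or_lt_of_le (not_lt.1 hn) with e | e
  · subst e
    have h0 := hh.balance
    rcases eq_or_lt_of_le hh.k_mem.1 with e0 | e0
    · rw [← e0] at h0
      simp [IsPriceDensity.cdf_zero] at h0
    rcases eq_or_lt_of_le hh.k_mem.2 with e1 | e1
    · rw [e1, h.ask.cdf_one, h.bid.cdf_one] at h0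
      norm_num at h0
    have := hh.one_le c ⟨e0, e1⟩
    rw [hh.b_left h ⟨e0, e1⟩, hh.a_right h ⟨e0, e1⟩] at this
    norm_num at this
  · obtain ⟨x, hx⟩ := exists_between e
    have hx1 : x ∈ Ioo (0 : ℝ) 1 := ⟨hh.c_mem.1.trans_lt hx.1, hx.2.trans_le hh.k_mem.2⟩
    have := hh.one_le x hx1
    rw [hh.zeroA x hx1 hx.1, hh.zeroB x hx1 hx.2] at this
    norm_num at this

/-- Between the thresholds upper and lower inequalities are both available and sandwich the
increments, which gives the derivatives wherever `F_a`, respectively `F_b`, is differentiable with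
the right derivative. -/
lemma balanceSystem (hh : LimitInequalities fa fb k c a b) (h : DensityPair fa fb m M) :
    BalanceSystem fa fb a b k c := by
  have hsub : Ioo k c ⊆ Ioo 0 1 := Ioo_subset_Ioo hh.k_mem.1 hh.c_mem.2
  have hmm : ∀ {x y : ℝ}, x ∈ Ioo k c → y ∈ Ioo k c → 0 < min x y ∧ max x y < 1 :=
    fun hx hy => ⟨lt_min (hsub hx).1 (hsub hy).1, max_lt (hsub hx).2 (hsub hy).2⟩
  refine ⟨fun x hx y hy => ?_, fun x hx y hy => ?_, ?_, ?_⟩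
  · exact (hh.lipschitzA h (hmm hx hy).1 (hmm hx hy).2).absolutelyContinuousOnInterval
  · exact (hh.lipschitzB h (hmm hx hy).1 (hmm hx hy).2).absolutelyContinuousOnInterval
  · filter_upwards [h.ask.ae_hasDerivAt_cdf h.pos] with x hd hx
    have hx1 := hsub hx
    have hq : ContinuousAt (fun y => b y / (1 - cdf fb y)) x :=
      (hh.continuousAtB h hx1).div (continuousAt_const.sub
        ((h.bid.continuousOn_cdf h.pos).continuousAt (Icc_mem_nhds hx1.1 hx1.2)))
        (h.cdf_bid_lt hx1).ne'
    have key := hasDerivAt_of_sandwich (b := fun y => -a y) (hd hx1) hq (by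
      filter_upwards [isOpen_Ioo.mem_nhds hx] with y hy
      have hy1 := hsub hy
      have px := h.cdf_bid_lt hx1
      have py := h.cdf_bid_lt hy1
      rcases lt_trichotomy x y with hlt | rfl | hlt
      · have hF := h.ask.strictMonoOn_cdf h.pos (Ioo_subset_Icc_self hx1)
          (Ioo_subset_Icc_self hy1) hlt
        have h1 := hh.upA x y hx1.1 hlt hy1.2
        have h2 := hh.loA x y hx1.1 hlt hy1.2 hy.2
        rw [mul_comm (1 - cdf fb y), ← le_div_iff₀ py, mul_div_assoc] at h1
        rw [mul_comm (1 - cdf fb x), ← div_le_iff₀ px, mul_div_assoc] at h2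
        rw [abs_of_pos (sub_pos.2 hF), abs_of_nonneg (by linarith)]
        have := mul_le_mul_of_nonneg_left (le_abs_self (b y / (1 - cdf fb y) - b x / (1 - cdf fb x)))
          (sub_pos.2 hF).le
        linarith
      · simp
      · have hF := h.ask.strictMonoOn_cdf h.pos (Ioo_subset_Icc_self hy1)
          (Ioo_subset_Icc_self hx1) hlt
        have h1 := hh.upA y x hy1.1 hlt hx1.2
        have h2 := hh.loA y x hy1.1 hlt hx1.2 hx.2
        rw [mul_comm (1 - cdf fb x), ← le_div_iff₀ px, mul_div_assoc] at h1
        rw [mul_comm (1 - cdf fb y), ← div_le_iff₀ py, mul_div_assoc] at h2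
        rw [abs_of_neg (sub_neg.2 hF), abs_of_nonneg (by linarith)]
        have := mul_le_mul_of_nonneg_left
          (neg_le_abs (b y / (1 - cdf fb y) - b x / (1 - cdf fb x))) (sub_pos.2 hF).le
        linarith)
    have := key.fun_neg
    simp only [neg_neg] at this
    refine this.congr_deriv ?_
    rw [mul_div_assoc]
  · filter_upwards [h.bid.ae_hasDerivAt_cdf h.pos] with x hd hx
    have hx1 := hsub hx
    have hq : ContinuousAt (fun y => a y / cdf fa y) x :=
      (hh.continuousAtA h hx1).div
        ((h.ask.continuousOn_cdf h.pos).continuousAt (Icc_mem_nhds hx1.1 hx1.2))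
        (h.cdf_ask_pos hx1).ne'
    have key := hasDerivAt_of_sandwich (b := b) (hd hx1) hq (by
      filter_upwards [isOpen_Ioo.mem_nhds hx] with y hy
      have hy1 := hsub hy
      have px := h.cdf_ask_pos hx1
      have py := h.cdf_ask_pos hy1
      rcases lt_trichotomy x y with hlt | rfl | hlt
      · have hF := h.bid.strictMonoOn_cdf h.pos (Ioo_subset_Icc_self hx1)
          (Ioo_subset_Icc_self hy1) hlt
        have h1 := hh.upB x y hx1.1 hlt hy1.2
        have h2 := hh.loB x y hx1.1 hlt hy1.2 hx.1
        rw [mul_comm (cdf fa x), ← le_div_iff₀ px, mul_div_assoc] at h1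
        rw [mul_comm (cdf fa y), ← div_le_iff₀ py, mul_div_assoc] at h2
        rw [abs_of_pos (sub_pos.2 hF), abs_of_nonpos (by linarith)]
        have := mul_le_mul_of_nonneg_left (neg_le_abs (a y / cdf fa y - a x / cdf fa x))
          (sub_pos.2 hF).le
        linarith
      · simp
      · have hF := h.bid.strictMonoOn_cdf h.pos (Ioo_subset_Icc_self hy1)
          (Ioo_subset_Icc_self hx1) hlt
        have h1 := hh.upB y x hy1.1 hlt hx1.2
        have h2 := hh.loB y x hy1.1 hlt hx1.2 hy.1
        rw [mul_comm (cdf fa y), ← le_div_iff₀ py, mul_div_assoc] at h1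
        rw [mul_comm (cdf fa x), ← div_le_iff₀ px, mul_div_assoc] at h2
        rw [abs_of_neg (sub_neg.2 hF), abs_of_nonpos (by linarith)]
        have := mul_le_mul_of_nonneg_left
          (le_abs_self (a y / cdf fa y - a x / cdf fa x)) (sub_pos.2 hF).le
        linarith)
    refine key.congr_deriv ?_
    rw [mul_div_assoc]

/-- The case `k = 0` is the one excluded by the divergent kernel; the conserved quantity is positive
because `a + b ≥ 1`. -/
lemma k_mem_Ioo (hh : LimitInequalities fa fb k c a b) (h : DensityPair fa fb m M) :
    k ∈ Ioo (0 : ℝ) 1 := by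
  have hlt := hh.lt h
  refine ⟨hh.k_mem.1.lt_of_ne ?_, hlt.trans_le hh.c_mem.2⟩
  intro e
  have hs := hh.balanceSystem h
  rw [← e] at hs hlt
  have hsub : Ioo 0 c ⊆ Ioo 0 1 := Ioo_subset_Ioo le_rfl hh.c_mem.2
  obtain ⟨x, hx⟩ : (Ioo 0 c).Nonempty := nonempty_Ioo.2 hlt
  refine hs.false_of_left_zero h hlt hh.c_mem.2
    (c := cdf fa x * b x + (1 - cdf fb x) * a x) ?_
    (fun y hy => hs.conserved h le_rfl hh.c_mem.2 hy hx) ?_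
  · have h1 := h.cdf_ask_pos (hsub hx)
    have h2 := h.cdf_bid_lt (hsub hx)
    have h3 := hh.one_le x (hsub hx)
    have h4 := (hh.a_mem x).1
    have h5 := (hh.b_mem x).1
    rcases eq_or_lt_of_le h4 with e | e
    · have : 0 < b x := by linarith
      have := mul_pos h1 this
      have := mul_nonneg h2.le h4
      linarith
    · have := mul_pos h2 e
      have := mul_nonneg h1.le h5
      linarith
  · exact Eventually.of_forall fun y => by linarith [(hh.b_mem y).1]

lemma c_mem_Ioo (hh : LimitInequalities fa fb k c a b) (h : DensityPair fa fb m M) :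
    c ∈ Ioo (0 : ℝ) 1 := by
  have hk := hh.k_mem_Ioo h
  refine ⟨hk.1.trans (hh.lt h), hh.c_mem.2.lt_of_ne ?_⟩
  intro e
  have h0 := hh.balance
  rw [e, h.ask.cdf_one] at h0
  linarith [h.bid.cdf_pos h.pos hk.1 hk.2.le]

/-- Continuity gives `b = 0` at `k` and `a = 0` at `c`; the two remaining boundary values follow
from `a + b ≥ 1` and the bound `1` on each. -/
lemma boundarySolution (hh : LimitInequalities fa fb k c a b) (h : DensityPair fa fb m M) :
    BoundarySolution fa fb a b k c := by
  have hk := hh.k_mem_Ioo h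
  have hc := hh.c_mem_Ioo h
  have e1 := hh.b_left h hk
  have e2 := hh.a_right h hc
  have e3 : a k = 1 := by
    have := hh.one_le k hk
    have := (hh.a_mem k).2
    linarith
  have e4 : b c = 1 := by
    have := hh.one_le c hc
    have := (hh.b_mem c).2
    linarith
  refine ⟨hh.balanceSystem h, hk.1.le, hh.lt h, hc.2.le, ?_, ?_, ?_, ?_⟩
  · rw [← e3]; exact (hh.continuousAtA h hk).tendsto.mono_left nhdsWithin_le_nhds
  · rw [← e1]; exact (hh.continuousAtB h hk).tendsto.mono_left nhdsWithin_le_nhds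
  · rw [← e2]; exact (hh.continuousAtA h hc).tendsto.mono_left nhdsWithin_le_nhds
  · rw [← e4]; exact (hh.continuousAtB h hc).tendsto.mono_left nhdsWithin_le_nhds

/-- The inequalities determine the limits. -/
lemma eq_limitPair (hh : LimitInequalities fa fb k c a b) (h : DensityPair fa fb m M)
    {κb κa : ℝ} {A B : ℝ → ℝ} (hp : LimitPair fa fb κb κa A B) :
    k = κb ∧ c = κa ∧ ∀ x ∈ Ioo (0 : ℝ) 1, a x = A x ∧ b x = B x := by
  obtain ⟨rfl, rfl, eA, eB⟩ := hp.sol.unique h (hh.boundarySolution h)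
  refine ⟨rfl, rfl, fun x hx => ?_⟩
  have hs := hh.one_le x hx
  have hk := hh.k_mem_Ioo h
  have hc := hh.c_mem_Ioo h
  rcases lt_or_ge k x with h1 | h1
  · rcases lt_or_ge x c with h2 | h2
    · exact ⟨eA ⟨h1, h2⟩, eB ⟨h1, h2⟩⟩
    · have h0 : a x = 0 := by
        rcases eq_or_lt_of_le h2 with e | e
        · rw [← e]; exact hh.a_right h hc
        · exact hh.zeroA x hx e
      rw [hp.A_of_ge x h2, hp.B_of_ge x h2]
      exact ⟨h0, by linarith [(hh.b_mem x).2]⟩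
  · have h0 : b x = 0 := by
      rcases eq_or_lt_of_le h1 with e | e
      · rw [e]; exact hh.b_left h hk
      · exact hh.zeroB x hx e
    rw [hp.A_of_le x h1, hp.B_of_le x h1]
    exact ⟨by linarith [(hh.a_mem x).2], h0⟩

end LimitInequalities

/-- Approximate versions of the inequalities, along a filter. -/
structure ApproxInequalities {ι : Type*} (l : Filter ι) (fa fb : ℝ → ℝ) (k c : ι → ℝ)
    (a b : ι → ℝ → ℝ) : Prop where
  k_mem : ∀ i, k i ∈ Icc (0 : ℝ) 1
  c_mem : ∀ i, c i ∈ Icc (0 : ℝ) 1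
  balance : ∀ i, cdf fb (k i) = 1 - cdf fa (c i)
  a_mem : ∀ i x, a i x ∈ Icc (0 : ℝ) 1
  b_mem : ∀ i x, b i x ∈ Icc (0 : ℝ) 1
  one_le : ∀ x ∈ Ioo (0 : ℝ) 1, ∀ᶠ i in l, 1 ≤ a i x + b i x
  anti : ∀ x y, 0 < x → x < y → y < 1 → ∀ᶠ i in l, a i y ≤ a i x
  mono : ∀ x y, 0 < x → x < y → y < 1 → ∀ᶠ i in l, b i x ≤ b i y
  upB : ∀ x y, 0 < x → x < y → y < 1 → ∀ δ > 0, ∀ᶠ i in l,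
    cdf fa x * (b i y - b i x) ≤ (cdf fb y - cdf fb x) * a i x + δ
  loB : ∀ x y, 0 < x → x < y → y < 1 → ∀ δ > 0, ∀ᶠ i in l, k i + δ < x →
    (cdf fb y - cdf fb x) * a i y ≤ cdf fa y * (b i y - b i x) + δ
  upA : ∀ x y, 0 < x → x < y → y < 1 → ∀ δ > 0, ∀ᶠ i in l,
    (1 - cdf fb y) * (a i x - a i y) ≤ (cdf fa y - cdf fa x) * b i y + δ
  loA : ∀ x y, 0 < x → x < y → y < 1 → ∀ δ > 0, ∀ᶠ i in l, y + δ < c i →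
    (cdf fa y - cdf fa x) * b i x ≤ (1 - cdf fb x) * (a i x - a i y) + δ
  zeroB : ∀ x ∈ Ioo (0 : ℝ) 1, ∀ δ > 0, ∀ᶠ i in l, x + δ < k i → b i x ≤ δ
  zeroA : ∀ x ∈ Ioo (0 : ℝ) 1, ∀ δ > 0, ∀ᶠ i in l, c i + δ < x → a i x ≤ δ

/-- Restricting to `δ < δ₀` matters for the inequalities with a side condition such as `k i + δ <
x`, which holds eventually only when `δ` is small compared with the gap in the limit. -/
lemma le_of_tendsto_approx {ι : Type*} {l : Filter ι} [l.NeBot] {f g : ι → ℝ} {F G δ₀ : ℝ}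
    (hδ₀ : 0 < δ₀) (hf : Tendsto f l (𝓝 F)) (hg : Tendsto g l (𝓝 G))
    (h : ∀ δ > 0, δ < δ₀ → ∀ᶠ i in l, f i ≤ g i + δ) : F ≤ G := by
  refine le_of_forall_pos_le_add fun ε hε => ?_
  have h0 : 0 < min ε (δ₀ / 2) := by positivity
  have := le_of_tendsto_of_tendsto hf (hg.add_const (min ε (δ₀ / 2)))
    (h _ h0 ((min_le_right _ _).trans_lt (by linarith)))
  exact this.trans (by linarith [min_le_left ε (δ₀ / 2)])

lemma exists_ultrafilter_limit {ι : Type*} (u : Ultrafilter ι) {f : ι → ℝ}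
    (hf : ∀ i, f i ∈ Icc (0 : ℝ) 1) : ∃ y ∈ Icc (0 : ℝ) 1, Tendsto f u (𝓝 y) := by
  have hm : ((u.map f : Ultrafilter ℝ) : Filter ℝ) ≤ 𝓟 (Icc 0 1) := by
    rw [Ultrafilter.coe_map, le_principal_iff, mem_map]
    exact Filter.univ_mem' hf
  exact isCompact_Icc.ultrafilter_le_nhds (u.map f) hm

/-- Approximate solutions of the balance inequalities converge. -/
theorem ApproxInequalities.tendsto {ι : Type*} {l : Filter ι} (h : DensityPair fa fb m M)
    {k c : ι → ℝ} {a b : ι → ℝ → ℝ} (hh : ApproxInequalities l fa fb k c a b)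
    {κb κa : ℝ} {A B : ℝ → ℝ} (hp : LimitPair fa fb κb κa A B) :
    Tendsto k l (𝓝 κb) ∧ Tendsto c l (𝓝 κa) ∧
      ∀ x ∈ Ioo (0 : ℝ) 1, Tendsto (fun i => a i x) l (𝓝 (A x)) ∧
        Tendsto (fun i => b i x) l (𝓝 (B x)) := by
  -- Along an ultrafilter all the quantities, at all prices simultaneously, converge by compactness
  -- of `[0,1]`; no diagonal extraction is needed. The limit does not depend on the ultrafilter,
  -- which is convergence along `l`.
  have main : ∀ u : Ultrafilter ι, (u : Filter ι) ≤ l →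
      Tendsto k u (𝓝 κb) ∧ Tendsto c u (𝓝 κa) ∧
      ∀ x ∈ Ioo (0 : ℝ) 1, Tendsto (fun i => a i x) u (𝓝 (A x)) ∧
        Tendsto (fun i => b i x) u (𝓝 (B x)) := by
    intro u hu
    obtain ⟨k', hk, tk⟩ := exists_ultrafilter_limit u hh.k_mem
    obtain ⟨c', hc, tc⟩ := exists_ultrafilter_limit u hh.c_mem
    have hA := fun x => exists_ultrafilter_limit u fun i => hh.a_mem i x
    have hB := fun x => exists_ultrafilter_limit u fun i => hh.b_mem i x
    choose a' ha ta using hA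
    choose b' hb tb using hB
    have sub := fun x y => (tb y).sub (tb x)
    have sua := fun x y => (ta x).sub (ta y)
    have lim : LimitInequalities fa fb k' c' a' b' := by
      refine ⟨hk, hc, ?_, ha, hb, ?_, ?_, ?_, ?_, ?_, ?_, ?_, ?_, ?_⟩
      · have h1 : Tendsto (fun i => cdf fb (k i)) u (𝓝 (cdf fb k')) :=
          ((h.bid.continuousOn_cdf h.pos k' hk).tendsto).comp
            (tendsto_nhdsWithin_iff.2 ⟨tk, Eventually.of_forall hh.k_mem⟩)
        have h2 : Tendsto (fun i => cdf fa (c i)) u (𝓝 (cdf fa c')) :=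
          ((h.ask.continuousOn_cdf h.pos c' hc).tendsto).comp
            (tendsto_nhdsWithin_iff.2 ⟨tc, Eventually.of_forall hh.c_mem⟩)
        exact tendsto_nhds_unique (h1.congr hh.balance) (h2.const_sub 1)
      · exact fun x hx => ge_of_tendsto ((ta x).add (tb x)) (hu (hh.one_le x hx))
      · exact fun x y h1 h2 h3 => le_of_tendsto_of_tendsto (ta y) (ta x) (hu (hh.anti x y h1 h2 h3))
      · exact fun x y h1 h2 h3 => le_of_tendsto_of_tendsto (tb x) (tb y) (hu (hh.mono x y h1 h2 h3))
      · exact fun x y h1 h2 h3 => le_of_tendsto_approx one_pos ((sub x y).const_mul _)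
          ((ta x).const_mul _) fun δ hδ _ => hu (hh.upB x y h1 h2 h3 δ hδ)
      · intro x y h1 h2 h3 h4
        -- With `δ` below half the gap `x - k'`, the condition `k i + δ < x` holds eventually.
        refine le_of_tendsto_approx (half_pos (sub_pos.2 h4)) ((ta y).const_mul _)
          ((sub x y).const_mul _) fun δ hδ hδ' => ?_
        filter_upwards [hu (hh.loB x y h1 h2 h3 δ hδ),
          tk.eventually (gt_mem_nhds (show k' < x - δ by linarith))] with i hi hi'
        exact hi (by linarith)
      · exact fun x y h1 h2 h3 => le_of_tendsto_approx one_pos ((sua x y).const_mul _)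
          ((tb y).const_mul _) fun δ hδ _ => hu (hh.upA x y h1 h2 h3 δ hδ)
      · intro x y h1 h2 h3 h4
        refine le_of_tendsto_approx (half_pos (sub_pos.2 h4)) ((tb x).const_mul _)
          ((sua x y).const_mul _) fun δ hδ hδ' => ?_
        filter_upwards [hu (hh.loA x y h1 h2 h3 δ hδ),
          tc.eventually (lt_mem_nhds (show y + δ < c' by linarith))] with i hi hi'
        exact hi (by linarith)
      · intro x hx h4
        refine le_antisymm ?_ (hb x).1
        refine le_of_tendsto_approx (half_pos (sub_pos.2 h4)) (tb x)
          (tendsto_const_nhds (x := (0 : ℝ))) fun δ hδ hδ' => ?_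
        filter_upwards [hu (hh.zeroB x hx δ hδ),
          tk.eventually (lt_mem_nhds (show x + δ < k' by linarith))] with i hi hi'
        simpa using hi hi'
      · intro x hx h4
        refine le_antisymm ?_ (ha x).1
        refine le_of_tendsto_approx (half_pos (sub_pos.2 h4)) (ta x)
          (tendsto_const_nhds (x := (0 : ℝ))) fun δ hδ hδ' => ?_
        filter_upwards [hu (hh.zeroA x hx δ hδ),
          tc.eventually (gt_mem_nhds (show c' < x - δ by linarith))] with i hi hi'
        simpa using hi (by linarith)
    obtain ⟨rfl, rfl, hab⟩ := lim.eq_limitPair h hp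
    exact ⟨tk, tc, fun x hx => ⟨(hab x hx).1 ▸ ta x, (hab x hx).2 ▸ tb x⟩⟩
  refine ⟨?_, ?_, fun x hx => ⟨?_, ?_⟩⟩ <;> rw [tendsto_iff_ultrafilter]
  · exact fun u hu => (main u hu).1
  · exact fun u hu => (main u hu).2.1
  · exact fun u hu => ((main u hu).2.2 x hx).1
  · exact fun u hu => ((main u hu).2.2 x hx).2

end

noncomputable section

/-! ### Bins -/

/-- The bin of the value `v`. -/
def level (P : ℝ → ℝ) (v : ℝ) : Set ℝ := {y ∈ Icc (0 : ℝ) 1 | P y = v}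

lemma bin_eq_level (P : ℝ → ℝ) (x : ℝ) : bin P x = level P (P x) := rfl

lemma level_subset (P : ℝ → ℝ) (v : ℝ) : level P v ⊆ Icc 0 1 := fun _ hx => hx.1

lemma mem_bin_self {P : ℝ → ℝ} {x : ℝ} (hx : x ∈ Icc (0 : ℝ) 1) : x ∈ bin P x := ⟨hx, rfl⟩

lemma volume_level_lt_top (P : ℝ → ℝ) (v : ℝ) : volume (level P v) < ∞ :=
  (measure_mono (level_subset P v)).trans_lt (by simp)

namespace IsBinned

variable {P : ℝ → ℝ}

/-- The finite set of the values of a binned price equivalence function. -/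
def vals (hP : IsBinned P) : Finset ℝ := hP.finite_image.toFinset

lemma mem_vals (hP : IsBinned P) {x : ℝ} (hx : x ∈ Icc (0 : ℝ) 1) : P x ∈ hP.vals := by
  simp only [vals, Finite.mem_toFinset]
  exact mem_image_of_mem P hx

lemma ordConnected_level (hP : IsBinned P) (v : ℝ) : (level P v).OrdConnected := by
  refine ⟨fun x hx y hy z hz => ?_⟩
  have hz1 : z ∈ Icc (0 : ℝ) 1 := ⟨hx.1.1.trans hz.1, hz.2.trans hy.1.2⟩
  refine ⟨hz1, le_antisymm ?_ ?_⟩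
  · rw [← hy.2]; exact hP.monotoneOn hz1 hy.1 hz.2
  · rw [← hx.2]; exact hP.monotoneOn hx.1 hz1 hz.1

lemma measurableSet_level (hP : IsBinned P) (v : ℝ) : MeasurableSet (level P v) :=
  (hP.ordConnected_level v).measurableSet

lemma indicator_comp_eq_sum (hP : IsBinned P) (G : ℝ → ℝ) :
    (Icc (0 : ℝ) 1).indicator (fun x => G (P x)) =
      fun x => ∑ v ∈ hP.vals, (level P v).indicator (fun _ => G v) x := by
  funext x
  by_cases hx : x ∈ Icc (0 : ℝ) 1
  · rw [indicator_of_mem hx, Finset.sum_eq_single_of_mem (P x) (hP.mem_vals hx)]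
    · rw [indicator_of_mem (show x ∈ level P (P x) from ⟨hx, rfl⟩)]
    · intro v _ hv
      exact indicator_of_notMem (fun h => hv h.2.symm) _
  · rw [indicator_of_notMem hx, Finset.sum_eq_zero]
    intro v _
    exact indicator_of_notMem (fun h => hx h.1) _

lemma integrable_indicator_comp (hP : IsBinned P) (G : ℝ → ℝ) :
    Integrable ((Icc (0 : ℝ) 1).indicator (fun x => G (P x))) := by
  rw [hP.indicator_comp_eq_sum]
  refine integrable_finsetSum _ fun v _ => ?_
  exact (integrable_indicator_iff (hP.measurableSet_level v)).2
    (integrableOn_const (volume_level_lt_top P v).ne)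

lemma integrableOn_comp (hP : IsBinned P) (G : ℝ → ℝ) :
    IntegrableOn (fun x => G (P x)) (Icc 0 1) :=
  (integrable_indicator_iff measurableSet_Icc).1 (hP.integrable_indicator_comp G)

lemma integral_comp (hP : IsBinned P) (G : ℝ → ℝ) :
    ∫ x in Ioo (0 : ℝ) 1, G (P x) = ∑ v ∈ hP.vals, volume.real (level P v) * G v := by
  rw [← integral_Icc_eq_integral_Ioo, ← integral_indicator measurableSet_Icc,
    hP.indicator_comp_eq_sum, integral_finsetSum]
  · refine Finset.sum_congr rfl fun v _ => ?_
    rw [integral_indicator (hP.measurableSet_level v)]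
    simp
  · intro v _
    exact (integrable_indicator_iff (hP.measurableSet_level v)).2
      (integrableOn_const (volume_level_lt_top P v).ne)

/-- Almost every price lies in a bin of positive length. -/
lemma ae_volume_bin_pos (hP : IsBinned P) :
    ∀ᵐ x, x ∈ Icc (0 : ℝ) 1 → 0 < volume.real (bin P x) := by
  have h : ∀ᵐ x, ∀ v ∈ hP.vals, volume.real (level P v) = 0 → x ∉ level P v := by
    refine (Finset.eventually_all hP.vals).2 fun v _ => ?_
    by_cases h0 : volume.real (level P v) = 0
    · have : volume (level P v) = 0 :=
        (measureReal_eq_zero_iff (volume_level_lt_top P v).ne).1 h0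
      filter_upwards [measure_eq_zero_iff_ae_notMem.1 this] with x hx _ using hx
    · exact Eventually.of_forall fun x h1 => absurd h1 h0
  filter_upwards [h] with x hx hx1
  refine lt_of_le_of_ne measureReal_nonneg fun h0 => ?_
  exact hx (P x) (hP.mem_vals hx1) h0.symm ⟨hx1, rfl⟩

end IsBinned

/-- The average of `f` over the bin of `x`. -/
def binAverage (P : ℝ → ℝ) (f : ℝ → ℝ) (x : ℝ) : ℝ :=
  (∫ y in bin P x, f y) / volume.real (bin P x)

section Average

variable {f : ℝ → ℝ} {m M : ℝ}

lemma ae_restrict_Icc_iff_Ioo {p : ℝ → Prop} :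
    (∀ᵐ x ∂volume.restrict (Icc (0 : ℝ) 1), p x) ↔ ∀ᵐ x ∂volume.restrict (Ioo (0 : ℝ) 1), p x := by
  rw [restrict_Ioo_eq_restrict_Icc]

lemma IsPriceDensity.ae_nonneg_le (hf : IsPriceDensity f m M) (hm : 0 < m) :
    ∀ᵐ x ∂volume.restrict (Icc (0 : ℝ) 1), 0 ≤ f x ∧ f x ≤ M := by
  rw [ae_restrict_Icc_iff_Ioo]
  filter_upwards [ae_restrict_mem measurableSet_Ioo] with x hx
  exact ⟨hm.le.trans (hf.lower x hx), hf.upper x hx⟩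

lemma IsPriceDensity.setIntegral_nonneg_le (hf : IsPriceDensity f m M) (hm : 0 < m) {s : Set ℝ}
    (hs : s ⊆ Icc 0 1) : 0 ≤ ∫ y in s, f y ∧ ∫ y in s, f y ≤ M * volume.real s := by
  have hae := ae_restrict_of_ae_restrict_of_subset hs (hf.ae_nonneg_le hm)
  have hfin : volume s ≠ ∞ := ((measure_mono hs).trans_lt (by simp)).ne
  refine ⟨integral_nonneg_of_ae (hae.mono fun x hx => hx.1), ?_⟩
  have hi : IntegrableOn f s := by
    have : IntegrableOn f (Icc 0 1) := by
      rw [integrableOn_Icc_iff_integrableOn_Ioo]; exact hf.integrableOn_Ioo hm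
    exact this.mono_set hs
  calc ∫ y in s, f y ≤ ∫ y in s, M :=
        integral_mono_ae hi (integrableOn_const hfin) (hae.mono fun x hx => hx.2)
    _ = M * volume.real s := by simp [mul_comm]

lemma IsPriceDensity.binAverage_mem (hf : IsPriceDensity f m M) (hm : 0 < m) (P : ℝ → ℝ) (x : ℝ) :
    binAverage P f x ∈ Icc 0 M := by
  have h := hf.setIntegral_nonneg_le hm (level_subset P (P x))
  have hM : 0 ≤ M := hm.le.trans hf.le_bound
  unfold binAverage
  rw [bin_eq_level]
  exact ⟨div_nonneg h.1 measureReal_nonneg, div_le_of_le_mul₀ measureReal_nonneg hM h.2⟩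

/-- A bin is an interval around `x` up to its endpoints, so the average is a difference quotient of
the distribution function over an interval that contains `x` and shrinks to it. Differentiability at
`x` suffices, hence the limit holds almost everywhere. Bins of length zero are avoided by almost
every `x`. -/
lemma tendsto_binAverage {P : ℕ → ℝ → ℝ} (hf : IsPriceDensity f m M) (hm : 0 < m)
    (hP : ∀ N, IsBinned (P N)) (hs : BinsShrink P) :
    ∀ᵐ x, x ∈ Ioo (0 : ℝ) 1 → Tendsto (fun N => binAverage (P N) f x) atTop (𝓝 (f x)) := by
  have hpos : ∀ᵐ x, ∀ N, x ∈ Icc (0 : ℝ) 1 → 0 < volume.real (bin (P N) x) :=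
    ae_all_iff.2 fun N => (hP N).ae_volume_bin_pos
  filter_upwards [hpos, hf.ae_hasDerivAt_cdf hm] with x hx hd hx01
  have hd := hd hx01
  have hxI := Ioo_subset_Icc_self hx01
  rw [hasDerivAt_iff_isLittleO] at hd
  rw [Metric.tendsto_atTop]
  intro ε hε
  obtain ⟨δ, hδ, hball⟩ := Metric.eventually_nhds_iff.1
    ((Asymptotics.isLittleO_iff.1 hd) (half_pos hε))
  obtain ⟨N₀, hN₀⟩ := eventually_atTop.1 (hs δ hδ)
  refine ⟨N₀, fun N hN => ?_⟩
  set S := bin (P N) x with hS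
  have hoc : S.OrdConnected := (hP N).ordConnected_level _
  have hSI : S ⊆ Icc 0 1 := level_subset _ _
  have hne : S.Nonempty := ⟨x, hxI, rfl⟩
  have hbb : BddBelow S := ⟨0, fun y hy => (hSI hy).1⟩
  have hba : BddAbove S := ⟨1, fun y hy => (hSI hy).2⟩
  set s := sInf S
  set t := sSup S
  have hxs : s ≤ x := csInf_le hbb ⟨hxI, rfl⟩
  have hxt : x ≤ t := le_csSup hba ⟨hxI, rfl⟩
  have hst := hxs.trans hxt
  have h0s : 0 ≤ s := le_csInf hne fun y hy => (hSI hy).1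
  have ht1 : t ≤ 1 := csSup_le hne fun y hy => (hSI hy).2
  have hsub1 : S ⊆ Icc s t := fun y hy => ⟨csInf_le hbb hy, le_csSup hba hy⟩
  have hsub2 : Ioo s t ⊆ S := by
    intro y hy
    obtain ⟨u, hu, hu'⟩ := exists_lt_of_csInf_lt hne hy.1
    obtain ⟨w, hw, hw'⟩ := exists_lt_of_lt_csSup hne hy.2
    exact hoc.out hu hw ⟨hu'.le, hw'.le⟩
  have hae : S =ᵐ[volume] Icc s t := by
    refine (LE.le.eventuallyLE hsub1).antisymm ?_
    exact Ioo_ae_eq_Icc.symm.le.trans (LE.le.eventuallyLE hsub2)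
  have hvol : volume.real S = t - s := by
    rw [measureReal_congr hae]
    simp [hst]
  have hint : ∫ y in S, f y = cdf f t - cdf f s := by
    rw [setIntegral_congr_set hae, integral_Icc_eq_integral_Ioc,
      ← intervalIntegral.integral_of_le hst,
      hf.cdf_sub hm ⟨h0s, hst.trans ht1⟩ ⟨h0s.trans hst, ht1⟩]
  have hp := hx N hxI
  rw [← hS, hvol] at hp
  have hlt : t - s < δ := hvol ▸ hN₀ N hN x hxI
  have b1 := hball (y := t) (by rw [Real.dist_eq, abs_of_nonneg (by linarith)]; linarith)
  have b2 := hball (y := s) (by rw [Real.dist_eq, abs_sub_comm, abs_of_nonneg (by linarith)]; linarith)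
  rw [Real.norm_eq_abs, Real.norm_eq_abs, smul_eq_mul, abs_of_nonneg (sub_nonneg.2 hxt)] at b1
  rw [Real.norm_eq_abs, Real.norm_eq_abs, smul_eq_mul, abs_sub_comm s x,
    abs_of_nonneg (sub_nonneg.2 hxs)] at b2
  rw [binAverage, ← hS, hvol, hint, Real.dist_eq, div_sub' hp.ne', abs_div, abs_of_pos hp,
    div_lt_iff₀ hp]
  -- Splitting at `x` uses the derivative at `x` only; the two errors are at most `ε / 2` times `t -
  -- x` and `x - s`.
  have e : cdf f t - cdf f s - (t - s) * f x =
      (cdf f t - cdf f x - (t - x) * f x) - (cdf f s - cdf f x - (s - x) * f x) := by ring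
  rw [e]
  have := abs_sub (cdf f t - cdf f x - (t - x) * f x) (cdf f s - cdf f x - (s - x) * f x)
  nlinarith

lemma integrableOn_binAverage {P : ℝ → ℝ} (hP : IsBinned P) :
    IntegrableOn (binAverage P f) (Ioo 0 1) :=
  (hP.integrableOn_comp fun v => (∫ y in level P v, f y) / volume.real (level P v)).mono_set
    Ioo_subset_Icc_self

lemma tendsto_integral_binAverage {P : ℕ → ℝ → ℝ} (hf : IsPriceDensity f m M) (hm : 0 < m)
    (hP : ∀ N, IsBinned (P N)) (hs : BinsShrink P) :
    Tendsto (fun N => ∫ x in Ioo (0 : ℝ) 1, |binAverage (P N) f x - f x|) atTop (𝓝 0) := by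
  suffices h : Tendsto (fun N => ∫ x in Ioo (0 : ℝ) 1, |binAverage (P N) f x - f x|) atTop
      (𝓝 (∫ x in Ioo (0 : ℝ) 1, (0 : ℝ))) by
    simpa only [integral_zero] using h
  refine tendsto_integral_of_dominated_convergence (fun _ => M) (fun N => ?_)
    (integrable_const M) (fun N => ?_) ?_
  · exact ((integrableOn_binAverage (hP N)).sub (hf.integrableOn_Ioo hm)).abs.aestronglyMeasurable
  · filter_upwards [ae_restrict_mem measurableSet_Ioo] with x hx
    have h1 := hf.binAverage_mem hm (P N) x
    have h2 := hf.lower x hx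
    have h3 := hf.upper x hx
    rw [Real.norm_eq_abs, abs_abs, abs_le]
    constructor <;> linarith [h1.1, h1.2]
  · filter_upwards [ae_restrict_of_ae (tendsto_binAverage hf hm hP hs),
      ae_restrict_mem measurableSet_Ioo] with x hx hx1
    simpa using ((hx hx1).sub_const (f x)).abs

end Average

/-! ### Convergence in mean from one-sided bounds -/

/-- A family of densities `d i` with the pointwise upper bound `(g i * a i + δ) / F`, almost full
mass, and no mass to the left of `κ`, converges in mean to `f * A / F`. -/
theorem tendsto_mean_of_upper_bound {ι : Type*} {l : Filter ι} [l.IsCountablyGenerated]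
    {f F A π : ℝ → ℝ} {κ κ' m M : ℝ} (hf : IsPriceDensity f m M) (hm : 0 < m)
    (hF : ∀ x ∈ Ioo (0 : ℝ) 1, 0 < F x) (hFm : MonotoneOn F (Ioo 0 1))
    (hκ : 0 < κ) (hκκ : κ < κ') (hκ' : κ' < 1)
    (hA : Continuous A) (hA01 : ∀ x, A x ∈ Icc (0 : ℝ) 1) (hA1 : ∀ x ≤ κ, A x = 1) (hA0 : ∀ x, κ' ≤ x → A x = 0)
    (hπ : ∀ x ∈ Ioo κ κ', π x = f x * A x / F x) (hπ0 : ∀ x, x ∉ Ioo κ κ' → π x = 0)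
    (hπi : IntegrableOn π (Ioo 0 1)) (hπ1 : ∫ x in Ioo (0 : ℝ) 1, π x = 1)
    {d g a b : ι → ℝ → ℝ} (hd0 : ∀ i x, 0 ≤ d i x) (hdi : ∀ i, IntegrableOn (d i) (Ioo 0 1))
    (hgi : ∀ i, IntegrableOn (g i) (Ioo 0 1))
    (hg : Tendsto (fun i => ∫ x in Ioo (0 : ℝ) 1, |g i x - f x|) l (𝓝 0))
    (ham : ∀ i, AEStronglyMeasurable (a i) (volume.restrict (Ioo 0 1)))
    (ha01 : ∀ i x, a i x ∈ Icc (0 : ℝ) 1)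
    (ha : ∀ x ∈ Ioo (0 : ℝ) 1, Tendsto (fun i => a i x) l (𝓝 (A x)))
    (hb : ∀ x ∈ Ioo (0 : ℝ) 1, x < κ → Tendsto (fun i => b i x) l (𝓝 0))
    (hup : ∀ δ > 0, ∀ᶠ i in l, ∀ x ∈ Ioo (0 : ℝ) 1, F x * d i x ≤ g i x * a i x + δ)
    (hmass : ∀ x ∈ Ioo (0 : ℝ) 1, ∀ δ > 0, ∀ᶠ i in l,
      1 - b i x ≤ (∫ y in Ioo (0 : ℝ) 1, d i y) + δ)
    (hlow : ∀ x y, 0 < x → x < y → y < 1 → ∀ δ > 0, ∀ᶠ i in l,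
      ∫ z in Ioo (0 : ℝ) x, d i z ≤ b i y + δ) :
    ∀ η > 0, ∀ᶠ i in l, ∫ x in Ioo (0 : ℝ) 1, |d i x - π x| < η := by
  intro η hη
  have hM : 0 < M := hm.trans_le hf.le_bound
  have hfi := hf.integrableOn_Ioo hm
  have hgai : ∀ i, IntegrableOn (fun x => g i x * a i x) (Ioo 0 1) := fun i =>
    (hgi i).mul_bdd (c := 1) (ham i) (Eventually.of_forall fun x => by
      rw [Real.norm_eq_abs, abs_of_nonneg (ha01 i x).1]; exact (ha01 i x).2)
  have hfAi : IntegrableOn (fun x => f x * A x) (Ioo 0 1) :=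
    hfi.mul_bdd (c := 1) hA.aestronglyMeasurable (Eventually.of_forall fun x => by
      rw [Real.norm_eq_abs, abs_of_nonneg (hA01 x).1]; exact (hA01 x).2)
  -- The integrand is at most `|g - f| + M |a - A|`; the first part tends to `0` by hypothesis, the
  -- second by dominated convergence.
  have hE : Tendsto (fun i => ∫ x in Ioo (0 : ℝ) 1, |g i x * a i x - f x * A x|) l (𝓝 0) := by
    have h1 : Tendsto (fun i => ∫ x in Ioo (0 : ℝ) 1, M * |a i x - A x|) l (𝓝 0) := by
      suffices h : Tendsto (fun i => ∫ x in Ioo (0 : ℝ) 1, M * |a i x - A x|) l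
          (𝓝 (∫ x in Ioo (0 : ℝ) 1, (0 : ℝ))) by
        simpa only [integral_zero] using h
      refine tendsto_integral_filter_of_dominated_convergence (fun _ => M)
        (Eventually.of_forall fun i => ?_) (Eventually.of_forall fun i => ?_)
        (integrable_const M) ?_
      · exact (((ham i).sub hA.aestronglyMeasurable).norm).const_mul M
      · refine Eventually.of_forall fun x => ?_
        rw [Real.norm_eq_abs, abs_mul, abs_abs, abs_of_pos hM]
        refine mul_le_of_le_one_right hM.le ?_
        rw [abs_le]
        constructor <;> linarith [(ha01 i x).1, (ha01 i x).2, (hA01 x).1, (hA01 x).2]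
      · filter_upwards [ae_restrict_mem measurableSet_Ioo] with x hx
        simpa using (((ha x hx).sub_const (A x)).abs).const_mul M
    have h2 := hg.add h1
    rw [add_zero] at h2
    refine squeeze_zero (fun i => integral_nonneg fun x => abs_nonneg _) (fun i => ?_) h2
    have i1 : IntegrableOn (fun x => |g i x - f x|) (Ioo 0 1) := ((hgi i).sub hfi).abs
    have i2 : IntegrableOn (fun x => M * |a i x - A x|) (Ioo 0 1) := by
      refine Integrable.const_mul (Integrable.abs ?_) M
      refine Integrable.sub ?_ ?_
      · exact Integrable.of_bound (ham i) 1 (Eventually.of_forall fun x => by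
          rw [Real.norm_eq_abs, abs_of_nonneg (ha01 i x).1]; exact (ha01 i x).2)
      · exact Integrable.of_bound hA.aestronglyMeasurable 1 (Eventually.of_forall fun x => by
          rw [Real.norm_eq_abs, abs_of_nonneg (hA01 x).1]; exact (hA01 x).2)
    rw [← integral_add i1 i2]
    refine setIntegral_mono_on ((hgai i).sub hfAi).abs (i1.add i2) measurableSet_Ioo fun x hx => ?_
    have e : g i x * a i x - f x * A x = (g i x - f x) * a i x + f x * (a i x - A x) := by ring
    have hfx := hf.lower x hx
    have hfx' := hf.upper x hx
    rw [e]
    refine (abs_add_le _ _).trans (add_le_add ?_ ?_)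
    · rw [abs_mul]
      refine mul_le_of_le_one_right (abs_nonneg _) ?_
      rw [abs_of_nonneg (ha01 i x).1]; exact (ha01 i x).2
    · rw [abs_mul, abs_of_pos (hm.trans_le hfx)]
      exact mul_le_mul_of_nonneg_right hfx' (abs_nonneg _)
  have hκ0 : κ / 2 ∈ Ioo (0 : ℝ) 1 := ⟨by linarith, by linarith⟩
  have hF0 := hF _ hκ0
  -- the split point
  set θ := min (κ / 4) (η / 16 * F (κ / 2) / M) with hθ
  have hθ0 : 0 < θ := lt_min (by linarith) (by positivity)
  have hθ1 : θ ≤ κ / 4 := min_le_left _ _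
  set x₁ := κ - θ with hx₁
  have hx1 : x₁ ∈ Ioo (0 : ℝ) 1 := ⟨by linarith, by linarith⟩
  have hF1 : F (κ / 2) ≤ F x₁ := hFm hκ0 hx1 (by linarith)
  have hF1' : 0 < F x₁ := hF _ hx1
  have hstrip : M / F x₁ * (κ - x₁) ≤ η / 16 := by
    have h1 : κ - x₁ = θ := by rw [hx₁]; ring
    rw [h1]
    calc M / F x₁ * θ ≤ M / F (κ / 2) * (η / 16 * F (κ / 2) / M) := by
          gcongr; exact min_le_right _ _
      _ = η / 16 := by field_simp
  -- Two points are needed below `κ`: the mass of `d i` to the left of `x₁` is controlled by `b i`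
  -- at a strictly larger price.
  obtain ⟨x₂, hx2⟩ := exists_between (show x₁ < κ by linarith)
  have hx2' : x₂ ∈ Ioo (0 : ℝ) 1 := ⟨hx1.1.trans hx2.1, by linarith⟩
  have hδ : 0 < η / 16 * F x₁ := by positivity
  have hEev := hE.eventually (gt_mem_nhds hδ)
  filter_upwards [hEev, hup _ hδ, hmass x₂ hx2' (η / 16) (by positivity),
    hlow x₁ x₂ hx1.1 hx2.1 hx2'.2 (η / 16) (by positivity),
    (hb x₂ hx2' hx2.2).eventually (gt_mem_nhds (show 0 < η / 16 by positivity))]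
    with i h1 h2 h3 h4 h5
  -- `r` bounds the excess of `d i` over `π`: to the left of `x₁` it contains all of `d i` (there
  -- `F` is not bounded below), between `x₁` and `κ` a constant on a short strip where the pointwise
  -- bound does not vanish although `π` does, and everywhere the error of the pointwise bound.
  set r : ℝ → ℝ := fun x => (Ioo 0 x₁).indicator (d i) x +
    ((Icc x₁ κ).indicator (fun _ => M / F x₁) x +
      (|g i x * a i x - f x * A x| + η / 16 * F x₁) / F x₁) with hr
  -- As in Scheffé's lemma: `|d - π|` is twice the positive part of `d - π` minus `d - π`, and the
  -- positive part is at most `r`. Integration then only needs the mass of `d i`.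
  have key : ∀ x ∈ Ioo (0 : ℝ) 1, |d i x - π x| ≤ 2 * r x - d i x + π x := by
    intro x hx
    have habs := abs_nonneg (g i x * a i x - f x * A x)
    have hrr : 0 ≤ (|g i x * a i x - f x * A x| + η / 16 * F x₁) / F x₁ := by positivity
    rcases lt_or_ge x x₁ with hlt | hge
    · have e1 : π x = 0 := hπ0 x fun hh => by linarith [hh.1, hx2.1, hx2.2]
      have e2 : r x = d i x + (|g i x * a i x - f x * A x| + η / 16 * F x₁) / F x₁ := by
        simp only [hr]
        rw [indicator_of_mem (show x ∈ Ioo 0 x₁ from ⟨hx.1, hlt⟩),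
          indicator_of_notMem (fun hh => absurd hh.1 (not_le.2 hlt))]
        ring
      rw [e1, e2, sub_zero, abs_of_nonneg (hd0 i x)]
      linarith
    · have e0 : r x = (Icc x₁ κ).indicator (fun _ => M / F x₁) x +
          (|g i x * a i x - f x * A x| + η / 16 * F x₁) / F x₁ := by
        simp only [hr]
        rw [indicator_of_notMem (fun hh => absurd hh.2 (not_lt.2 hge))]
        ring
      have hFx := hF x hx
      have hFle : F x₁ ≤ F x := hFm hx1 hx hge
      have hdle : d i x ≤ f x * A x / F x +
          (|g i x * a i x - f x * A x| + η / 16 * F x₁) / F x₁ := by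
        have i1 : d i x ≤ (f x * A x + (|g i x * a i x - f x * A x| + η / 16 * F x₁)) / F x := by
          rw [le_div_iff₀ hFx, mul_comm]
          have := le_abs_self (g i x * a i x - f x * A x)
          linarith [h2 x hx]
        rw [add_div] at i1
        refine i1.trans (add_le_add le_rfl ?_)
        gcongr
      have hind : 0 ≤ (Icc x₁ κ).indicator (fun _ => M / F x₁) x :=
        indicator_nonneg (fun _ _ => by positivity) x
      have hπr : f x * A x / F x ≤ π x + (Icc x₁ κ).indicator (fun _ => M / F x₁) x := by
        rcases le_or_gt x κ with hk | hk
        · rw [indicator_of_mem (show x ∈ Icc x₁ κ from ⟨hge, hk⟩), hA1 x hk,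
            hπ0 x fun hh => absurd hh.1 (not_lt.2 hk), zero_add, mul_one]
          have := hf.upper x hx
          gcongr
        · rcases lt_or_ge x κ' with hk' | hk'
          · rw [hπ x ⟨hk, hk'⟩]; linarith
          · rw [hA0 x hk', hπ0 x fun hh => absurd hh.2 (not_lt.2 hk')]
            simpa using hind
      rw [abs_le]
      constructor <;> linarith
  have hi1 : IntegrableOn ((Ioo 0 x₁).indicator (d i)) (Ioo 0 1) :=
    (hdi i).indicator measurableSet_Ioo
  have hi2 : IntegrableOn ((Icc x₁ κ).indicator (fun _ => M / F x₁)) (Ioo 0 1) :=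
    (integrable_const _).indicator measurableSet_Icc
  have hi3 : IntegrableOn
      (fun x => (|g i x * a i x - f x * A x| + η / 16 * F x₁) / F x₁) (Ioo 0 1) :=
    ((((hgai i).sub hfAi).abs).add (integrable_const _)).div_const _
  have hir : IntegrableOn r (Ioo 0 1) := hi1.add (hi2.add hi3)
  have hIr : ∫ x in Ioo (0 : ℝ) 1, r x ≤ (b i x₂ + η / 16) + (η / 16 + (η / 16 + η / 16)) := by
    have s1 : ∫ x in Ioo (0 : ℝ) 1, (Ioo 0 x₁).indicator (d i) x = ∫ z in Ioo (0 : ℝ) x₁, d i z := by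
      rw [setIntegral_indicator measurableSet_Ioo, inter_eq_right.2]
      exact Ioo_subset_Ioo le_rfl hx1.2.le
    have s2 : ∫ x in Ioo (0 : ℝ) 1, (Icc x₁ κ).indicator (fun _ => M / F x₁) x ≤ η / 16 := by
      rw [setIntegral_indicator measurableSet_Icc, inter_eq_right.2]
      · rw [setIntegral_const, smul_eq_mul, mul_comm, measureReal_def, Real.volume_Icc,
          ENNReal.toReal_ofReal (by linarith)]
        exact hstrip
      · exact fun x hx => ⟨hx1.1.trans_le hx.1, by linarith [hx.2]⟩
    have s3 : ∫ x in Ioo (0 : ℝ) 1,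
        (|g i x * a i x - f x * A x| + η / 16 * F x₁) / F x₁ ≤ η / 16 + η / 16 := by
      have hi4 : IntegrableOn (fun x => |g i x * a i x - f x * A x|) (Ioo 0 1) :=
        ((hgai i).sub hfAi).abs
      rw [integral_div, integral_add hi4 (integrable_const _),
        div_le_iff₀ hF1']
      simp only [integral_const, measureReal_restrict_apply_univ, Real.volume_real_Ioo, sub_zero,
        smul_eq_mul]
      norm_num
      linarith
    have hi23 : IntegrableOn (fun x => (Icc x₁ κ).indicator (fun _ => M / F x₁) x +
        (|g i x * a i x - f x * A x| + η / 16 * F x₁) / F x₁) (Ioo 0 1) := hi2.add hi3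
    simp only [hr]
    rw [integral_add hi1 hi23, integral_add hi2 hi3, s1]
    linarith
  have hfin : ∫ x in Ioo (0 : ℝ) 1, |d i x - π x| ≤
      2 * (∫ x in Ioo (0 : ℝ) 1, r x) - (∫ x in Ioo (0 : ℝ) 1, d i x) + 1 := by
    have j1 : IntegrableOn (fun x => 2 * r x) (Ioo 0 1) := hir.const_mul 2
    have j2 : IntegrableOn (fun x => 2 * r x - d i x) (Ioo 0 1) := j1.sub (hdi i)
    have j3 : IntegrableOn (fun x => |d i x - π x|) (Ioo 0 1) := ((hdi i).sub hπi).abs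
    have j4 : ∫ x in Ioo (0 : ℝ) 1, (2 * r x - d i x + π x) =
        2 * (∫ x in Ioo (0 : ℝ) 1, r x) - (∫ x in Ioo (0 : ℝ) 1, d i x) + 1 := by
      rw [integral_add j2 hπi, integral_sub j1 (hdi i), integral_const_mul, hπ1]
    rw [← j4]
    exact setIntegral_mono_on j3 (j2.add hπi) measurableSet_Ioo key
  -- The integral of `r` is below `5 η / 16` and the mass missing from `d i` below `2 η / 16`; in
  -- total less than `12 η / 16`.
  linarith

end

noncomputable section

/-! ### The dynamics of the book -/

namespace Book

variable {P : ℝ → ℝ} {b : Book} {o : Order}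

lemma step_bid_match (h1 : o.1 = true) (h2 : ∃ q ∈ b.asks, P q ≤ P o.2) :
    b.step P o = ⟨b.bids, b.asks.erase b.bestAsk⟩ := by
  simp only [step, if_pos h1, if_pos h2]

lemma step_bid_join (h1 : o.1 = true) (h2 : ¬ ∃ q ∈ b.asks, P q ≤ P o.2) :
    b.step P o = ⟨o.2 ::ₘ b.bids, b.asks⟩ := by
  simp only [step, if_pos h1, if_neg h2]

lemma step_ask_match (h1 : o.1 = false) (h2 : ∃ p ∈ b.bids, P o.2 ≤ P p) :
    b.step P o = ⟨b.bids.erase b.bestBid, b.asks⟩ := by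
  simp only [step, h1, Bool.false_eq_true, if_false, if_pos h2]

lemma step_ask_join (h1 : o.1 = false) (h2 : ¬ ∃ p ∈ b.bids, P o.2 ≤ P p) :
    b.step P o = ⟨b.bids, o.2 ::ₘ b.asks⟩ := by
  simp only [step, h1, Bool.false_eq_true, if_false, if_neg h2]

lemma finite_setOf_mem (s : Multiset ℝ) : {p | p ∈ s}.Finite := by
  classical
  refine (s.toFinset.finite_toSet).subset fun p hp => ?_
  simpa using hp

lemma ne_zero_of_mem {s : Multiset ℝ} {p : ℝ} (h : p ∈ s) : s ≠ 0 := by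
  rintro rfl; simp at h

lemma bestBid_mem (h : b.bids ≠ 0) : b.bestBid ∈ b.bids := by
  obtain ⟨p, hp⟩ := Multiset.exists_mem_of_ne_zero h
  exact Set.Nonempty.csSup_mem (s := {p | p ∈ b.bids}) ⟨p, hp⟩ (finite_setOf_mem _)

lemma le_bestBid {p : ℝ} (h : p ∈ b.bids) : p ≤ b.bestBid :=
  le_csSup (finite_setOf_mem b.bids).bddAbove h

lemma bestBid_eq {p : ℝ} (h : p ∈ b.bids) (h' : ∀ r ∈ b.bids, r ≤ p) : b.bestBid = p :=
  le_antisymm (h' _ (bestBid_mem (Book.ne_zero_of_mem h))) (le_bestBid h)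

/-- The number of queued bids with price in `C`. -/
def bidCount (b : Book) (C : Set ℝ) : ℕ := open Classical in b.bids.countP (· ∈ C)

/-- The number of queued asks with price in `C`. -/
def askCount (b : Book) (C : Set ℝ) : ℕ := open Classical in b.asks.countP (· ∈ C)

/-- There are bids, and the highest one is in `D`. -/
def BestBidIn (b : Book) (D : Set ℝ) : Prop := b.bids ≠ 0 ∧ b.bestBid ∈ D

/-- There are asks, and the lowest one is in `D`. -/
def BestAskIn (b : Book) (D : Set ℝ) : Prop := b.asks ≠ 0 ∧ b.bestAsk ∈ D

/-- All bids are in bins below `v`. -/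
def NoBid (P : ℝ → ℝ) (b : Book) (v : ℝ) : Prop := ∀ p ∈ b.bids, P p < v

/-- All asks are in bins above `v`. -/
def NoAsk (P : ℝ → ℝ) (b : Book) (v : ℝ) : Prop := ∀ q ∈ b.asks, v < P q

lemma bidCount_eq_zero {C : Set ℝ} : b.bidCount C = 0 ↔ ∀ p ∈ b.bids, p ∉ C := by
  classical exact Multiset.countP_eq_zero

lemma bidCount_pos {C : Set ℝ} : 0 < b.bidCount C ↔ ∃ p ∈ b.bids, p ∈ C := by
  classical exact Multiset.countP_pos

lemma askCount_eq_zero {C : Set ℝ} : b.askCount C = 0 ↔ ∀ p ∈ b.asks, p ∉ C := by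
  classical exact Multiset.countP_eq_zero

lemma askCount_pos {C : Set ℝ} : 0 < b.askCount C ↔ ∃ p ∈ b.asks, p ∈ C := by
  classical exact Multiset.countP_pos

lemma bidCount_le_card (C : Set ℝ) : b.bidCount C ≤ b.bids.card := by
  classical exact Multiset.countP_le_card _ _

open Classical in
lemma bidCount_step_bid (h1 : o.1 = true) (C : Set ℝ) :
    (b.step P o).bidCount C =
      b.bidCount C + if (¬ ∃ q ∈ b.asks, P q ≤ P o.2) ∧ o.2 ∈ C then 1 else 0 := by
  by_cases h2 : ∃ q ∈ b.asks, P q ≤ P o.2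
  · rw [step_bid_match h1 h2, if_neg fun h => h.1 h2]; rfl
  · rw [step_bid_join h1 h2]
    simp only [bidCount, Multiset.countP_cons]
    congr 1
    by_cases h3 : o.2 ∈ C
    · rw [if_pos h3, if_pos ⟨h2, h3⟩]
    · rw [if_neg h3, if_neg fun h => h3 h.2]

open Classical in
lemma bidCount_step_ask_match (h1 : o.1 = false) (h2 : ∃ p ∈ b.bids, P o.2 ≤ P p) (C : Set ℝ) :
    (b.step P o).bidCount C + (if b.bestBid ∈ C then 1 else 0) = b.bidCount C := by
  rw [step_ask_match h1 h2]
  obtain ⟨p, hp, -⟩ := h2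
  have := Multiset.cons_erase (bestBid_mem (Book.ne_zero_of_mem hp))
  simp only [bidCount]
  conv_rhs => rw [← this, Multiset.countP_cons]

lemma bidCount_step_ask_join (h1 : o.1 = false) (h2 : ¬ ∃ p ∈ b.bids, P o.2 ≤ P p) (C : Set ℝ) :
    (b.step P o).bidCount C = b.bidCount C := by
  rw [step_ask_join h1 h2]; rfl

lemma mem_bids_step_of_mem {p : ℝ} (h : p ∈ b.bids)
    (h' : ¬ (o.1 = false ∧ (∃ r ∈ b.bids, P o.2 ≤ P r) ∧ b.bestBid = p)) :
    p ∈ (b.step P o).bids := by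
  rcases Bool.eq_false_or_eq_true o.1 with h1 | h1
  · by_cases h2 : ∃ q ∈ b.asks, P q ≤ P o.2
    · rw [step_bid_match h1 h2]; exact h
    · rw [step_bid_join h1 h2]; exact Multiset.mem_cons_of_mem h
  · by_cases h2 : ∃ p ∈ b.bids, P o.2 ≤ P p
    · rw [step_ask_match h1 h2]
      exact (Multiset.mem_erase_of_ne fun h3 => h' ⟨h1, h2, h3.symm⟩).2 h
    · rw [step_ask_join h1 h2]; exact h

lemma NoBid.mono {u v : ℝ} (h : NoBid P b u) (huv : u ≤ v) : NoBid P b v :=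
  fun q hq => (h q hq).trans_le huv

/-! #### Exchanging bids and asks -/

/-- The book in which bids and asks are exchanged, with prices reflected. -/
def reflect (b : Book) : Book := ⟨b.asks.map (1 - ·), b.bids.map (1 - ·)⟩

end Book

/-- The price equivalence function for reflected prices. -/
def reflectPrice (P : ℝ → ℝ) : ℝ → ℝ := fun x => 1 - P (1 - x)

/-- The order of the other type at the reflected price. -/
def reflectOrder (o : Order) : Order := (!o.1, 1 - o.2)

@[simp] lemma reflectPrice_reflectPrice (P : ℝ → ℝ) : reflectPrice (reflectPrice P) = P := by
  funext x; simp [reflectPrice]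

@[simp] lemma reflectOrder_reflectOrder (o : Order) : reflectOrder (reflectOrder o) = o := by
  simp [reflectOrder]

lemma reflectPrice_one_sub (P : ℝ → ℝ) (x : ℝ) : reflectPrice P (1 - x) = 1 - P x := by
  simp [reflectPrice]

namespace Book

variable {P : ℝ → ℝ} {b : Book} {o : Order}

@[simp] lemma reflect_reflect (b : Book) : b.reflect.reflect = b := by
  simp [reflect]

lemma mem_bids_reflect {p : ℝ} : p ∈ b.reflect.bids ↔ 1 - p ∈ b.asks := by
  simp only [reflect, Multiset.mem_map]
  constructor
  · rintro ⟨a, ha, rfl⟩; simpa using ha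
  · exact fun h => ⟨1 - p, h, by ring⟩

lemma mem_asks_reflect {p : ℝ} : p ∈ b.reflect.asks ↔ 1 - p ∈ b.bids := by
  simp only [reflect, Multiset.mem_map]
  constructor
  · rintro ⟨a, ha, rfl⟩; simpa using ha
  · exact fun h => ⟨1 - p, h, by ring⟩

lemma bids_reflect_ne_zero : b.reflect.bids ≠ 0 ↔ b.asks ≠ 0 := by
  simp [reflect]

lemma asks_reflect_ne_zero : b.reflect.asks ≠ 0 ↔ b.bids ≠ 0 := by
  simp [reflect]

lemma bestAsk_mem (h : b.asks ≠ 0) : b.bestAsk ∈ b.asks := by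
  obtain ⟨p, hp⟩ := Multiset.exists_mem_of_ne_zero h
  exact Set.Nonempty.csInf_mem (s := {p | p ∈ b.asks}) ⟨p, hp⟩ (finite_setOf_mem _)

lemma bestAsk_le {p : ℝ} (h : p ∈ b.asks) : b.bestAsk ≤ p :=
  csInf_le (finite_setOf_mem b.asks).bddBelow h

lemma bestBid_reflect (h : b.asks ≠ 0) : b.reflect.bestBid = 1 - b.bestAsk := by
  refine bestBid_eq ?_ fun r hr => ?_
  · rw [mem_bids_reflect]; simpa using bestAsk_mem h
  · rw [mem_bids_reflect] at hr
    linarith [bestAsk_le hr]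

lemma bestAsk_reflect (h : b.bids ≠ 0) : b.reflect.bestAsk = 1 - b.bestBid := by
  have := bestBid_reflect (b := b.reflect) (asks_reflect_ne_zero.2 h)
  rw [reflect_reflect] at this
  linarith

lemma exists_compatible_ask_reflect (p : ℝ) :
    (∃ q ∈ b.reflect.asks, reflectPrice P q ≤ reflectPrice P (1 - p)) ↔
      ∃ q ∈ b.bids, P p ≤ P q := by
  constructor
  · rintro ⟨q, hq, h⟩
    refine ⟨1 - q, mem_asks_reflect.1 hq, ?_⟩
    rw [reflectPrice_one_sub] at h
    simp only [reflectPrice] at h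
    linarith
  · rintro ⟨q, hq, h⟩
    refine ⟨1 - q, mem_asks_reflect.2 (by simpa using hq), ?_⟩
    rw [reflectPrice_one_sub, reflectPrice_one_sub]
    linarith

lemma exists_compatible_bid_reflect (p : ℝ) :
    (∃ q ∈ b.reflect.bids, reflectPrice P (1 - p) ≤ reflectPrice P q) ↔
      ∃ q ∈ b.asks, P q ≤ P p := by
  constructor
  · rintro ⟨q, hq, h⟩
    refine ⟨1 - q, mem_bids_reflect.1 hq, ?_⟩
    rw [reflectPrice_one_sub] at h
    simp only [reflectPrice] at h
    linarith
  · rintro ⟨q, hq, h⟩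
    refine ⟨1 - q, mem_bids_reflect.2 (by simpa using hq), ?_⟩
    rw [reflectPrice_one_sub, reflectPrice_one_sub]
    linarith

/-- The dynamics commutes with exchanging bids and asks and reflecting prices, so each result about
bids yields one about asks. -/
lemma step_reflect (P : ℝ → ℝ) (b : Book) (o : Order) :
    (b.step P o).reflect = b.reflect.step (reflectPrice P) (reflectOrder o) := by
  have hinj : Function.Injective fun x : ℝ => 1 - x := fun x y h => by simpa using h
  rcases Bool.eq_false_or_eq_true o.1 with h1 | h1
  · have h1' : (reflectOrder o).1 = false := by simp [reflectOrder, h1]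
    by_cases h2 : ∃ q ∈ b.asks, P q ≤ P o.2
    · have hne : b.asks ≠ 0 := by
        obtain ⟨q, hq, -⟩ := h2; exact Book.ne_zero_of_mem hq
      rw [step_bid_match h1 h2, step_ask_match h1' ((exists_compatible_bid_reflect o.2).2 h2),
        bestBid_reflect hne]
      simp only [reflect, Book.mk.injEq, and_true]
      exact Multiset.map_erase _ hinj _ _
    · rw [step_bid_join h1 h2,
        step_ask_join h1' fun h => h2 ((exists_compatible_bid_reflect o.2).1 h)]
      simp [reflect, reflectOrder]
  · have h1' : (reflectOrder o).1 = true := by simp [reflectOrder, h1]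
    by_cases h2 : ∃ p ∈ b.bids, P o.2 ≤ P p
    · have hne : b.bids ≠ 0 := by
        obtain ⟨q, hq, -⟩ := h2; exact Book.ne_zero_of_mem hq
      rw [step_ask_match h1 h2, step_bid_match h1' ((exists_compatible_ask_reflect o.2).2 h2),
        bestAsk_reflect hne]
      simp only [reflect, Book.mk.injEq, true_and]
      exact Multiset.map_erase _ hinj _ _
    · rw [step_ask_join h1 h2,
        step_bid_join h1' fun h => h2 ((exists_compatible_ask_reflect o.2).1 h)]
      simp [reflect, reflectOrder]

lemma askCount_eq_reflect (b : Book) (C : Set ℝ) :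
    b.askCount C = b.reflect.bidCount ((1 - ·) ⁻¹' C) := by
  classical
  rw [askCount, bidCount, reflect, Multiset.countP_map, Multiset.countP_eq_card_filter]
  simp

lemma bestBidIn_reflect (D : Set ℝ) :
    b.reflect.BestBidIn ((1 - ·) ⁻¹' D) ↔ b.BestAskIn D := by
  unfold BestBidIn BestAskIn
  rw [bids_reflect_ne_zero]
  refine and_congr_right fun h => ?_
  rw [bestBid_reflect h]
  simp

lemma noBid_reflect (v : ℝ) : NoBid (reflectPrice P) b.reflect (1 - v) ↔ NoAsk P b v := by
  constructor
  · intro h q hq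
    have := h (1 - q) (mem_bids_reflect.2 (by simpa using hq))
    rw [reflectPrice_one_sub] at this
    linarith
  · intro h p hp
    have := h _ (mem_bids_reflect.1 hp)
    simp only [reflectPrice]
    linarith

lemma noAsk_reflect (v : ℝ) : NoAsk (reflectPrice P) b.reflect (1 - v) ↔ NoBid P b v := by
  constructor
  · intro h q hq
    have := h (1 - q) (mem_asks_reflect.2 (by simpa using hq))
    rw [reflectPrice_one_sub] at this
    linarith
  · intro h p hp
    have := h _ (mem_asks_reflect.1 hp)
    simp only [reflectPrice]
    linarith

lemma Admissible.reflect (h : b.Admissible P) : b.reflect.Admissible (reflectPrice P) := by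
  refine ⟨fun p hp => ?_, fun q hq => ?_, fun p hp q hq => ?_⟩
  · have := h.2.1 _ (mem_bids_reflect.1 hp)
    exact ⟨by linarith [this.2], by linarith [this.1]⟩
  · have := h.1 _ (mem_asks_reflect.1 hq)
    exact ⟨by linarith [this.2], by linarith [this.1]⟩
  · have := h.2.2 _ (mem_asks_reflect.1 hq) _ (mem_bids_reflect.1 hp)
    simp only [reflectPrice]
    intro h'
    exact this (by linarith)

/-! #### Preserved properties -/

lemma Admissible.step (h : b.Admissible P) (ho : o.2 ∈ Icc (0 : ℝ) 1) :
    (b.step P o).Admissible P := by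
  rcases Bool.eq_false_or_eq_true o.1 with h1 | h1
  · by_cases h2 : ∃ q ∈ b.asks, P q ≤ P o.2
    · rw [step_bid_match h1 h2]
      exact ⟨h.1, fun q hq => h.2.1 q (Multiset.mem_of_mem_erase hq),
        fun p hp q hq => h.2.2 p hp q (Multiset.mem_of_mem_erase hq)⟩
    · rw [step_bid_join h1 h2]
      refine ⟨fun p hp => ?_, h.2.1, fun p hp q hq => ?_⟩
      · rcases Multiset.mem_cons.1 hp with rfl | hp
        · exact ho
        · exact h.1 p hp
      · rcases Multiset.mem_cons.1 hp with rfl | hp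
        · exact fun h3 => h2 ⟨q, hq, h3⟩
        · exact h.2.2 p hp q hq
  · by_cases h2 : ∃ p ∈ b.bids, P o.2 ≤ P p
    · rw [step_ask_match h1 h2]
      exact ⟨fun q hq => h.1 q (Multiset.mem_of_mem_erase hq), h.2.1,
        fun p hp q hq => h.2.2 p (Multiset.mem_of_mem_erase hp) q hq⟩
    · rw [step_ask_join h1 h2]
      refine ⟨h.1, fun p hp => ?_, fun p hp q hq => ?_⟩
      · rcases Multiset.mem_cons.1 hp with rfl | hp
        · exact ho
        · exact h.2.1 p hp
      · rcases Multiset.mem_cons.1 hq with rfl | hq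
        · exact fun h3 => h2 ⟨p, hp, h3⟩
        · exact h.2.2 p hp q hq

/-- The second book has one more bid, or one less ask. -/
def Exceeds (b₁ b₂ : Book) : Prop :=
  (∃ p ∈ Icc (0 : ℝ) 1, b₂ = ⟨p ::ₘ b₁.bids, b₁.asks⟩) ∨
    ∃ q ∈ Icc (0 : ℝ) 1, b₁ = ⟨b₂.bids, q ::ₘ b₂.asks⟩

lemma Exceeds.reflect {b₁ b₂ : Book} (h : Exceeds b₁ b₂) : Exceeds b₂.reflect b₁.reflect := by
  rcases h with ⟨p, hp, rfl⟩ | ⟨q, hq, rfl⟩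
  · refine Or.inr ⟨1 - p, ⟨by linarith [hp.2], by linarith [hp.1]⟩, ?_⟩
    simp [Book.reflect]
  · refine Or.inl ⟨1 - q, ⟨by linarith [hq.2], by linarith [hq.1]⟩, ?_⟩
    simp [Book.reflect]

/-- One additional bid stays a discrepancy of one order. An arriving bid treats both books alike. An
arriving ask may remove different bids, and then the extra bid of the second book changes its price;
or it may match only the extra bid, and then the discrepancy becomes an extra ask in the first book.
-/
lemma exceeds_step_cons (hP : MonotoneOn P (Icc 0 1)) {p : ℝ} (hp : p ∈ Icc (0 : ℝ) 1)
    (hb : ∀ r ∈ b.bids, r ∈ Icc (0 : ℝ) 1) (ho : o.2 ∈ Icc (0 : ℝ) 1) :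
    Exceeds (b.step P o) (Book.step P ⟨p ::ₘ b.bids, b.asks⟩ o) := by
  set b₂ : Book := ⟨p ::ₘ b.bids, b.asks⟩ with hb₂
  rcases Bool.eq_false_or_eq_true o.1 with h1 | h1
  · by_cases h2 : ∃ q ∈ b.asks, P q ≤ P o.2
    · rw [step_bid_match h1 h2, step_bid_match (b := b₂) h1 h2]
      exact Or.inl ⟨p, hp, rfl⟩
    · rw [step_bid_join h1 h2, step_bid_join (b := b₂) h1 h2]
      refine Or.inl ⟨p, hp, ?_⟩
      simp only [hb₂]
      rw [Multiset.cons_swap]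
  · by_cases h2 : ∃ r ∈ b.bids, P o.2 ≤ P r
    · have h2' : ∃ r ∈ b₂.bids, P o.2 ≤ P r := by
        obtain ⟨r, hr, hr'⟩ := h2
        exact ⟨r, Multiset.mem_cons_of_mem hr, hr'⟩
      rw [step_ask_match h1 h2, step_ask_match (b := b₂) h1 h2']
      have hne : b.bids ≠ 0 := by
        obtain ⟨r, hr, -⟩ := h2; exact Book.ne_zero_of_mem hr
      have hmem := bestBid_mem hne
      rcases le_or_gt p b.bestBid with hle | hlt
      · have e : b₂.bestBid = b.bestBid := by
          refine bestBid_eq (Multiset.mem_cons_of_mem hmem) fun r hr => ?_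
          rcases Multiset.mem_cons.1 hr with rfl | hr
          · exact hle
          · exact le_bestBid hr
        refine Or.inl ⟨p, hp, ?_⟩
        rw [e]
        simp only [hb₂, Book.mk.injEq, and_true]
        by_cases hpe : p = b.bestBid
        · rw [← hpe, Multiset.erase_cons_head, Multiset.cons_erase (hpe ▸ hmem)]
        · rw [Multiset.erase_cons_tail _ (fun h => hpe h)]
      · have e : b₂.bestBid = p := by
          refine bestBid_eq (Multiset.mem_cons_self _ _) fun r hr => ?_
          rcases Multiset.mem_cons.1 hr with rfl | hr
          · exact le_rfl
          · exact (le_bestBid hr).trans hlt.le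
        refine Or.inl ⟨b.bestBid, hb _ hmem, ?_⟩
        rw [e]
        simp only [hb₂, Multiset.erase_cons_head, Book.mk.injEq, and_true]
        rw [Multiset.cons_erase hmem]
    · rw [step_ask_join h1 h2]
      by_cases h3 : P o.2 ≤ P p
      · have h2' : ∃ r ∈ b₂.bids, P o.2 ≤ P r := ⟨p, Multiset.mem_cons_self _ _, h3⟩
        rw [step_ask_match (b := b₂) h1 h2']
        have e : b₂.bestBid = p := by
          refine bestBid_eq (Multiset.mem_cons_self _ _) fun r hr => ?_
          rcases Multiset.mem_cons.1 hr with rfl | hr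
          · exact le_rfl
          · by_contra hlt
            exact h2 ⟨r, hr, h3.trans (hP hp (hb r hr) (not_le.1 hlt).le)⟩
        refine Or.inr ⟨o.2, ho, ?_⟩
        rw [e]
        simp only [hb₂, Multiset.erase_cons_head]
      · have h2' : ¬ ∃ r ∈ b₂.bids, P o.2 ≤ P r := by
          rintro ⟨r, hr, hr'⟩
          rcases Multiset.mem_cons.1 hr with rfl | hr
          · exact h3 hr'
          · exact h2 ⟨r, hr, hr'⟩
        rw [step_ask_join (b := b₂) h1 h2']
        exact Or.inl ⟨p, hp, rfl⟩

lemma monotoneOn_reflectPrice (hP : MonotoneOn P (Icc 0 1)) :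
    MonotoneOn (reflectPrice P) (Icc 0 1) := by
  intro x hx y hy hxy
  have := hP (a := 1 - y) (b := 1 - x) ⟨by linarith [hy.2], by linarith [hy.1]⟩
    ⟨by linarith [hx.2], by linarith [hx.1]⟩ (by linarith)
  simp only [reflectPrice]
  linarith

lemma Exceeds.step (hP : MonotoneOn P (Icc 0 1)) {b₁ b₂ : Book} (h₁ : b₁.Admissible P)
    (h₂ : b₂.Admissible P) (h : Exceeds b₁ b₂) (ho : o.2 ∈ Icc (0 : ℝ) 1) :
    Exceeds (b₁.step P o) (b₂.step P o) := by
  rcases h with ⟨p, hp, rfl⟩ | ⟨q, hq, rfl⟩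
  -- A missing ask becomes an additional bid after reflection, so the other case needs no second
  -- analysis.
  · exact exceeds_step_cons hP hp h₁.1 ho
  · have ho' : (reflectOrder o).2 ∈ Icc (0 : ℝ) 1 :=
      ⟨by simp only [reflectOrder]; linarith [ho.2], by simp only [reflectOrder]; linarith [ho.1]⟩
    have key := exceeds_step_cons (b := b₂.reflect) (monotoneOn_reflectPrice hP)
      (p := 1 - q) ⟨by linarith [hq.2], by linarith [hq.1]⟩ h₂.reflect.1 ho'
    have e : (⟨(1 - q) ::ₘ b₂.reflect.bids, b₂.reflect.asks⟩ : Book) =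
        Book.reflect ⟨b₂.bids, q ::ₘ b₂.asks⟩ := by simp [Book.reflect]
    rw [e, ← step_reflect, ← step_reflect] at key
    simpa using key.reflect

end Book

/-! ### The path of the book -/

section Path

variable {P : ℝ → ℝ} {init : Book} {o : ℕ → Order}

lemma bookAfter_succ (n : ℕ) :
    bookAfter P init o (n + 1) = (bookAfter P init o n).step P (o n) := rfl

lemma bookAfter_reflect (n : ℕ) :
    bookAfter (reflectPrice P) init.reflect (fun i => reflectOrder (o i)) n =
      (bookAfter P init o n).reflect := by
  induction n with
  | zero => rfl
  | succ n ih => rw [bookAfter_succ, bookAfter_succ, ih, Book.step_reflect]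

lemma bookAfter_add (k n : ℕ) :
    bookAfter P init o (k + n) = bookAfter P (bookAfter P init o k) (fun i => o (k + i)) n := by
  induction n with
  | zero => rfl
  | succ n ih => rw [← add_assoc, bookAfter_succ, bookAfter_succ, ih]

lemma admissible_bookAfter (h : init.Admissible P) (ho : ∀ n, (o n).2 ∈ Icc (0 : ℝ) 1) (n : ℕ) :
    (bookAfter P init o n).Admissible P := by
  induction n with
  | zero => exact h
  | succ n ih => exact ih.step (ho n)

lemma Book.Exceeds.bookAfter (hP : MonotoneOn P (Icc 0 1)) {b₁ b₂ : Book} (h₁ : b₁.Admissible P)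
    (h₂ : b₂.Admissible P) (h : Exceeds b₁ b₂) (ho : ∀ n, (o n).2 ∈ Icc (0 : ℝ) 1) (n : ℕ) :
    Exceeds (bookAfter P b₁ o n) (bookAfter P b₂ o n) := by
  induction n with
  | zero => exact h
  | succ n ih =>
    exact ih.step hP (admissible_bookAfter h₁ ho n) (admissible_bookAfter h₂ ho n) (ho n)

lemma Book.Exceeds.bidCount_le {b₁ b₂ : Book} (h : Exceeds b₁ b₂) (C : Set ℝ) :
    b₁.bidCount C ≤ b₂.bidCount C ∧ b₂.bidCount C ≤ b₁.bidCount C + 1 := by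
  classical
  rcases h with ⟨p, hp, rfl⟩ | ⟨q, hq, rfl⟩
  · simp only [Book.bidCount, Multiset.countP_cons]
    split_ifs <;> omega
  · simp [Book.bidCount]

/-- The numbers of bids started from two different initial states stay within a bounded distance
of each other; here one of the initial states is the empty book. -/
lemma bidCount_bookAfter_empty (hP : MonotoneOn P (Icc 0 1)) (ho : ∀ n, (o n).2 ∈ Icc (0 : ℝ) 1)
    (C : Set ℝ) (s t : Multiset ℝ) (h : Book.Admissible P ⟨s, t⟩) (n : ℕ) :
    (bookAfter P ⟨0, 0⟩ o n).bidCount C ≤ (bookAfter P ⟨s, t⟩ o n).bidCount C + t.card ∧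
      (bookAfter P ⟨s, t⟩ o n).bidCount C ≤ (bookAfter P ⟨0, 0⟩ o n).bidCount C + s.card := by
  induction s using Multiset.induction_on with
  | empty =>
    induction t using Multiset.induction_on with
    | empty => simp
    | cons q t ih =>
      have h' : Book.Admissible P ⟨0, t⟩ :=
        ⟨h.1, fun q hq => h.2.1 q (Multiset.mem_cons_of_mem hq), fun p hp => by simp at hp⟩
      have hE : Book.Exceeds ⟨0, q ::ₘ t⟩ ⟨0, t⟩ :=
        Or.inr ⟨q, h.2.1 q (Multiset.mem_cons_self _ _), rfl⟩
      have := (hE.bookAfter hP h h' ho n).bidCount_le C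
      have := ih h'
      simp only [Multiset.card_cons, Multiset.card_zero] at *
      omega
  | cons p s ih =>
    have h' : Book.Admissible P ⟨s, t⟩ :=
      ⟨fun q hq => h.1 q (Multiset.mem_cons_of_mem hq), h.2.1,
        fun p hp => h.2.2 p (Multiset.mem_cons_of_mem hp)⟩
    have hE : Book.Exceeds ⟨s, t⟩ ⟨p ::ₘ s, t⟩ :=
      Or.inl ⟨p, h.1 p (Multiset.mem_cons_self _ _), rfl⟩
    have := (hE.bookAfter hP h' h ho n).bidCount_le C
    have := ih h'
    simp only [Multiset.card_cons] at *
    omega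

/-- Numbers of bids and asks differ by the sum of the signs of the orders. -/
lemma card_sub_card (n : ℕ) :
    ((bookAfter P init o n).bids.card : ℤ) - (bookAfter P init o n).asks.card =
      (init.bids.card - init.asks.card) +
        ∑ i ∈ Finset.range n, (if (o i).1 = true then 1 else -1) := by
  induction n with
  | zero => simp [bookAfter]
  | succ n ih =>
    rw [Finset.sum_range_succ, ← add_assoc, ← ih, bookAfter_succ]
    set b := bookAfter P init o n
    rcases Bool.eq_false_or_eq_true (o n).1 with h1 | h1
    · rw [if_pos h1]
      by_cases h2 : ∃ q ∈ b.asks, P q ≤ P (o n).2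
      · rw [Book.step_bid_match h1 h2]
        have hne : b.asks ≠ 0 := by
          obtain ⟨r, hr, -⟩ := h2; exact Book.ne_zero_of_mem hr
        have := Multiset.card_erase_add_one (Book.bestAsk_mem hne)
        simp only
        omega
      · rw [Book.step_bid_join h1 h2]
        simp only [Multiset.card_cons]
        omega
    · rw [if_neg (by simp [h1])]
      by_cases h2 : ∃ q ∈ b.bids, P (o n).2 ≤ P q
      · rw [Book.step_ask_match h1 h2]
        have hne : b.bids ≠ 0 := by
          obtain ⟨r, hr, -⟩ := h2; exact Book.ne_zero_of_mem hr
        have := Multiset.card_erase_add_one (Book.bestBid_mem hne)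
        simp only
        omega
      · rw [Book.step_ask_join h1 h2]
        simp only [Multiset.card_cons]
        omega

open Classical in
/-- The bids in a block above `u` are fed by the bids which arrive while there are no asks up to
`u`, and are consumed by the asks up to `u` whenever the best bid is in the block. -/
lemma bidCount_add_count_le {u : ℝ} {D : Set ℝ} (hD : ∀ p ∈ D, u ≤ P p) (L : ℕ) :
    (bookAfter P init o L).bidCount D +
        Nat.count (fun n => (bookAfter P init o n).BestBidIn D ∧
          (o n).1 = false ∧ P (o n).2 ≤ u) L ≤
      init.bidCount D + Nat.count (fun n => (bookAfter P init o n).NoAsk P u ∧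
          (o n).1 = true ∧ (o n).2 ∈ D) L := by
  induction L with
  | zero => simp [bookAfter]
  | succ n ih =>
    rw [Nat.count_succ, Nat.count_succ, bookAfter_succ]
    set b := bookAfter P init o n
    rcases Bool.eq_false_or_eq_true (o n).1 with h1 | h1
    · rw [Book.bidCount_step_bid h1,
        if_neg (c := b.BestBidIn D ∧ (o n).1 = false ∧ P (o n).2 ≤ u) (by simp [h1])]
      -- A bid that joins the block is incompatible with every queued ask, so all asks lie in bins
      -- above its own and hence above `u`.
      have : (if (¬ ∃ q ∈ b.asks, P q ≤ P (o n).2) ∧ (o n).2 ∈ D then 1 else 0) ≤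
          if b.NoAsk P u ∧ (o n).1 = true ∧ (o n).2 ∈ D then 1 else 0 := by
        split_ifs with h2 h3
        · exact le_rfl
        · exact absurd ⟨fun q hq => lt_of_not_ge fun h4 => h2.1 ⟨q, hq, h4.trans (hD _ h2.2)⟩,
            h1, h2.2⟩ h3
        · exact zero_le_one
        · exact le_rfl
      omega
    · rw [if_neg (c := b.NoAsk P u ∧ (o n).1 = true ∧ (o n).2 ∈ D) (by simp [h1])]
      by_cases h2 : ∃ p ∈ b.bids, P (o n).2 ≤ P p
      · have h3 := Book.bidCount_step_ask_match h1 h2 D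
        have : (if b.BestBidIn D ∧ (o n).1 = false ∧ P (o n).2 ≤ u then 1 else 0) ≤
            if b.bestBid ∈ D then 1 else 0 := by
          split_ifs with h4 h5
          · exact le_rfl
          · exact absurd h4.1.2 h5
          · exact zero_le_one
          · exact le_rfl
        omega
      · rw [Book.bidCount_step_ask_join h1 h2, if_neg]
        · omega
        -- An ask up to `u` that finds the best bid in the block is compatible with it, so it cannot
        -- be an ask that joins.
        · rintro ⟨h3, -, h4⟩
          exact h2 ⟨_, Book.bestBid_mem h3.1, h4.trans (hD _ h3.2)⟩

open Classical in
/-- The bids in a block below `v` are fed by all bids which arrive while there are no asks up to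
`v`, and are consumed only by asks below `v` when the best bid is in the block. -/
lemma le_bidCount_add_count (hP : MonotoneOn P (Icc 0 1)) (hi : init.Admissible P)
    (ho : ∀ n, (o n).2 ∈ Icc (0 : ℝ) 1) {v : ℝ} {D : Set ℝ} (hD : ∀ p ∈ D, P p < v) (L : ℕ) :
    init.bidCount D + Nat.count (fun n => (bookAfter P init o n).NoAsk P v ∧
          (o n).1 = true ∧ (o n).2 ∈ D) L ≤
    (bookAfter P init o L).bidCount D +
        Nat.count (fun n => (bookAfter P init o n).BestBidIn D ∧
          (o n).1 = false ∧ P (o n).2 < v) L := by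
  induction L with
  | zero => simp [bookAfter]
  | succ n ih =>
    rw [Nat.count_succ, Nat.count_succ, bookAfter_succ]
    set b := bookAfter P init o n
    rcases Bool.eq_false_or_eq_true (o n).1 with h1 | h1
    · rw [Book.bidCount_step_bid h1]
      -- An ask compatible with a bid of the block would lie in a bin below `v`, so in the absence
      -- of such asks the bid joins.
      have : (if b.NoAsk P v ∧ (o n).1 = true ∧ (o n).2 ∈ D then 1 else 0) ≤
          (if (¬ ∃ q ∈ b.asks, P q ≤ P (o n).2) ∧ (o n).2 ∈ D then 1 else 0) := by
        split_ifs with h2 h3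
        · exact le_rfl
        · refine absurd ⟨?_, h2.2.2⟩ h3
          rintro ⟨q, hq, h4⟩
          exact absurd (h2.1 q hq) (not_lt.2 (h4.trans (hD _ h2.2.2).le))
        · exact zero_le_one
        · exact le_rfl
      omega
    · rw [if_neg (c := b.NoAsk P v ∧ (o n).1 = true ∧ (o n).2 ∈ D) (by simp [h1])]
      by_cases h2 : ∃ p ∈ b.bids, P (o n).2 ≤ P p
      · have h3 := Book.bidCount_step_ask_match h1 h2 D
        have hne : b.bids ≠ 0 := by
          obtain ⟨r, hr, -⟩ := h2; exact Book.ne_zero_of_mem hr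
        -- An ask that removes a bid of the block is compatible with the best bid, hence in a bin
        -- below `v` itself.
        have : (if b.bestBid ∈ D then 1 else 0) ≤
            if b.BestBidIn D ∧ (o n).1 = false ∧ P (o n).2 < v then 1 else 0 := by
          split_ifs with h4 h5
          · exact le_rfl
          · obtain ⟨r, hr, hr'⟩ := h2
            have hadm := (admissible_bookAfter hi ho n).1
            exact absurd ⟨⟨hne, h4⟩, h1, (hr'.trans (hP (hadm r hr)
              (hadm _ (Book.bestBid_mem hne)) (Book.le_bestBid hr))).trans_lt (hD _ h4)⟩ h5
          · exact zero_le_one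
          · exact le_rfl
        omega
      · rw [Book.bidCount_step_ask_join h1 h2]
        omega

end Path

end

noncomputable section

/-! ### Independent identically distributed sequences and predictable events -/

/-- `X` is a sequence of independent random variables with the law `ν`. -/
structure IsIID {Ω E : Type*} [MeasurableSpace Ω] [MeasurableSpace E] (μ : Measure Ω)
    (X : ℕ → Ω → E) (ν : Measure E) : Prop where
  measurable : ∀ n, Measurable (X n)
  indep : iIndepFun X μ
  law : ∀ n, μ.map (X n) = ν

/-- The information carried by the first `n` terms of the sequence `X`. -/
@[reducible] def past {Ω E : Type*} [mE : MeasurableSpace E] (X : ℕ → Ω → E) (n : ℕ) : MeasurableSpace Ω :=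
  ⨆ i ∈ Iio n, mE.comap (X i)

section Past

variable {Ω E : Type*} [mΩ : MeasurableSpace Ω] [mE : MeasurableSpace E] {X : ℕ → Ω → E}

lemma past_mono {i j : ℕ} (h : i ≤ j) : past X i ≤ past X j :=
  biSup_mono fun _ hk => lt_of_lt_of_le hk h

lemma past_le (hX : ∀ n, Measurable (X n)) (n : ℕ) : past X n ≤ mΩ :=
  iSup₂_le fun i _ => (hX i).comap_le

lemma measurable_past {i n : ℕ} (h : i < n) : Measurable[past X n] (X i) :=
  (comap_measurable (X i)).mono (le_iSup₂_of_le i h le_rfl) le_rfl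

/-- The filtration of the pasts of a sequence. -/
def pastFiltration (hX : ∀ n, Measurable (X n)) : Filtration ℕ mΩ where
  seq := past X
  mono' _ _ h := past_mono h
  le' := past_le hX

end Past

namespace IsIID

variable {Ω E : Type*} [mΩ : MeasurableSpace Ω] [mE : MeasurableSpace E] {μ : Measure Ω}
  [IsProbabilityMeasure μ] {X : ℕ → Ω → E} {ν : Measure E}

lemma indep_past (h : IsIID μ X ν) (n : ℕ) : Indep (mE.comap (X n)) (past X n) μ := by
  have h1 := indep_iSup_of_disjoint (fun i => (h.measurable i).comap_le) h.indep
    (S := {n}) (T := Iio n) (by simp)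
  simpa [past] using h1

lemma integral_comp (h : IsIID μ X ν) {f : E → ℝ} (hf : Measurable f) (n : ℕ) :
    ∫ ω, f (X n ω) ∂μ = ∫ x, f x ∂ν := by
  rw [← h.law n, integral_map (h.measurable n).aemeasurable hf.aestronglyMeasurable]

lemma memLp_comp (h : IsIID μ X ν) {f : E → ℝ} {p : ℝ≥0∞} (hf : MemLp f p ν) (n : ℕ) :
    MemLp (fun ω => f (X n ω)) p μ := by
  rw [← h.law n] at hf
  exact hf.comp_of_map (h.measurable n).aemeasurable

lemma integrable_comp (h : IsIID μ X ν) {f : E → ℝ} (hf : Integrable f ν) (n : ℕ) :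
    Integrable (fun ω => f (X n ω)) μ := by
  rw [← h.law n] at hf
  exact hf.comp_measurable (h.measurable n)

/-- The strong law of large numbers. -/
lemma tendsto_average (h : IsIID μ X ν) {f : E → ℝ} (hf : Measurable f) (hi : Integrable f ν) :
    ∀ᵐ ω ∂μ, Tendsto (fun L : ℕ => (∑ n ∈ Finset.range L, f (X n ω)) / L) atTop
      (𝓝 (∫ x, f x ∂ν)) := by
  have h1 := strong_law_ae_real (μ := μ) (fun n ω => f (X n ω)) (h.integrable_comp hi 0)
    (fun i j hij => (h.indep.indepFun hij).comp hf hf)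
    (fun i => (IdentDistrib.mk (h.measurable i).aemeasurable (h.measurable 0).aemeasurable
      ((h.law i).trans (h.law 0).symm)).comp hf)
  rw [h.integral_comp hf 0] at h1
  exact h1

end IsIID

open Classical in
/-- The indicator of a proposition. -/
def ind (p : Prop) : ℝ := if p then 1 else 0

lemma ind_nonneg (p : Prop) : 0 ≤ ind p := by unfold ind; split_ifs <;> norm_num
lemma ind_le_one (p : Prop) : ind p ≤ 1 := by unfold ind; split_ifs <;> norm_num
lemma ind_of_true {p : Prop} (h : p) : ind p = 1 := if_pos h
lemma ind_of_false {p : Prop} (h : ¬ p) : ind p = 0 := if_neg h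
lemma ind_le_ind {p q : Prop} (h : p → q) : ind p ≤ ind q := by
  by_cases hp : p
  · rw [ind_of_true hp, ind_of_true (h hp)]
  · rw [ind_of_false hp]; exact ind_nonneg q
lemma ind_and (p q : Prop) : ind (p ∧ q) = ind p * ind q := by
  by_cases hp : p <;> by_cases hq : q <;> simp [ind, hp, hq]

lemma ite_eq_ind (p : Prop) [Decidable p] : (if p then (1 : ℝ) else 0) = ind p := by
  by_cases h : p <;> simp [ind, h]

lemma count_eq_sum_ind (p : ℕ → Prop) [DecidablePred p] (L : ℕ) :
    (Nat.count p L : ℝ) = ∑ n ∈ Finset.range L, ind (p n) := by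
  induction L with
  | zero => simp
  | succ n ih =>
    rw [Nat.count_succ, Finset.sum_range_succ, ← ih, ← ite_eq_ind]
    push_cast; rfl

lemma measurable_ind {Ω : Type*} {m : MeasurableSpace Ω} {p : Ω → Prop}
    (h : MeasurableSet[m] {ω | p ω}) : Measurable[m] (fun ω => ind (p ω)) := by
  classical
  exact Measurable.ite h measurable_const measurable_const

/-- Averages along the squares and monotone control in between give convergence of averages. -/
lemma tendsto_div_of_squares {S T : ℕ → ℝ} {c : ℝ}
    (hST : ∀ m n, m ≤ n → |S n - S m| ≤ T n - T m)
    (hT : Tendsto (fun n : ℕ => T n / n) atTop (𝓝 c))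
    (hS : Tendsto (fun k : ℕ => S (k ^ 2) / (k ^ 2 : ℕ)) atTop (𝓝 0)) :
    Tendsto (fun n : ℕ => S n / n) atTop (𝓝 0) := by
  have hsq : Tendsto (fun k : ℕ => k ^ 2) atTop atTop :=
    tendsto_pow_atTop two_ne_zero
  have hr : Tendsto (fun k : ℕ => (((k + 1) ^ 2 : ℕ) : ℝ) / ((k ^ 2 : ℕ) : ℝ)) atTop (𝓝 1) := by
    have h1 : Tendsto (fun k : ℕ => (((k : ℝ) + 1) / k)) atTop (𝓝 1) := by
      have : Tendsto (fun k : ℕ => 1 + 1 / (k : ℝ)) atTop (𝓝 (1 + 0)) :=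
        tendsto_const_nhds.add tendsto_one_div_atTop_nhds_zero_nat
      rw [add_zero] at this
      refine this.congr' ?_
      filter_upwards [eventually_gt_atTop 0] with k hk
      field_simp
    have h2 := h1.pow 2
    rw [one_pow] at h2
    refine h2.congr fun k => ?_
    push_cast
    rw [div_pow]
  -- Consecutive squares have ratio tending to `1`, so `T` grows by `o(k^2)` between them. This
  -- bounds the variation of `S` there.
  have hgap : Tendsto (fun k : ℕ => (T ((k + 1) ^ 2) - T (k ^ 2)) / (k ^ 2 : ℕ)) atTop (𝓝 0) := by
    have h1 : Tendsto (fun k : ℕ => T ((k + 1) ^ 2) / (((k + 1) ^ 2 : ℕ) : ℝ)) atTop (𝓝 c) :=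
      hT.comp (hsq.comp (tendsto_add_atTop_nat 1))
    have h2 : Tendsto (fun k : ℕ => T (k ^ 2) / ((k ^ 2 : ℕ) : ℝ)) atTop (𝓝 c) := hT.comp hsq
    have h3 := (h1.mul hr).sub h2
    rw [mul_one, sub_self] at h3
    refine h3.congr' ?_
    filter_upwards [eventually_gt_atTop 0] with k hk
    have hk' : ((k ^ 2 : ℕ) : ℝ) ≠ 0 := by positivity
    have hk'' : (((k + 1) ^ 2 : ℕ) : ℝ) ≠ 0 := by positivity
    field_simp
  have hsum := hS.abs.add hgap
  rw [abs_zero, add_zero] at hsum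
  have hsqrt : Tendsto Nat.sqrt atTop atTop := by
    refine tendsto_atTop.2 fun b => ?_
    filter_upwards [eventually_ge_atTop (b ^ 2)] with n hn
    exact Nat.le_sqrt'.2 hn
  refine squeeze_zero_norm' ?_ (hsum.comp hsqrt)
  filter_upwards [eventually_gt_atTop 0] with n hn
  set k := n.sqrt with hk
  have hk1 : k ^ 2 ≤ n := Nat.sqrt_le' n
  have hk2 : n ≤ (k + 1) ^ 2 := (Nat.lt_succ_sqrt' n).le
  have hk0 : 0 < k := Nat.sqrt_pos.2 hn
  have hT1 : T n ≤ T ((k + 1) ^ 2) := by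
    have := (abs_nonneg _).trans (hST _ _ hk2); linarith
  have hn' : (0 : ℝ) < n := by exact_mod_cast hn
  have hkk : (0 : ℝ) < (k ^ 2 : ℕ) := by positivity
  have hb : |S n| ≤ |S (k ^ 2)| + (T ((k + 1) ^ 2) - T (k ^ 2)) := by
    have h1 := hST _ _ hk1
    have h2 := abs_sub_abs_le_abs_sub (S n) (S (k ^ 2))
    linarith
  simp only [Function.comp]
  rw [Real.norm_eq_abs, abs_div, abs_of_pos hn', ← hk, abs_div, abs_of_pos hkk, ← add_div]
  have h0 : 0 ≤ |S (k ^ 2)| + (T ((k + 1) ^ 2) - T (k ^ 2)) := (abs_nonneg _).trans hb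
  calc |S n| / n ≤ (|S (k ^ 2)| + (T ((k + 1) ^ 2) - T (k ^ 2))) / n := by gcongr
    _ ≤ _ := by gcongr

/-! ### Laws of large numbers, conditional Borel–Cantelli and zero–one law. -/

namespace IsIID

variable {Ω E : Type*} [mΩ : MeasurableSpace Ω] [mE : MeasurableSpace E] {μ : Measure Ω}
  [IsProbabilityMeasure μ] {X : ℕ → Ω → E} {ν : Measure E}

lemma memLp_partialSum (h : IsIID μ X ν) {f : E → ℝ} (hf2 : MemLp f 2 ν)
    {H : ℕ → Ω → Prop} (hH : ∀ n, MeasurableSet[past X n] {ω | H n ω}) (L : ℕ) :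
    MemLp (fun ω => ∑ n ∈ Finset.range L, ind (H n ω) * f (X n ω)) 2 μ := by
  refine memLp_finsetSum _ fun n _ => ?_
  refine (h.memLp_comp hf2 n).of_le ?_ (Eventually.of_forall fun ω => ?_)
  · exact (((measurable_ind (hH n)).mono (past_le h.measurable n) le_rfl).aestronglyMeasurable).mul
      (h.memLp_comp hf2 n).aestronglyMeasurable
  · rw [norm_mul, Real.norm_eq_abs, abs_of_nonneg (ind_nonneg _)]
    exact mul_le_of_le_one_left (norm_nonneg _) (ind_le_one _)

lemma measurable_partialSum {f : E → ℝ} (hf : Measurable f)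
    {H : ℕ → Ω → Prop} (hH : ∀ n, MeasurableSet[past X n] {ω | H n ω}) (L : ℕ) :
    Measurable[past X L] (fun ω => ∑ n ∈ Finset.range L, ind (H n ω) * f (X n ω)) := by
  refine Finset.measurable_fun_sum _ fun n hn => ?_
  have hn' := Finset.mem_range.1 hn
  exact ((measurable_ind (hH n)).mono (past_mono hn'.le) le_rfl).mul
    (hf.comp (measurable_past hn'))

lemma integral_mul_eq_zero (h : IsIID μ X ν) {f : E → ℝ} (hf : Measurable f)
    (hf0 : ∫ x, f x ∂ν = 0) {n : ℕ} {Y : Ω → ℝ} (hY : Measurable[past X n] Y) :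
    ∫ ω, Y ω * f (X n ω) ∂μ = 0 := by
  have hind : IndepFun Y (fun ω => f (X n ω)) μ := by
    rw [IndepFun_iff_Indep]
    refine (indep_of_indep_of_le_left (indep_of_indep_of_le_right (h.indep_past n).symm ?_) ?_)
    · exact (hf.comp (comap_measurable (X n))).comap_le
    · exact hY.comap_le
  rw [hind.integral_fun_mul_eq_mul_integral
    (hY.mono (past_le h.measurable n) le_rfl).aestronglyMeasurable
    (hf.comp (h.measurable n)).aestronglyMeasurable, h.integral_comp hf, hf0, mul_zero]

/-- The increments are martingale differences: the next term is centred and independent of the past,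
so the cross terms vanish and the second moments add up. -/
lemma integral_sq_partialSum_le (h : IsIID μ X ν) {f : E → ℝ} (hf : Measurable f)
    (hf2 : MemLp f 2 ν) (hf0 : ∫ x, f x ∂ν = 0)
    {H : ℕ → Ω → Prop} (hH : ∀ n, MeasurableSet[past X n] {ω | H n ω}) (L : ℕ) :
    ∫ ω, (∑ n ∈ Finset.range L, ind (H n ω) * f (X n ω)) ^ 2 ∂μ ≤ L * ∫ x, f x ^ 2 ∂ν := by
  induction L with
  | zero => simp
  | succ n ih =>
    set S : Ω → ℝ := fun ω => ∑ n ∈ Finset.range n, ind (H n ω) * f (X n ω) with hS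
    have hSL : MemLp S 2 μ := h.memLp_partialSum hf2 hH n
    have hSm : Measurable[past X n] S := measurable_partialSum hf hH n
    have hfL := h.memLp_comp hf2 n
    have hIm := measurable_ind (hH n)
    have hIm' := hIm.mono (past_le h.measurable n) le_rfl
    have hcL : MemLp (fun ω => 2 * (S ω * ind (H n ω))) 2 μ := by
      refine MemLp.const_mul ?_ 2
      refine hSL.of_le (hSL.aestronglyMeasurable.mul hIm'.aestronglyMeasurable)
        (Eventually.of_forall fun ω => ?_)
      rw [norm_mul, Real.norm_eq_abs (ind _), abs_of_nonneg (ind_nonneg _)]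
      exact mul_le_of_le_one_right (norm_nonneg _) (ind_le_one _)
    have hcross : ∫ ω, 2 * (S ω * ind (H n ω)) * f (X n ω) ∂μ = 0 :=
      h.integral_mul_eq_zero hf hf0 ((hSm.mul hIm).const_mul 2)
    have i1 : Integrable (fun ω => S ω ^ 2) μ := hSL.integrable_sq
    have i2 : Integrable (fun ω => 2 * (S ω * ind (H n ω)) * f (X n ω)) μ := hcL.integrable_mul hfL
    have i3 : Integrable (fun ω => f (X n ω) ^ 2) μ := hfL.integrable_sq
    have i12 : Integrable (fun ω => S ω ^ 2 + 2 * (S ω * ind (H n ω)) * f (X n ω)) μ := i1.add i2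
    calc ∫ ω, (∑ n ∈ Finset.range (n + 1), ind (H n ω) * f (X n ω)) ^ 2 ∂μ
        ≤ ∫ ω, (S ω ^ 2 + 2 * (S ω * ind (H n ω)) * f (X n ω) + f (X n ω) ^ 2) ∂μ := by
          refine integral_mono (h.memLp_partialSum hf2 hH (n + 1)).integrable_sq (i12.add i3)
            fun ω => ?_
          simp only [Finset.sum_range_succ]
          have e1 : (S ω + ind (H n ω) * f (X n ω)) ^ 2 =
            S ω ^ 2 + 2 * (S ω * ind (H n ω)) * f (X n ω) + (ind (H n ω)) ^ 2 * f (X n ω) ^ 2 := by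
            ring
          change (S ω + ind (H n ω) * f (X n ω)) ^ 2 ≤ _
          rw [e1]
          have : ind (H n ω) ^ 2 ≤ 1 := pow_le_one₀ (ind_nonneg _) (ind_le_one _)
          nlinarith [sq_nonneg (f (X n ω))]
      _ = (∫ ω, S ω ^ 2 ∂μ) + 0 + ∫ x, f x ^ 2 ∂ν := by
          rw [integral_add i12 i3, integral_add i1 i2, hcross,
            h.integral_comp (f := fun x => f x ^ 2) (hf.pow_const 2)]
      _ ≤ _ := by push_cast; linarith

/-- The law of large numbers for sums over predictable events. -/
theorem tendsto_average_predictable (h : IsIID μ X ν) {f : E → ℝ} (hf : Measurable f)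
    (hf2 : MemLp f 2 ν) (hf0 : ∫ x, f x ∂ν = 0)
    {H : ℕ → Ω → Prop} (hH : ∀ n, MeasurableSet[past X n] {ω | H n ω}) :
    ∀ᵐ ω ∂μ, Tendsto (fun L : ℕ => (∑ n ∈ Finset.range L, ind (H n ω) * f (X n ω)) / L) atTop
      (𝓝 0) := by
  have : IsProbabilityMeasure ν := by
    rw [← h.law 0]; exact Measure.isProbabilityMeasure_map (h.measurable 0).aemeasurable
  set σ := ∫ x, f x ^ 2 ∂ν with hσ
  have hσ0 : 0 ≤ σ := integral_nonneg fun x => sq_nonneg _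
  set S : ℕ → Ω → ℝ := fun L ω => ∑ n ∈ Finset.range L, ind (H n ω) * f (X n ω) with hS
  -- Along the squares the second moment of the average is at most `σ / k^2`, which is summable;
  -- hence the squared averages are almost surely summable and tend to `0`.
  have hSq : ∀ᵐ ω ∂μ, Tendsto (fun k : ℕ => S (k ^ 2) ω / (k ^ 2 : ℕ)) atTop (𝓝 0) := by
    have hm : ∀ k : ℕ, Measurable fun ω => ENNReal.ofReal ((S (k ^ 2) ω / (k ^ 2 : ℕ)) ^ 2) :=
      fun k => (((measurable_partialSum hf hH (k ^ 2)).mono (past_le h.measurable _)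
        le_rfl).div_const _ |>.pow_const 2).ennreal_ofReal
    have hb : ∀ k : ℕ, ∫⁻ ω, ENNReal.ofReal ((S (k ^ 2) ω / (k ^ 2 : ℕ)) ^ 2) ∂μ ≤
        ENNReal.ofReal (σ * (1 / (k : ℝ) ^ 2)) := by
      intro k
      have hi : Integrable (fun ω => (S (k ^ 2) ω / (k ^ 2 : ℕ)) ^ 2) μ := by
        simp only [div_pow]
        exact (h.memLp_partialSum hf2 hH (k ^ 2)).integrable_sq.div_const _
      rw [← ofReal_integral_eq_lintegral_ofReal hi (Eventually.of_forall fun ω => sq_nonneg _)]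
      refine ENNReal.ofReal_le_ofReal ?_
      simp only [div_pow, integral_div]
      rcases Nat.eq_zero_or_pos k with rfl | hk
      · simp
      have hk' : (0 : ℝ) < k := by exact_mod_cast hk
      rw [div_le_iff₀ (by positivity)]
      refine (h.integral_sq_partialSum_le hf hf2 hf0 hH (k ^ 2)).trans (le_of_eq ?_)
      rw [← hσ]
      push_cast
      field_simp
    have hsum : Summable fun k : ℕ => σ * (1 / (k : ℝ) ^ 2) :=
      (Real.summable_one_div_nat_pow.2 one_lt_two).mul_left σ
    have htot : ∫⁻ ω, ∑' k : ℕ, ENNReal.ofReal ((S (k ^ 2) ω / (k ^ 2 : ℕ)) ^ 2) ∂μ ≠ ∞ := by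
      rw [lintegral_tsum fun k => (hm k).aemeasurable]
      refine ne_top_of_le_ne_top ?_ (ENNReal.tsum_le_tsum hb)
      rw [← ENNReal.ofReal_tsum_of_nonneg (fun k => by positivity) hsum]
      exact ENNReal.ofReal_ne_top
    filter_upwards [ae_lt_top (Measurable.tsum hm) htot] with ω hω
    have h1 := ENNReal.tendsto_atTop_zero_of_tsum_ne_top hω.ne
    have h2 := (ENNReal.tendsto_toReal ENNReal.zero_ne_top).comp h1
    have h3 : Tendsto (fun k : ℕ => (S (k ^ 2) ω / (k ^ 2 : ℕ)) ^ 2) atTop (𝓝 0) := by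
      refine h2.congr fun k => ?_
      simp only [Function.comp]
      rw [ENNReal.toReal_ofReal (sq_nonneg _)]
    have h4 := h3.sqrt
    simp only [Real.sqrt_sq_eq_abs, Real.sqrt_zero] at h4
    exact (tendsto_zero_iff_abs_tendsto_zero _).2 h4
  have hfi : Integrable f ν := hf2.integrable (by norm_num)
  filter_upwards [hSq, h.tendsto_average (f := fun x => |f x|) hf.abs hfi.abs] with ω h1 h2
  -- Between squares the sum moves by at most the sum of `|f (X i)|`, whose average converges by the
  -- ordinary strong law.
  refine tendsto_div_of_squares (T := fun n => ∑ i ∈ Finset.range n, |f (X i ω)|)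
    (fun m n hmn => ?_) h2 h1
  rw [← Finset.sum_Ico_eq_sub _ hmn, ← Finset.sum_Ico_eq_sub _ hmn]
  refine (Finset.abs_sum_le_sum_abs _ _).trans (Finset.sum_le_sum fun i _ => ?_)
  rw [abs_mul, abs_of_nonneg (ind_nonneg _)]
  exact mul_le_of_le_one_left (abs_nonneg _) (ind_le_one _)

/-- Predictable events and the next term of the sequence are asymptotically independent. -/
theorem tendsto_average_ind (h : IsIID μ X ν) {S : Set E} (hS : MeasurableSet S)
    {H : ℕ → Ω → Prop} (hH : ∀ n, MeasurableSet[past X n] {ω | H n ω}) :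
    ∀ᵐ ω ∂μ, Tendsto (fun L : ℕ => (∑ n ∈ Finset.range L, ind (H n ω ∧ X n ω ∈ S)) / L -
      ν.real S * ((∑ n ∈ Finset.range L, ind (H n ω)) / L)) atTop (𝓝 0) := by
  have : IsProbabilityMeasure ν := by
    rw [← h.law 0]; exact Measure.isProbabilityMeasure_map (h.measurable 0).aemeasurable
  have hm : Measurable fun x => ind (x ∈ S) - ν.real S := (measurable_ind hS).sub_const _
  have hint : ∫ x, ind (x ∈ S) ∂ν = ν.real S := by
    have : (fun x => ind (x ∈ S)) = S.indicator (fun _ => (1 : ℝ)) := by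
      funext x; simp [ind, indicator]
    rw [this, integral_indicator_const _ hS, smul_eq_mul, mul_one]
  have hbd : Integrable (fun x => ind (x ∈ S)) ν :=
    Integrable.of_bound (measurable_ind hS).aestronglyMeasurable 1 (Eventually.of_forall fun x => by
      rw [Real.norm_eq_abs, abs_of_nonneg (ind_nonneg _)]; exact ind_le_one _)
  have h0 : ∫ x, (ind (x ∈ S) - ν.real S) ∂ν = 0 := by
    rw [integral_sub hbd (integrable_const _), hint]; simp
  have h2 : MemLp (fun x => ind (x ∈ S) - ν.real S) 2 ν := by
    refine MemLp.of_bound hm.aestronglyMeasurable 1 (Eventually.of_forall fun x => ?_)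
    have a1 := ind_nonneg (x ∈ S)
    have a2 := ind_le_one (x ∈ S)
    have a3 : 0 ≤ ν.real S := measureReal_nonneg
    have a4 : ν.real S ≤ 1 := measureReal_le_one
    rw [Real.norm_eq_abs, abs_le]
    constructor <;> linarith
  filter_upwards [h.tendsto_average_predictable hm h2 h0 hH] with ω hω
  refine hω.congr fun L => ?_
  rw [mul_div_assoc', ← sub_div, Finset.mul_sum, ← Finset.sum_sub_distrib]
  congr 1
  refine Finset.sum_congr rfl fun n _ => ?_
  rw [ind_and]; ring

lemma condExp_ind (h : IsIID μ X ν) {S : Set E} (hS : MeasurableSet S) {n : ℕ} {H : Set Ω}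
    (hH : MeasurableSet[past X n] H) :
    μ[(H ∩ X n ⁻¹' S).indicator (1 : Ω → ℝ) | past X n] =ᵐ[μ]
      H.indicator (fun _ => ν.real S) := by
  have hXS : MeasurableSet (X n ⁻¹' S) := h.measurable n hS
  have e : (H ∩ X n ⁻¹' S).indicator (1 : Ω → ℝ) =
      H.indicator ((X n ⁻¹' S).indicator (1 : Ω → ℝ)) := by
    rw [indicator_indicator]
  rw [e]
  refine (condExp_indicator ((integrable_const (1 : ℝ)).indicator hXS) hH).trans ?_
  have hsm : StronglyMeasurable[mE.comap (X n)] ((X n ⁻¹' S).indicator (1 : Ω → ℝ)) :=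
    StronglyMeasurable.indicator (@stronglyMeasurable_const _ _ (mE.comap (X n)) _ (1 : ℝ))
      ⟨S, hS, rfl⟩
  have h2 := condExp_indep_eq (h.measurable n).comap_le (past_le h.measurable n) hsm
    (h.indep_past n)
  filter_upwards [h2] with ω hω
  by_cases hm : ω ∈ H
  · rw [indicator_of_mem hm, indicator_of_mem hm]
    refine Eq.trans hω ?_
    rw [integral_indicator_one hXS, ← h.law n,
      measureReal_def, measureReal_def, Measure.map_apply (h.measurable n) hS]
  · rw [indicator_of_notMem hm, indicator_of_notMem hm]

/-- Lévy's conditional Borel–Cantelli lemma: if predictable events happen infinitely often, then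
infinitely often the next term of the sequence is in a given set of positive probability. -/
theorem frequently_and (h : IsIID μ X ν) {S : Set E} (hS : MeasurableSet S) (hS0 : 0 < ν.real S)
    {H : ℕ → Ω → Prop} (hH : ∀ n, MeasurableSet[past X n] {ω | H n ω}) :
    ∀ᵐ ω ∂μ, (∃ᶠ n in atTop, H n ω) → ∃ᶠ n in atTop, H n ω ∧ X n ω ∈ S := by
  -- The event that involves `X n` is known only at time `n + 1`, whence the shift of the index.
  set s : ℕ → Set Ω := fun n => match n with
    | 0 => ∅
    | n + 1 => {ω | H n ω} ∩ X n ⁻¹' S with hs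
  have hsm : ∀ n, MeasurableSet[pastFiltration h.measurable n] (s n) := by
    intro n
    cases n with
    | zero => exact @MeasurableSet.empty _ (past X 0)
    | succ n =>
      exact @MeasurableSet.inter _ (past X (n + 1)) _ _ (past_mono n.le_succ _ (hH n))
        (measurable_past n.lt_succ_self hS)
  have hce : ∀ᵐ ω ∂μ, ∀ n, (μ[(s (n + 1)).indicator (1 : Ω → ℝ) | past X n]) ω =
      {ω | H n ω}.indicator (fun _ => ν.real S) ω :=
    ae_all_iff.2 fun n => h.condExp_ind hS (hH n)
  filter_upwards [ae_mem_limsup_atTop_iff (ℱ := pastFiltration h.measurable) μ hsm, hce]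
    with ω h1 h2 hfr
  -- The conditional probabilities add up to `ν.real S` times the number of occurrences of `H`,
  -- which diverges when `H` occurs infinitely often.
  have h3 : Tendsto (fun L => ∑ n ∈ Finset.range L,
      (μ[(s (n + 1)).indicator (1 : Ω → ℝ) | pastFiltration h.measurable n]) ω) atTop atTop := by
    classical
    have e : ∀ L, ∑ n ∈ Finset.range L,
        (μ[(s (n + 1)).indicator (1 : Ω → ℝ) | pastFiltration h.measurable n]) ω =
        (Nat.count (fun n => H n ω) L : ℝ) * ν.real S := by
      intro L
      rw [count_eq_sum_ind, Finset.sum_mul]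
      refine Finset.sum_congr rfl fun n _ => ?_
      have := h2 n
      change (μ[(s (n + 1)).indicator (1 : Ω → ℝ) | past X n]) ω = _
      rw [this]
      by_cases hm : H n ω
      · rw [indicator_of_mem (show ω ∈ {ω | H n ω} from hm), ind_of_true hm, one_mul]
      · rw [indicator_of_notMem (show ω ∉ {ω | H n ω} from hm), ind_of_false hm, zero_mul]
    simp_rw [e]
    refine Tendsto.atTop_mul_const hS0 (tendsto_natCast_atTop_atTop.comp ?_)
    refine tendsto_atTop_atTop.2 fun c => ?_
    have hinf : {n | H n ω}.Infinite := Nat.frequently_atTop_iff_infinite.1 hfr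
    refine ⟨Nat.nth (fun n => H n ω) c, fun L hL => ?_⟩
    calc c = Nat.count (fun n => H n ω) (Nat.nth (fun n => H n ω) c) :=
          (Nat.count_nth_of_infinite hinf c).symm
      _ ≤ _ := Nat.count_monotone _ hL
  have h4 := mem_limsup_iff_frequently_mem.1 (h1.2 h3)
  rw [Nat.frequently_atTop_iff_infinite] at h4 ⊢
  refine Set.infinite_of_not_bddAbove fun ⟨B, hB⟩ => h4 ?_
  refine (Set.finite_Iic (B + 1)).subset fun n hn => ?_
  cases n with
  | zero => simp
  | succ n =>
    have : n ≤ B := hB hn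
    exact Nat.succ_le_succ this

/-- The Kolmogorov zero-one law. -/
theorem ae_or_ae_not_of_tail (h : IsIID μ X ν) {p : Ω → Prop}
    (hp : ∀ k, MeasurableSet[⨆ i ≥ k, mE.comap (X i)] {ω | p ω}) :
    (∀ᵐ ω ∂μ, p ω) ∨ ∀ᵐ ω ∂μ, ¬ p ω := by
  have hle : ∀ i, mE.comap (X i) ≤ mΩ := fun i => (h.measurable i).comap_le
  have hm : MeasurableSet {ω | p ω} := (iSup₂_le fun i _ => hle i) _ (hp 0)
  have hlim : MeasurableSet[limsup (fun i => mE.comap (X i)) atTop] {ω | p ω} := by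
    rw [limsup_eq_iInf_iSup_of_nat, MeasurableSpace.measurableSet_iInf]
    exact hp
  rcases measure_zero_or_one_of_measurableSet_limsup_atTop hle h.indep hlim with h0 | h1
  · exact Or.inr (measure_eq_zero_iff_ae_notMem.1 h0)
  · refine Or.inl ?_
    rw [ae_iff]
    exact (prob_compl_eq_zero_iff hm).2 h1

end IsIID

end

noncomputable section

/-! ### The law of the orders -/

section Law

variable {f : ℝ → ℝ} {m M : ℝ}

lemma IsPriceDensity.priceLaw_apply (hf : IsPriceDensity f m M) (hm : 0 < m) {S : Set ℝ}
    (hS : MeasurableSet S) : priceLaw f S = ENNReal.ofReal (∫ x in S ∩ Ioo 0 1, f x) := by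
  rw [priceLaw, withDensity_apply _ hS, Measure.restrict_restrict hS,
    ofReal_integral_eq_lintegral_ofReal]
  · exact (hf.integrableOn_Ioo hm).mono_set inter_subset_right
  · filter_upwards [ae_restrict_mem (hS.inter measurableSet_Ioo)] with x hx
    exact hm.le.trans (hf.lower x hx.2)

lemma IsPriceDensity.priceLaw_real (hf : IsPriceDensity f m M) (hm : 0 < m) {S : Set ℝ}
    (hS : MeasurableSet S) : (priceLaw f).real S = ∫ x in S ∩ Ioo 0 1, f x := by
  rw [measureReal_def, hf.priceLaw_apply hm hS, ENNReal.toReal_ofReal]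
  refine setIntegral_nonneg (hS.inter measurableSet_Ioo) fun x hx => ?_
  exact hm.le.trans (hf.lower x hx.2)

lemma IsPriceDensity.isProbabilityMeasure_priceLaw (hf : IsPriceDensity f m M) (hm : 0 < m) :
    IsProbabilityMeasure (priceLaw f) := by
  refine ⟨?_⟩
  rw [hf.priceLaw_apply hm MeasurableSet.univ, univ_inter, ← integral_Ioc_eq_integral_Ioo,
    ← intervalIntegral.integral_of_le zero_le_one, hf.integral_eq_one, ENNReal.ofReal_one]

lemma IsPriceDensity.priceLaw_reflect (hf : IsPriceDensity f m M) (hm : 0 < m) :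
    (priceLaw f).map (fun x => 1 - x) = priceLaw (fun x => f (1 - x)) := by
  ext S hS
  have hme : Measurable fun x : ℝ => 1 - x := measurable_const.sub measurable_id
  rw [Measure.map_apply hme hS, hf.priceLaw_apply hm (hme hS),
    (hf.reflect).priceLaw_apply hm hS]
  congr 1
  have e : ((fun x : ℝ => 1 - x) ⁻¹' S) ∩ Ioo 0 1 = (fun x : ℝ => 1 - x) ⁻¹' (S ∩ Ioo 0 1) := by
    ext x
    simp only [mem_inter_iff, mem_preimage, mem_Ioo]
    constructor
    · rintro ⟨h1, h2, h3⟩; exact ⟨h1, by linarith, by linarith⟩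
    · rintro ⟨h1, h2, h3⟩; exact ⟨h1, by linarith, by linarith⟩
  rw [e]
  have hmp : MeasurePreserving (fun x : ℝ => 1 - x) volume volume :=
    Measure.measurePreserving_sub_left volume 1
  have hemb : MeasurableEmbedding fun x : ℝ => 1 - x :=
    (MeasurableEquiv.subLeft (1 : ℝ)).measurableEmbedding
  rw [← hmp.setIntegral_preimage_emb hemb (fun x => f (1 - x))]
  simp

end Law

/-- The joint law of a waiting time and an order. -/
def flowLaw (fa fb : ℝ → ℝ) : Measure (ℝ × Order) := (expMeasure 2).prod (orderLaw fa fb)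

/-- The next order is a bid with price in `S`. -/
def bidSet (S : Set ℝ) : Set (ℝ × Order) := {e | e.2.1 = true ∧ e.2.2 ∈ S}

/-- The next order is an ask with price in `S`. -/
def askSet (S : Set ℝ) : Set (ℝ × Order) := {e | e.2.1 = false ∧ e.2.2 ∈ S}

lemma bidSet_eq (S : Set ℝ) : bidSet S = univ ×ˢ ({true} ×ˢ S) := by
  ext ⟨g, b, p⟩; simp [bidSet]

lemma askSet_eq (S : Set ℝ) : askSet S = univ ×ˢ ({false} ×ˢ S) := by
  ext ⟨g, b, p⟩; simp [askSet]

lemma measurableSet_bidSet {S : Set ℝ} (hS : MeasurableSet S) : MeasurableSet (bidSet S) := by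
  rw [bidSet_eq]
  exact MeasurableSet.univ.prod ((measurableSet_singleton _).prod hS)

lemma measurableSet_askSet {S : Set ℝ} (hS : MeasurableSet S) : MeasurableSet (askSet S) := by
  rw [askSet_eq]
  exact MeasurableSet.univ.prod ((measurableSet_singleton _).prod hS)

section OrderLaw

variable {fa fb : ℝ → ℝ} {m M : ℝ}

lemma DensityPair.orderLaw_prod (h : DensityPair fa fb m M) (B : Set Bool) {S : Set ℝ} :
    orderLaw fa fb (B ×ˢ S) = 2⁻¹ * (B.indicator 1 true * priceLaw fb S) +
      2⁻¹ * (B.indicator 1 false * priceLaw fa S) := by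
  have := h.ask.isProbabilityMeasure_priceLaw h.pos
  have := h.bid.isProbabilityMeasure_priceLaw h.pos
  simp only [orderLaw, Measure.coe_add, Pi.add_apply, Measure.smul_apply, smul_eq_mul]
  rw [Measure.prod_prod, Measure.prod_prod, Measure.dirac_apply, Measure.dirac_apply]

lemma DensityPair.isProbabilityMeasure_orderLaw (h : DensityPair fa fb m M) :
    IsProbabilityMeasure (orderLaw fa fb) := by
  have := h.ask.isProbabilityMeasure_priceLaw h.pos
  have := h.bid.isProbabilityMeasure_priceLaw h.pos
  refine ⟨?_⟩
  rw [← univ_prod_univ, h.orderLaw_prod]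
  simp [ENNReal.inv_two_add_inv_two]

lemma DensityPair.isProbabilityMeasure_flowLaw (h : DensityPair fa fb m M) :
    IsProbabilityMeasure (flowLaw fa fb) := by
  have := h.isProbabilityMeasure_orderLaw
  have := isProbabilityMeasure_expMeasure (r := 2) (by norm_num)
  unfold flowLaw
  infer_instance

lemma DensityPair.flowLaw_bidSet (h : DensityPair fa fb m M) {S : Set ℝ} (hS : MeasurableSet S) :
    (flowLaw fa fb).real (bidSet S) = (∫ x in S ∩ Ioo 0 1, fb x) / 2 := by
  have := h.isProbabilityMeasure_orderLaw
  have := isProbabilityMeasure_expMeasure (r := 2) (by norm_num)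
  rw [measureReal_def, flowLaw, bidSet_eq, Measure.prod_prod, h.orderLaw_prod,
    ← h.bid.priceLaw_real h.pos hS]
  simp [measureReal_def, ENNReal.toReal_mul]
  ring

lemma DensityPair.flowLaw_askSet (h : DensityPair fa fb m M) {S : Set ℝ} (hS : MeasurableSet S) :
    (flowLaw fa fb).real (askSet S) = (∫ x in S ∩ Ioo 0 1, fa x) / 2 := by
  have := h.isProbabilityMeasure_orderLaw
  have := isProbabilityMeasure_expMeasure (r := 2) (by norm_num)
  rw [measureReal_def, flowLaw, askSet_eq, Measure.prod_prod, h.orderLaw_prod,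
    ← h.ask.priceLaw_real h.pos hS]
  simp [measureReal_def, ENNReal.toReal_mul]
  ring

lemma measurable_reflectOrder : Measurable reflectOrder :=
  (measurable_of_finite (fun b : Bool => !b)).comp measurable_fst |>.prodMk
    (measurable_const.sub measurable_snd)

lemma DensityPair.orderLaw_reflect (h : DensityPair fa fb m M) :
    (orderLaw fa fb).map reflectOrder = orderLaw (fun x => fb (1 - x)) (fun x => fa (1 - x)) := by
  have := h.ask.isProbabilityMeasure_priceLaw h.pos
  have := h.bid.isProbabilityMeasure_priceLaw h.pos
  have hr : reflectOrder = Prod.map (fun b : Bool => !b) (fun x : ℝ => 1 - x) := rfl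
  have hb : Measurable fun b : Bool => !b := measurable_of_finite _
  have hme : Measurable fun x : ℝ => 1 - x := measurable_const.sub measurable_id
  have key : ∀ (t : Bool) (f : ℝ → ℝ) (hf : IsPriceDensity f m M),
      ((Measure.dirac t).prod (priceLaw f)).map reflectOrder =
        (Measure.dirac (!t)).prod (priceLaw fun x => f (1 - x)) := by
    intro t f hf
    have := hf.isProbabilityMeasure_priceLaw h.pos
    rw [hr, ← Measure.map_prod_map _ _ hb hme, Measure.map_dirac' hb, hf.priceLaw_reflect h.pos]
  rw [orderLaw, Measure.map_add _ _ measurable_reflectOrder, Measure.map_smul, Measure.map_smul,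
    key _ _ h.bid, key _ _ h.ask, orderLaw, add_comm]
  rfl

end OrderLaw

section Flow

variable {Ω : Type*} [MeasurableSpace Ω] {μ : Measure Ω} {fa fb : ℝ → ℝ} {m M : ℝ}
  {gap : ℕ → Ω → ℝ} {order : ℕ → Ω → Order}

lemma IsOrderFlow.isIID (h : IsOrderFlow μ fa fb gap order) :
    IsIID μ (fun n ω => (gap n ω, order n ω)) (flowLaw fa fb) where
  measurable n := (h.measurable_gap n).prodMk (h.measurable_order n)
  indep := h.indep
  law := h.law

lemma IsOrderFlow.comp (h : IsOrderFlow μ fa fb gap order) {fa' fb' : ℝ → ℝ} {φ : Order → Order}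
    (hφ : Measurable φ) [SFinite (orderLaw fa fb)] (hm : (orderLaw fa fb).map φ = orderLaw fa' fb') :
    IsOrderFlow μ fa' fb' gap (fun n ω => φ (order n ω)) where
  measurable_gap := h.measurable_gap
  measurable_order n := hφ.comp (h.measurable_order n)
  indep := h.indep.comp (fun _ => Prod.map id φ) fun _ => measurable_id.prodMap hφ
  law n := by
    have hpm : Measurable (Prod.map (id : ℝ → ℝ) φ) := measurable_id.prodMap hφ
    have e : (fun ω => (gap n ω, φ (order n ω))) =
        Prod.map id φ ∘ fun ω => (gap n ω, order n ω) := rfl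
    have := isProbabilityMeasure_expMeasure (r := 2) (by norm_num)
    rw [e, ← Measure.map_map hpm ((h.measurable_gap n).prodMk (h.measurable_order n)), h.law n,
      ← Measure.map_prod_map _ _ measurable_id hφ, Measure.map_id, hm]

lemma IsOrderFlow.reflect (h : IsOrderFlow μ fa fb gap order) (hd : DensityPair fa fb m M) :
    IsOrderFlow μ (fun x => fb (1 - x)) (fun x => fa (1 - x)) gap
      (fun n ω => reflectOrder (order n ω)) := by
  have := hd.isProbabilityMeasure_orderLaw
  exact h.comp measurable_reflectOrder hd.orderLaw_reflect

open Classical in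
/-- The order, with its price replaced by `1/2` if it is not in `(0,1)`. -/
def clampOrder (o : Order) : Order := (o.1, if o.2 ∈ Ioo (0 : ℝ) 1 then o.2 else 1 / 2)

lemma clampOrder_mem (o : Order) : (clampOrder o).2 ∈ Ioo (0 : ℝ) 1 := by
  simp only [clampOrder]
  split_ifs with h
  · exact h
  · norm_num

lemma clampOrder_of_mem {o : Order} (h : o.2 ∈ Ioo (0 : ℝ) 1) : clampOrder o = o := by
  rw [clampOrder, if_pos h]

lemma measurable_clampOrder : Measurable clampOrder := by
  classical
  exact measurable_fst.prodMk
    (Measurable.ite (measurable_snd measurableSet_Ioo) measurable_snd measurable_const)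

lemma DensityPair.ae_orderLaw (h : DensityPair fa fb m M) :
    ∀ᵐ o ∂orderLaw fa fb, o.2 ∈ Ioo (0 : ℝ) 1 := by
  have e : {o : Order | ¬ o.2 ∈ Ioo (0 : ℝ) 1} = univ ×ˢ (Ioo (0 : ℝ) 1)ᶜ := by
    ext ⟨b, p⟩; simp
  rw [ae_iff, e, h.orderLaw_prod, h.ask.priceLaw_apply h.pos measurableSet_Ioo.compl,
    h.bid.priceLaw_apply h.pos measurableSet_Ioo.compl]
  simp

lemma IsOrderFlow.ae_price_mem (h : IsOrderFlow μ fa fb gap order) (hd : DensityPair fa fb m M) :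
    ∀ᵐ ω ∂μ, ∀ n, (order n ω).2 ∈ Ioo (0 : ℝ) 1 := by
  have := hd.isProbabilityMeasure_orderLaw
  have := isProbabilityMeasure_expMeasure (r := 2) (by norm_num)
  refine ae_all_iff.2 fun n => ?_
  have h1 : ∀ᵐ e ∂(flowLaw fa fb), e.2.2 ∈ Ioo (0 : ℝ) 1 := by
    unfold flowLaw
    exact Measure.quasiMeasurePreserving_snd.ae hd.ae_orderLaw
  rw [flowLaw, ← h.law n] at h1
  exact ae_of_ae_map ((h.measurable_gap n).prodMk (h.measurable_order n)).aemeasurable h1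

lemma IsOrderFlow.clamp (h : IsOrderFlow μ fa fb gap order) (hd : DensityPair fa fb m M) :
    IsOrderFlow μ fa fb gap (fun n ω => clampOrder (order n ω)) := by
  have := hd.isProbabilityMeasure_orderLaw
  refine h.comp measurable_clampOrder ?_
  rw [Measure.map_congr (f := clampOrder) (g := id)
    (hd.ae_orderLaw.mono fun o ho => clampOrder_of_mem ho),
    Measure.map_id]

end Flow

/-! ### Measurability of events of the book -/

lemma IsBinned.reflect {P : ℝ → ℝ} (hP : IsBinned P) : IsBinned (reflectPrice P) where
  monotoneOn := Book.monotoneOn_reflectPrice hP.monotoneOn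
  mapsTo x hx := by
    have := hP.mapsTo (x := 1 - x) ⟨by linarith [hx.2], by linarith [hx.1]⟩
    simp only [reflectPrice]
    exact ⟨by linarith [this.2], by linarith [this.1]⟩
  finite_image := by
    refine (hP.finite_image.image (1 - ·)).subset ?_
    rintro _ ⟨x, hx, rfl⟩
    exact ⟨P (1 - x), ⟨1 - x, ⟨by linarith [hx.2], by linarith [hx.1]⟩, rfl⟩, rfl⟩

/-- A set of prices which contains all the higher prices in `[0,1]`. -/
def IsUpperIn (C : Set ℝ) : Prop := ∀ x ∈ C, ∀ y ∈ Icc (0 : ℝ) 1, x ≤ y → y ∈ C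

/-- A set of prices which contains all the lower prices in `[0,1]`. -/
def IsLowerIn (C : Set ℝ) : Prop := ∀ x ∈ C, ∀ y ∈ Icc (0 : ℝ) 1, y ≤ x → y ∈ C

lemma IsUpperIn.measurableSet {C : Set ℝ} (hC : IsUpperIn C) :
    MeasurableSet (C ∩ Icc (0 : ℝ) 1) := by
  refine OrdConnected.measurableSet ⟨fun x hx y hy z hz => ?_⟩
  have : z ∈ Icc (0 : ℝ) 1 := ⟨hx.2.1.trans hz.1, hz.2.trans hy.2.2⟩
  exact ⟨hC x hx.1 z this hz.1, this⟩

lemma IsLowerIn.preimage {C : Set ℝ} (hC : IsLowerIn C) : IsUpperIn ((1 - ·) ⁻¹' C) :=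
  fun x hx y hy hxy => hC _ hx (1 - y) ⟨by linarith [hy.2], by linarith [hy.1]⟩ (by linarith)

lemma isUpperIn_Ioi (x : ℝ) : IsUpperIn (Ioi x) := fun _ hx _ _ h => lt_of_lt_of_le hx h

lemma IsBinned.isUpperIn_ge {P : ℝ → ℝ} (hP : IsBinned P) (v : ℝ) :
    IsUpperIn {p ∈ Icc (0 : ℝ) 1 | v ≤ P p} :=
  fun _ hx _ hy h => ⟨hy, hx.2.trans (hP.monotoneOn hx.1 hy h)⟩

lemma IsBinned.isUpperIn_gt {P : ℝ → ℝ} (hP : IsBinned P) (v : ℝ) :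
    IsUpperIn {p ∈ Icc (0 : ℝ) 1 | v < P p} :=
  fun _ hx _ hy h => ⟨hy, hx.2.trans_le (hP.monotoneOn hx.1 hy h)⟩

lemma IsBinned.isLowerIn_le {P : ℝ → ℝ} (hP : IsBinned P) (v : ℝ) :
    IsLowerIn {p ∈ Icc (0 : ℝ) 1 | P p ≤ v} :=
  fun _ hx _ hy h => ⟨hy, (hP.monotoneOn hy hx.1 h).trans hx.2⟩

section Measurability

variable {Ω : Type*} {m' : MeasurableSpace Ω}

/-- No measurable structure on books is introduced; all events are expressed by counts. Counts in
upper sets are closed under the dynamics: if the best bid is outside an upper set, no bid is in it,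
so whether a removal affects the count can be read off the count itself. Since `P` has finitely many
values, compatibility with the arriving order is a finite union of events about such counts. -/
lemma measurable_bidCount_step {P : ℝ → ℝ} (hP : IsBinned P) {b : Ω → Book} {o : Ω → Order}
    (hb : ∀ ω, (b ω).Admissible P) (ho : ∀ ω, (o ω).2 ∈ Icc (0 : ℝ) 1) (hom : Measurable o)
    (hbid : ∀ C, IsUpperIn C → Measurable fun ω => (b ω).bidCount C)
    (hask : ∀ C, IsLowerIn C → Measurable fun ω => (b ω).askCount C)
    {C : Set ℝ} (hC : IsUpperIn C) : Measurable fun ω => ((b ω).step P (o ω)).bidCount C := by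
  classical
  have hprice : Measurable fun ω => (o ω).2 := measurable_snd.comp hom
  have e1 : {ω | ∃ q ∈ (b ω).asks, P q ≤ P (o ω).2} =
      ⋃ v ∈ hP.vals, {ω | (o ω).2 ∈ level P v} ∩
        {ω | 0 < (b ω).askCount {p ∈ Icc (0 : ℝ) 1 | P p ≤ v}} := by
    ext ω
    simp only [mem_iUnion, exists_prop]
    constructor
    · rintro ⟨q, hq, h⟩
      refine ⟨P (o ω).2, hP.mem_vals (ho ω), ⟨ho ω, rfl⟩, ?_⟩
      exact Book.askCount_pos.2 ⟨q, hq, (hb ω).2.1 q hq, h⟩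
    · rintro ⟨v, -, h1, h2⟩
      obtain ⟨q, hq, h3⟩ := Book.askCount_pos.1 h2
      exact ⟨q, hq, h3.2.trans h1.2.ge⟩
  have e2 : {ω | ∃ p ∈ (b ω).bids, P (o ω).2 ≤ P p} =
      ⋃ v ∈ hP.vals, {ω | (o ω).2 ∈ level P v} ∩
        {ω | 0 < (b ω).bidCount {p ∈ Icc (0 : ℝ) 1 | v ≤ P p}} := by
    ext ω
    simp only [mem_iUnion, exists_prop]
    constructor
    · rintro ⟨q, hq, h⟩
      refine ⟨P (o ω).2, hP.mem_vals (ho ω), ⟨ho ω, rfl⟩, ?_⟩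
      exact Book.bidCount_pos.2 ⟨q, hq, (hb ω).1 q hq, h⟩
    · rintro ⟨v, -, h1, h2⟩
      obtain ⟨q, hq, h3⟩ := Book.bidCount_pos.1 h2
      exact ⟨q, hq, h1.2.le.trans h3.2⟩
  have m1 : MeasurableSet {ω | ∃ q ∈ (b ω).asks, P q ≤ P (o ω).2} := by
    rw [e1]
    refine Finset.measurableSet_biUnion _ fun v _ => ?_
    exact (hprice (hP.measurableSet_level v)).inter
      (hask _ (hP.isLowerIn_le v) (measurableSet_Ioi (a := 0)))
  have m2 : MeasurableSet {ω | ∃ p ∈ (b ω).bids, P (o ω).2 ≤ P p} := by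
    rw [e2]
    refine Finset.measurableSet_biUnion _ fun v _ => ?_
    exact (hprice (hP.measurableSet_level v)).inter
      (hbid _ (hP.isUpperIn_ge v) (measurableSet_Ioi (a := 0)))
  have m3 : MeasurableSet {ω | (o ω).1 = true} :=
    (measurable_fst.comp hom) (measurableSet_singleton true)
  have m4 : MeasurableSet {ω | (o ω).2 ∈ C} := by
    have : {ω | (o ω).2 ∈ C} = (fun ω => (o ω).2) ⁻¹' (C ∩ Icc (0 : ℝ) 1) := by
      ext ω; exact ⟨fun h => ⟨h, ho ω⟩, fun h => h.1⟩
    rw [this]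
    exact hprice hC.measurableSet
  have hW := hbid C hC
  have e : (fun ω => ((b ω).step P (o ω)).bidCount C) = fun ω =>
      if (o ω).1 = true then
        (b ω).bidCount C +
          if (¬ ∃ q ∈ (b ω).asks, P q ≤ P (o ω).2) ∧ (o ω).2 ∈ C then 1 else 0
      else if ∃ p ∈ (b ω).bids, P (o ω).2 ≤ P p then (b ω).bidCount C - 1
      else (b ω).bidCount C := by
    funext ω
    rcases Bool.eq_false_or_eq_true (o ω).1 with h1 | h1
    · rw [if_pos h1, Book.bidCount_step_bid h1]
    · rw [if_neg (by simp [h1])]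
      by_cases h2 : ∃ p ∈ (b ω).bids, P (o ω).2 ≤ P p
      · rw [if_pos h2]
        have h3 := Book.bidCount_step_ask_match h1 h2 C
        have hne : (b ω).bids ≠ 0 := by
          obtain ⟨r, hr, -⟩ := h2; exact Book.ne_zero_of_mem hr
        have hbm := Book.bestBid_mem hne
        by_cases h4 : (b ω).bestBid ∈ C
        · rw [if_pos h4] at h3; omega
        · rw [if_neg h4] at h3
          have : (b ω).bidCount C = 0 := Book.bidCount_eq_zero.2 fun p hp hpC =>
            h4 (hC p hpC _ ((hb ω).1 _ hbm) (Book.le_bestBid hp))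
          omega
      · rw [if_neg h2, Book.bidCount_step_ask_join h1 h2]
  rw [e]
  refine Measurable.ite m3 (hW.add (Measurable.ite (m1.compl.inter m4) measurable_const
    measurable_const)) (Measurable.ite m2 ?_ hW)
  exact (measurable_from_nat (f := fun n : ℕ => n - 1)).comp hW

/-- Counts of bids are measurable functions of the past orders. -/
theorem measurable_bidCount {P : ℝ → ℝ} (hP : IsBinned P) {init : Book}
    (hi : init.Admissible P) {order : ℕ → Ω → Order}
    (ho : ∀ n ω, (order n ω).2 ∈ Icc (0 : ℝ) 1) {n : ℕ} (hm : ∀ i < n, Measurable (order i))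
    {C : Set ℝ} (hC : IsUpperIn C) :
    Measurable fun ω => (bookAfter P init (fun i => order i ω) n).bidCount C := by
  -- The step needs the counts of asks as well. They are counts of bids of the reflected book, so
  -- the induction must range over all price functions and initial states.
  induction n generalizing P init order C with
  | zero =>
    change Measurable fun _ : Ω => init.bidCount C
    exact measurable_const
  | succ n ih =>
    refine measurable_bidCount_step hP (fun ω => admissible_bookAfter hi (fun i => ho i ω) n)
      (ho n) (hm n n.lt_succ_self) (fun D hD => ih hP hi ho (fun i h => hm i (h.trans n.lt_succ_self)) hD)
      (fun D hD => ?_) hC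
    have := ih hP.reflect hi.reflect (order := fun i ω => reflectOrder (order i ω))
      (fun i ω => ⟨by simp only [reflectOrder]; linarith [(ho i ω).2],
        by simp only [reflectOrder]; linarith [(ho i ω).1]⟩)
      (fun i h => measurable_reflectOrder.comp (hm i (h.trans n.lt_succ_self))) hD.preimage
    simpa only [bookAfter_reflect, ← Book.askCount_eq_reflect] using this

end Measurability

end

noncomputable section

/-! ### Almost sure properties of a binned book -/

/-- The book after `n` arrivals, as a random variable. -/
def path {Ω : Type*} (P : ℝ → ℝ) (init : Book) (order : ℕ → Ω → Order) (n : ℕ) (ω : Ω) : Book :=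
  bookAfter P init (fun i => order i ω) n

/-- Waiting times and orders. -/
def flowSeq {Ω : Type*} (gap : ℕ → Ω → ℝ) (order : ℕ → Ω → Order) (n : ℕ) (ω : Ω) : ℝ × Order :=
  (gap n ω, order n ω)

/-- A binned book with an admissible initial state, driven by an order flow all of whose prices are
in `(0,1)`. -/
structure BookModel {Ω : Type*} [MeasurableSpace Ω] (μ : Measure Ω) (fa fb : ℝ → ℝ) (m M : ℝ)
    (gap : ℕ → Ω → ℝ) (order : ℕ → Ω → Order) (P : ℝ → ℝ) (init : Book) : Prop where
  dens : DensityPair fa fb m M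
  flow : IsOrderFlow μ fa fb gap order
  price_mem : ∀ n ω, (order n ω).2 ∈ Ioo (0 : ℝ) 1
  binned : IsBinned P
  admissible : init.Admissible P

lemma path_succ {Ω : Type*} {P : ℝ → ℝ} {init : Book} {order : ℕ → Ω → Order} (n : ℕ) (ω : Ω) :
    path P init order (n + 1) ω = (path P init order n ω).step P (order n ω) := rfl

lemma path_reflect {Ω : Type*} {P : ℝ → ℝ} {init : Book} {order : ℕ → Ω → Order} (n : ℕ) (ω : Ω) :
    path (reflectPrice P) init.reflect (fun n ω => reflectOrder (order n ω)) n ω =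
      (path P init order n ω).reflect := bookAfter_reflect n

lemma measurableSet_frequently {Ω : Type*} {m' : MeasurableSpace Ω} {p : ℕ → Ω → Prop}
    (hp : ∀ n, MeasurableSet {ω | p n ω}) : MeasurableSet {ω | ∃ᶠ n in atTop, p n ω} := by
  have e : {ω | ∃ᶠ n in atTop, p n ω} = limsup (fun n => {ω | p n ω}) atTop := by
    ext ω
    rw [mem_limsup_iff_frequently_mem]
    rfl
  rw [e]
  exact MeasurableSet.measurableSet_limsup hp

lemma measurableSet_exists_frequently {Ω : Type*} {m' : MeasurableSpace Ω} {P : ℝ → ℝ}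
    (hP : IsBinned P) {order : ℕ → Ω → Order} (ho : ∀ n ω, (order n ω).2 ∈ Icc (0 : ℝ) 1)
    (hm : ∀ i, Measurable (order i)) {C : Set ℝ} (hC : IsUpperIn C) :
    MeasurableSet {ω | ∃ c, ∃ᶠ n in atTop,
      (bookAfter P ⟨0, 0⟩ (fun i => order i ω) n).bidCount C ≤ c} := by
  have hadm : Book.Admissible P ⟨0, 0⟩ :=
    ⟨fun p hp => by simp at hp, fun p hp => by simp at hp, fun p hp => by simp at hp⟩
  have e : {ω | ∃ c, ∃ᶠ n in atTop,
      (bookAfter P ⟨0, 0⟩ (fun i => order i ω) n).bidCount C ≤ c} =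
      ⋃ c, {ω | ∃ᶠ n in atTop, (bookAfter P ⟨0, 0⟩ (fun i => order i ω) n).bidCount C ≤ c} := by
    ext ω; simp
  rw [e]
  exact MeasurableSet.iUnion fun c => measurableSet_frequently fun n =>
    measurable_bidCount hP hadm ho (fun i _ => hm i) hC (measurableSet_Iic (a := c))

/-- Presence of the best bid in a difference of upper sets is thus an event about counts in upper
sets, whose measurability is known. -/
lemma Book.Admissible.bestBidIn_diff {P : ℝ → ℝ} {b : Book} (hb : b.Admissible P) {U U' : Set ℝ}
    (hU : IsUpperIn U) (hU' : IsUpperIn U') :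
    b.BestBidIn (U \ U') ↔ 0 < b.bidCount U ∧ b.bidCount U' = 0 := by
  rw [bidCount_pos, bidCount_eq_zero]
  constructor
  · rintro ⟨hne, h1, h2⟩
    have hmem := Book.bestBid_mem hne
    exact ⟨⟨_, hmem, h1⟩, fun p hp hpU => h2 (hU' p hpU _ (hb.1 _ hmem) (Book.le_bestBid hp))⟩
  · rintro ⟨⟨p, hp, hpU⟩, h2⟩
    have hne := Book.ne_zero_of_mem hp
    have hmem := Book.bestBid_mem hne
    exact ⟨hne, hU p hpU _ (hb.1 _ hmem) (Book.le_bestBid hp), h2 _ hmem⟩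

lemma Book.Admissible.noBid_iff {P : ℝ → ℝ} {b : Book} (hb : b.Admissible P) {v : ℝ} :
    b.NoBid P v ↔ b.bidCount {p ∈ Icc (0 : ℝ) 1 | v ≤ P p} = 0 := by
  rw [bidCount_eq_zero]
  exact ⟨fun h p hp hpv => absurd (h p hp) (not_lt.2 hpv.2),
    fun h p hp => lt_of_not_ge fun h' => h p hp ⟨hb.1 p hp, h'⟩⟩

lemma Book.Admissible.noAsk_iff {P : ℝ → ℝ} {b : Book} (hb : b.Admissible P) {v : ℝ} :
    b.NoAsk P v ↔ b.askCount {p ∈ Icc (0 : ℝ) 1 | P p ≤ v} = 0 := by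
  rw [askCount_eq_zero]
  exact ⟨fun h p hp hpv => absurd (h p hp) (not_lt.2 hpv.2),
    fun h p hp => lt_of_not_ge fun h' => h p hp ⟨hb.2.1 p hp, h'⟩⟩

lemma bidDeparts_reflect {P : ℝ → ℝ} {init : Book} {o : ℕ → Order} {x : ℝ} {n : ℕ} :
    BidDeparts (reflectPrice P) init.reflect (fun i => reflectOrder (o i)) x n ↔
      AskDeparts P init o (1 - x) n := by
  unfold BidDeparts AskDeparts
  rw [bookAfter_reflect]
  have e1 : (reflectOrder (o n)).1 = false ↔ (o n).1 = true := by simp [reflectOrder]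
  rw [e1]
  refine and_congr_right fun _ => ?_
  have e2 := Book.exists_compatible_bid_reflect (P := P) (b := bookAfter P init o n) (o n).2
  rw [show (reflectOrder (o n)).2 = 1 - (o n).2 from rfl, e2]
  refine and_congr_right fun h => ?_
  obtain ⟨q, hq, -⟩ := h
  rw [Book.bestBid_reflect (Book.ne_zero_of_mem hq)]
  constructor <;> intro h <;> linarith

lemma BidDeparts.mono {P : ℝ → ℝ} {init : Book} {o : ℕ → Order} {x y : ℝ} {n : ℕ}
    (h : BidDeparts P init o x n) (hxy : x ≤ y) : BidDeparts P init o y n :=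
  ⟨h.1, h.2.1, h.2.2.trans hxy⟩

open Classical in
/-- Only finitely many bids depart from prices at most zero. -/
lemma finite_bidDeparts_zero {P : ℝ → ℝ} {init : Book} {o : ℕ → Order}
    (ho : ∀ n, (o n).2 ∈ Ioo (0 : ℝ) 1) : {n | BidDeparts P init o 0 n}.Finite := by
  -- All arriving prices are positive, so every such departure uses up one of the finitely many
  -- initial bids at prices at most `0`.
  have key : ∀ L, (bookAfter P init o L).bidCount (Iic 0) +
      Nat.count (fun n => BidDeparts P init o 0 n) L ≤ init.bidCount (Iic 0) := by
    intro L
    induction L with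
    | zero => simp [bookAfter]
    | succ n ih =>
      rw [Nat.count_succ, bookAfter_succ]
      rcases Bool.eq_false_or_eq_true (o n).1 with h1 | h1
      · rw [Book.bidCount_step_bid h1,
          if_neg (fun h : _ ∧ (o n).2 ∈ Iic (0 : ℝ) => absurd h.2 (not_le.2 (ho n).1)),
          if_neg (fun h : BidDeparts P init o 0 n => by simp [h.1] at h1)]
        omega
      · by_cases h2 : ∃ p ∈ (bookAfter P init o n).bids, P (o n).2 ≤ P p
        · have h3 := Book.bidCount_step_ask_match h1 h2 (Iic 0)
          by_cases h4 : (bookAfter P init o n).bestBid ∈ Iic (0 : ℝ)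
          · rw [if_pos h4] at h3
            split_ifs <;> omega
          · rw [if_neg (fun h : BidDeparts P init o 0 n => h4 h.2.2)]
            omega
        · rw [Book.bidCount_step_ask_join h1 h2,
            if_neg (fun h : BidDeparts P init o 0 n => h2 h.2.1)]
          omega
  by_contra hinf
  have := key (Nat.nth (fun n => BidDeparts P init o 0 n) (init.bidCount (Iic 0) + 1))
  rw [Nat.count_nth_of_infinite hinf] at this
  omega

namespace BookModel

variable {Ω : Type*} [mΩ : MeasurableSpace Ω] {μ : Measure Ω} {fa fb : ℝ → ℝ} {m M : ℝ}
  {gap : ℕ → Ω → ℝ} {order : ℕ → Ω → Order} {P : ℝ → ℝ} {init : Book}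

lemma reflect (h : BookModel μ fa fb m M gap order P init) :
    BookModel μ (fun x => fb (1 - x)) (fun x => fa (1 - x)) m M gap
      (fun n ω => reflectOrder (order n ω)) (reflectPrice P) init.reflect where
  dens := h.dens.reflect
  flow := h.flow.reflect h.dens
  price_mem n ω := by
    have := h.price_mem n ω
    simp only [reflectOrder]
    exact ⟨by linarith [this.2], by linarith [this.1]⟩
  binned := h.binned.reflect
  admissible := h.admissible.reflect

lemma price_mem_Icc (h : BookModel μ fa fb m M gap order P init) (n : ℕ) (ω : Ω) :
    (order n ω).2 ∈ Icc (0 : ℝ) 1 := Ioo_subset_Icc_self (h.price_mem n ω)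

lemma iid (h : BookModel μ fa fb m M gap order P init) :
    IsIID μ (flowSeq gap order) (flowLaw fa fb) := h.flow.isIID

lemma admissible_path (h : BookModel μ fa fb m M gap order P init) (n : ℕ) (ω : Ω) :
    (path P init order n ω).Admissible P :=
  admissible_bookAfter h.admissible (fun i => h.price_mem_Icc i ω) n

lemma measurable_order_past {i n : ℕ} (hi : i < n) :
    Measurable[past (flowSeq gap order) n] (order i) :=
  measurable_snd.comp (measurable_past (X := flowSeq gap order) hi)

lemma measurable_bidCount (h : BookModel μ fa fb m M gap order P init) {C : Set ℝ}
    (hC : IsUpperIn C) (n : ℕ) :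
    Measurable[past (flowSeq gap order) n] fun ω => (path P init order n ω).bidCount C :=
  LOB.measurable_bidCount (m' := past (flowSeq gap order) n) h.binned h.admissible
    h.price_mem_Icc (fun _ hi => measurable_order_past hi) hC

lemma measurable_askCount (h : BookModel μ fa fb m M gap order P init) {C : Set ℝ}
    (hC : IsLowerIn C) (n : ℕ) :
    Measurable[past (flowSeq gap order) n] fun ω => (path P init order n ω).askCount C := by
  have := LOB.measurable_bidCount (m' := past (flowSeq gap order) n) h.reflect.binned
    h.reflect.admissible h.reflect.price_mem_Icc
    (fun i hi => measurable_reflectOrder.comp (measurable_order_past hi)) hC.preimage (n := n)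
  simp only [bookAfter_reflect, ← Book.askCount_eq_reflect] at this
  exact this

lemma measurableSet_noAsk (h : BookModel μ fa fb m M gap order P init) (v : ℝ) (n : ℕ) :
    MeasurableSet[past (flowSeq gap order) n] {ω | (path P init order n ω).NoAsk P v} := by
  simp_rw [(h.admissible_path n _).noAsk_iff]
  exact h.measurable_askCount (h.binned.isLowerIn_le v) n (measurableSet_singleton 0)

lemma measurableSet_bestBidIn (h : BookModel μ fa fb m M gap order P init) {U U' : Set ℝ}
    (hU : IsUpperIn U) (hU' : IsUpperIn U') (n : ℕ) :
    MeasurableSet[past (flowSeq gap order) n]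
      {ω | (path P init order n ω).BestBidIn (U \ U')} := by
  simp_rw [(h.admissible_path n _).bestBidIn_diff hU hU']
  exact @MeasurableSet.inter _ (past (flowSeq gap order) n) _ _
    (h.measurable_bidCount hU n (measurableSet_Ioi (a := 0)))
    (h.measurable_bidCount hU' n (measurableSet_singleton 0))

/-! #### The zero-one law -/

/-- Restarting at time `k` from the empty book changes all later counts by at most the size of the
book at time `k`. Boundedness along a subsequence therefore depends only on the orders after `k`,
which makes it a tail event. -/
lemma exists_frequently_bidCount_le_iff (h : BookModel μ fa fb m M gap order P init) (C : Set ℝ)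
    (k : ℕ) (ω : Ω) :
    (∃ c, ∃ᶠ n in atTop, (path P init order n ω).bidCount C ≤ c) ↔
      ∃ c, ∃ᶠ n in atTop, (bookAfter P ⟨0, 0⟩ (fun i => order (k + i) ω) n).bidCount C ≤ c := by
  set b := path P init order k ω with hb
  have hadm : Book.Admissible P ⟨b.bids, b.asks⟩ := h.admissible_path k ω
  have key := fun n => bidCount_bookAfter_empty h.binned.monotoneOn
    (fun n => h.price_mem_Icc (k + n) ω) C b.bids b.asks hadm n
  have e : ∀ n, path P init order (k + n) ω =
      bookAfter P ⟨b.bids, b.asks⟩ (fun i => order (k + i) ω) n := fun n => bookAfter_add k n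
  simp_rw [← e] at key
  constructor
  · rintro ⟨c, hc⟩
    refine ⟨c + b.asks.card, ?_⟩
    rw [frequently_atTop] at hc ⊢
    intro N
    obtain ⟨n, hn, hn'⟩ := hc (k + N)
    obtain ⟨j, rfl⟩ := Nat.exists_eq_add_of_le (le_of_add_le_left hn : k ≤ n)
    exact ⟨j, by omega, (key j).1.trans (by omega)⟩
  · rintro ⟨c, hc⟩
    refine ⟨c + b.bids.card, ?_⟩
    rw [frequently_atTop] at hc ⊢
    intro N
    obtain ⟨n, hn, hn'⟩ := hc N
    exact ⟨k + n, by omega, (key n).2.trans (by omega)⟩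

lemma measurableSet_tail (h : BookModel μ fa fb m M gap order P init) {C : Set ℝ}
    (hC : IsUpperIn C) (k : ℕ) :
    MeasurableSet[⨆ i ≥ k, MeasurableSpace.comap (flowSeq gap order i) inferInstance]
      {ω | ∃ c, ∃ᶠ n in atTop, (path P init order n ω).bidCount C ≤ c} := by
  simp_rw [h.exists_frequently_bidCount_le_iff C k]
  exact measurableSet_exists_frequently h.binned (order := fun i => order (k + i))
    (fun n ω => h.price_mem_Icc (k + n) ω) (fun i => measurable_snd.comp
      ((comap_measurable (flowSeq gap order (k + i))).mono
        (le_iSup₂_of_le (k + i) (Nat.le_add_right k i) le_rfl) le_rfl)) hC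

variable [IsProbabilityMeasure μ]

/-- Either almost surely the number of bids in an upper set is bounded along a subsequence, or
almost surely it tends to infinity. -/
lemma zero_one (h : BookModel μ fa fb m M gap order P init) {C : Set ℝ} (hC : IsUpperIn C) :
    (∀ᵐ ω ∂μ, ∃ c, ∃ᶠ n in atTop, (path P init order n ω).bidCount C ≤ c) ∨
      ∀ᵐ ω ∂μ, ∀ c, ∀ᶠ n in atTop, c < (path P init order n ω).bidCount C := by
  refine (h.iid.ae_or_ae_not_of_tail (h.measurableSet_tail hC)).imp id fun h' => ?_
  filter_upwards [h'] with ω hω c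
  have : ¬ _ := fun hc => hω ⟨c, hc⟩
  rw [not_frequently] at this
  simpa using this

lemma flowLaw_askSet_pos (h : DensityPair fa fb m M) {s t : ℝ} (hs : 0 ≤ s) (hst : s < t)
    (ht : t ≤ 1) : 0 < (flowLaw fa fb).real (askSet (Ioo s t)) := by
  rw [h.flowLaw_askSet measurableSet_Ioo, inter_eq_left.2 (Ioo_subset_Ioo hs ht),
    ← integral_Ioc_eq_integral_Ioo, ← intervalIntegral.integral_of_le hst.le,
    ← h.ask.cdf_sub h.pos ⟨hs, hst.le.trans ht⟩ ⟨hs.trans hst.le, ht⟩]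
  have := h.ask.le_cdf_sub h.pos hs hst.le ht
  have := mul_pos h.pos (sub_pos.2 hst)
  linarith

lemma flowLaw_bidSet_pos (h : DensityPair fa fb m M) {s t : ℝ} (hs : 0 ≤ s) (hst : s < t)
    (ht : t ≤ 1) : 0 < (flowLaw fa fb).real (bidSet (Ioo s t)) := by
  rw [h.flowLaw_bidSet measurableSet_Ioo, inter_eq_left.2 (Ioo_subset_Ioo hs ht),
    ← integral_Ioc_eq_integral_Ioo, ← intervalIntegral.integral_of_le hst.le,
    ← h.bid.cdf_sub h.pos ⟨hs, hst.le.trans ht⟩ ⟨hs.trans hst.le, ht⟩]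
  have := h.bid.le_cdf_sub h.pos hs hst.le ht
  have := mul_pos h.pos (sub_pos.2 hst)
  linarith

/-- If the number of bids in an upper set stays bounded along a subsequence, then there are
infinitely often no bids in it. -/
lemma frequently_bidCount_eq_zero (h : BookModel μ fa fb m M gap order P init) {C : Set ℝ}
    (hC : IsUpperIn C) {t : ℝ} (ht0 : 0 < t) (ht1 : t ≤ 1)
    (hit : ∀ q ∈ Ioo 0 t, ∀ p ∈ C, p ∈ Icc (0 : ℝ) 1 → P q ≤ P p) :
    ∀ᵐ ω ∂μ, (∃ c, ∃ᶠ n in atTop, (path P init order n ω).bidCount C ≤ c) →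
      ∃ᶠ n in atTop, (path P init order n ω).bidCount C = 0 := by
  have h1 : ∀ᵐ ω ∂μ, ∀ c : ℕ,
      (∃ᶠ n in atTop, (path P init order n ω).bidCount C ∈ Ioc 0 (c + 1)) →
      ∃ᶠ n in atTop, (path P init order n ω).bidCount C ∈ Ioc 0 (c + 1) ∧
        flowSeq gap order n ω ∈ askSet (Ioo 0 t) :=
    ae_all_iff.2 fun c => h.iid.frequently_and (measurableSet_askSet measurableSet_Ioo)
      (flowLaw_askSet_pos h.dens le_rfl ht0 ht1)
      (H := fun n ω => (path P init order n ω).bidCount C ∈ Ioc 0 (c + 1))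
      fun n => h.measurable_bidCount hC n measurableSet_Ioc
  filter_upwards [h1] with ω hω
  rintro ⟨c, hc⟩
  -- Whenever the count is positive and at most `c + 1`, an ask in `(0, t)` is compatible with a bid
  -- of `C` and removes the best bid, which is in the upper set `C`. This happens infinitely often,
  -- so the bound drops to `c`.
  induction c with
  | zero => exact hc.mono fun n hn => Nat.le_zero.1 hn
  | succ c ih =>
    by_cases hz : ∃ᶠ n in atTop, (path P init order n ω).bidCount C = 0
    · exact hz
    rw [not_frequently] at hz
    refine ih ?_
    have h2 := hω c ((hc.and_eventually hz).mono fun n hn => ⟨Nat.pos_of_ne_zero hn.2, hn.1⟩)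
    refine (tendsto_add_atTop_nat 1).frequently (h2.mono fun n hn => ?_)
    obtain ⟨⟨h3, h4⟩, h5, h6⟩ := hn
    obtain ⟨p, hp, hpC⟩ := Book.bidCount_pos.1 h3
    have hadm := (h.admissible_path n ω).1
    have hb := Book.bestBid_mem (Book.ne_zero_of_mem hp)
    have h7 := Book.bidCount_step_ask_match (P := P) (b := path P init order n ω) h5
      ⟨p, hp, hit _ h6 p hpC (hadm p hp)⟩ C
    rw [if_pos (hC p hpC _ (hadm _ hb) (Book.le_bestBid hp))] at h7
    rw [path_succ]
    change Book.bidCount _ C ≤ c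
    have e : (flowSeq gap order n ω).2 = order n ω := rfl
    rw [e] at h7
    omega

/-! #### The thresholds -/

lemma bidThreshold_nonempty (h : BookModel μ fa fb m M gap order P init) :
    (0 : ℝ) ∈ {x ∈ Icc (0 : ℝ) 1 |
      ∀ᵐ ω ∂μ, {n | BidDeparts P init (fun i => order i ω) x n}.Finite} :=
  ⟨by simp, Eventually.of_forall fun ω => finite_bidDeparts_zero fun n => h.price_mem n ω⟩

lemma bddAbove_bidThreshold : BddAbove {x ∈ Icc (0 : ℝ) 1 |
      ∀ᵐ ω ∂μ, {n | BidDeparts P init (fun i => order i ω) x n}.Finite} :=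
  ⟨1, fun _ hx => hx.1.2⟩

lemma bidThreshold_mem (h : BookModel μ fa fb m M gap order P init) :
    bidThreshold μ P init order ∈ Icc (0 : ℝ) 1 :=
  ⟨le_csSup bddAbove_bidThreshold h.bidThreshold_nonempty,
    csSup_le ⟨0, h.bidThreshold_nonempty⟩ fun _ hx => hx.1.2⟩

lemma bidThreshold_reflect (h : BookModel μ fa fb m M gap order P init) :
    bidThreshold μ (reflectPrice P) init.reflect (fun n ω => reflectOrder (order n ω)) =
      1 - askThreshold μ P init order := by
  set S := {x ∈ Icc (0 : ℝ) 1 |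
    ∀ᵐ ω ∂μ, {n | AskDeparts P init (fun i => order i ω) x n}.Finite} with hS
  have e : {x ∈ Icc (0 : ℝ) 1 | ∀ᵐ ω ∂μ, {n | BidDeparts (reflectPrice P) init.reflect
      (fun i => reflectOrder (order i ω)) x n}.Finite} = {x | 1 - x ∈ S} := by
    ext x
    simp only [bidDeparts_reflect, hS, mem_ofPred_eq, mem_Icc]
    refine and_congr_left fun _ => ?_
    constructor <;> rintro ⟨h1, h2⟩ <;> constructor <;> linarith
  have h0 := h.reflect.bidThreshold_nonempty
  rw [e] at h0
  have hlub : IsGLB S (sInf S) := Real.isGLB_sInf ⟨_, h0⟩ ⟨0, fun _ hx => hx.1.1⟩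
  have : IsLUB {x | 1 - x ∈ S} (1 - sInf S) := by
    constructor
    · intro x hx
      linarith [hlub.1 hx]
    · intro y hy
      have : 1 - y ≤ sInf S := hlub.2 fun z hz => by
        have := hy (show 1 - (1 - z) ∈ S by simpa using hz)
        linarith
      linarith
  rw [bidThreshold, e]
  exact this.csSup_eq ⟨0, h0⟩

lemma askThreshold_mem (h : BookModel μ fa fb m M gap order P init) :
    askThreshold μ P init order ∈ Icc (0 : ℝ) 1 := by
  have := h.reflect.bidThreshold_mem
  rw [h.bidThreshold_reflect] at this
  exact ⟨by linarith [this.2], by linarith [this.1]⟩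

lemma ae_finite_bidDeparts (h : BookModel μ fa fb m M gap order P init) {x : ℝ}
    (hx : x < bidThreshold μ P init order) :
    ∀ᵐ ω ∂μ, {n | BidDeparts P init (fun i => order i ω) x n}.Finite := by
  obtain ⟨y, hy, hxy⟩ := exists_lt_of_lt_csSup ⟨0, h.bidThreshold_nonempty⟩ hx
  filter_upwards [hy.2] with ω hω
  exact hω.subset fun n hn =>
    BidDeparts.mono (show BidDeparts P init (fun i => order i ω) x n from hn) hxy.le

/-- Above the threshold, there are infinitely often no bids. -/
theorem frequently_no_bids_above (h : BookModel μ fa fb m M gap order P init) {x : ℝ}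
    (hx : bidThreshold μ P init order < x) :
    ∀ᵐ ω ∂μ, ∃ᶠ n in atTop, ∀ p ∈ (path P init order n ω).bids, p ≤ x := by
  rcases le_or_gt 1 x with h1 | h1
  · exact Eventually.of_forall fun ω => Frequently.of_forall fun n p hp =>
      ((h.admissible_path n ω).1 p hp).2.trans h1
  have hx0 : 0 < x := h.bidThreshold_mem.1.trans_lt hx
  have hxI : x ∈ Icc (0 : ℝ) 1 := ⟨hx0.le, h1.le⟩
  rcases h.zero_one (isUpperIn_Ioi x) with hc | hc
  · have h2 := h.frequently_bidCount_eq_zero (isUpperIn_Ioi x) hx0 h1.le fun q hq p hp hp' =>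
      h.binned.monotoneOn ⟨hq.1.le, hq.2.le.trans h1.le⟩ hp' (hq.2.le.trans (le_of_lt hp))
    filter_upwards [hc, h2] with ω a b
    refine (b a).mono fun n hn p hp => ?_
    simpa using Book.bidCount_eq_zero.1 hn p hp
  -- If there were eventually always a bid above `x`, no bid could depart from prices at most `x`
  -- any more, and `x` would not exceed the threshold.
  · refine absurd (le_csSup bddAbove_bidThreshold ⟨hxI, ?_⟩) (not_le.2 hx)
    filter_upwards [hc] with ω hω
    obtain ⟨N, hN⟩ := eventually_atTop.1 (hω 0)
    refine (finite_Iio N).subset fun n hn => ?_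
    by_contra hle
    obtain ⟨p, hp, hpx⟩ := Book.bidCount_pos.1 (hN n (not_lt.1 hle))
    have h3 : p ≤ (path P init order n ω).bestBid := Book.le_bestBid hp
    have h4 : (path P init order n ω).bestBid ≤ x := hn.2.2
    exact absurd hpx (not_lt.2 (h3.trans h4))

end BookModel

end

noncomputable section

/-! ### Pathwise consequences of the dynamics -/

section Pathwise

variable {P : ℝ → ℝ} {init : Book} {o : ℕ → Order}

open Classical in
lemma bidCount_le_init_add_count (D : Set ℝ) (L : ℕ) :
    (bookAfter P init o L).bidCount D ≤
      init.bidCount D + Nat.count (fun n => (o n).1 = true ∧ (o n).2 ∈ D) L := by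
  induction L with
  | zero => simp [bookAfter]
  | succ n ih =>
    rw [Nat.count_succ, bookAfter_succ]
    rcases Bool.eq_false_or_eq_true (o n).1 with h1 | h1
    · rw [Book.bidCount_step_bid h1]
      have : (if (¬ ∃ q ∈ (bookAfter P init o n).asks, P q ≤ P (o n).2) ∧ (o n).2 ∈ D then 1 else 0)
          ≤ if (o n).1 = true ∧ (o n).2 ∈ D then 1 else 0 := by
        split_ifs with h2 h3
        · exact le_rfl
        · exact absurd ⟨h1, h2.2⟩ h3
        · exact zero_le_one
        · exact le_rfl
      omega
    · by_cases h2 : ∃ p ∈ (bookAfter P init o n).bids, P (o n).2 ≤ P p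
      · have := Book.bidCount_step_ask_match h1 h2 D
        omega
      · rw [Book.bidCount_step_ask_join h1 h2]
        omega

lemma mem_bids_of_le {x : ℝ} {N : ℕ} (hN : ∀ n ≥ N, ¬ BidDeparts P init o x n) {p : ℝ} (hp : p ≤ x)
    {n : ℕ} (hn : N ≤ n) (h : p ∈ (bookAfter P init o n).bids) {k : ℕ} (hk : n ≤ k) :
    p ∈ (bookAfter P init o k).bids := by
  induction k, hk using Nat.le_induction with
  | base => exact h
  | succ k hk ih =>
    rw [bookAfter_succ]
    refine Book.mem_bids_step_of_mem ih fun h' => hN k (hn.trans hk) ⟨h'.1, h'.2.1, ?_⟩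
    rw [h'.2.2]; exact hp

lemma mem_bids_succ_of_noAsk {v : ℝ} {n : ℕ} (h1 : (o n).1 = true)
    (h2 : (bookAfter P init o n).NoAsk P v) (h3 : P (o n).2 ≤ v) :
    (o n).2 ∈ (bookAfter P init o (n + 1)).bids := by
  rw [bookAfter_succ, Book.step_bid_join h1]
  · exact Multiset.mem_cons_self _ _
  · rintro ⟨q, hq, h⟩
    exact absurd (h2 q hq) (not_lt.2 (h.trans h3))

lemma Book.Admissible.noAsk_of_mem {b : Book} (hb : b.Admissible P) {p v : ℝ} (hp : p ∈ b.bids)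
    (hv : v ≤ P p) : b.NoAsk P v := fun q hq =>
  lt_of_not_ge fun h => hb.2.2 p hp q hq (h.trans hv)

open Classical in
-- From time `N` on, every bid up to `x` joins and none departs, so the count in the book keeps pace
-- with the arrivals. The first `N` arrivals contribute at most `N`.
lemma count_le_bidCount_add {x : ℝ} {N : ℕ} (hN : ∀ n ≥ N, ¬ BidDeparts P init o x n)
    (hA : ∀ n ≥ N, ∀ p ≤ x, p = (o n).2 → ¬ ∃ q ∈ (bookAfter P init o n).asks, P q ≤ P p)
    {n : ℕ} (hn : N ≤ n) :
    Nat.count (fun k => (o k).1 = true ∧ (o k).2 ∈ Iic x) n ≤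
      (bookAfter P init o n).bidCount (Iic x) + N := by
  induction n, hn using Nat.le_induction with
  | base => exact le_trans (Nat.count_le _) (Nat.le_add_left _ _)
  | succ n hn ih =>
    rw [Nat.count_succ, bookAfter_succ]
    rcases Bool.eq_false_or_eq_true (o n).1 with h1 | h1
    · rw [Book.bidCount_step_bid h1]
      by_cases h2 : (o n).2 ∈ Iic x
      · rw [if_pos ⟨h1, h2⟩, if_pos ⟨hA n hn _ h2 rfl, h2⟩]
        omega
      · rw [if_neg fun h3 => h2 h3.2, if_neg fun h3 => h2 h3.2]
        omega
    · rw [if_neg (by simp [h1])]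
      by_cases h2 : ∃ p ∈ (bookAfter P init o n).bids, P (o n).2 ≤ P p
      · have h3 := Book.bidCount_step_ask_match h1 h2 (Iic x)
        rw [if_neg (c := _ ∈ Iic x) fun h4 => hN n hn ⟨h1, h2, h4⟩] at h3
        omega
      · rw [Book.bidCount_step_ask_join h1 h2]
        omega

end Pathwise

section LawIntegrals

variable {fa fb : ℝ → ℝ} {m M : ℝ}

lemma DensityPair.flowLaw_bidSet_univ (h : DensityPair fa fb m M) :
    (flowLaw fa fb).real (bidSet univ) = 1 / 2 := by
  rw [h.flowLaw_bidSet MeasurableSet.univ, univ_inter, ← integral_Ioc_eq_integral_Ioo,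
    ← intervalIntegral.integral_of_le zero_le_one, h.bid.integral_eq_one]

lemma setIntegral_Iic_inter_Ioo (f : ℝ → ℝ) {x : ℝ} (hx : x ∈ Icc (0 : ℝ) 1) :
    ∫ y in Iic x ∩ Ioo 0 1, f y = cdf f x := by
  have : (Iic x ∩ Ioo 0 1 : Set ℝ) =ᵐ[volume] Ioc 0 x := by
    rcases eq_or_lt_of_le hx.2 with rfl | hlt
    · have : (Iic 1 ∩ Ioo 0 1 : Set ℝ) = Ioo 0 1 :=
        inter_eq_right.2 fun y hy => hy.2.le
      rw [this]
      exact Ioo_ae_eq_Ioc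
    · have : (Iic x ∩ Ioo 0 1 : Set ℝ) = Ioc 0 x := by
        ext y
        simp only [mem_inter_iff, mem_Iic, mem_Ioo, mem_Ioc]
        constructor
        · rintro ⟨h1, h2, -⟩; exact ⟨h2, h1⟩
        · rintro ⟨h1, h2⟩; exact ⟨h2, h1, h2.trans_lt hlt⟩
      exact this ▸ ae_eq_refl _
  rw [setIntegral_congr_set this, cdf, intervalIntegral.integral_of_le hx.1]

lemma DensityPair.flowLaw_bidSet_Iic (h : DensityPair fa fb m M) {x : ℝ}
    (hx : x ∈ Icc (0 : ℝ) 1) : (flowLaw fa fb).real (bidSet (Iic x)) = cdf fb x / 2 := by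
  rw [h.flowLaw_bidSet measurableSet_Iic, setIntegral_Iic_inter_Ioo fb hx]

end LawIntegrals

/-- The sign of an order: `1` for bids and `-1` for asks. -/
def orderSign (e : ℝ × Order) : ℝ := 2 * ind (e ∈ bidSet univ) - 1

lemma orderSign_eq (e : ℝ × Order) : orderSign e = if e.2.1 = true then 1 else -1 := by
  have : e ∈ bidSet univ ↔ e.2.1 = true := by simp [bidSet]
  unfold orderSign
  split_ifs with h
  · rw [ind_of_true (this.2 h)]; norm_num
  · rw [ind_of_false (mt this.1 h)]; norm_num

lemma abs_orderSign_le (e : ℝ × Order) : |orderSign e| ≤ 1 := by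
  rw [orderSign_eq]; split_ifs <;> norm_num

lemma measurable_orderSign : Measurable orderSign :=
  ((measurable_ind (measurableSet_bidSet MeasurableSet.univ)).const_mul 2).sub_const 1

/-! ### Recurrence of the best prices and persistence of bids below the threshold. -/

namespace BookModel

variable {Ω : Type*} [mΩ : MeasurableSpace Ω] {μ : Measure Ω} {fa fb : ℝ → ℝ} {m M : ℝ}
  {gap : ℕ → Ω → ℝ} {order : ℕ → Ω → Order} {P : ℝ → ℝ} {init : Book}

lemma card_sub_card (n : ℕ) (ω : Ω) :
    ((path P init order n ω).bids.card : ℝ) - (path P init order n ω).asks.card =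
      ((init.bids.card : ℝ) - init.asks.card) +
        ∑ i ∈ Finset.range n, orderSign (flowSeq gap order i ω) := by
  have := LOB.card_sub_card (P := P) (init := init) (o := fun i => order i ω) n
  have h2 := congrArg (Int.cast : ℤ → ℝ) this
  push_cast at h2
  simp only [orderSign_eq]
  exact h2

variable [IsProbabilityMeasure μ]

lemma integral_ind (_h : BookModel μ fa fb m M gap order P init) {S : Set (ℝ × Order)}
    (hS : MeasurableSet S) : ∫ e, ind (e ∈ S) ∂(flowLaw fa fb) = (flowLaw fa fb).real S := by
  have : (fun x => ind (x ∈ S)) = S.indicator (fun _ => (1 : ℝ)) := by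
    funext x; simp [ind, indicator]
  rw [this, integral_indicator_const _ hS, smul_eq_mul, mul_one]

lemma integrable_ind (h : BookModel μ fa fb m M gap order P init) {S : Set (ℝ × Order)}
    (hS : MeasurableSet S) : Integrable (fun e => ind (e ∈ S)) (flowLaw fa fb) := by
  have := h.dens.isProbabilityMeasure_flowLaw
  exact Integrable.of_bound (measurable_ind (p := fun e => e ∈ S) hS).aestronglyMeasurable 1
    (Eventually.of_forall fun x => by
      rw [Real.norm_eq_abs, abs_of_nonneg (ind_nonneg _)]; exact ind_le_one _)

/-- Frequencies of orders converge. -/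
lemma tendsto_count (h : BookModel μ fa fb m M gap order P init) {S : Set (ℝ × Order)}
    (hS : MeasurableSet S) :
    ∀ᵐ ω ∂μ, Tendsto (fun L : ℕ => (∑ n ∈ Finset.range L, ind (flowSeq gap order n ω ∈ S)) / L) atTop
      (𝓝 ((flowLaw fa fb).real S)) := by
  filter_upwards [h.iid.tendsto_average (measurable_ind (p := fun e => e ∈ S) hS)
    (h.integrable_ind hS)] with ω hω
  rw [h.integral_ind hS] at hω
  exact hω

lemma integrable_orderSign (h : BookModel μ fa fb m M gap order P init) :
    Integrable orderSign (flowLaw fa fb) := by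
  have := h.dens.isProbabilityMeasure_flowLaw
  exact Integrable.of_bound measurable_orderSign.aestronglyMeasurable 1
    (Eventually.of_forall abs_orderSign_le)

lemma integral_orderSign (h : BookModel μ fa fb m M gap order P init) :
    ∫ e, orderSign e ∂(flowLaw fa fb) = 0 := by
  have := h.dens.isProbabilityMeasure_flowLaw
  have hS := measurableSet_bidSet MeasurableSet.univ
  unfold orderSign
  rw [integral_sub ((h.integrable_ind hS).const_mul 2) (integrable_const _), integral_const_mul,
    h.integral_ind hS, h.dens.flowLaw_bidSet_univ]
  simp

/-- The numbers of bids and asks are asymptotically equal. -/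
lemma tendsto_card_sub_card (h : BookModel μ fa fb m M gap order P init) :
    ∀ᵐ ω ∂μ, Tendsto (fun n : ℕ => (((path P init order n ω).bids.card : ℝ) -
      (path P init order n ω).asks.card) / n) atTop (𝓝 0) := by
  filter_upwards [h.iid.tendsto_average measurable_orderSign h.integrable_orderSign] with ω hω
  rw [h.integral_orderSign] at hω
  have h1 := (tendsto_const_div_atTop_nhds_zero_nat ((init.bids.card : ℝ) - init.asks.card)).add hω
  rw [add_zero] at h1
  refine h1.congr fun n => ?_
  rw [card_sub_card (gap := gap) n ω, add_div]

/-- The difference of the numbers of bids and asks does not tend to infinity. -/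
lemma not_tendsto_card_sub_card (h : BookModel μ fa fb m M gap order P init) :
    ∀ᵐ ω ∂μ, ¬ Tendsto (fun n : ℕ => ((path P init order n ω).bids.card : ℝ) -
      (path P init order n ω).asks.card) atTop atTop := by
  set S : ℕ → Ω → ℝ := fun n ω => ∑ i ∈ Finset.range n, orderSign (flowSeq gap order i ω) with hS
  have hint : ∀ n, Integrable (fun ω => orderSign (flowSeq gap order n ω)) μ := fun n =>
    h.iid.integrable_comp h.integrable_orderSign n
  -- A martingale with bounded increments almost surely does not tend to infinity.
  have hmart : Martingale S (pastFiltration h.iid.measurable) μ := by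
    refine martingale_of_condExp_sub_eq_zero_nat (fun n => ?_) (fun n => integrable_finsetSum _ fun i _ => hint i)
      fun n => ?_
    · have : Measurable[past (flowSeq gap order) n] (S n) :=
        Finset.measurable_fun_sum _ fun i hi =>
          measurable_orderSign.comp (measurable_past (Finset.mem_range.1 hi))
      exact this.stronglyMeasurable
    · have e : S (n + 1) - S n = fun ω => orderSign (flowSeq gap order n ω) := by
        funext ω
        simp [hS, Finset.sum_range_succ]
      rw [e]
      have h2 := condExp_indep_eq (μ := μ) (f := fun ω => orderSign (flowSeq gap order n ω))
        (h.iid.measurable n).comap_le (past_le h.iid.measurable n)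
        (measurable_orderSign.comp (comap_measurable (flowSeq gap order n))).stronglyMeasurable
        (h.iid.indep_past n)
      refine h2.trans (Eventually.of_forall fun ω => ?_)
      simp only [Pi.zero_apply]
      rw [h.iid.integral_comp measurable_orderSign, h.integral_orderSign]
  have hinc : ∀ᵐ ω ∂μ, ∀ n, |S (n + 1) ω - S n ω| ≤ ((1 : NNReal) : ℝ) :=
    Eventually.of_forall fun ω n => by
      simpa [hS, Finset.sum_range_succ] using abs_orderSign_le _
  filter_upwards [hmart.ae_not_tendsto_atTop_atTop hinc] with ω hω ht
  refine hω ?_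
  have := tendsto_atTop_add_const_left _ (-((init.bids.card : ℝ) - init.asks.card)) ht
  refine this.congr fun n => ?_
  rw [card_sub_card (gap := gap) n ω]
  ring

/-- Infinitely often there are no bids in the highest bin of `(0,1)`. -/
theorem exists_frequently_noBid (h : BookModel μ fa fb m M gap order P init) :
    ∃ z ∈ Ioo (0 : ℝ) 1, (∀ p ∈ Ioo (0 : ℝ) 1, P p ≤ P z) ∧
      ∀ᵐ ω ∂μ, ∃ᶠ n in atTop, (path P init order n ω).NoBid P (P z) := by
  have hfin : (P '' Ioo 0 1).Finite :=
    h.binned.finite_image.subset (image_mono Ioo_subset_Icc_self)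
  -- The maximum is taken over the open interval: an arriving price is almost surely in it, and the
  -- bin of the price `1` could be the single point `1`.
  obtain ⟨_, ⟨z, hz, rfl⟩, hmax⟩ := exists_max_image (P '' Ioo 0 1) id hfin
    ⟨P (1 / 2), 1 / 2, by norm_num, rfl⟩
  have hmax' : ∀ p ∈ Ioo (0 : ℝ) 1, P p ≤ P z := fun p hp => hmax _ ⟨p, hp, rfl⟩
  refine ⟨z, hz, hmax', ?_⟩
  simp_rw [(h.admissible_path _ _).noBid_iff]
  set C := {p ∈ Icc (0 : ℝ) 1 | P z ≤ P p} with hC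
  have hCu : IsUpperIn C := h.binned.isUpperIn_ge (P z)
  rcases h.zero_one hCu with hc | hc
  · have h2 := h.frequently_bidCount_eq_zero hCu zero_lt_one le_rfl fun q hq p hp _ =>
      (hmax' q hq).trans hp.2
    filter_upwards [hc, h2] with ω a b using b a
  · exfalso
    have : ∀ᵐ ω ∂μ, False := by
      filter_upwards [hc, h.not_tendsto_card_sub_card] with ω h1 h2
      refine h2 ?_
      obtain ⟨N, hN⟩ := eventually_atTop.1 (h1 0)
      -- While the top bin contains a bid every arriving ask is matched, so the number of asks no
      -- longer increases. If moreover the number of bids tends to infinity, the random walk of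
      -- signs would do so.
      have hasks : ∀ n ≥ N, (path P init order n ω).asks.card ≤
          (path P init order N ω).asks.card := by
        intro n hn
        induction n, hn using Nat.le_induction with
        | base => exact le_rfl
        | succ n hn ih =>
          refine le_trans ?_ ih
          rw [path_succ]
          rcases Bool.eq_false_or_eq_true (order n ω).1 with h3 | h3
          · by_cases h4 : ∃ q ∈ (path P init order n ω).asks, P q ≤ P (order n ω).2
            · rw [Book.step_bid_match h3 h4]
              exact Multiset.card_erase_le
            · rw [Book.step_bid_join h3 h4]
          · obtain ⟨p, hp, hpC⟩ := Book.bidCount_pos.1 (hN n hn)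
            rw [Book.step_ask_match h3 ⟨p, hp, (hmax' _ (h.price_mem n ω)).trans hpC.2⟩]
      rw [tendsto_atTop]
      intro r
      obtain ⟨c, hc⟩ := exists_nat_ge (r + (path P init order N ω).asks.card)
      filter_upwards [h1 c, eventually_ge_atTop N] with n h3 h4
      have h5 : ((path P init order n ω).asks.card : ℝ) ≤ (path P init order N ω).asks.card := by
        exact_mod_cast hasks n h4
      have h6 : (c : ℝ) ≤ (path P init order n ω).bids.card := by
        exact_mod_cast h3.le.trans (Book.bidCount_le_card C)
      linarith
    rw [ae_iff] at this
    simp at this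

/-- Infinitely often an arrival of a bid in `(s, t)` coincides with the absence of asks up to `v`,
and that bid joins. Once the last departure from prices up to `x` is over, such a bid stays forever.
-/
lemma eventually_exists_bid (h : BookModel μ fa fb m M gap order P init) {x s t v : ℝ}
    (hs : 0 ≤ s) (hst : s < t) (ht : t ≤ 1) (htx : t ≤ x) (hv : ∀ p ∈ Ioo s t, P p ≤ v) :
    ∀ᵐ ω ∂μ, {n | BidDeparts P init (fun i => order i ω) x n}.Finite →
      (∃ᶠ n in atTop, (path P init order n ω).NoAsk P v) →
      ∀ᶠ n in atTop, ∃ p ∈ (path P init order n ω).bids, p ∈ Ioo s t := by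
  filter_upwards [h.iid.frequently_and (measurableSet_bidSet measurableSet_Ioo)
    (flowLaw_bidSet_pos h.dens hs hst ht) (h.measurableSet_noAsk v)] with ω hω hfin hfr
  obtain ⟨N, hN⟩ := hfin.bddAbove
  have hN' : ∀ n ≥ N + 1, ¬ BidDeparts P init (fun i => order i ω) x n := fun n hn hd =>
    absurd (hN hd) (by omega)
  obtain ⟨n, ⟨h1, h2, h3⟩, hn⟩ := ((hω hfr).and_eventually (eventually_ge_atTop (N + 1))).exists
  filter_upwards [eventually_ge_atTop (n + 1)] with k hk
  exact ⟨_, mem_bids_of_le hN' (h3.2.le.trans htx) (hn.trans n.le_succ)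
    (mem_bids_succ_of_noAsk (o := fun i => order i ω) h2 h1 (hv _ h3)) hk, h3⟩

/-- Below the bid threshold, there are always bids. -/
theorem eventually_exists_bid_of_lt (h : BookModel μ fa fb m M gap order P init) {x y : ℝ}
    (hy : 0 ≤ y) (hyx : y < x) (hx : x < bidThreshold μ P init order) :
    ∀ᵐ ω ∂μ, ∀ᶠ n in atTop, ∃ p ∈ (path P init order n ω).bids, p ∈ Ioo y x := by
  have hx1 : x < 1 := hx.trans_le h.bidThreshold_mem.2
  have hx0 : 0 < x := hy.trans_lt hyx
  obtain ⟨z, hz, hzmax, hzf⟩ := h.reflect.exists_frequently_noBid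
  set w := 1 - z with hw
  have hw0 : w ∈ Ioo (0 : ℝ) 1 := ⟨by linarith [hz.2], by linarith [hz.1]⟩
  have hwmin : ∀ p ∈ Ioo (0 : ℝ) 1, P w ≤ P p := by
    intro p hp
    have := hzmax (1 - p) ⟨by linarith [hp.2], by linarith [hp.1]⟩
    rw [reflectPrice_one_sub] at this
    simp only [reflectPrice] at this
    linarith
  have hrz : reflectPrice P z = 1 - P w := rfl
  simp only [path_reflect, hrz, Book.noBid_reflect] at hzf
  -- On `(0, t)` the price function is constant, with its lowest value over `(0,1)`; an ask arriving
  -- there is compatible with any bid there.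
  set t := min w x with ht
  have ht0 : 0 < t := lt_min hw0.1 hx0
  have hPt : ∀ p ∈ Ioo 0 t, P p = P w := fun p hp => by
    have hp1 : p < w := hp.2.trans_le (min_le_left _ _)
    exact le_antisymm (h.binned.monotoneOn ⟨hp.1.le, (hp1.trans hw0.2).le⟩
      (Ioo_subset_Icc_self hw0) hp1.le) (hwmin p ⟨hp.1, hp1.trans hw0.2⟩)
  have htx : t ≤ x := min_le_right _ _
  filter_upwards [h.ae_finite_bidDeparts hx, hzf,
    h.eventually_exists_bid le_rfl ht0 (htx.trans hx1.le) htx (fun p hp => (hPt p hp).le),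
    h.eventually_exists_bid hy hyx hx1.le le_rfl (v := P x) (fun p hp =>
      h.binned.monotoneOn ⟨hy.trans hp.1.le, hp.2.le.trans hx1.le⟩ ⟨hx0.le, hx1.le⟩ hp.2.le),
    h.iid.frequently_and (measurableSet_askSet measurableSet_Ioo)
      (flowLaw_askSet_pos h.dens le_rfl ht0 (htx.trans hx1.le)) (H := fun _ _ => True)
      (fun _ => MeasurableSet.univ)] with ω hfin hA h1 h2 h3
  -- It remains to see that asks up to `x` are absent infinitely often. Late asks in `(0, t)` find a
  -- permanent bid compatible with them but may not remove a bid up to `x`; so the best bid is above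
  -- `x` at these times, which excludes asks up to the bin of `x`.
  refine h2 hfin ?_
  obtain ⟨N, hN⟩ := hfin.bddAbove
  refine ((h3 (Frequently.of_forall fun _ => trivial)).and_eventually
    ((h1 hfin hA).and (eventually_gt_atTop N))).mono ?_
  rintro n ⟨⟨-, h4, h5⟩, ⟨p, hp, hpt⟩, hn⟩
  have hadm := h.admissible_path n ω
  have hmem := Book.bestBid_mem (Book.ne_zero_of_mem hp)
  have hbest : x < (path P init order n ω).bestBid := by
    by_contra hle
    have h6 : P (order n ω).2 ≤ P p := ((hPt _ h5).trans (hPt p hpt).symm).le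
    have hd : BidDeparts P init (fun i => order i ω) x n := ⟨h4, ⟨p, hp, h6⟩, not_lt.1 hle⟩
    exact absurd (hN hd) (by omega)
  exact hadm.noAsk_of_mem hmem (h.binned.monotoneOn ⟨hx0.le, hx1.le⟩ (hadm.1 _ hmem) hbest.le)

/-- Below the bid threshold, almost all arriving bids stay in the book. -/
theorem exists_sum_ind_le_bidCount (h : BookModel μ fa fb m M gap order P init) {x : ℝ}
    (hx0 : 0 < x) (hx : x < bidThreshold μ P init order) :
    ∀ᵐ ω ∂μ, ∃ N : ℕ, ∀ n ≥ N, ∑ k ∈ Finset.range n, ind (flowSeq gap order k ω ∈ bidSet (Iic x)) ≤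
      ((path P init order n ω).bidCount (Iic x) : ℝ) + N := by
  -- A permanent supply of bids in `(x, x₂)` keeps away all asks compatible with bids up to `x`, so
  -- that every arriving bid up to `x` joins.
  obtain ⟨x₂, hx2, hx2'⟩ := exists_between hx
  have hx1 : x₂ ≤ 1 := hx2'.le.trans h.bidThreshold_mem.2
  filter_upwards [h.ae_finite_bidDeparts hx, h.eventually_exists_bid_of_lt hx0.le hx2 hx2']
    with ω hfin hev
  obtain ⟨N₁, hN₁⟩ := hfin.bddAbove
  obtain ⟨N₂, hN₂⟩ := eventually_atTop.1 hev
  refine ⟨max (N₁ + 1) N₂, fun n hn => ?_⟩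
  classical
  have key := count_le_bidCount_add (P := P) (init := init) (o := fun i => order i ω) (x := x)
    (N := max (N₁ + 1) N₂) (fun k hk hd => ?_) (fun k hk p hp hpo => ?_) hn
  · have key' := Nat.cast_le (α := ℝ).2 key
    rw [count_eq_sum_ind] at key'
    push_cast at key' ⊢
    exact key'
  · have h1 := hN₁ hd
    have := (le_max_left (N₁ + 1) N₂).trans hk
    omega
  · obtain ⟨r, hr, hr'⟩ := hN₂ k ((le_max_right _ _).trans hk)
    rintro ⟨q, hq, h2⟩
    refine (h.admissible_path k ω).2.2 r hr q hq (h2.trans ?_)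
    have hp0 : p ∈ Icc (0 : ℝ) 1 := by rw [hpo]; exact h.price_mem_Icc k ω
    exact h.binned.monotoneOn hp0 ((h.admissible_path k ω).1 r hr) (hp.trans hr'.1.le)

end BookModel

end

noncomputable section

/-- The fraction of the first `L` indices with the property `p`. -/
def frac (p : ℕ → Prop) (L : ℕ) : ℝ := (∑ n ∈ Finset.range L, ind (p n)) / L

lemma frac_nonneg (p : ℕ → Prop) (L : ℕ) : 0 ≤ frac p L :=
  div_nonneg (Finset.sum_nonneg fun _ _ => ind_nonneg _) (Nat.cast_nonneg L)

lemma frac_le_one (p : ℕ → Prop) (L : ℕ) : frac p L ≤ 1 := by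
  refine div_le_one_of_le₀ ?_ (Nat.cast_nonneg L)
  calc ∑ n ∈ Finset.range L, ind (p n) ≤ ∑ n ∈ Finset.range L, (1 : ℝ) :=
        Finset.sum_le_sum fun _ _ => ind_le_one _
    _ = L := by simp

lemma frac_mono {p q : ℕ → Prop} (h : ∀ n, p n → q n) (L : ℕ) : frac p L ≤ frac q L :=
  div_le_div_of_nonneg_right (Finset.sum_le_sum fun n _ => ind_le_ind (h n)) (Nat.cast_nonneg L)

lemma frac_congr {p q : ℕ → Prop} (h : ∀ n, p n ↔ q n) (L : ℕ) : frac p L = frac q L :=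
  le_antisymm (frac_mono (fun n => (h n).1) L) (frac_mono (fun n => (h n).2) L)

namespace BookModel

variable {Ω : Type*} [mΩ : MeasurableSpace Ω] {μ : Measure Ω} {fa fb : ℝ → ℝ} {m M : ℝ}
  {gap : ℕ → Ω → ℝ} {order : ℕ → Ω → Order} {P : ℝ → ℝ} {init : Book} [IsProbabilityMeasure μ]

/-! ### Balance of the thresholds -/

/-- The bid threshold of the reflected book. -/
def coThreshold (μ : Measure Ω) (P : ℝ → ℝ) (init : Book) (order : ℕ → Ω → Order) : ℝ :=
  bidThreshold μ (reflectPrice P) init.reflect (fun n ω => reflectOrder (order n ω))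

lemma coThreshold_eq (h : BookModel μ fa fb m M gap order P init) :
    coThreshold μ P init order = 1 - askThreshold μ P init order := h.bidThreshold_reflect

/-- The bids in the book are initial ones or arrivals, and an arrival is a bid up to `x` with
probability `F_b(x) / 2`. Below the threshold `le_bidCount_div` shows that this rate is attained. -/
lemma bidCount_div_le (h : BookModel μ fa fb m M gap order P init) {x : ℝ}
    (hx : x ∈ Icc (0 : ℝ) 1) :
    ∀ᵐ ω ∂μ, ∀ δ > 0, ∀ᶠ n : ℕ in atTop,
      ((path P init order n ω).bidCount (Iic x) : ℝ) ≤ (cdf fb x / 2 + δ) * n := by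
  classical
  filter_upwards [h.tendsto_count (measurableSet_bidSet (S := Iic x) measurableSet_Iic)]
    with ω hω δ hδ
  rw [h.dens.flowLaw_bidSet_Iic hx] at hω
  have h1 := hω.add (tendsto_const_div_atTop_nhds_zero_nat (init.bidCount (Iic x) : ℝ))
  rw [add_zero] at h1
  filter_upwards [h1.eventually (gt_mem_nhds (lt_add_of_pos_right _ hδ)), eventually_gt_atTop 0]
    with n hn hn0
  have h2 := Nat.cast_le (α := ℝ).2 (bidCount_le_init_add_count (P := P) (init := init)
    (o := fun i => order i ω) (Iic x) n)
  push_cast at h2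
  rw [count_eq_sum_ind] at h2
  have hn' : (0 : ℝ) < n := by exact_mod_cast hn0
  rw [← add_div, div_lt_iff₀ hn'] at hn
  exact h2.trans (by rw [add_comm]; exact hn.le)

lemma le_bidCount_div (h : BookModel μ fa fb m M gap order P init) {x : ℝ} (hx0 : 0 ≤ x)
    (hx : x < bidThreshold μ P init order) :
    ∀ᵐ ω ∂μ, ∀ δ > 0, ∀ᶠ n : ℕ in atTop,
      (cdf fb x / 2 - δ) * n ≤ (path P init order n ω).bidCount (Iic x) := by
  rcases eq_or_lt_of_le hx0 with rfl | hx0'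
  · refine Eventually.of_forall fun ω δ hδ => Eventually.of_forall fun n => ?_
    rw [IsPriceDensity.cdf_zero]
    have h1 : (0 : ℝ) ≤ n := Nat.cast_nonneg n
    have h2 : (0 : ℝ) ≤ (path P init order n ω).bidCount (Iic 0) := Nat.cast_nonneg _
    nlinarith
  filter_upwards [h.exists_sum_ind_le_bidCount hx0' hx,
    h.tendsto_count (measurableSet_bidSet (S := Iic x) measurableSet_Iic)] with ω hN hω δ hδ
  rw [h.dens.flowLaw_bidSet_Iic ⟨hx0, hx.le.trans h.bidThreshold_mem.2⟩] at hω
  obtain ⟨N, hN⟩ := hN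
  have h1 := hω.sub (tendsto_const_div_atTop_nhds_zero_nat (N : ℝ))
  rw [sub_zero] at h1
  filter_upwards [h1.eventually (lt_mem_nhds (sub_lt_self _ hδ)), eventually_gt_atTop 0,
    eventually_ge_atTop N] with n hn hn0 hnN
  have hn' : (0 : ℝ) < n := by exact_mod_cast hn0
  rw [← sub_div, lt_div_iff₀ hn'] at hn
  linarith [hN n hnN]

lemma bids_card_eq {b : Book} {x : ℝ} (hb : ∀ p ∈ b.bids, p ≤ x) :
    b.bidCount (Iic x) = b.bids.card := by
  classical
  exact Multiset.countP_eq_card.2 hb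

/-- The excess of asks near the times without bids above the threshold. -/
lemma frequently_asks_le (h : BookModel μ fa fb m M gap order P init) {ε : ℝ} (hε : 0 < ε)
    {x : ℝ} (hx : x ∈ Icc (0 : ℝ) 1) (hxb : x = 1 ∨ bidThreshold μ P init order < x) :
    ∀ᵐ ω ∂μ, ∃ᶠ n : ℕ in atTop, (∀ p ∈ (path P init order n ω).bids, p ≤ x) ∧
      ((path P init order n ω).asks.card : ℝ) ≤ (cdf fb x / 2 + ε) * n := by
  have hfr : ∀ᵐ ω ∂μ, ∃ᶠ n in atTop, ∀ p ∈ (path P init order n ω).bids, p ≤ x := by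
    rcases hxb with rfl | hxb
    · exact Eventually.of_forall fun ω => Frequently.of_forall fun n p hp =>
        ((h.admissible_path n ω).1 p hp).2
    · exact h.frequently_no_bids_above hxb
  filter_upwards [hfr, h.bidCount_div_le hx, h.tendsto_card_sub_card] with ω h1 h2 h3
  refine (h1.and_eventually ((h2 (ε / 2) (half_pos hε)).and ((h3.eventually
    (lt_mem_nhds (show -(ε / 2) < 0 by linarith))).and (eventually_gt_atTop 0)))).mono ?_
  rintro n ⟨h4, h5, h6, h7⟩
  refine ⟨h4, ?_⟩
  have hn' : (0 : ℝ) < n := by exact_mod_cast h7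
  rw [lt_div_iff₀ hn'] at h6
  rw [bids_card_eq h4] at h5
  linarith

lemma card_asks_reflect (b : Book) : b.reflect.bids.card = b.asks.card := Multiset.card_map _ _

/-- At a time without bids above `y` the number of bids, hence that of asks, is at most about
`F_b(y) n / 2`. The asks beyond the ask threshold, which accumulate at full rate, must fit into this
number. -/
lemma cdf_le_of_lt (h : BookModel μ fa fb m M gap order P init) {x y : ℝ} (hx0 : 0 ≤ x)
    (hy : y ∈ Icc (0 : ℝ) 1) (hx : x < coThreshold μ P init order)
    (hyb : y = 1 ∨ bidThreshold μ P init order < y) :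
    cdf (fun z => fa (1 - z)) x ≤ cdf fb y := by
  refine le_of_forall_pos_le_add fun ε hε => ?_
  have hε' : 0 < ε / 4 := by positivity
  obtain ⟨ω, h1, h2⟩ := ((h.frequently_asks_le hε' hy hyb).and
    (h.reflect.le_bidCount_div hx0 hx)).exists
  obtain ⟨n, ⟨-, h3⟩, h4, h5⟩ :=
    (h1.and_eventually ((h2 _ hε').and (eventually_gt_atTop 0))).exists
  rw [path_reflect] at h4
  have h6 : (((path P init order n ω).reflect.bidCount (Iic x) : ℕ) : ℝ) ≤
      (path P init order n ω).asks.card := by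
    rw [← card_asks_reflect]
    exact_mod_cast Book.bidCount_le_card _
  have hn' : (0 : ℝ) < n := by exact_mod_cast h5
  have h7 : (cdf (fun z => fa (1 - z)) x / 2 - ε / 4) * n ≤ (cdf fb y / 2 + ε / 4) * n :=
    h4.trans (h6.trans h3)
  have := le_of_mul_le_mul_right h7 hn'
  linarith

/-- Both prices tend to the thresholds, clamped to `[0,1]`. With displacement `ε / (2 M)` each
distribution function changes by at most `ε / 2`. -/
lemma cdf_coThreshold_le (h : BookModel μ fa fb m M gap order P init) :
    cdf (fun z => fa (1 - z)) (coThreshold μ P init order) ≤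
      cdf fb (bidThreshold μ P init order) := by
  set k := coThreshold μ P init order with hk
  set c := bidThreshold μ P init order with hc
  have hk0 : k ∈ Icc (0 : ℝ) 1 := h.reflect.bidThreshold_mem
  have hc0 : c ∈ Icc (0 : ℝ) 1 := h.bidThreshold_mem
  have hM : 0 < M := h.dens.pos.trans_le h.dens.ask.le_bound
  refine le_of_forall_pos_le_add fun ε hε => ?_
  rcases eq_or_lt_of_le hk0.1 with h0 | h0
  · rw [← h0, IsPriceDensity.cdf_zero]
    have := (h.dens.bid.cdf_mem_Icc h.dens.pos hc0).1
    linarith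
  set x := max 0 (k - ε / (2 * M)) with hx
  set y := min 1 (c + ε / (2 * M)) with hy
  have he : 0 < ε / (2 * M) := by positivity
  have hxk : x < k := max_lt h0 (by linarith)
  have hx0 : 0 ≤ x := le_max_left _ _
  have hy1 : y ≤ 1 := min_le_left _ _
  have hcy : c ≤ y := le_min hc0.2 (by linarith)
  have hyc : y = 1 ∨ c < y := by
    rcases le_total 1 (c + ε / (2 * M)) with h1 | h1
    · exact Or.inl (min_eq_left h1)
    · right; rw [hy, min_eq_right h1]; linarith
  have h1 := h.cdf_le_of_lt hx0 ⟨hc0.1.trans hcy, hy1⟩ hxk hyc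
  have h2 := h.dens.reflect.bid.cdf_sub_le h.dens.pos hx0 hxk.le hk0.2
  have h3 := h.dens.bid.cdf_sub_le h.dens.pos hc0.1 hcy hy1
  have h4 : k - x ≤ ε / (2 * M) := by linarith [le_max_right 0 (k - ε / (2 * M))]
  have h5 : y - c ≤ ε / (2 * M) := by linarith [min_le_right 1 (c + ε / (2 * M))]
  have h6 : M * (ε / (2 * M)) = ε / 2 := by field_simp
  have h7 := mul_le_mul_of_nonneg_left h4 hM.le
  have h8 := mul_le_mul_of_nonneg_left h5 hM.le
  linarith

lemma coThreshold_reflect (_h : BookModel μ fa fb m M gap order P init) :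
    coThreshold μ (reflectPrice P) init.reflect (fun n ω => reflectOrder (order n ω)) =
      bidThreshold μ P init order := by
  simp [coThreshold]

/-- The thresholds balance the flows of bids and asks which stay in the book. -/
theorem cdf_bidThreshold (h : BookModel μ fa fb m M gap order P init) :
    cdf fb (bidThreshold μ P init order) = 1 - cdf fa (askThreshold μ P init order) := by
  -- The same inequality for the reflected book is the converse one.
  have h1 := h.cdf_coThreshold_le
  have h2 := h.reflect.cdf_coThreshold_le
  rw [h.coThreshold_reflect] at h2
  simp only [sub_sub_cancel] at h2
  have e : cdf (fun z => fa (1 - z)) (coThreshold μ P init order) =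
      1 - cdf fa (askThreshold μ P init order) := by
    rw [h.coThreshold_eq, h.dens.ask.cdf_reflect h.dens.pos, sub_sub_cancel]
    rw [← h.coThreshold_eq]
    exact h.reflect.bidThreshold_mem
  rw [← e]
  exact le_antisymm h2 h1

open Classical in
/-- Infinitely often there are no bids above the bid threshold and few asks below the ask
threshold. -/
theorem frequently_good (h : BookModel μ fa fb m M gap order P init) {ε : ℝ} (hε : 0 < ε) :
    ∀ᵐ ω ∂μ, ∃ᶠ n : ℕ in atTop,
      (∀ p ∈ (path P init order n ω).bids, p ≤ bidThreshold μ P init order + ε) ∧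
      (((path P init order n ω).asks.filter
        (fun q => q < askThreshold μ P init order - ε)).card : ℝ) ≤ (M + 1 / 2) * ε * n := by
  set k := coThreshold μ P init order with hk
  set c := bidThreshold μ P init order with hc
  have hk0 : k ∈ Icc (0 : ℝ) 1 := h.reflect.bidThreshold_mem
  have hc0 : c ∈ Icc (0 : ℝ) 1 := h.bidThreshold_mem
  have hM : 0 < M := h.dens.pos.trans_le h.dens.ask.le_bound
  set y := min 1 (c + ε) with hy
  have hy1 : y ≤ 1 := min_le_left _ _
  have hcy : c ≤ y := le_min hc0.2 (by linarith)
  have hyc : y = 1 ∨ c < y := by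
    rcases le_total 1 (c + ε) with h1 | h1
    · exact Or.inl (min_eq_left h1)
    · right; rw [hy, min_eq_right h1]; linarith
  have hyI : y ∈ Icc (0 : ℝ) 1 := ⟨hc0.1.trans hcy, hy1⟩
  have hbal : cdf (fun z => fa (1 - z)) k = cdf fb c := by
    refine le_antisymm h.cdf_coThreshold_le ?_
    have h2 := h.reflect.cdf_coThreshold_le
    rw [h.coThreshold_reflect] at h2
    simp only [sub_sub_cancel] at h2
    exact h2
  have h3 := h.dens.bid.cdf_sub_le h.dens.pos hc0.1 hcy hy1
  have h5 : y - c ≤ ε := by linarith [min_le_right 1 (c + ε)]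
  -- a lower bound for the number of asks above the threshold
  have hgrow : ∀ᵐ ω ∂μ, ∀ᶠ n : ℕ in atTop, (cdf fb c / 2 - M * ε / 2 - ε / 4) * n ≤
      (path P init order n ω).reflect.bidCount (Iic (k - ε)) := by
    rcases lt_or_ge (k - ε) 0 with hneg | hpos
    · refine Eventually.of_forall fun ω => Eventually.of_forall fun n => ?_
      have h6 := h.dens.reflect.bid.cdf_sub_le h.dens.pos le_rfl hk0.1 hk0.2
      rw [IsPriceDensity.cdf_zero, hbal] at h6
      have h7 : (0 : ℝ) ≤ n := Nat.cast_nonneg n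
      have h8 : (0 : ℝ) ≤ (path P init order n ω).reflect.bidCount (Iic (k - ε)) :=
        Nat.cast_nonneg _
      have h9 : M * k ≤ M * ε := mul_le_mul_of_nonneg_left (by linarith) hM.le
      nlinarith
    · have hke : k - ε < k := by linarith
      filter_upwards [h.reflect.le_bidCount_div hpos hke] with ω hω
      filter_upwards [hω (ε / 4) (by positivity)] with n hn
      rw [path_reflect] at hn
      refine le_trans (mul_le_mul_of_nonneg_right ?_ (Nat.cast_nonneg n)) hn
      have h6 := h.dens.reflect.bid.cdf_sub_le h.dens.pos hpos hke.le hk0.2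
      rw [hbal] at h6
      have e : M * (k - (k - ε)) = M * ε := by ring
      rw [e] at h6
      linarith
  filter_upwards [h.frequently_asks_le (show 0 < ε / 4 by positivity) hyI hyc, hgrow]
    with ω h1 h2
  refine (h1.and_eventually h2).mono ?_
  rintro n ⟨⟨h4, h6⟩, h7⟩
  refine ⟨fun p hp => (h4 p hp).trans (min_le_right _ _), ?_⟩
  set b := path P init order n ω with hb
  -- Asks below the ask threshold minus `ε` and asks at least `ε` above it are disjoint parts of the
  -- book, and the second part alone already accounts for nearly all asks.
  have hcount : (b.asks.filter (fun q => q < askThreshold μ P init order - ε)).card +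
      b.reflect.bidCount (Iic (k - ε)) ≤ b.asks.card := by
    have e1 : b.reflect.bidCount (Iic (k - ε)) =
        (b.asks.filter fun q => 1 - q ∈ Iic (k - ε)).card := by
      simp only [Book.bidCount, Book.reflect, Multiset.countP_map]
      congr
    rw [e1, Multiset.card_eq_countP_add_countP
      (fun q => q < askThreshold μ P init order - ε) b.asks, ← Multiset.countP_eq_card_filter,
      ← Multiset.countP_eq_card_filter]
    refine Nat.add_le_add_left ?_ _
    rw [Multiset.countP_eq_card_filter, Multiset.countP_eq_card_filter]
    refine Multiset.card_le_card (Multiset.monotone_filter_right _ fun q hq => ?_)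
    have hk' : k = 1 - askThreshold μ P init order := h.coThreshold_eq
    simp only [mem_Iic] at hq
    rw [not_lt]
    linarith
  have hcount' : ((b.asks.filter (fun q => q < askThreshold μ P init order - ε)).card : ℝ) +
      b.reflect.bidCount (Iic (k - ε)) ≤ b.asks.card := by exact_mod_cast hcount
  have h8 : M * (y - c) ≤ M * ε := mul_le_mul_of_nonneg_left h5 hM.le
  have h9 : (cdf fb y / 2 + ε / 4) * n ≤ (cdf fb c / 2 + M * ε / 2 + ε / 4) * n :=
    mul_le_mul_of_nonneg_right (by linarith) (Nat.cast_nonneg n)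
  -- The upper and lower bounds each deviate from `F_b(c) n / 2` by `(M / 2 + 1 / 4) ε n`.
  have e : (M + 1 / 2) * ε * n = (cdf fb c / 2 + M * ε / 2 + ε / 4) * n -
      (cdf fb c / 2 - M * ε / 2 - ε / 4) * n := by ring
  rw [e]
  linarith

/-! ### Balance of blocks of bins -/

/-- The fraction of time that the best bid is in a block, in terms of the fraction of time that
there are no asks below the block. -/
theorem block_le (h : BookModel μ fa fb m M gap order P init) {U U' : Set ℝ}
    (hU : IsUpperIn U) (hU' : IsUpperIn U') {u : ℝ} (hu : ∀ p ∈ U \ U', u ≤ P p) :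
    ∀ᵐ ω ∂μ, ∀ δ > 0, ∀ᶠ L : ℕ in atTop,
      (flowLaw fa fb).real (askSet {p ∈ Icc (0 : ℝ) 1 | P p ≤ u}) *
          frac (fun n => (path P init order n ω).BestBidIn (U \ U')) L ≤
        (flowLaw fa fb).real (bidSet ((U \ U') ∩ Icc 0 1)) *
          frac (fun n => (path P init order n ω).NoAsk P u) L + δ := by
  classical
  have hD : MeasurableSet ((U \ U') ∩ Icc (0 : ℝ) 1) := by
    have : (U \ U') ∩ Icc (0 : ℝ) 1 = (U ∩ Icc 0 1) \ (U' ∩ Icc 0 1) := by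
      ext x
      simp only [mem_inter_iff, Set.mem_sdiff, mem_Icc]
      tauto
    rw [this]
    exact hU.measurableSet.diff hU'.measurableSet
  have hA : MeasurableSet {p ∈ Icc (0 : ℝ) 1 | P p ≤ u} := by
    have : {p ∈ Icc (0 : ℝ) 1 | P p ≤ u} =
        Icc (0 : ℝ) 1 \ ({p ∈ Icc (0 : ℝ) 1 | u < P p} ∩ Icc 0 1) := by
      ext x
      simp only [mem_inter_iff, Set.mem_sdiff, mem_ofPred_eq, not_and, ]
      constructor
      · rintro ⟨h1, h2⟩; exact ⟨h1, fun h3 => absurd h3.2 (not_lt.2 h2)⟩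
      · rintro ⟨h1, h2⟩; exact ⟨h1, not_lt.1 fun h3 => h2 ⟨h1, h3⟩ h1⟩
    rw [this]
    exact measurableSet_Icc.diff (h.binned.isUpperIn_gt u).measurableSet
  filter_upwards [h.iid.tendsto_average_ind (measurableSet_askSet hA)
    (h.measurableSet_bestBidIn hU hU'),
    h.iid.tendsto_average_ind (measurableSet_bidSet hD) (h.measurableSet_noAsk u)] with ω h1 h2 δ hδ
  -- After division by `L` the initial count disappears, and each joint frequency may be replaced by
  -- the arrival probability times the frequency of the predictable event.
  have h3 := (tendsto_const_div_atTop_nhds_zero_nat (init.bidCount (U \ U') : ℝ)).add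
    (h2.sub h1)
  simp only [sub_zero, add_zero] at h3
  filter_upwards [h3.eventually (gt_mem_nhds hδ), eventually_gt_atTop 0] with L hL hL0
  have hL' : (0 : ℝ) < L := by exact_mod_cast hL0
  have key := Nat.cast_le (α := ℝ).2 ((Nat.le_add_left _ _).trans
    (bidCount_add_count_le (P := P) (init := init) (o := fun i => order i ω) hu L))
  push_cast at key
  rw [count_eq_sum_ind, count_eq_sum_ind] at key
  have e1 : ∑ n ∈ Finset.range L, ind ((bookAfter P init (fun i => order i ω) n).BestBidIn (U \ U') ∧
      (order n ω).1 = false ∧ P (order n ω).2 ≤ u) =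
      ∑ n ∈ Finset.range L, ind ((path P init order n ω).BestBidIn (U \ U') ∧
        flowSeq gap order n ω ∈ askSet {p ∈ Icc (0 : ℝ) 1 | P p ≤ u}) := by
    refine Finset.sum_congr rfl fun n _ => ?_
    refine le_antisymm (ind_le_ind fun h => ⟨h.1, h.2.1, ?_, h.2.2⟩)
      (ind_le_ind fun h => ⟨h.1, h.2.1, h.2.2.2⟩)
    exact BookModel.price_mem_Icc (by assumption) n ω
  have e2 : ∑ n ∈ Finset.range L, ind ((bookAfter P init (fun i => order i ω) n).NoAsk P u ∧
      (order n ω).1 = true ∧ (order n ω).2 ∈ U \ U') =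
      ∑ n ∈ Finset.range L, ind ((path P init order n ω).NoAsk P u ∧
        flowSeq gap order n ω ∈ bidSet ((U \ U') ∩ Icc 0 1)) := by
    refine Finset.sum_congr rfl fun n _ => ?_
    refine le_antisymm (ind_le_ind fun h => ⟨h.1, h.2.1, h.2.2, ?_⟩)
      (ind_le_ind fun h => ⟨h.1, h.2.1, h.2.2.1⟩)
    exact BookModel.price_mem_Icc (by assumption) n ω
  rw [e1, e2] at key
  have key' := div_le_div_of_nonneg_right key hL'.le
  rw [add_div] at key'
  unfold frac
  linarith

/-- The converse inequality, up to the number of bids in the block. -/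
theorem le_block (h : BookModel μ fa fb m M gap order P init) {U U' : Set ℝ}
    (hU : IsUpperIn U) (hU' : IsUpperIn U') {v : ℝ} (hv : ∀ p ∈ U \ U', P p < v) :
    ∀ᵐ ω ∂μ, ∀ δ > 0, ∀ᶠ L : ℕ in atTop,
      (flowLaw fa fb).real (bidSet ((U \ U') ∩ Icc 0 1)) *
          frac (fun n => (path P init order n ω).NoAsk P v) L ≤
        (flowLaw fa fb).real (askSet {p ∈ Icc (0 : ℝ) 1 | P p < v}) *
          frac (fun n => (path P init order n ω).BestBidIn (U \ U')) L +
        (path P init order L ω).bidCount (U \ U') / L + δ := by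
  classical
  have hD : MeasurableSet ((U \ U') ∩ Icc (0 : ℝ) 1) := by
    have : (U \ U') ∩ Icc (0 : ℝ) 1 = (U ∩ Icc 0 1) \ (U' ∩ Icc 0 1) := by
      ext x
      simp only [mem_inter_iff, Set.mem_sdiff, mem_Icc]
      tauto
    rw [this]
    exact hU.measurableSet.diff hU'.measurableSet
  have hA : MeasurableSet {p ∈ Icc (0 : ℝ) 1 | P p < v} := by
    have : {p ∈ Icc (0 : ℝ) 1 | P p < v} =
        Icc (0 : ℝ) 1 \ ({p ∈ Icc (0 : ℝ) 1 | v ≤ P p} ∩ Icc 0 1) := by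
      ext x
      simp only [mem_inter_iff, Set.mem_sdiff, mem_ofPred_eq, not_and]
      constructor
      · rintro ⟨h1, h2⟩; exact ⟨h1, fun h3 => absurd h3.2 (not_le.2 h2)⟩
      · rintro ⟨h1, h2⟩; exact ⟨h1, not_le.1 fun h3 => h2 ⟨h1, h3⟩ h1⟩
    rw [this]
    exact measurableSet_Icc.diff (h.binned.isUpperIn_ge v).measurableSet
  filter_upwards [h.iid.tendsto_average_ind (measurableSet_askSet hA)
    (h.measurableSet_bestBidIn hU hU'),
    h.iid.tendsto_average_ind (measurableSet_bidSet hD) (h.measurableSet_noAsk v)] with ω h1 h2 δ hδ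
  have h3 := h1.sub h2
  simp only [sub_zero] at h3
  filter_upwards [h3.eventually (gt_mem_nhds hδ), eventually_gt_atTop 0] with L hL hL0
  have hL' : (0 : ℝ) < L := by exact_mod_cast hL0
  have key := Nat.cast_le (α := ℝ).2 ((Nat.le_add_left _ _).trans
    (le_bidCount_add_count (P := P) (init := init) (o := fun i => order i ω)
      h.binned.monotoneOn h.admissible (fun n => h.price_mem_Icc n ω) hv L))
  push_cast at key
  rw [count_eq_sum_ind, count_eq_sum_ind] at key
  have e1 : ∑ n ∈ Finset.range L, ind ((bookAfter P init (fun i => order i ω) n).BestBidIn (U \ U') ∧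
      (order n ω).1 = false ∧ P (order n ω).2 < v) =
      ∑ n ∈ Finset.range L, ind ((path P init order n ω).BestBidIn (U \ U') ∧
        flowSeq gap order n ω ∈ askSet {p ∈ Icc (0 : ℝ) 1 | P p < v}) := by
    refine Finset.sum_congr rfl fun n _ => ?_
    refine le_antisymm (ind_le_ind fun h => ⟨h.1, h.2.1, ?_, h.2.2⟩)
      (ind_le_ind fun h => ⟨h.1, h.2.1, h.2.2.2⟩)
    exact BookModel.price_mem_Icc (by assumption) n ω
  have e2 : ∑ n ∈ Finset.range L, ind ((bookAfter P init (fun i => order i ω) n).NoAsk P v ∧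
      (order n ω).1 = true ∧ (order n ω).2 ∈ U \ U') =
      ∑ n ∈ Finset.range L, ind ((path P init order n ω).NoAsk P v ∧
        flowSeq gap order n ω ∈ bidSet ((U \ U') ∩ Icc 0 1)) := by
    refine Finset.sum_congr rfl fun n _ => ?_
    refine le_antisymm (ind_le_ind fun h => ⟨h.1, h.2.1, h.2.2, ?_⟩)
      (ind_le_ind fun h => ⟨h.1, h.2.1, h.2.2.1⟩)
    exact BookModel.price_mem_Icc (by assumption) n ω
  rw [e1, e2] at key
  have key' := div_le_div_of_nonneg_right key hL'.le
  rw [add_div] at key'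
  unfold frac
  have e3 : (path P init order L ω) = bookAfter P init (fun i => order i ω) L := rfl
  rw [e3]
  linarith

end BookModel

end

noncomputable section

/-! ### Waiting times -/

lemma expMeasure_eq : expMeasure 2 = volume.withDensity fun x => ENNReal.ofReal
    (exponentialPDFReal 2 x) := rfl

lemma exponentialPDFReal_eq_indicator (x : ℝ) :
    exponentialPDFReal 2 x = (Ici (0 : ℝ)).indicator (fun x => 2 * Real.exp (-(2 * x))) x := by
  rw [exponentialPDFReal, gammaPDFReal, indicator_apply]
  simp

lemma integrableOn_pow_mul_exp (k : ℕ) :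
    IntegrableOn (fun x : ℝ => x ^ k * Real.exp (-(2 * x))) (Ioi 0) := by
  have := integrableOn_rpow_mul_exp_neg_mul_rpow (p := 1) (s := k) (b := 2)
    (by have : (0 : ℝ) ≤ k := Nat.cast_nonneg k
        linarith) one_pos two_pos
  refine this.congr_fun (fun x _ => ?_) measurableSet_Ioi
  simp

lemma expMeasure_smul_eq (k : ℕ) (x : ℝ) : (ENNReal.ofReal (exponentialPDFReal 2 x)).toReal • x ^ k =
    (Ici (0 : ℝ)).indicator (fun x => 2 * (x ^ k * Real.exp (-(2 * x)))) x := by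
  rw [ENNReal.toReal_ofReal (exponentialPDFReal_nonneg two_pos x), exponentialPDFReal_eq_indicator,
    smul_eq_mul]
  by_cases h : x ∈ Ici (0 : ℝ)
  · rw [indicator_of_mem h, indicator_of_mem h]; ring
  · rw [indicator_of_notMem h, indicator_of_notMem h, zero_mul]

lemma integrable_pow_expMeasure (k : ℕ) : Integrable (fun x : ℝ => x ^ k) (expMeasure 2) := by
  rw [expMeasure_eq, integrable_withDensity_iff_integrable_smul'
    (measurable_exponentialPDFReal 2).ennreal_ofReal (Eventually.of_forall fun x => by simp)]
  simp_rw [expMeasure_smul_eq]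
  rw [integrable_indicator_iff measurableSet_Ici, integrableOn_Ici_iff_integrableOn_Ioi]
  exact (integrableOn_pow_mul_exp k).const_mul 2

lemma integral_expMeasure : ∫ x, x ∂(expMeasure 2) = 1 / 2 := by
  have h1 : ∫ x, x ∂(expMeasure 2) = ∫ x, x ^ 1 ∂(expMeasure 2) := by simp
  rw [h1, expMeasure_eq, integral_withDensity_eq_integral_toReal_smul
    (measurable_exponentialPDFReal 2).ennreal_ofReal (Eventually.of_forall fun x => by simp)]
  simp_rw [expMeasure_smul_eq]
  rw [integral_indicator measurableSet_Ici, integral_Ici_eq_integral_Ioi, integral_const_mul]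
  have := Real.integral_rpow_mul_exp_neg_mul_Ioi (a := 2) (r := 2) two_pos two_pos
  have e : ∫ x in Ioi (0 : ℝ), x ^ 1 * Real.exp (-(2 * x)) =
      ∫ x in Ioi (0 : ℝ), x ^ ((2 : ℝ) - 1) * Real.exp (-(2 * x)) := by
    refine setIntegral_congr_fun measurableSet_Ioi fun x _ => ?_
    norm_num
  rw [e, this, Real.Gamma_two]
  norm_num

lemma ae_pos_expMeasure : ∀ᵐ x ∂(expMeasure 2), (0 : ℝ) < x := by
  rw [expMeasure_eq, ae_withDensity_iff (measurable_exponentialPDFReal 2).ennreal_ofReal]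
  filter_upwards [Measure.ae_ne volume (0 : ℝ)] with x hx0 hx
  by_contra hle
  have hlt : x < 0 := lt_of_le_of_ne (not_lt.1 hle) hx0
  refine hx ?_
  rw [exponentialPDFReal_eq_indicator, indicator_of_notMem (show x ∉ Ici (0 : ℝ) from not_le.2 hlt)]
  simp

/-- A sequence of waiting times which are positive, with asymptotic mean `1/2`. -/
structure RegularGaps (g : ℕ → ℝ) : Prop where
  pos : ∀ n, 0 < g n
  lim : Tendsto (fun n : ℕ => (∑ i ∈ Finset.range n, g i) / n) atTop (𝓝 (1 / 2))

namespace RegularGaps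

variable {g : ℕ → ℝ}

lemma strictMono (hg : RegularGaps g) : StrictMono fun n => ∑ i ∈ Finset.range n, g i :=
  strictMono_nat_of_lt_succ fun n => by
    rw [Finset.sum_range_succ]; linarith [hg.pos n]

lemma tendsto_sum (hg : RegularGaps g) :
    Tendsto (fun n => ∑ i ∈ Finset.range n, g i) atTop atTop := by
  have h1 : Tendsto (fun n : ℕ => (∑ i ∈ Finset.range n, g i) / n * n) atTop atTop :=
    hg.lim.pos_mul_atTop (by norm_num) tendsto_natCast_atTop_atTop
  refine h1.congr' ?_
  filter_upwards [eventually_gt_atTop 0] with n hn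
  field_simp

lemma setOf_arrivalTime_le (hg : RegularGaps g) {n : ℕ} {s : ℝ}
    (h1 : ∑ i ∈ Finset.range n, g i ≤ s) (h2 : s < ∑ i ∈ Finset.range (n + 1), g i) :
    {k | arrivalTime g k ≤ s} = Iio n := by
  ext k
  simp only [arrivalTime, mem_ofPred_eq, mem_Iio]
  constructor
  · intro h
    have := hg.strictMono.lt_iff_lt.1 (h.trans_lt h2)
    omega
  · intro h
    exact (hg.strictMono.monotone (by omega : k + 1 ≤ n)).trans h1

lemma arrivalCount_eq (hg : RegularGaps g) {n : ℕ} {s : ℝ}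
    (h1 : ∑ i ∈ Finset.range n, g i ≤ s) (h2 : s < ∑ i ∈ Finset.range (n + 1), g i) :
    arrivalCount g s = n := by
  rw [arrivalCount, hg.setOf_arrivalTime_le h1 h2]
  simp [Set.ncard_eq_toFinset_card']

lemma exists_arrivalCount (hg : RegularGaps g) {s : ℝ} (hs : 0 ≤ s) :
    ∑ i ∈ Finset.range (arrivalCount g s), g i ≤ s ∧
      s < ∑ i ∈ Finset.range (arrivalCount g s + 1), g i := by
  have hex : ∃ n, s < ∑ i ∈ Finset.range (n + 1), g i := by
    obtain ⟨n, hn⟩ := ((hg.tendsto_sum.comp (tendsto_add_atTop_nat 1)).eventually_gt_atTop s).exists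
    exact ⟨n, hn⟩
  classical
  have h2 := Nat.find_spec hex
  have h1 : ∑ i ∈ Finset.range (Nat.find hex), g i ≤ s := by
    rcases Nat.eq_zero_or_pos (Nat.find hex) with h0 | h0
    · rw [h0]; simpa using hs
    · have := Nat.find_min hex (Nat.sub_lt h0 one_pos)
      rw [show Nat.find hex - 1 + 1 = Nat.find hex by omega] at this
      exact not_lt.1 this
  rw [hg.arrivalCount_eq h1 h2]
  exact ⟨h1, h2⟩

lemma arrivalCount_mono (hg : RegularGaps g) : Monotone (arrivalCount g) := by
  intro s t hst
  rcases lt_or_ge s 0 with hs | hs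
  · have : {n | arrivalTime g n ≤ s} = ∅ := by
      ext n
      simp only [mem_ofPred_eq, mem_empty_iff_false, iff_false, not_le]
      exact hs.trans_le (Finset.sum_nonneg fun i _ => (hg.pos i).le)
    rw [arrivalCount, this, ncard_empty]
    exact Nat.zero_le _
  · have h1 := hg.exists_arrivalCount hs
    have h2 := hg.exists_arrivalCount (hs.trans hst)
    have := hg.strictMono.lt_iff_lt.1 (h1.1.trans_lt (hst.trans_lt h2.2))
    omega

lemma tendsto_arrivalCount (hg : RegularGaps g) : Tendsto (arrivalCount g) atTop atTop := by
  refine tendsto_atTop.2 fun n => ?_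
  filter_upwards [eventually_ge_atTop (∑ i ∈ Finset.range n, g i), eventually_ge_atTop (0 : ℝ)]
    with t ht ht0
  have := hg.strictMono.lt_iff_lt.1 (ht.trans_lt (hg.exists_arrivalCount ht0).2)
  omega

lemma arrivalCount_sum (hg : RegularGaps g) (n : ℕ) :
    arrivalCount g (∑ i ∈ Finset.range n, g i) = n :=
  hg.arrivalCount_eq le_rfl (hg.strictMono n.lt_succ_self)

lemma tendsto_div_arrivalCount (hg : RegularGaps g) :
    Tendsto (fun t => t / arrivalCount g t) atTop (𝓝 (1 / 2)) := by
  have h1 := hg.lim.comp hg.tendsto_arrivalCount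
  have h2 : Tendsto (fun n : ℕ => (∑ i ∈ Finset.range (n + 1), g i) / n) atTop (𝓝 (1 / 2)) := by
    have h3 := hg.lim.comp (tendsto_add_atTop_nat 1)
    have h4 : Tendsto (fun n : ℕ => ((n + 1 : ℕ) : ℝ) / n) atTop (𝓝 1) := by
      have : Tendsto (fun n : ℕ => 1 + 1 / (n : ℝ)) atTop (𝓝 (1 + 0)) :=
        tendsto_const_nhds.add tendsto_one_div_atTop_nhds_zero_nat
      rw [add_zero] at this
      refine this.congr' ?_
      filter_upwards [eventually_gt_atTop 0] with k hk
      push_cast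
      field_simp
    have h5 := h3.mul h4
    rw [mul_one] at h5
    refine h5.congr' ?_
    filter_upwards [eventually_gt_atTop 0] with k hk
    simp only [Function.comp]
    push_cast
    field_simp
  have h3 := h2.comp hg.tendsto_arrivalCount
  refine tendsto_of_tendsto_of_tendsto_of_le_of_le' h1 h3 ?_ ?_
  · filter_upwards [eventually_ge_atTop (0 : ℝ)] with t ht
    exact div_le_div_of_nonneg_right (hg.exists_arrivalCount ht).1 (Nat.cast_nonneg _)
  · filter_upwards [eventually_ge_atTop (0 : ℝ)] with t ht
    exact div_le_div_of_nonneg_right (hg.exists_arrivalCount ht).2.le (Nat.cast_nonneg _)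

lemma measurable_ind_arrivalCount (hg : RegularGaps g) (H : ℕ → Prop) :
    Measurable fun s => ind (H (arrivalCount g s)) :=
  (measurable_from_nat (f := fun n => ind (H n))).comp hg.arrivalCount_mono.measurable

lemma intervalIntegrable_ind (hg : RegularGaps g) (H : ℕ → Prop) (s t : ℝ) :
    IntervalIntegrable (fun s => ind (H (arrivalCount g s))) volume s t := by
  rw [intervalIntegrable_iff]
  exact Measure.integrableOn_of_bounded (M := 1) (by simp)
    (hg.measurable_ind_arrivalCount H).aestronglyMeasurable (Eventually.of_forall fun x => by
      rw [Real.norm_eq_abs, abs_of_nonneg (ind_nonneg _)]; exact ind_le_one _)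

lemma volume_eq_integral (hg : RegularGaps g) (H : ℕ → Prop) {t : ℝ} (ht : 0 ≤ t) :
    volume.real {s ∈ Icc 0 t | H (arrivalCount g s)} =
      ∫ s in (0 : ℝ)..t, ind (H (arrivalCount g s)) := by
  have hm : MeasurableSet {s | H (arrivalCount g s)} :=
    hg.arrivalCount_mono.measurable (MeasurableSet.of_discrete (s := {n | H n}))
  have e : {s ∈ Icc 0 t | H (arrivalCount g s)} = Icc 0 t ∩ {s | H (arrivalCount g s)} := rfl
  have e2 : (fun s => ind (H (arrivalCount g s))) =
      {s | H (arrivalCount g s)}.indicator fun _ => (1 : ℝ) := by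
    funext s
    by_cases h : H (arrivalCount g s)
    · rw [ind_of_true h, indicator_of_mem (show s ∈ {s | H (arrivalCount g s)} from h)]
    · rw [ind_of_false h, indicator_of_notMem (show s ∉ {s | H (arrivalCount g s)} from h)]
  rw [e, intervalIntegral.integral_of_le ht, ← integral_Icc_eq_integral_Ioc, e2,
    setIntegral_indicator hm, setIntegral_const, smul_eq_mul, mul_one]

lemma integral_gap (hg : RegularGaps g) (H : ℕ → Prop) (n : ℕ) :
    ∫ s in (∑ i ∈ Finset.range n, g i)..(∑ i ∈ Finset.range (n + 1), g i),
      ind (H (arrivalCount g s)) = ind (H n) * g n := by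
  have hle := (hg.strictMono n.lt_succ_self).le
  simp only at hle
  rw [intervalIntegral.integral_of_le hle, ← integral_Ico_eq_integral_Ioc,
    setIntegral_congr_fun (g := fun _ => ind (H n)) measurableSet_Ico fun s hs => by
      simp only [hg.arrivalCount_eq hs.1 hs.2], setIntegral_const, smul_eq_mul,
    Real.volume_real_Ico_of_le hle, Finset.sum_range_succ]
  ring

/-- The state of the book is constant between arrivals, so the time spent is the sum of the
corresponding waiting times, except for the incomplete last one. -/
lemma abs_volume_sub_le (hg : RegularGaps g) (H : ℕ → Prop) {t : ℝ} (ht : 0 ≤ t) :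
    |volume.real {s ∈ Icc 0 t | H (arrivalCount g s)} -
      ∑ n ∈ Finset.range (arrivalCount g t), ind (H n) * g n| ≤ g (arrivalCount g t) := by
  set L := arrivalCount g t with hL
  have h0 := hg.exists_arrivalCount ht
  rw [← hL] at h0
  have hsum := intervalIntegral.sum_integral_adjacent_intervals (n := L)
    (a := fun n => ∑ i ∈ Finset.range n, g i) (μ := volume)
    (f := fun s => ind (H (arrivalCount g s))) fun k _ => hg.intervalIntegrable_ind H _ _
  simp only [hg.integral_gap H, Finset.range_zero, Finset.sum_empty] at hsum
  rw [hg.volume_eq_integral H ht, ← intervalIntegral.integral_add_adjacent_intervals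
    (hg.intervalIntegrable_ind H 0 (∑ i ∈ Finset.range L, g i)) (hg.intervalIntegrable_ind H _ t),
    ← hsum, add_sub_cancel_left]
  have h1 := intervalIntegral.norm_integral_le_of_norm_le_const (C := 1)
    (a := ∑ i ∈ Finset.range L, g i) (b := t)
    (f := fun s => ind (H (arrivalCount g s))) fun x _ => by
      rw [Real.norm_eq_abs, abs_of_nonneg (ind_nonneg _)]; exact ind_le_one _
  rw [Real.norm_eq_abs, one_mul, abs_of_nonneg (sub_nonneg.2 h0.1)] at h1
  refine h1.trans ?_
  have h2 := h0.2
  rw [Finset.sum_range_succ] at h2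
  linarith

lemma tendsto_gap_div (hg : RegularGaps g) : Tendsto (fun n : ℕ => g n / n) atTop (𝓝 0) := by
  have h3 := hg.lim.comp (tendsto_add_atTop_nat 1)
  have h4 : Tendsto (fun n : ℕ => ((n + 1 : ℕ) : ℝ) / n) atTop (𝓝 1) := by
    have : Tendsto (fun n : ℕ => 1 + 1 / (n : ℝ)) atTop (𝓝 (1 + 0)) :=
      tendsto_const_nhds.add tendsto_one_div_atTop_nhds_zero_nat
    rw [add_zero] at this
    refine this.congr' ?_
    filter_upwards [eventually_gt_atTop 0] with k hk
    push_cast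
    field_simp
  have h5 := (h3.mul h4).sub hg.lim
  rw [mul_one, sub_self] at h5
  refine h5.congr' ?_
  filter_upwards [eventually_gt_atTop 0] with k hk
  simp only [Function.comp]
  rw [Finset.sum_range_succ]
  push_cast
  field_simp
  ring

/-- Fractions of time and fractions of arrivals agree asymptotically. -/
lemma tendsto_timeFrac_sub_frac (hg : RegularGaps g) {H : ℕ → Prop}
    (hH : Tendsto (fun L : ℕ => (∑ n ∈ Finset.range L, ind (H n) * (g n - 1 / 2)) / L) atTop (𝓝 0)) :
    Tendsto (fun t => volume.real {s ∈ Icc 0 t | H (arrivalCount g s)} / t -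
      frac H (arrivalCount g t)) atTop (𝓝 0) := by
  set L := arrivalCount g with hL
  set V : ℝ → ℝ := fun t => volume.real {s ∈ Icc 0 t | H (arrivalCount g s)} with hV
  have h1 : Tendsto (fun t => (V t - ∑ n ∈ Finset.range (L t), ind (H n) * g n) / L t) atTop
      (𝓝 0) := by
    refine squeeze_zero_norm' ?_ (hg.tendsto_gap_div.comp hg.tendsto_arrivalCount)
    filter_upwards [eventually_ge_atTop (0 : ℝ)] with t ht
    rw [Real.norm_eq_abs, abs_div, Nat.abs_cast]
    exact div_le_div_of_nonneg_right (hg.abs_volume_sub_le H ht) (Nat.cast_nonneg _)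
  -- The waiting time after a predictable event has mean `1/2` whatever the event, so the time spent
  -- per arrival is half of the fraction of arrivals.
  have h2 : Tendsto (fun t => V t / L t - 1 / 2 * frac H (L t)) atTop (𝓝 0) := by
    have := h1.add (hH.comp hg.tendsto_arrivalCount)
    rw [add_zero] at this
    refine this.congr fun t => ?_
    simp only [Function.comp, frac, ← hL]
    rw [← add_div, mul_div_assoc', ← sub_div, Finset.mul_sum]
    congr 1
    rw [sub_add, sub_right_inj, ← Finset.sum_sub_distrib]
    refine Finset.sum_congr rfl fun n _ => ?_
    ring
  have h3 := hg.tendsto_div_arrivalCount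
  have h4 := h3.inv₀ (by norm_num : (1 / 2 : ℝ) ≠ 0)
  have h5 : Tendsto (fun t => 1 / 2 * (t / (L t : ℝ))⁻¹ - 1) atTop (𝓝 0) := by
    have := (h4.const_mul (1 / 2 : ℝ)).sub_const 1
    norm_num at this
    simpa using this
  -- Passing from division by `L t` to division by `t` costs a factor that tends to `2`, harmless
  -- since fractions are bounded.
  have h6 : Tendsto (fun t => frac H (L t) * (1 / 2 * (t / (L t : ℝ))⁻¹ - 1)) atTop (𝓝 0) := by
    refine squeeze_zero_norm (fun t => ?_) (norm_zero (E := ℝ) ▸ h5.norm)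
    rw [norm_mul, Real.norm_eq_abs (frac _ _), abs_of_nonneg (frac_nonneg _ _)]
    exact mul_le_of_le_one_left (norm_nonneg _) (frac_le_one _ _)
  have h7 := (h2.mul h4).add h6
  rw [zero_mul, zero_add] at h7
  refine h7.congr' ?_
  filter_upwards [eventually_gt_atTop (0 : ℝ), hg.tendsto_arrivalCount.eventually_gt_atTop 0]
    with t ht hLt
  have hLt' : (0 : ℝ) < L t := by exact_mod_cast hLt
  change (V t / L t - 1 / 2 * frac H (L t)) * (t / L t)⁻¹ +
    frac H (L t) * (1 / 2 * (t / L t)⁻¹ - 1) = V t / t - frac H (L t)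
  field_simp
  ring

end RegularGaps

/-! ### Fractions of time, and existence of good times. -/

namespace BookModel

variable {Ω : Type*} [mΩ : MeasurableSpace Ω] {μ : Measure Ω} {fa fb : ℝ → ℝ} {m M : ℝ}
  {gap : ℕ → Ω → ℝ} {order : ℕ → Ω → Order} {P : ℝ → ℝ} {init : Book} [IsProbabilityMeasure μ]

lemma map_fst_flowLaw (h : BookModel μ fa fb m M gap order P init) :
    (flowLaw fa fb).map Prod.fst = expMeasure 2 := by
  have := h.dens.isProbabilityMeasure_orderLaw
  have := isProbabilityMeasure_expMeasure (r := 2) (by norm_num)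
  rw [flowLaw, Measure.map_fst_prod, measure_univ, one_smul]

lemma integrable_pow_gap (h : BookModel μ fa fb m M gap order P init) (k : ℕ) :
    Integrable (fun e : ℝ × Order => e.1 ^ k) (flowLaw fa fb) := by
  have h1 := integrable_pow_expMeasure k
  rw [← h.map_fst_flowLaw] at h1
  exact h1.comp_measurable measurable_fst

lemma integral_gap (h : BookModel μ fa fb m M gap order P init) :
    ∫ e : ℝ × Order, e.1 ∂(flowLaw fa fb) = 1 / 2 := by
  rw [← integral_expMeasure, ← h.map_fst_flowLaw, integral_map measurable_fst.aemeasurable]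
  exact measurable_id.aestronglyMeasurable

lemma memLp_gap (h : BookModel μ fa fb m M gap order P init) :
    MemLp (fun e : ℝ × Order => e.1 - 1 / 2) 2 (flowLaw fa fb) := by
  have := h.dens.isProbabilityMeasure_flowLaw
  refine MemLp.sub ?_ (memLp_const _)
  rw [memLp_two_iff_integrable_sq measurable_fst.aestronglyMeasurable]
  exact h.integrable_pow_gap 2

lemma integral_gap_sub (h : BookModel μ fa fb m M gap order P init) :
    ∫ e : ℝ × Order, (e.1 - 1 / 2) ∂(flowLaw fa fb) = 0 := by
  have := h.dens.isProbabilityMeasure_flowLaw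
  have hi : Integrable (fun e : ℝ × Order => e.1) (flowLaw fa fb) := by
    simpa using h.integrable_pow_gap 1
  rw [integral_sub hi (integrable_const _), h.integral_gap]; simp

lemma regularGaps (h : BookModel μ fa fb m M gap order P init) :
    ∀ᵐ ω ∂μ, RegularGaps fun n => gap n ω := by
  have hpos : ∀ᵐ ω ∂μ, ∀ n, 0 < gap n ω := by
    refine ae_all_iff.2 fun n => ?_
    have h1 := ae_pos_expMeasure
    rw [← h.map_fst_flowLaw] at h1
    have h2 := ae_of_ae_map measurable_fst.aemeasurable h1
    rw [← h.iid.law n] at h2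
    exact ae_of_ae_map (h.iid.measurable n).aemeasurable h2
  have hi : Integrable (fun e : ℝ × Order => e.1) (flowLaw fa fb) := by
    simpa using h.integrable_pow_gap 1
  filter_upwards [hpos, h.iid.tendsto_average measurable_fst hi] with ω h1 h2
  rw [h.integral_gap] at h2
  exact ⟨h1, h2⟩

/-- The fraction of time that the best bid is in a block of bins. -/
lemma tendsto_timeFrac (h : BookModel μ fa fb m M gap order P init) {H : ℕ → Ω → Prop}
    (hH : ∀ n, MeasurableSet[past (flowSeq gap order) n] {ω | H n ω}) :
    ∀ᵐ ω ∂μ, Tendsto (fun t => volume.real {s ∈ Icc 0 t | H (arrivalCount (gap · ω) s) ω} / t -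
      frac (H · ω) (arrivalCount (gap · ω) t)) atTop (𝓝 0) := by
  have h3 := h.iid.tendsto_average_predictable (measurable_fst.sub_const (1 / 2)) h.memLp_gap
    h.integral_gap_sub hH
  filter_upwards [h.regularGaps, h3] with ω hg h4
  exact RegularGaps.tendsto_timeFrac_sub_frac (H := fun n => H n ω) hg h4

/-- Monotonicity in `ε` allows the null sets to be collected over a sequence `1 / (k + 1)` only. -/
lemma IsGoodTimes.mono {g : ℕ → ℝ} {o : ℕ → Order} {κb κa ε ε' : ℝ} {T : ℕ → ℝ} (hM : 0 ≤ M)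
    (hT : ∀ n, 0 ≤ T n) (hε : ε ≤ ε') (h : IsGoodTimes P init g o κb κa M ε T) :
    IsGoodTimes P init g o κb κa M ε' T := by
  refine ⟨h.1, fun n => ⟨fun p hp => ((h.2 n).1 p hp).trans (by linarith), ?_⟩⟩
  refine le_trans ?_ ((h.2 n).2.trans ?_)
  · exact_mod_cast Multiset.card_le_card
      (Multiset.monotone_filter_right _ fun q (hq : q < _) => hq.trans_le (by linarith))
  · have := hT n
    gcongr

/-- Good times exist. -/
theorem exists_isGoodTimes (h : BookModel μ fa fb m M gap order P init) :
    ∀ᵐ ω ∂μ, ∀ ε > 0, ∃ T : ℕ → ℝ, IsGoodTimes P init (fun i => gap i ω) (fun i => order i ω)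
      (bidThreshold μ P init order) (askThreshold μ P init order) M ε T := by
  have hM : 0 < M := h.dens.pos.trans_le h.dens.ask.le_bound
  have hfr : ∀ᵐ ω ∂μ, ∀ k : ℕ, _ := ae_all_iff.2 fun k : ℕ =>
    h.frequently_good (show (0 : ℝ) < 1 / (k + 1) by positivity)
  filter_upwards [h.regularGaps, hfr] with ω hg hω ε hε
  obtain ⟨k, hk⟩ := exists_nat_one_div_lt hε
  set ε₀ : ℝ := 1 / (k + 1) with hε₀
  have hε₀0 : 0 < ε₀ := by positivity
  -- The `n`-th state is entered at a time close to `n / 2`. The slack between `M + 1/2` and `M + 1`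
  -- absorbs the error when the bound `(M + 1/2) ε n` is expressed through time.
  have hratio : ∀ᶠ n : ℕ in atTop, (M + 1 / 2) / (2 * (M + 1)) <
      (∑ i ∈ Finset.range n, gap i ω) / n := by
    refine hg.lim.eventually (lt_mem_nhds ?_)
    rw [div_lt_div_iff₀ (by positivity) two_pos]
    linarith
  obtain ⟨φ, hφ, hφ'⟩ := extraction_of_frequently_atTop
    ((hω k).and_eventually (hratio.and (eventually_gt_atTop 0)))
  refine ⟨fun j => ∑ i ∈ Finset.range (φ j), gap i ω, ?_⟩
  have hT0 : ∀ j, 0 ≤ ∑ i ∈ Finset.range (φ j), gap i ω := fun j =>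
    Finset.sum_nonneg fun i _ => (hg.pos i).le
  refine IsGoodTimes.mono hM.le hT0 hk.le ⟨hg.tendsto_sum.comp hφ.tendsto_atTop, fun j => ?_⟩
  obtain ⟨⟨h1, h2⟩, h3, h4⟩ := hφ' j
  have hmemb : bidThreshold μ P init order ≤ sSup (bin P (bidThreshold μ P init order)) :=
    le_csSup ⟨1, fun y hy => hy.1.2⟩ (mem_bin_self h.bidThreshold_mem)
  have hmema : sInf (bin P (askThreshold μ P init order)) ≤ askThreshold μ P init order :=
    csInf_le ⟨0, fun y hy => hy.1.1⟩ (mem_bin_self h.askThreshold_mem)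
  have e : bookAt P init (fun i => gap i ω) (fun i => order i ω)
      (∑ i ∈ Finset.range (φ j), gap i ω) = path P init order (φ j) ω := by
    rw [bookAt, hg.arrivalCount_sum]; rfl
  rw [e]
  have e1 : bidThreshold μ P init order + 1 / ((k : ℝ) + 1) ≤
      sSup (bin P (bidThreshold μ P init order)) + ε₀ := by linarith
  have e2 : sInf (bin P (askThreshold μ P init order)) - ε₀ ≤
      askThreshold μ P init order - 1 / ((k : ℝ) + 1) := by linarith
  refine ⟨fun p hp => (h1 p hp).trans e1, ?_⟩
  have hn' : (0 : ℝ) < φ j := by exact_mod_cast h4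
  rw [lt_div_iff₀ hn', div_mul_eq_mul_div, div_lt_iff₀ (by positivity)] at h3
  refine le_trans ?_ (h2.trans ?_)
  · exact_mod_cast Multiset.card_le_card
      (Multiset.monotone_filter_right _ fun q (hq : q < _) => hq.trans_le e2)
  · nlinarith

end BookModel

end

noncomputable section

/-! ### Estimates along a typical path -/

/-- The bins from that of value `u` to the one before that of value `w`. -/
def block (P : ℝ → ℝ) (u w : ℝ) : Set ℝ :=
  {p ∈ Icc (0 : ℝ) 1 | u ≤ P p} \ {p ∈ Icc (0 : ℝ) 1 | w ≤ P p}

lemma mem_block {P : ℝ → ℝ} {u w p : ℝ} : p ∈ block P u w ↔ p ∈ Icc (0 : ℝ) 1 ∧ u ≤ P p ∧ P p < w := by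
  constructor
  · rintro ⟨h1, h2⟩
    exact ⟨h1.1, h1.2, lt_of_not_ge fun h => h2 ⟨h1.1, h⟩⟩
  · rintro ⟨h1, h2, h3⟩
    exact ⟨⟨h1, h2⟩, fun h => absurd h.2 (not_le.2 h3)⟩

lemma level_eq_diff (P : ℝ → ℝ) (v : ℝ) :
    level P v = {p ∈ Icc (0 : ℝ) 1 | v ≤ P p} \ {p ∈ Icc (0 : ℝ) 1 | v < P p} := by
  ext p
  constructor
  · rintro ⟨h1, h2⟩
    exact ⟨⟨h1, h2.ge⟩, fun h => absurd h.2 (not_lt.2 h2.le)⟩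
  · rintro ⟨h1, h2⟩
    exact ⟨h1.1, le_antisymm (not_lt.1 fun h => h2 ⟨h1.1, h⟩) h1.2⟩

lemma IsBinned.measurableSet_block {P : ℝ → ℝ} (hP : IsBinned P) (u w : ℝ) :
    MeasurableSet (block P u w) := by
  refine OrdConnected.measurableSet ⟨fun x hx y hy z hz => ?_⟩
  rw [mem_block] at hx hy ⊢
  have hz1 : z ∈ Icc (0 : ℝ) 1 := ⟨hx.1.1.trans hz.1, hz.2.trans hy.1.2⟩
  exact ⟨hz1, hx.2.1.trans (hP.monotoneOn hx.1 hz1 hz.1),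
    (hP.monotoneOn hz1 hy.1 hz.2).trans_lt hy.2.2⟩

/-- The fraction of arrivals which find no ask in bins of value at most `v`. -/
def askFree (P : ℝ → ℝ) (init : Book) (o : ℕ → Order) (L : ℕ) (v : ℝ) : ℝ :=
  frac (fun n => (bookAfter P init o n).NoAsk P v) L

/-- The fraction of arrivals which find no bid in bins of value at least `v`. -/
def bidFree (P : ℝ → ℝ) (init : Book) (o : ℕ → Order) (L : ℕ) (v : ℝ) : ℝ :=
  frac (fun n => (bookAfter P init o n).NoBid P v) L

/-- The fraction of arrivals which find the best bid in the bin of value `v`. -/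
def bidFrac (P : ℝ → ℝ) (init : Book) (o : ℕ → Order) (L : ℕ) (v : ℝ) : ℝ :=
  frac (fun n => (bookAfter P init o n).BestBidIn (level P v)) L

/-- The fraction of time that the best bid is in the bin of value `v`. -/
def bidTime (P : ℝ → ℝ) (init : Book) (g : ℕ → ℝ) (o : ℕ → Order) (t v : ℝ) : ℝ :=
  volume.real {s ∈ Icc 0 t | (bookAt P init g o s).BestBidIn (level P v)} / t

/-- This turns the time that the best bid spends in a block into an increment of the free fraction
`bidFree`, the discrete counterpart of `dB`. -/
lemma Book.Admissible.bestBidIn_block {P : ℝ → ℝ} (hP : IsBinned P) {b : Book}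
    (hb : b.Admissible P) {u w : ℝ} (huw : u ≤ w) :
    ind (b.BestBidIn (block P u w)) = ind (b.NoBid P w) - ind (b.NoBid P u) := by
  have key : b.BestBidIn (block P u w) ↔ ¬ b.NoBid P u ∧ b.NoBid P w := by
    rw [block, hb.bestBidIn_diff (hP.isUpperIn_ge u) (hP.isUpperIn_ge w), hb.noBid_iff,
      hb.noBid_iff, Nat.pos_iff_ne_zero]
  by_cases h1 : b.NoBid P u
  · rw [ind_of_true h1, ind_of_true (h1.mono huw), ind_of_false fun h => (key.1 h).1 h1, sub_self]
  · rw [ind_of_false h1, sub_zero]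
    exact le_antisymm (ind_le_ind fun h => (key.1 h).2) (ind_le_ind fun h => key.2 ⟨h1, h⟩)

lemma frac_bestBidIn_block {P : ℝ → ℝ} (hP : IsBinned P) {init : Book} {o : ℕ → Order}
    (hb : ∀ n, (bookAfter P init o n).Admissible P) {u w : ℝ} (huw : u ≤ w) (L : ℕ) :
    frac (fun n => (bookAfter P init o n).BestBidIn (block P u w)) L =
      bidFree P init o L w - bidFree P init o L u := by
  unfold bidFree frac
  rw [← sub_div, ← Finset.sum_sub_distrib]
  congr 1
  exact Finset.sum_congr rfl fun n _ => (hb n).bestBidIn_block hP huw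

/-- The almost sure limiting behaviour of a path of a binned book, as seen by the bids. -/
structure BidLimits (fa fb P : ℝ → ℝ) (init : Book) (g : ℕ → ℝ) (o : ℕ → Order) (κ : ℝ) :
    Prop where
  binned : IsBinned P
  admissible : ∀ n, (bookAfter P init o n).Admissible P
  gaps : RegularGaps g
  up : ∀ u ∈ IsBinned.vals binned, ∀ w ∈ IsBinned.vals binned, u ≤ w → ∀ δ > 0, ∀ᶠ L in atTop,
    (flowLaw fa fb).real (askSet {p ∈ Icc (0 : ℝ) 1 | P p ≤ u}) *
        (bidFree P init o L w - bidFree P init o L u) ≤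
      (flowLaw fa fb).real (bidSet (block P u w)) * askFree P init o L u + δ
  lo : ∀ u ∈ IsBinned.vals binned, ∀ w ∈ IsBinned.vals binned, u ≤ w → ∀ δ > 0, ∀ᶠ L in atTop,
    (flowLaw fa fb).real (bidSet (block P u w)) * askFree P init o L w ≤
      (flowLaw fa fb).real (askSet {p ∈ Icc (0 : ℝ) 1 | P p < w}) *
        (bidFree P init o L w - bidFree P init o L u) +
      ((bookAfter P init o L).bidCount (block P u w) : ℝ) / L + δ
  level : ∀ v ∈ IsBinned.vals binned, ∀ δ > 0, ∀ᶠ L in atTop,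
    (flowLaw fa fb).real (askSet {p ∈ Icc (0 : ℝ) 1 | P p ≤ v}) * bidFrac P init o L v ≤
      (flowLaw fa fb).real (bidSet (level P v)) * askFree P init o L v + δ
  zero : ∀ x ∈ Icc (0 : ℝ) 1, x < κ → ∀ δ > 0, ∀ᶠ L in atTop, bidFree P init o L (P x) ≤ δ
  time : ∀ v ∈ IsBinned.vals binned,
    Tendsto (fun t => bidTime P init g o t v - bidFrac P init o (arrivalCount g t) v) atTop (𝓝 0)

lemma tendsto_frac_zero {p : ℕ → Prop} (h : ∀ᶠ n in atTop, ¬ p n) :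
    Tendsto (frac p) atTop (𝓝 0) := by
  have h1 : Tendsto (fun n => ind (p n)) atTop (𝓝 0) :=
    tendsto_const_nhds.congr' (h.mono fun n hn => (ind_of_false hn).symm)
  refine h1.cesaro.congr fun n => ?_
  rw [frac, div_eq_inv_mul]

namespace BookModel

variable {Ω : Type*} [mΩ : MeasurableSpace Ω] {μ : Measure Ω} {fa fb : ℝ → ℝ} {m M : ℝ}
  {gap : ℕ → Ω → ℝ} {order : ℕ → Ω → Order} {P : ℝ → ℝ} {init : Book} [IsProbabilityMeasure μ]

/-- Below the threshold there are eventually always bids. Rational prices suffice, so that one null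
set serves all `x`. -/
lemma ae_bidFree_tendsto (h : BookModel μ fa fb m M gap order P init) :
    ∀ᵐ ω ∂μ, ∀ x ∈ Icc (0 : ℝ) 1, x < bidThreshold μ P init order → ∀ δ > 0, ∀ᶠ L in atTop,
      bidFree P init (fun i => order i ω) L (P x) ≤ δ := by
  have h1 : ∀ᵐ ω ∂μ, ∀ r s : ℚ, 0 ≤ (r : ℝ) → (r : ℝ) < s → (s : ℝ) < bidThreshold μ P init order →
      ∀ᶠ n in atTop, ∃ p ∈ (path P init order n ω).bids, p ∈ Ioo (r : ℝ) s := by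
    refine ae_all_iff.2 fun r => ae_all_iff.2 fun s => ?_
    by_cases hc : 0 ≤ (r : ℝ) ∧ (r : ℝ) < s ∧ (s : ℝ) < bidThreshold μ P init order
    · filter_upwards [h.eventually_exists_bid_of_lt hc.1 hc.2.1 hc.2.2] with ω hω _ _ _ using hω
    · exact Eventually.of_forall fun ω a b c => absurd ⟨a, b, c⟩ hc
  filter_upwards [h1] with ω hω x hx hxκ δ hδ
  obtain ⟨r, hr1, hr2⟩ := exists_rat_btwn hxκ
  obtain ⟨s, hs1, hs2⟩ := exists_rat_btwn hr2
  have hev := hω r s (hx.1.trans hr1.le) hs1 hs2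
  have h0 : Tendsto (fun L => bidFree P init (fun i => order i ω) L (P x)) atTop (𝓝 0) := by
    refine tendsto_frac_zero ?_
    filter_upwards [hev] with n hn hno
    obtain ⟨p, hp, hp1⟩ := hn
    have hpI := (h.admissible_path n ω).1 p hp
    exact absurd (hno p hp) (not_lt.2 (h.binned.monotoneOn hx hpI (hr1.trans hp1.1).le))
  exact (h0.eventually (gt_mem_nhds hδ)).mono fun L hL => hL.le

theorem ae_bidLimits (h : BookModel μ fa fb m M gap order P init) :
    ∀ᵐ ω ∂μ, BidLimits fa fb P init (fun i => gap i ω) (fun i => order i ω)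
      (bidThreshold μ P init order) := by
  have hge := fun v => h.binned.isUpperIn_ge v
  have hgt := fun v => h.binned.isUpperIn_gt v
  have hblock : ∀ u w, block P u w ∩ Icc 0 1 = block P u w := fun u w =>
    inter_eq_left.2 fun p hp => (mem_block.1 hp).1
  have hlevel : ∀ v, level P v ∩ Icc 0 1 = level P v := fun v =>
    inter_eq_left.2 (level_subset P v)
  have hup : ∀ᵐ ω ∂μ, ∀ u ∈ h.binned.vals, ∀ w ∈ h.binned.vals, _ :=
    (Finset.eventually_all _).2 fun u _ => (Finset.eventually_all _).2 fun w _ =>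
      h.block_le (hge u) (hge w) (u := u) fun p (hp : p ∈ block P u w) => (mem_block.1 hp).2.1
  have hlo : ∀ᵐ ω ∂μ, ∀ u ∈ h.binned.vals, ∀ w ∈ h.binned.vals, _ :=
    (Finset.eventually_all _).2 fun u _ => (Finset.eventually_all _).2 fun w _ =>
      h.le_block (hge u) (hge w) (v := w) fun p (hp : p ∈ block P u w) => (mem_block.1 hp).2.2
  have hlev : ∀ᵐ ω ∂μ, ∀ v ∈ h.binned.vals, _ :=
    (Finset.eventually_all _).2 fun v _ =>
      h.block_le (hge v) (hgt v) (u := v) fun p hp => hp.1.2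
  have htime : ∀ᵐ ω ∂μ, ∀ v ∈ h.binned.vals, _ :=
    (Finset.eventually_all _).2 fun v _ => h.tendsto_timeFrac
      (H := fun n ω => (path P init order n ω).BestBidIn ({p ∈ Icc (0 : ℝ) 1 | v ≤ P p} \
        {p ∈ Icc (0 : ℝ) 1 | v < P p})) fun n => h.measurableSet_bestBidIn (hge v) (hgt v) n
  filter_upwards [h.regularGaps, hup, hlo, hlev, htime, h.ae_bidFree_tendsto]
    with ω hg hup hlo hlev htime hzero
  have hadm : ∀ n, (bookAfter P init (fun i => order i ω) n).Admissible P := fun n =>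
    h.admissible_path n ω
  refine ⟨h.binned, hadm, hg, fun u hu w hw huw δ hδ => ?_, fun u hu w hw huw δ hδ => ?_,
    fun v hv δ hδ => ?_, hzero, fun v hv => ?_⟩
  · filter_upwards [hup u hu w hw δ hδ] with L hL
    change _ ≤ (flowLaw fa fb).real (bidSet (block P u w ∩ Icc 0 1)) * _ + δ at hL
    rw [hblock] at hL
    rw [← frac_bestBidIn_block h.binned hadm huw]
    exact hL
  · filter_upwards [hlo u hu w hw δ hδ] with L hL
    change (flowLaw fa fb).real (bidSet (block P u w ∩ Icc 0 1)) * _ ≤ _ at hL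
    rw [hblock] at hL
    rw [← frac_bestBidIn_block h.binned hadm huw]
    exact hL
  · filter_upwards [hlev v hv δ hδ] with L hL
    rw [← level_eq_diff, hlevel] at hL
    exact hL
  · have := htime v hv
    simp only [← level_eq_diff] at this
    exact this

end BookModel

end

noncomputable section

/-! ### Probabilities of arrivals in blocks of bins -/

namespace DensityPair

variable {fa fb : ℝ → ℝ} {m M : ℝ} {P : ℝ → ℝ}

lemma flowLaw_bidSet_mono (h : DensityPair fa fb m M) {S S' : Set ℝ} (hS : MeasurableSet S)
    (hSS : S ∩ Ioo 0 1 ⊆ S') :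
    (flowLaw fa fb).real (bidSet S) ≤ (flowLaw fa fb).real (bidSet S') := by
  have := h.isProbabilityMeasure_flowLaw
  have e : (flowLaw fa fb).real (bidSet S) = (flowLaw fa fb).real (bidSet (S ∩ Ioo 0 1)) := by
    rw [h.flowLaw_bidSet hS, h.flowLaw_bidSet (hS.inter measurableSet_Ioo), inter_assoc, inter_self]
  rw [e]
  exact measureReal_mono fun e he => ⟨he.1, hSS he.2⟩

lemma flowLaw_askSet_mono (h : DensityPair fa fb m M) {S S' : Set ℝ} (hS : MeasurableSet S)
    (hSS : S ∩ Ioo 0 1 ⊆ S') :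
    (flowLaw fa fb).real (askSet S) ≤ (flowLaw fa fb).real (askSet S') := by
  have := h.isProbabilityMeasure_flowLaw
  have e : (flowLaw fa fb).real (askSet S) = (flowLaw fa fb).real (askSet (S ∩ Ioo 0 1)) := by
    rw [h.flowLaw_askSet hS, h.flowLaw_askSet (hS.inter measurableSet_Ioo), inter_assoc, inter_self]
  rw [e]
  exact measureReal_mono fun e he => ⟨he.1, hSS he.2⟩

lemma flowLaw_askSet_Iic (h : DensityPair fa fb m M)
    {x : ℝ} (hx : x ∈ Icc (0 : ℝ) 1) : (flowLaw fa fb).real (askSet (Iic x)) = cdf fa x / 2 := by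
  rw [h.flowLaw_askSet measurableSet_Iic, setIntegral_Iic_inter_Ioo fa hx]

lemma flowLaw_bidSet_level (h : DensityPair fa fb m M) (hP : IsBinned P) (v : ℝ) :
    (flowLaw fa fb).real (bidSet (level P v)) = (∫ y in level P v, fb y) / 2 := by
  have e : (level P v ∩ Ioo 0 1 : Set ℝ) =ᵐ[volume] level P v := by
    have h1 : (level P v ∩ Ioo 0 1 : Set ℝ) =ᵐ[volume] (level P v ∩ Icc 0 1 : Set ℝ) :=
      (ae_eq_refl _).inter Ioo_ae_eq_Icc
    rwa [inter_eq_left.2 (level_subset P v)] at h1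
  rw [h.flowLaw_bidSet (hP.measurableSet_level v), setIntegral_congr_set e]

lemma flowLaw_bidSet_level_le (h : DensityPair fa fb m M) (hP : IsBinned P) (v : ℝ) :
    (flowLaw fa fb).real (bidSet (level P v)) ≤ M * volume.real (level P v) / 2 := by
  rw [h.flowLaw_bidSet_level hP]
  have := (h.bid.setIntegral_nonneg_le h.pos (level_subset P v)).2
  linarith

lemma flowLaw_bidSet_Ioc (h : DensityPair fa fb m M) {x y : ℝ} (hx : x ∈ Icc (0 : ℝ) 1)
    (hy : y ∈ Icc (0 : ℝ) 1) (hxy : x ≤ y) :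
    (flowLaw fa fb).real (bidSet (Ioc x y)) = (cdf fb y - cdf fb x) / 2 := by
  have := h.isProbabilityMeasure_flowLaw
  have e : bidSet (Ioc x y) = bidSet (Iic y) \ bidSet (Iic x) := by
    ext e
    constructor
    · rintro ⟨h1, h2⟩
      exact ⟨⟨h1, h2.2⟩, fun h3 => absurd h3.2 (not_le.2 h2.1)⟩
    · rintro ⟨h1, h2⟩
      exact ⟨h1.1, not_le.1 fun h3 => h2 ⟨h1.1, h3⟩, h1.2⟩
  have hsub : bidSet (Iic x) ⊆ bidSet (Iic y) := fun e he => ⟨he.1, le_trans he.2 hxy⟩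
  rw [e, measureReal_sdiff hsub
    (measurableSet_bidSet measurableSet_Iic), h.flowLaw_bidSet_Iic hx, h.flowLaw_bidSet_Iic hy]
  ring

lemma bidSet_union (S S' : Set ℝ) : bidSet (S ∪ S') = bidSet S ∪ bidSet S' := by
  ext e
  simp only [bidSet, mem_union, mem_ofPred_eq]
  tauto

/-- A block of bins and the interval of prices `(x, y]` differ by at most one bin at each end; for
the upper bound only the bin of `x` matters, for the lower one only that of `y`. -/
lemma flowLaw_block_le (h : DensityPair fa fb m M) (hP : IsBinned P) {x y : ℝ}
    (hx : x ∈ Icc (0 : ℝ) 1) (hy : y ∈ Icc (0 : ℝ) 1) (hxy : x ≤ y) :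
    (flowLaw fa fb).real (bidSet (block P (P x) (P y))) ≤
      (cdf fb y - cdf fb x) / 2 + M * volume.real (bin P x) / 2 := by
  rw [← h.flowLaw_bidSet_Ioc hx hy hxy]
  refine le_trans ?_ (add_le_add_right (h.flowLaw_bidSet_level_le hP (P x)) _)
  refine le_trans ?_ (measureReal_union_le _ _)
  rw [← bidSet_union]
  refine h.flowLaw_bidSet_mono (hP.measurableSet_block _ _) fun p hp => ?_
  obtain ⟨h1, h2, h3⟩ := mem_block.1 hp.1
  rcases le_or_gt p x with hpx | hpx
  · exact Or.inr ⟨h1, le_antisymm (hP.monotoneOn h1 hx hpx) h2⟩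
  · exact Or.inl ⟨hpx, le_of_not_gt fun h4 => absurd (hP.monotoneOn hy h1 h4.le) (not_le.2 h3)⟩

lemma le_flowLaw_block (h : DensityPair fa fb m M) (hP : IsBinned P) {x y : ℝ}
    (hx : x ∈ Icc (0 : ℝ) 1) (hy : y ∈ Icc (0 : ℝ) 1) (hxy : x ≤ y) :
    (cdf fb y - cdf fb x) / 2 ≤ (flowLaw fa fb).real (bidSet (block P (P x) (P y))) +
      M * volume.real (bin P y) / 2 := by
  rw [← h.flowLaw_bidSet_Ioc hx hy hxy]
  refine le_trans ?_ (add_le_add_right (h.flowLaw_bidSet_level_le hP (P y)) _)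
  refine le_trans ?_ (measureReal_union_le _ _)
  rw [← bidSet_union]
  refine h.flowLaw_bidSet_mono measurableSet_Ioc fun p hp => ?_
  have h1 : p ∈ Icc (0 : ℝ) 1 := Ioo_subset_Icc_self hp.2
  have h2 := hP.monotoneOn hx h1 hp.1.1.le
  rcases (hP.monotoneOn h1 hy hp.1.2).eq_or_lt with h3 | h3
  · exact Or.inr ⟨h1, h3⟩
  · exact Or.inl (mem_block.2 ⟨h1, h2, h3⟩)

lemma cdf_le_flowLaw_askSet (h : DensityPair fa fb m M) (hP : IsBinned P) {x : ℝ}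
    (hx : x ∈ Icc (0 : ℝ) 1) {v : ℝ} (hv : P x ≤ v) :
    cdf fa x / 2 ≤ (flowLaw fa fb).real (askSet {p ∈ Icc (0 : ℝ) 1 | P p ≤ v}) := by
  rw [← h.flowLaw_askSet_Iic hx]
  refine h.flowLaw_askSet_mono measurableSet_Iic fun p hp => ?_
  have h1 : p ∈ Icc (0 : ℝ) 1 := Ioo_subset_Icc_self hp.2
  exact ⟨h1, (hP.monotoneOn h1 hx hp.1).trans hv⟩

lemma flowLaw_askSet_le_cdf (h : DensityPair fa fb m M) (hP : IsBinned P) {y : ℝ}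
    (hy : y ∈ Icc (0 : ℝ) 1) :
    (flowLaw fa fb).real (askSet {p ∈ Icc (0 : ℝ) 1 | P p < P y}) ≤ cdf fa y / 2 := by
  rw [← h.flowLaw_askSet_Iic hy]
  have := h.isProbabilityMeasure_flowLaw
  refine measureReal_mono fun e he => ⟨he.1, show e.2.2 ≤ y from le_of_not_gt fun h1 => ?_⟩
  exact absurd (hP.monotoneOn hy he.2.1 (le_of_lt h1)) (not_le.2 he.2.2)

end DensityPair

/-- Approximate balance relations for a path up to some time, as seen by the bids. Here `a x` and
`b x` stand for the fractions of arrivals finding no ask below and no bid above the bin of `x`, and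
`d` for the empirical density of the best bid. -/
structure BidEstimates (fa fb P : ℝ → ℝ) (κ δ : ℝ) (a b d : ℝ → ℝ) (c : ℝ → ℝ → ℝ) : Prop where
  a_mem : ∀ x, a x ∈ Icc (0 : ℝ) 1
  b_mem : ∀ x, b x ∈ Icc (0 : ℝ) 1
  a_meas : AEStronglyMeasurable a (volume.restrict (Ioo 0 1))
  one_le : ∀ x ∈ Icc (0 : ℝ) 1, 1 ≤ a x + b x
  mono : ∀ x ∈ Icc (0 : ℝ) 1, ∀ y ∈ Icc (0 : ℝ) 1, x ≤ y → b x ≤ b y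
  up : ∀ x ∈ Icc (0 : ℝ) 1, ∀ y ∈ Icc (0 : ℝ) 1, x ≤ y →
    cdf fa x * (b y - b x) ≤ (cdf fb y - cdf fb x) * a x + δ
  lo : ∀ x ∈ Icc (0 : ℝ) 1, ∀ y ∈ Icc (0 : ℝ) 1, x ≤ y →
    (cdf fb y - cdf fb x) * a y ≤ cdf fa y * (b y - b x) + c x y + δ
  zero : ∀ x ∈ Icc (0 : ℝ) 1, x < κ → b x ≤ δ
  d_nonneg : ∀ x, 0 ≤ d x
  d_int : IntegrableOn d (Ioo 0 1)
  dens : ∀ x ∈ Ioo (0 : ℝ) 1, cdf fa x * d x ≤ binAverage P fb x * a x + δ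
  mass : ∀ x ∈ Ioo (0 : ℝ) 1,
    cdf fa x * (1 - b x) ≤ cdf fa x * (∫ y in Ioo (0 : ℝ) 1, d y) + δ
  low : ∀ x ∈ Icc (0 : ℝ) 1, ∀ y ∈ Icc (0 : ℝ) 1, P x < P y →
    ∫ z in Ioo (0 : ℝ) x, d z ≤ b y + δ

section Paths

variable {P : ℝ → ℝ} {init : Book} {o : ℕ → Order} {g : ℕ → ℝ}

lemma askFree_mem (L : ℕ) (v : ℝ) : askFree P init o L v ∈ Icc (0 : ℝ) 1 :=
  ⟨frac_nonneg _ _, frac_le_one _ _⟩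

lemma bidFree_mem (L : ℕ) (v : ℝ) : bidFree P init o L v ∈ Icc (0 : ℝ) 1 :=
  ⟨frac_nonneg _ _, frac_le_one _ _⟩

lemma frac_true {L : ℕ} (hL : L ≠ 0) : frac (fun _ => True) L = 1 := by
  have : (L : ℝ) ≠ 0 := by exact_mod_cast hL
  simp [frac, ind, this]

lemma frac_add (p q : ℕ → Prop) (L : ℕ) :
    frac p L + frac q L = (∑ n ∈ Finset.range L, (ind (p n) + ind (q n))) / L := by
  rw [frac, frac, ← add_div, Finset.sum_add_distrib]

/-- A bid at or above the bin of `v` and an ask at or below it would be compatible, so one of the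
two is always absent. -/
lemma one_le_askFree_add_bidFree (hb : ∀ n, (bookAfter P init o n).Admissible P) {L : ℕ}
    (hL : L ≠ 0) (v : ℝ) : 1 ≤ askFree P init o L v + bidFree P init o L v := by
  rw [← frac_true hL, askFree, bidFree, frac_add, frac]
  refine div_le_div_of_nonneg_right (Finset.sum_le_sum fun n _ => ?_) (Nat.cast_nonneg _)
  rw [ind_of_true trivial]
  by_cases h1 : (bookAfter P init o n).NoBid P v
  · rw [ind_of_true h1]; linarith [ind_nonneg ((bookAfter P init o n).NoAsk P v)]
  · have h2 : (bookAfter P init o n).NoAsk P v := by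
      simp only [Book.NoBid, not_forall, not_lt] at h1
      obtain ⟨p, hp, hpv⟩ := h1
      exact fun q hq => lt_of_not_ge fun h3 => (hb n).2.2 p hp q hq (h3.trans hpv)
    rw [ind_of_true h2]; linarith [ind_nonneg ((bookAfter P init o n).NoBid P v)]

lemma bidFree_mono (L : ℕ) {u v : ℝ} (huv : u ≤ v) :
    bidFree P init o L u ≤ bidFree P init o L v := frac_mono (fun _ h => h.mono huv) L

lemma sum_ind_mul_bidFrac (L : ℕ) (s : Finset ℝ) :
    ∑ v ∈ s, bidFrac P init o L v = (∑ n ∈ Finset.range L,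
      ∑ v ∈ s, ind ((bookAfter P init o n).BestBidIn (level P v))) / L := by
  rw [Finset.sum_comm, Finset.sum_div]
  rfl

/-- The best bid is above any price below which not all bids are. -/
lemma one_sub_bidFree_le (hP : IsBinned P) (hb : ∀ n, (bookAfter P init o n).Admissible P) {L : ℕ}
    (hL : L ≠ 0) (u : ℝ) :
    1 - bidFree P init o L u ≤ ∑ v ∈ hP.vals.filter (u ≤ ·), bidFrac P init o L v := by
  rw [sub_le_iff_le_add', sum_ind_mul_bidFrac, ← frac_true hL, bidFree, frac, frac, ← add_div,
    ← Finset.sum_add_distrib]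
  refine div_le_div_of_nonneg_right (Finset.sum_le_sum fun n _ => ?_) (Nat.cast_nonneg _)
  rw [ind_of_true trivial]
  by_cases h1 : (bookAfter P init o n).NoBid P u
  · rw [ind_of_true h1]
    linarith [Finset.sum_nonneg fun v (_ : v ∈ hP.vals.filter (u ≤ ·)) =>
      ind_nonneg ((bookAfter P init o n).BestBidIn (level P v))]
  · rw [ind_of_false h1, zero_add]
    simp only [Book.NoBid, not_forall, not_lt] at h1
    obtain ⟨p, hp, hpu⟩ := h1
    have hmem := Book.bestBid_mem (Book.ne_zero_of_mem hp)
    have hI := (hb n).1 _ hmem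
    have hv : P (bookAfter P init o n).bestBid ∈ hP.vals.filter (u ≤ ·) :=
      Finset.mem_filter.2 ⟨hP.mem_vals hI,
        hpu.trans (hP.monotoneOn ((hb n).1 _ hp) hI (Book.le_bestBid hp))⟩
    refine le_trans ?_ (Finset.single_le_sum (fun v _ => ind_nonneg _) hv)
    rw [ind_of_true ⟨Book.ne_zero_of_mem hp, hI, rfl⟩]

lemma sum_bidFrac_le (hP : IsBinned P) (hb : ∀ n, (bookAfter P init o n).Admissible P) (L : ℕ)
    {u w : ℝ} (huw : u < w) :
    ∑ v ∈ hP.vals.filter (· ≤ u), bidFrac P init o L v ≤ bidFree P init o L w := by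
  rw [sum_ind_mul_bidFrac, bidFree, frac]
  refine div_le_div_of_nonneg_right (Finset.sum_le_sum fun n _ => ?_) (Nat.cast_nonneg _)
  by_cases h1 : ∃ v ∈ hP.vals.filter (· ≤ u), (bookAfter P init o n).BestBidIn (level P v)
  · obtain ⟨v, hv, hne, hI, hvb⟩ := h1
    have h2 : (bookAfter P init o n).NoBid P w := fun p hp => by
      have := hP.monotoneOn ((hb n).1 _ hp) hI (Book.le_bestBid hp)
      exact (this.trans (hvb.le.trans (Finset.mem_filter.1 hv).2)).trans_lt huw
    rw [Finset.sum_eq_single_of_mem v hv fun w _ hwv => ind_of_false fun h3 =>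
      hwv (h3.2.2.symm.trans hvb), ind_of_true h2]
    exact ind_le_one _
  · push Not at h1
    rw [Finset.sum_eq_zero fun v hv => ind_of_false (h1 v hv)]
    exact ind_nonneg _

lemma bidTime_nonneg {t : ℝ} (ht : 0 ≤ t) (v : ℝ) : 0 ≤ bidTime P init g o t v :=
  div_nonneg measureReal_nonneg ht

lemma bidDensity_eq (t x : ℝ) :
    bidDensity P init g o t x = bidTime P init g o t (P x) / volume.real (level P (P x)) := by
  rw [bidTime, div_div]; rfl

lemma integrableOn_bidDensity (hP : IsBinned P) (t : ℝ) :
    IntegrableOn (bidDensity P init g o t) (Ioo 0 1) := by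
  refine IntegrableOn.congr_fun ((hP.integrableOn_comp fun v =>
    bidTime P init g o t v / volume.real (level P v)).mono_set Ioo_subset_Icc_self)
    (fun x _ => (bidDensity_eq t x).symm) measurableSet_Ioo

lemma integral_bidDensity (hP : IsBinned P) (t : ℝ) :
    ∫ x in Ioo (0 : ℝ) 1, bidDensity P init g o t x =
      ∑ v ∈ hP.vals.filter (fun v => volume.real (level P v) ≠ 0), bidTime P init g o t v := by
  simp_rw [bidDensity_eq]
  rw [hP.integral_comp fun v => bidTime P init g o t v / volume.real (level P v),
    Finset.sum_filter]
  refine Finset.sum_congr rfl fun v _ => ?_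
  split_ifs with h
  · field_simp
  · rw [not_not.1 h, zero_mul]

/-- Only an inequality holds: the bin of `x` may extend beyond `x`, and bins of length zero do not
contribute to the integral. -/
lemma setIntegral_bidDensity_le (hP : IsBinned P) {t : ℝ} (ht : 0 ≤ t) {x : ℝ}
    (hx : x ∈ Icc (0 : ℝ) 1) : ∫ z in Ioo (0 : ℝ) x, bidDensity P init g o t z ≤
      ∑ v ∈ hP.vals.filter (· ≤ P x), bidTime P init g o t v := by
  set G : ℝ → ℝ := fun v => if v ≤ P x then bidTime P init g o t v / volume.real (level P v) else 0
    with hG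
  have hG0 : ∀ v, 0 ≤ G v := fun v => by
    simp only [hG]; split_ifs
    · exact div_nonneg (bidTime_nonneg ht v) measureReal_nonneg
    · exact le_rfl
  have h1 : ∫ z in Ioo (0 : ℝ) x, bidDensity P init g o t z = ∫ z in Ioo (0 : ℝ) x, G (P z) := by
    refine setIntegral_congr_fun measurableSet_Ioo fun z hz => ?_
    have hz1 : z ∈ Icc (0 : ℝ) 1 := ⟨hz.1.le, hz.2.le.trans hx.2⟩
    simp only [hG, bidDensity_eq]
    rw [if_pos (hP.monotoneOn hz1 hx hz.2.le)]
  have h2 : ∫ z in Ioo (0 : ℝ) x, G (P z) ≤ ∫ z in Ioo (0 : ℝ) 1, G (P z) :=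
    setIntegral_mono_set ((hP.integrableOn_comp G).mono_set Ioo_subset_Icc_self)
      (Eventually.of_forall fun z => hG0 _) (Ioo_subset_Ioo_right hx.2).eventuallyLE
  rw [h1]
  refine h2.trans ?_
  rw [hP.integral_comp G, Finset.sum_filter]
  refine Finset.sum_le_sum fun v _ => ?_
  simp only [hG]
  split_ifs with h
  · by_cases h0 : volume.real (level P v) = 0
    · rw [h0, zero_mul]; exact bidTime_nonneg ht v
    · exact (mul_div_cancel₀ _ h0).le
  · simp

/-- The limiting behaviour of a path implies the approximate balance relations at late times. -/
theorem eventually_bidEstimates {fa fb : ℝ → ℝ} {m M κ : ℝ} (h : DensityPair fa fb m M)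
    (hl : BidLimits fa fb P init g o κ) {δ : ℝ} (hδ : 0 < δ)
    (hW : ∀ x ∈ Icc (0 : ℝ) 1, M * volume.real (bin P x) ≤ δ / 2) :
    ∀ᶠ t in atTop, BidEstimates fa fb P κ δ
      (fun x => askFree P init o (arrivalCount g t) (P x))
      (fun x => bidFree P init o (arrivalCount g t) (P x)) (bidDensity P init g o t)
      fun x y => 2 * (((bookAfter P init o (arrivalCount g t)).bidCount (block P (P x) (P y)) : ℝ) /
        arrivalCount g t) := by
  have hP := hl.binned
  have hM : 0 < M := h.pos.trans_le h.ask.le_bound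
  have hprob := h.isProbabilityMeasure_flowLaw
  have hAC := hl.gaps.tendsto_arrivalCount
  have hδ4 : 0 < δ / 4 := by positivity
  set c : ℝ := (hP.vals.card : ℝ) with hc
  -- An error of `δ₁` in each of the `c` bins adds up to at most `δ / 2`.
  set δ₁ : ℝ := δ / (2 * (c + 1)) with hδ₁
  have hc0 : 0 ≤ c := Nat.cast_nonneg _
  have hδ₁0 : 0 < δ₁ := by positivity
  have hcδ : c * δ₁ ≤ δ / 2 := by
    rw [hδ₁, mul_div_assoc', div_le_div_iff₀ (by positivity) two_pos]
    nlinarith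
  have hup := (Finset.eventually_all _).2 fun u hu => (Finset.eventually_all _).2 fun w hw =>
    eventually_imp_distrib_left.2 fun huw => hAC.eventually (hl.up u hu w hw huw _ hδ4)
  have hlo := (Finset.eventually_all _).2 fun u hu => (Finset.eventually_all _).2 fun w hw =>
    eventually_imp_distrib_left.2 fun huw => hAC.eventually (hl.lo u hu w hw huw _ hδ4)
  have htime : ∀ᶠ t in atTop, ∀ v ∈ hP.vals,
      |bidTime P init g o t v - bidFrac P init o (arrivalCount g t) v| < δ₁ :=
    (Finset.eventually_all _).2 fun v hv => by
      simpa using (hl.time v hv).abs.eventually (gt_mem_nhds (by simpa using hδ₁0))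
  have hlev : ∀ δ' > 0, ∀ v ∈ hP.vals, ∀ᶠ t in atTop,
      2 * (flowLaw fa fb).real (askSet {p ∈ Icc (0 : ℝ) 1 | P p ≤ v}) * bidTime P init g o t v ≤
        2 * (flowLaw fa fb).real (bidSet (level P v)) * askFree P init o (arrivalCount g t) v +
          δ' := by
    intro δ' hδ' v hv
    filter_upwards [hAC.eventually (hl.level v hv (δ' / 4) (by positivity)),
      (hl.time v hv).abs.eventually (gt_mem_nhds (show |(0 : ℝ)| < δ' / 4 by
        rw [abs_zero]; positivity))] with t h1 h2
    have h3 := (abs_lt.1 h2).2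
    have h4 : (flowLaw fa fb).real (askSet {p ∈ Icc (0 : ℝ) 1 | P p ≤ v}) ≤ 1 :=
      measureReal_le_one
    have h5 : 0 ≤ (flowLaw fa fb).real (askSet {p ∈ Icc (0 : ℝ) 1 | P p ≤ v}) :=
      measureReal_nonneg
    nlinarith
  have hlev1 := (Finset.eventually_all _).2 (hlev δ₁ hδ₁0)
  -- For the density the error must be proportional to the length of the bin, because it is divided
  -- by that length. There are finitely many bins, so this is still an eventual property.
  have hlev2 : ∀ᶠ t in atTop, ∀ v ∈ hP.vals, 0 < volume.real (level P v) →
      2 * (flowLaw fa fb).real (askSet {p ∈ Icc (0 : ℝ) 1 | P p ≤ v}) * bidTime P init g o t v ≤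
        2 * (flowLaw fa fb).real (bidSet (level P v)) * askFree P init o (arrivalCount g t) v +
          δ * volume.real (level P v) :=
    (Finset.eventually_all _).2 fun v hv => eventually_imp_distrib_left.2 fun hpos =>
      hlev _ (by positivity) v hv
  have hzero : ∀ᶠ t in atTop, ∀ v ∈ hP.vals, (∃ x ∈ Icc (0 : ℝ) 1, x < κ ∧ P x = v) →
      bidFree P init o (arrivalCount g t) v ≤ δ :=
    (Finset.eventually_all _).2 fun v _ => eventually_imp_distrib_left.2 fun ⟨x, hx, hxκ, hxv⟩ => by
      have := hAC.eventually (hl.zero x hx hxκ δ hδ)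
      rwa [hxv] at this
  filter_upwards [hup, hlo, htime, hlev1, hlev2, hzero, hAC.eventually_ne_atTop 0,
    eventually_ge_atTop 0] with t hup hlo htime hlev1 hlev2 hzero hL ht
  set L := arrivalCount g t with hLdef
  have hv : ∀ x ∈ Icc (0 : ℝ) 1, P x ∈ hP.vals := fun x hx => hP.mem_vals hx
  have hbm : ∀ x ∈ Icc (0 : ℝ) 1, ∀ y ∈ Icc (0 : ℝ) 1, x ≤ y →
      0 ≤ bidFree P init o L (P y) - bidFree P init o L (P x) := fun x hx y hy hxy =>
    sub_nonneg.2 (bidFree_mono L (hP.monotoneOn hx hy hxy))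
  have hcdf : ∀ x ∈ Icc (0 : ℝ) 1, 0 ≤ cdf fa x ∧ cdf fa x ≤ 1 := fun x hx =>
    h.ask.cdf_mem_Icc h.pos hx
  have hsplit : ∀ v ∈ hP.vals, bidFrac P init o L v ≤ bidTime P init g o t v + δ₁ ∧
      bidTime P init g o t v ≤ bidFrac P init o L v + δ₁ := fun v hv => by
    have := abs_lt.1 (htime v hv)
    exact ⟨by linarith, by linarith⟩
  have hcard : ∀ p : ℝ → Prop, [DecidablePred p] → ((hP.vals.filter p).card : ℝ) * δ₁ ≤ δ / 2 := by
    intro p _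
    refine le_trans (mul_le_mul_of_nonneg_right ?_ hδ₁0.le) hcδ
    rw [hc]
    exact Nat.cast_le.2 (Finset.card_filter_le _ _)
  refine
    { a_mem := fun x => askFree_mem L _
      b_mem := fun x => bidFree_mem L _
      a_meas := ((hP.integrableOn_comp fun v => askFree P init o L v).mono_set
        Ioo_subset_Icc_self).aestronglyMeasurable
      one_le := fun x hx => one_le_askFree_add_bidFree hl.admissible hL _
      mono := fun x hx y hy hxy => sub_nonneg.1 (hbm x hx y hy hxy)
      up := fun x hx y hy hxy => ?_
      lo := fun x hx y hy hxy => ?_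
      zero := fun x hx hxκ => hzero _ (hv x hx) ⟨x, hx, hxκ, rfl⟩
      d_nonneg := fun x => by
        rw [bidDensity_eq]
        exact div_nonneg (bidTime_nonneg ht _) measureReal_nonneg
      d_int := integrableOn_bidDensity hP t
      dens := fun x hx => ?_
      mass := fun x hx => ?_
      low := fun x hx y hy hxy => ?_ }
  -- An order is of the right type with probability `1/2`, so the relation is doubled: the error `δ
  -- / 4` becomes `δ / 2`, and the bin at the edge adds at most `δ / 2`.
  · have h1 := hup _ (hv x hx) _ (hv y hy) (hP.monotoneOn hx hy hxy)
    have h2 := h.flowLaw_block_le hP hx hy hxy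
    have h3 := h.cdf_le_flowLaw_askSet hP hx (le_refl (P x))
    have h4 := hbm x hx y hy hxy
    have h5 := hW x hx
    have h6 := askFree_mem (P := P) (init := init) (o := o) L (P x)
    have h7 := mul_le_mul_of_nonneg_right h3 h4
    have h8 := mul_le_mul_of_nonneg_right h2 h6.1
    have h9 : M * volume.real (bin P x) * askFree P init o L (P x) ≤ δ / 2 :=
      (mul_le_of_le_one_right (by positivity) h6.2).trans h5
    linarith
  · have h1 := hlo _ (hv x hx) _ (hv y hy) (hP.monotoneOn hx hy hxy)
    have h2 := h.le_flowLaw_block hP hx hy hxy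
    have h3 := h.flowLaw_askSet_le_cdf hP hy
    have h4 := hbm x hx y hy hxy
    have h5 := hW y hy
    have h6 := askFree_mem (P := P) (init := init) (o := o) L (P y)
    have h7 := mul_le_mul_of_nonneg_right h3 h4
    have h8 := mul_le_mul_of_nonneg_right h2 h6.1
    have h9 : M * volume.real (bin P y) * askFree P init o L (P y) ≤ δ / 2 :=
      (mul_le_of_le_one_right (by positivity) h6.2).trans h5
    linarith
  · have hxI := Ioo_subset_Icc_self hx
    have h6 := askFree_mem (P := P) (init := init) (o := o) L (P x)
    rw [bidDensity_eq, binAverage, bin_eq_level]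
    rcases (measureReal_nonneg (μ := volume) (s := level P (P x))).eq_or_lt with h0 | h0
    · rw [← h0]; simpa using hδ.le
    · have h1 := hlev2 _ (hv x hxI) h0
      rw [h.flowLaw_bidSet_level hP] at h1
      have h3 := mul_le_mul_of_nonneg_right (h.cdf_le_flowLaw_askSet hP hxI (le_refl (P x)))
        (bidTime_nonneg (P := P) (init := init) (g := g) (o := o) ht (P x))
      rw [mul_div_assoc', div_mul_eq_mul_div, div_add' _ _ _ h0.ne', div_le_div_iff_of_pos_right h0]
      linarith
  · have hxI := Ioo_subset_Icc_self hx
    have hx1 := hcdf x hxI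
    rw [integral_bidDensity hP]
    have h1 := one_sub_bidFree_le hP hl.admissible hL (P x)
    have h2 : ∑ v ∈ hP.vals.filter (P x ≤ ·), bidFrac P init o L v ≤
        ∑ v ∈ hP.vals.filter (P x ≤ ·), bidTime P init g o t v + δ / 2 := by
      refine (Finset.sum_le_sum fun v hv => (hsplit v (Finset.mem_filter.1 hv).1).1).trans ?_
      rw [Finset.sum_add_distrib, Finset.sum_const, nsmul_eq_mul]
      exact add_le_add_right (hcard _) _
    have h3 : cdf fa x * ∑ v ∈ hP.vals.filter (P x ≤ ·), bidTime P init g o t v ≤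
        cdf fa x * ∑ v ∈ hP.vals.filter (fun v => volume.real (level P v) ≠ 0),
          bidTime P init g o t v + δ / 2 := by
      rw [← Finset.sum_filter_add_sum_filter_not (hP.vals.filter (P x ≤ ·))
        (fun v => volume.real (level P v) ≠ 0), mul_add]
      refine add_le_add (mul_le_mul_of_nonneg_left (Finset.sum_le_sum_of_subset_of_nonneg ?_
        fun v _ _ => bidTime_nonneg ht v) hx1.1) ?_
      · intro v hv
        rw [Finset.mem_filter, Finset.mem_filter] at hv
        exact Finset.mem_filter.2 ⟨hv.1.1, hv.2⟩
      -- The empirical density does not see bins of length zero. Bids almost never arrive there, so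
      -- the balance relation shows that the time spent in them is small once weighted by `F_a(x)`;
      -- this is why the estimate of the mass carries this factor.
      · rw [Finset.mul_sum, Finset.filter_filter]
        refine le_trans ?_ (hcard fun v => P x ≤ v ∧ ¬ volume.real (level P v) ≠ 0)
        rw [← nsmul_eq_mul, ← Finset.sum_const]
        refine Finset.sum_le_sum fun v hv => ?_
        obtain ⟨hv1, hv2, hv3⟩ := Finset.mem_filter.1 hv
        rw [not_not] at hv3
        have h4 := hlev1 v hv1
        have h5 := h.flowLaw_bidSet_level_le hP v
        rw [hv3, mul_zero, zero_div] at h5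
        have h6 := le_antisymm h5 measureReal_nonneg
        rw [h6, mul_zero, zero_mul, zero_add] at h4
        have h7 := mul_le_mul_of_nonneg_right (h.cdf_le_flowLaw_askSet hP hxI hv2)
          (bidTime_nonneg (P := P) (init := init) (g := g) (o := o) ht v)
        linarith
    have h4 := mul_le_mul_of_nonneg_left (h1.trans h2) hx1.1
    nlinarith
  · have h1 := setIntegral_bidDensity_le (init := init) (g := g) (o := o) hP ht hx
    have h2 := sum_bidFrac_le hP hl.admissible L hxy
    have h3 : ∑ v ∈ hP.vals.filter (· ≤ P x), bidTime P init g o t v ≤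
        ∑ v ∈ hP.vals.filter (· ≤ P x), bidFrac P init o L v + δ / 2 := by
      refine (Finset.sum_le_sum fun v hv => (hsplit v (Finset.mem_filter.1 hv).1).2).trans ?_
      rw [Finset.sum_add_distrib, Finset.sum_const, nsmul_eq_mul]
      exact add_le_add_right (hcard _) _
    linarith

end Paths

end

noncomputable section

/-! ### The length of the longest bin -/

/-- The length of the longest bin. -/
def mesh (P : ℝ → ℝ) : ℝ := ⨆ x : Icc (0 : ℝ) 1, volume.real (bin P x)

lemma volume_bin_le_one (P : ℝ → ℝ) (x : ℝ) : volume.real (bin P x) ≤ 1 := by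
  have h : volume.real (bin P x) ≤ volume.real (Icc (0 : ℝ) 1) :=
    measureReal_mono (fun y hy => hy.1) (by simp)
  simpa using h

lemma volume_bin_le_mesh {P : ℝ → ℝ} {x : ℝ} (hx : x ∈ Icc (0 : ℝ) 1) :
    volume.real (bin P x) ≤ mesh P :=
  le_ciSup (f := fun x : Icc (0 : ℝ) 1 => volume.real (bin P x))
    ⟨1, by rintro _ ⟨y, rfl⟩; exact volume_bin_le_one P y⟩ ⟨x, hx⟩

lemma mesh_nonneg (P : ℝ → ℝ) : 0 ≤ mesh P :=
  measureReal_nonneg.trans (volume_bin_le_mesh (x := 0) (by simp))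

lemma BinsShrink.tendsto_mesh {P : ℕ → ℝ → ℝ} (h : BinsShrink P) :
    Tendsto (fun N => mesh (P N)) atTop (𝓝 0) := by
  refine tendsto_order.2 ⟨fun a ha => Eventually.of_forall fun N => ha.trans_le (mesh_nonneg _),
    fun a ha => ?_⟩
  filter_upwards [h (a / 2) (by positivity)] with N hN
  have : Nonempty (Icc (0 : ℝ) 1) := ⟨⟨0, by simp⟩⟩
  exact (ciSup_le fun x : Icc (0 : ℝ) 1 => (hN x x.2).le).trans_lt (by linarith)

lemma BinsShrink.comp {P : ℕ → ℝ → ℝ} (h : BinsShrink P) {N : ℕ → ℕ} (hN : Tendsto N atTop atTop) :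
    BinsShrink fun i => P (N i) := fun η hη => hN.eventually (h η hη)

lemma preimage_bin (P : ℝ → ℝ) (x : ℝ) : bin (reflectPrice P) x = (1 - ·) ⁻¹' bin P (1 - x) := by
  ext y
  simp only [bin, reflectPrice, mem_preimage, mem_ofPred_eq, mem_Icc, sub_right_inj]
  refine and_congr_left fun _ => ?_
  constructor <;> rintro ⟨h1, h2⟩ <;> constructor <;> linarith

lemma volume_real_preimage_one_sub (s : Set ℝ) : volume.real ((1 - ·) ⁻¹' s) = volume.real s := by
  rw [measureReal_def, measureReal_def,
    (Measure.measurePreserving_sub_left volume (1 : ℝ)).measure_preimage_emb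
      (MeasurableEquiv.subLeft (1 : ℝ)).measurableEmbedding s]

lemma volume_bin_reflect (P : ℝ → ℝ) (x : ℝ) :
    volume.real (bin (reflectPrice P) x) = volume.real (bin P (1 - x)) := by
  rw [preimage_bin, volume_real_preimage_one_sub]

lemma BinsShrink.reflect {P : ℕ → ℝ → ℝ} (h : BinsShrink P) :
    BinsShrink fun N => reflectPrice (P N) := fun η hη => by
  filter_upwards [h η hη] with N hN x hx
  rw [volume_bin_reflect]
  exact hN _ ⟨by linarith [hx.2], by linarith [hx.1]⟩

namespace IsBinned

variable {P : ℝ → ℝ}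

lemma sub_le_mesh (hP : IsBinned P) {x y : ℝ} (hx : x ∈ Icc (0 : ℝ) 1) (hy : y ∈ Icc (0 : ℝ) 1)
    (h : P y ≤ P x) : y - x ≤ mesh P := by
  rcases le_or_gt y x with hxy | hxy
  · linarith [mesh_nonneg P]
  · have h1 : P y = P x := le_antisymm h (hP.monotoneOn hx hy hxy.le)
    have hsub : Icc x y ⊆ bin P x := (hP.ordConnected_level (P x)).out ⟨hx, rfl⟩ ⟨hy, h1⟩
    have h2 : volume.real (Icc x y) ≤ volume.real (bin P x) :=
      measureReal_mono hsub (volume_level_lt_top P (P x)).ne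
    rw [Real.volume_real_Icc_of_le hxy.le] at h2
    exact h2.trans (volume_bin_le_mesh hx)

lemma sSup_bin_le (hP : IsBinned P) {x : ℝ} (hx : x ∈ Icc (0 : ℝ) 1) :
    sSup (bin P x) ≤ x + mesh P :=
  csSup_le ⟨x, mem_bin_self hx⟩ fun y hy => by linarith [hP.sub_le_mesh hx hy.1 hy.2.le]

lemma le_sInf_bin (hP : IsBinned P) {x : ℝ} (hx : x ∈ Icc (0 : ℝ) 1) :
    x - mesh P ≤ sInf (bin P x) :=
  le_csInf ⟨x, mem_bin_self hx⟩ fun y hy => by linarith [hP.sub_le_mesh hy.1 hx hy.2.ge]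

end IsBinned

/-! ### Convergence of the empirical densities -/

/-- The empirical densities converge if the probabilities of free arrivals do. -/
theorem tendsto_integral_of_bidEstimates {fa fb : ℝ → ℝ} {m M : ℝ} (h : DensityPair fa fb m M)
    {P : ℕ → ℝ → ℝ} (hP : ∀ i, IsBinned (P i)) (hs : BinsShrink P) {k δ : ℕ → ℝ}
    {a b d : ℕ → ℝ → ℝ} {c : ℕ → ℝ → ℝ → ℝ}
    (hE : ∀ i, BidEstimates fa fb (P i) (k i) (δ i) (a i) (b i) (d i) (c i))
    (hδ : Tendsto δ atTop (𝓝 0)) {κ κ' : ℝ} {A π : ℝ → ℝ}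
    (hκ : 0 < κ) (hκκ : κ < κ') (hκ' : κ' < 1)
    (hA : Continuous A) (hA1 : ∀ x ≤ κ, A x = 1) (hA0 : ∀ x, κ' ≤ x → A x = 0)
    (hπ : ∀ x ∈ Ioo κ κ', π x = fb x * A x / cdf fa x) (hπ0 : ∀ x, x ∉ Ioo κ κ' → π x = 0)
    (hπi : IntegrableOn π (Ioo 0 1)) (hπ1 : ∫ x in Ioo (0 : ℝ) 1, π x = 1)
    (ha : ∀ x ∈ Ioo (0 : ℝ) 1, Tendsto (fun i => a i x) atTop (𝓝 (A x)))
    (hb : ∀ x ∈ Ioo (0 : ℝ) 1, x < κ → Tendsto (fun i => b i x) atTop (𝓝 0)) :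
    ∀ η > 0, ∀ᶠ i in atTop, ∫ x in Ioo (0 : ℝ) 1, |d i x - π x| < η := by
  have hF : ∀ x ∈ Ioo (0 : ℝ) 1, 0 < cdf fa x := fun x hx => h.ask.cdf_pos h.pos hx.1 hx.2.le
  have hδe : ∀ δ' > 0, ∀ᶠ i in atTop, δ i ≤ δ' := fun δ' hδ' =>
    (hδ.eventually (gt_mem_nhds hδ')).mono fun i hi => hi.le
  refine tendsto_mean_of_upper_bound (F := cdf fa) (A := A) (κ := κ) (κ' := κ')
    (g := fun i => binAverage (P i) fb) (a := a) (b := b) h.bid h.pos hF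
    ((h.ask.strictMonoOn_cdf h.pos).monotoneOn.mono Ioo_subset_Icc_self) hκ hκκ hκ' hA
    (fun x => ?_) hA1 hA0 hπ hπ0 hπi hπ1 (fun i => (hE i).d_nonneg) (fun i => (hE i).d_int)
    (fun i => integrableOn_binAverage (hP i)) (tendsto_integral_binAverage h.bid h.pos hP hs)
    (fun i => (hE i).a_meas) (fun i => (hE i).a_mem) ha hb (fun δ' hδ' => ?_)
    (fun x hx δ' hδ' => ?_) fun x y hx hxy hy δ' hδ' => ?_
  · rcases le_or_gt x 0 with h0 | h0
    · rw [hA1 x (h0.trans hκ.le)]; simp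
    · rcases le_or_gt 1 x with h1 | h1
      · rw [hA0 x (hκ'.le.trans h1)]; simp
      · exact isClosed_Icc.mem_of_tendsto (ha x ⟨h0, h1⟩) (Eventually.of_forall fun i =>
          (hE i).a_mem x)
  · filter_upwards [hδe δ' hδ'] with i hi x hx
    exact ((hE i).dens x hx).trans (by linarith)
  -- At fixed `x` the factor `F_a(x)` is positive and can be divided out.
  · filter_upwards [hδe (δ' * cdf fa x) (mul_pos hδ' (hF x hx))] with i hi
    have h1 := (hE i).mass x hx
    have h2 := hF x hx
    refine le_of_mul_le_mul_left ?_ h2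
    linarith
  · have hxI : x ∈ Icc (0 : ℝ) 1 := ⟨hx.le, (hxy.trans hy).le⟩
    have hyI : y ∈ Icc (0 : ℝ) 1 := ⟨(hx.trans hxy).le, hy.le⟩
    filter_upwards [hδe δ' hδ', hs.tendsto_mesh.eventually (gt_mem_nhds (sub_pos.2 hxy))]
      with i hi hmi
    -- Once all bins are shorter than `y - x`, the two prices are in different bins.
    have hlt : P i x < P i y := lt_of_not_ge fun hle =>
      absurd ((hP i).sub_le_mesh hxI hyI hle) (not_le.2 hmi)
    exact ((hE i).low x hxI y hyI hlt).trans (by linarith)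

/-! ### States of the book at good times -/

section Reflect

variable {P : ℝ → ℝ} {init : Book} {o : ℕ → Order} {g : ℕ → ℝ}

lemma askFree_reflect (L : ℕ) (x : ℝ) :
    askFree (reflectPrice P) init.reflect (fun n => reflectOrder (o n)) L (reflectPrice P x) =
      bidFree P init o L (P (1 - x)) :=
  frac_congr (fun n => by rw [bookAfter_reflect]; exact Book.noAsk_reflect _) L

lemma bidFree_reflect (L : ℕ) (x : ℝ) :
    bidFree (reflectPrice P) init.reflect (fun n => reflectOrder (o n)) L (reflectPrice P x) =
      askFree P init o L (P (1 - x)) :=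
  frac_congr (fun n => by rw [bookAfter_reflect]; exact Book.noBid_reflect _) L

lemma bidDensity_reflect (t x : ℝ) :
    bidDensity (reflectPrice P) init.reflect g (fun n => reflectOrder (o n)) t x =
      askDensity P init g o t (1 - x) := by
  unfold bidDensity askDensity
  rw [volume_bin_reflect]
  congr 2
  ext s
  refine and_congr_right fun _ => ?_
  rw [bookAt, bookAfter_reflect, preimage_bin]
  exact Book.bestBidIn_reflect _

end Reflect

/-- The state of a binned book at a late good time. -/
structure GoodState (fa fb P : ℝ → ℝ) (init : Book) (g : ℕ → ℝ) (o : ℕ → Order)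
    (k c M ε δ t : ℝ) : Prop where
  bid : BidEstimates fa fb P k δ
    (fun x => askFree P init o (arrivalCount g t) (P x))
    (fun x => bidFree P init o (arrivalCount g t) (P x)) (bidDensity P init g o t)
    fun x y => 2 * (((bookAfter P init o (arrivalCount g t)).bidCount (block P (P x) (P y)) : ℝ) /
        arrivalCount g t)
  ask : BidEstimates (fun x => fb (1 - x)) (fun x => fa (1 - x)) (reflectPrice P) (1 - c) δ
    (fun x => bidFree P init o (arrivalCount g t) (P (1 - x)))
    (fun x => askFree P init o (arrivalCount g t) (P (1 - x)))
    (fun x => askDensity P init g o t (1 - x))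
    fun x y => 2 * (((bookAfter P init o (arrivalCount g t)).reflect.bidCount
      (block (reflectPrice P) (reflectPrice P x) (reflectPrice P y)) : ℝ) / arrivalCount g t)
  bids_le : ∀ p ∈ (bookAt P init g o t).bids, p ≤ sSup (bin P k) + ε
  card_asks : (((bookAt P init g o t).asks.filter (fun q => q < sInf (bin P c) - ε)).card : ℝ) ≤
    2 * (M + 1) * ε * t
  pos : 0 < t
  le_count : t ≤ arrivalCount g t
  admissible : (bookAt P init g o t).Admissible P

/-- The tolerance `ε + 2 M mesh` leaves room for the probability of one bin, at most `M mesh`, in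
half of it. Time is eventually less than the number of arrivals since their ratio tends to `1/2`. -/
theorem eventually_goodState {fa fb P : ℝ → ℝ} {m M k c ε : ℝ} {init : Book} {g : ℕ → ℝ}
    {o : ℕ → Order} {T : ℕ → ℝ} (h : DensityPair fa fb m M)
    (hl : BidLimits fa fb P init g o k)
    (hl' : BidLimits (fun x => fb (1 - x)) (fun x => fa (1 - x)) (reflectPrice P) init.reflect g
      (fun n => reflectOrder (o n)) (1 - c)) (hε : 0 < ε)
    (hT : IsGoodTimes P init g o k c M ε T) :
    ∀ᶠ n in atTop, GoodState fa fb P init g o k c M ε (ε + 2 * M * mesh P) (T n) := by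
  have hM : 0 < M := h.pos.trans_le h.ask.le_bound
  have hδ : 0 < ε + 2 * M * mesh P := by
    have := mesh_nonneg P
    positivity
  have h1 := eventually_bidEstimates h hl hδ fun x hx => by
    have := mul_le_mul_of_nonneg_left (volume_bin_le_mesh (P := P) hx) hM.le
    linarith
  have h2 := eventually_bidEstimates h.reflect hl' hδ fun x hx => by
    rw [volume_bin_reflect]
    have := mul_le_mul_of_nonneg_left (volume_bin_le_mesh (P := P)
      (show 1 - x ∈ Icc (0 : ℝ) 1 from ⟨by linarith [hx.2], by linarith [hx.1]⟩)) hM.le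
    linarith
  have h3 : ∀ᶠ t : ℝ in atTop, t / arrivalCount g t < 1 :=
    hl.gaps.tendsto_div_arrivalCount.eventually (gt_mem_nhds (by norm_num))
  filter_upwards [hT.1.eventually h1, hT.1.eventually h2, hT.1.eventually h3,
    hT.1.eventually (hl.gaps.tendsto_arrivalCount.eventually_gt_atTop 0),
    hT.1.eventually_gt_atTop 0] with n h1 h2 h3 h4 h5
  have h4' : (0 : ℝ) < arrivalCount g (T n) := by exact_mod_cast h4
  rw [div_lt_one h4'] at h3
  simp only [askFree_reflect, bidFree_reflect, bookAfter_reflect] at h2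
  rw [show bidDensity (reflectPrice P) init.reflect g (fun n => reflectOrder (o n)) (T n) =
    fun x => askDensity P init g o (T n) (1 - x) from funext fun x => bidDensity_reflect _ x] at h2
  exact ⟨h1, h2, (hT.2 n).1, (hT.2 n).2, h5, h3.le, hl.admissible _⟩

namespace GoodState

variable {fa fb P : ℝ → ℝ} {m M k c ε δ t : ℝ} {init : Book} {g : ℕ → ℝ} {o : ℕ → Order}

/-- All bids are below the end of the bin of `k` plus `ε`, while the block begins at most one bin
length below `x`; hence two mesh sizes of separation suffice. -/
lemma bidCount_eq_zero (hs : GoodState fa fb P init g o k c M ε δ t) (hP : IsBinned P)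
    (hk : k ∈ Icc (0 : ℝ) 1) {x : ℝ} (hx : x ∈ Icc (0 : ℝ) 1) (hkx : k + 2 * mesh P + ε < x)
    (w : ℝ) : (bookAfter P init o (arrivalCount g t)).bidCount (block P (P x) w) = 0 := by
  rw [Book.bidCount_eq_zero]
  intro p hp hpb
  obtain ⟨h1, h2, -⟩ := mem_block.1 hpb
  have h3 := hs.bids_le p hp
  have h4 := hP.sSup_bin_le hk
  have h5 := hP.sub_le_mesh h1 hx h2
  linarith

/-- The asks in the block are below the bin of `c` by more than `ε`, and a good time has at most `2
(M + 1) ε t` of these. The bound `t ≤ arrivalCount g t` and the factor `2` in the balance relation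
give the constant. -/
lemma bidCount_reflect_div_le (hs : GoodState fa fb P init g o k c M ε δ t) (hP : IsBinned P)
    (hM : 0 < M) (hε : 0 < ε)
    (hc : c ∈ Icc (0 : ℝ) 1) {y : ℝ} (hy : y ∈ Icc (0 : ℝ) 1) (hyc : y + 2 * mesh P + ε < c)
    (w : ℝ) : 2 * (((bookAfter P init o (arrivalCount g t)).reflect.bidCount
      (block (reflectPrice P) (reflectPrice P (1 - y)) w) : ℝ) / arrivalCount g t) ≤
        4 * (M + 1) * ε := by
  classical
  have hL : (0 : ℝ) < arrivalCount g t := hs.pos.trans_le hs.le_count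
  have h1 : (bookAfter P init o (arrivalCount g t)).reflect.bidCount
      (block (reflectPrice P) (reflectPrice P (1 - y)) w) ≤
      ((bookAt P init g o t).asks.filter (fun q => q < sInf (bin P c) - ε)).card := by
    rw [Book.bidCount, Book.reflect, Multiset.countP_map]
    refine Multiset.card_le_card ?_
    rw [Multiset.le_filter]
    refine ⟨Multiset.filter_le _ _, fun q hq => ?_⟩
    obtain ⟨hq1, hq2⟩ := Multiset.mem_filter.1 hq
    obtain ⟨-, h2, -⟩ := mem_block.1 hq2
    simp only [reflectPrice, sub_sub_cancel] at h2
    have h4 := hP.le_sInf_bin hc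
    have h5 := hP.sub_le_mesh hy (hs.admissible.2.1 q hq1) (by linarith)
    linarith
  have h2 : ((bookAfter P init o (arrivalCount g t)).reflect.bidCount
      (block (reflectPrice P) (reflectPrice P (1 - y)) w) : ℝ) ≤ 2 * (M + 1) * ε * t :=
    le_trans (by exact_mod_cast h1) hs.card_asks
  have h3 : 2 * (M + 1) * ε * t ≤ 2 * (M + 1) * ε * arrivalCount g t := by
    have := hs.le_count
    gcongr
  rw [← mul_div_assoc, div_le_iff₀ hL]
  linarith

end GoodState

end

noncomputable section

/-! ### Convergence along sequences of good states -/

lemma setIntegral_one_sub (G : ℝ → ℝ) :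
    ∫ x in Ioo (0 : ℝ) 1, G (1 - x) = ∫ x in Ioo (0 : ℝ) 1, G x := by
  rw [← integral_Ioc_eq_integral_Ioo, ← integral_Ioc_eq_integral_Ioo,
    ← intervalIntegral.integral_of_le zero_le_one, ← intervalIntegral.integral_of_le zero_le_one]
  simp

section GoodStates

variable {fa fb : ℝ → ℝ} {m M : ℝ} {P : ℕ → ℝ → ℝ} {k c ε t : ℕ → ℝ} {init : ℕ → Book}
  {g : ℕ → ℝ} {o : ℕ → Order}

lemma tendsto_error (hsh : BinsShrink P) (hε : Tendsto ε atTop (𝓝 0)) :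
    Tendsto (fun i => ε i + 2 * M * mesh (P i)) atTop (𝓝 0) := by
  simpa using hε.add (hsh.tendsto_mesh.const_mul (2 * M))

/-- The estimates for bids give the inequalities for `b`, and those of the reflected book the
inequalities for `a`, with the order of prices reversed. The error terms of the converse
inequalities vanish by the choice of good times. -/
theorem approxInequalities_of_goodState (h : DensityPair fa fb m M) (hP : ∀ i, IsBinned (P i))
    (hsh : BinsShrink P) (hk : ∀ i, k i ∈ Icc (0 : ℝ) 1) (hc : ∀ i, c i ∈ Icc (0 : ℝ) 1)
    (hbal : ∀ i, cdf fb (k i) = 1 - cdf fa (c i)) (hε0 : ∀ i, 0 < ε i)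
    (hε : Tendsto ε atTop (𝓝 0))
    (hs : ∀ i, GoodState fa fb (P i) (init i) g o (k i) (c i) M (ε i)
      (ε i + 2 * M * mesh (P i)) (t i)) :
    ApproxInequalities atTop fa fb k c
      (fun i x => askFree (P i) (init i) o (arrivalCount g (t i)) (P i x))
      (fun i x => bidFree (P i) (init i) o (arrivalCount g (t i)) (P i x)) := by
  have hM : 0 < M := h.pos.trans_le h.ask.le_bound
  have hδe : ∀ δ > 0, ∀ᶠ i in atTop, ε i + 2 * M * mesh (P i) ≤ δ := fun δ hδ =>
    ((tendsto_error (M := M) hsh hε).eventually (gt_mem_nhds hδ)).mono fun i hi => hi.le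
  have hme : ∀ δ > 0, ∀ᶠ i in atTop, 2 * mesh (P i) + ε i ≤ δ := fun δ hδ => by
    have : Tendsto (fun i => 2 * mesh (P i) + ε i) atTop (𝓝 0) := by
      simpa using (hsh.tendsto_mesh.const_mul 2).add hε
    exact (this.eventually (gt_mem_nhds hδ)).mono fun i hi => hi.le
  have hεe : ∀ δ > 0, ∀ᶠ i in atTop, 4 * (M + 1) * ε i ≤ δ := fun δ hδ => by
    have : Tendsto (fun i => 4 * (M + 1) * ε i) atTop (𝓝 0) := by
      simpa using hε.const_mul (4 * (M + 1))
    exact (this.eventually (gt_mem_nhds hδ)).mono fun i hi => hi.le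
  have hfa : ∀ x ∈ Icc (0 : ℝ) 1, cdf (fun x => fa (1 - x)) (1 - x) = 1 - cdf fa x := fun x hx => by
    rw [h.ask.cdf_reflect h.pos ⟨by linarith [hx.2], by linarith [hx.1]⟩, sub_sub_cancel]
  have hfb : ∀ x ∈ Icc (0 : ℝ) 1, cdf (fun x => fb (1 - x)) (1 - x) = 1 - cdf fb x := fun x hx => by
    rw [h.bid.cdf_reflect h.pos ⟨by linarith [hx.2], by linarith [hx.1]⟩, sub_sub_cancel]
  have hr : ∀ x ∈ Icc (0 : ℝ) 1, 1 - x ∈ Icc (0 : ℝ) 1 := fun x hx =>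
    ⟨by linarith [hx.2], by linarith [hx.1]⟩
  have hI : ∀ x y : ℝ, 0 < x → x < y → y < 1 → x ∈ Icc (0 : ℝ) 1 ∧ y ∈ Icc (0 : ℝ) 1 :=
    fun x y hx hxy hy => ⟨⟨hx.le, (hxy.trans hy).le⟩, ⟨(hx.trans hxy).le, hy.le⟩⟩
  refine
    { k_mem := hk
      c_mem := hc
      balance := hbal
      a_mem := fun i x => (hs i).bid.a_mem x
      b_mem := fun i x => (hs i).bid.b_mem x
      one_le := fun x hx => Eventually.of_forall fun i =>
        (hs i).bid.one_le x (Ioo_subset_Icc_self hx)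
      anti := fun x y hx hxy hy => Eventually.of_forall fun i => ?_
      mono := fun x y hx hxy hy => Eventually.of_forall fun i =>
        (hs i).bid.mono x (hI x y hx hxy hy).1 y (hI x y hx hxy hy).2 hxy.le
      upB := fun x y hx hxy hy δ hδ => (hδe δ hδ).mono fun i hi => ?_
      loB := fun x y hx hxy hy δ hδ => ((hδe δ hδ).and (hme δ hδ)).mono fun i hi hkx => ?_
      upA := fun x y hx hxy hy δ hδ => (hδe δ hδ).mono fun i hi => ?_
      loA := fun x y hx hxy hy δ hδ => ((hδe (δ / 2) (by positivity)).and
        ((hme δ hδ).and (hεe (δ / 2) (by positivity)))).mono fun i hi hyc => ?_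
      zeroB := fun x hx δ hδ => (hδe δ hδ).mono fun i hi hxk =>
        ((hs i).bid.zero x (Ioo_subset_Icc_self hx) (by linarith)).trans hi
      zeroA := fun x hx δ hδ => (hδe δ hδ).mono fun i hi hcx => ?_ }
  · obtain ⟨h1, h2⟩ := hI x y hx hxy hy
    have := (hs i).ask.mono _ (hr y h2) _ (hr x h1) (by linarith)
    simpa only [sub_sub_cancel] using this
  · obtain ⟨h1, h2⟩ := hI x y hx hxy hy
    exact ((hs i).bid.up x h1 y h2 hxy.le).trans (by linarith)
  · obtain ⟨h1, h2⟩ := hI x y hx hxy hy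
    have h3 := (hs i).bid.lo x h1 y h2 hxy.le
    simp only [(hs i).bidCount_eq_zero (hP i) (hk i) h1 (by linarith) (P i y), Nat.cast_zero,
      zero_div, mul_zero, add_zero] at h3
    linarith
  · obtain ⟨h1, h2⟩ := hI x y hx hxy hy
    have h3 := (hs i).ask.up _ (hr y h2) _ (hr x h1) (by linarith)
    rw [hfb y h2, hfa x h1, hfa y h2] at h3
    simp only [sub_sub_cancel] at h3
    linarith
  · obtain ⟨h1, h2⟩ := hI x y hx hxy hy
    have h3 := (hs i).ask.lo _ (hr y h2) _ (hr x h1) (by linarith)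
    have h4 := (hs i).bidCount_reflect_div_le (hP i) hM (hε0 i) (hc i) h2 (by linarith)
      (reflectPrice (P i) (1 - x))
    rw [hfb x h1, hfa x h1, hfa y h2] at h3
    simp only [sub_sub_cancel] at h3
    linarith
  · have h1 := Ioo_subset_Icc_self hx
    have := (hs i).ask.zero _ (hr x h1) (by linarith)
    simp only [sub_sub_cancel] at this
    exact this.trans hi

lemma integrableOn_askDensity {P : ℝ → ℝ} {init : Book} (hP : IsBinned P) (t : ℝ) :
    IntegrableOn (askDensity P init g o t) (Ioo 0 1) := by
  have h1 : IntegrableOn (fun x => askDensity P init g o t (1 - x)) (Ioo 0 1) := by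
    simp_rw [← bidDensity_reflect]
    exact integrableOn_bidDensity hP.reflect t
  rw [← intervalIntegrable_iff_integrableOn_Ioo_of_le zero_le_one] at h1 ⊢
  have := h1.comp_sub_left 1
  simpa using this.symm

/-- Uniqueness in the limit first yields the thresholds and the free fractions at each price; the
empirical densities follow from these by the one-sided bounds, applied to the book and to its
reflection. -/
theorem tendsto_of_goodState (h : DensityPair fa fb m M) {κb κa : ℝ} {A B : ℝ → ℝ}
    (hp : LimitPair fa fb κb κa A B) (hP : ∀ i, IsBinned (P i))
    (hsh : BinsShrink P) (hk : ∀ i, k i ∈ Icc (0 : ℝ) 1) (hc : ∀ i, c i ∈ Icc (0 : ℝ) 1)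
    (hbal : ∀ i, cdf fb (k i) = 1 - cdf fa (c i)) (hε0 : ∀ i, 0 < ε i)
    (hε : Tendsto ε atTop (𝓝 0))
    (hs : ∀ i, GoodState fa fb (P i) (init i) g o (k i) (c i) M (ε i)
      (ε i + 2 * M * mesh (P i)) (t i)) :
    (Tendsto k atTop (𝓝 κb) ∧ Tendsto c atTop (𝓝 κa)) ∧
      (∀ η > 0, ∀ᶠ i in atTop, ∫ x in Ioo (0 : ℝ) 1,
        |bidDensity (P i) (init i) g o (t i) x - limitBid fa fb κb κa A x| < η) ∧
      ∀ η > 0, ∀ᶠ i in atTop, ∫ x in Ioo (0 : ℝ) 1,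
        |askDensity (P i) (init i) g o (t i) x - limitAsk fa fb κb κa B x| < η := by
  obtain ⟨h1, h2, h3⟩ :=
    (approxInequalities_of_goodState h hP hsh hk hc hbal hε0 hε hs).tendsto h hp
  have hδ := tendsto_error (M := M) hsh hε
  have hb0 : 0 < κb := (hp.Icc_subset h hp.left_mem).1
  have ha1 : κa < 1 := (hp.Icc_subset h hp.right_mem).2
  have hsub : Ioo κb κa ⊆ Ioo 0 1 := hp.Ioo_subset h
  have hone : ∀ ρ : ℝ → ℝ, IsDensityOn κb κa ρ → ∫ x in Ioo (0 : ℝ) 1, ρ x = 1 := fun ρ hρ => by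
    refine Eq.trans ?_ hρ.integral_eq_one
    exact setIntegral_eq_integral_of_forall_compl_eq_zero fun x hx =>
      hρ.support x fun hx' => hx (hsub hx')
  have hdb := hp.isDensityOn_bid h
  have hda := hp.isDensityOn_ask h
  refine ⟨⟨h1, h2⟩, ?_, ?_⟩
  · exact tendsto_integral_of_bidEstimates h hP hsh (fun i => (hs i).bid) hδ hb0 hp.lt ha1 hp.contA
      hp.A_of_le hp.A_of_ge (fun x hx => indicator_of_mem hx _) hdb.support
      hdb.integrable.integrableOn (hone _ hdb) (fun x hx => (h3 x hx).1) fun x hx hxκ => by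
        have := (h3 x hx).2
        rwa [hp.B_of_le x hxκ.le] at this
  · have hr : ∀ x ∈ Ioo (0 : ℝ) 1, 1 - x ∈ Ioo (0 : ℝ) 1 := fun x hx =>
      ⟨by linarith [hx.2], by linarith [hx.1]⟩
    have hrκ : ∀ x, x ∈ Ioo (1 - κa) (1 - κb) ↔ 1 - x ∈ Ioo κb κa := fun x =>
      ⟨fun hx => ⟨by linarith [hx.2], by linarith [hx.1]⟩,
        fun hx => ⟨by linarith [hx.2], by linarith [hx.1]⟩⟩
    have := tendsto_integral_of_bidEstimates h.reflect (fun i => (hP i).reflect) hsh.reflect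
      (fun i => (hs i).ask) hδ (κ := 1 - κa) (κ' := 1 - κb) (A := fun x => B (1 - x))
      (π := fun x => limitAsk fa fb κb κa B (1 - x)) (by linarith) (by linarith [hp.lt])
      (by linarith) (hp.contB.comp (continuous_const.sub continuous_id))
      (fun x hx => hp.B_of_ge _ (by linarith)) (fun x hx => hp.B_of_le _ (by linarith))
      (fun x hx => by
        have hx1 := (hrκ x).1 hx
        have hx0 := hr _ (hsub hx1)
        rw [sub_sub_cancel] at hx0
        rw [h.bid.cdf_reflect h.pos (Ioo_subset_Icc_self hx0), limitAsk, indicator_of_mem hx1])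
      (fun x hx => hda.support _ fun hx' => hx ((hrκ x).2 hx'))
      ((hda.integrable.comp_sub_left 1).integrableOn)
      ((setIntegral_one_sub _).trans (hone _ hda)) (fun x hx => (h3 _ (hr x hx)).2)
      fun x hx hxκ => by
        have := (h3 _ (hr x hx)).1
        rwa [hp.A_of_ge (1 - x) (by linarith)] at this
    intro η hη
    filter_upwards [this η hη] with i hi
    rwa [setIntegral_one_sub fun x =>
      |askDensity (P i) (init i) g o (t i) x - limitAsk fa fb κb κa B x|] at hi

end GoodStates

/-! ### The iterated limit -/

/-- If the joint limit failed, there would be a sequence of pairs `(N, ε)` along the filter, each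
with arbitrarily late bad times. For each pair one bad time is chosen so late that `Q` holds, which
contradicts convergence along sequences. -/
theorem convergesTo_of_sequences {d : ℕ → ℝ → ℝ → ℝ} {ρ : ℝ → ℝ}
    (hd : ∀ N t, IntegrableOn (d N t) (Ioo 0 1)) (hρ : IntegrableOn ρ (Ioo 0 1))
    {Q : ℕ → ℝ → ℝ → Prop} {T : ℕ → ℝ → ℕ → ℝ}
    (hT : ∀ N, ∀ ε > 0, ∀ᶠ n in atTop, Q N ε (T N ε n))
    (hseq : ∀ (N : ℕ → ℕ) (ε t : ℕ → ℝ), Tendsto N atTop atTop → (∀ i, 0 < ε i) →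
      Tendsto ε atTop (𝓝 0) → (∀ i, Q (N i) (ε i) (t i)) →
      ∀ η > 0, ∀ᶠ i in atTop, ∫ x in Ioo (0 : ℝ) 1, |d (N i) (t i) x - ρ x| < η) :
    ConvergesTo (fun N ε n x => d N (T N ε n) x) ρ := by
  intro η hη
  by_contra hcon
  have hpos : ∀ᶠ p : ℕ × ℝ in atTop ×ˢ 𝓝[>] (0 : ℝ), 0 < p.2 :=
    tendsto_snd.eventually self_mem_nhdsWithin
  obtain ⟨p, hp, hbad⟩ := exists_seq_forall_of_frequently
    ((not_eventually.1 hcon).and_eventually hpos)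
  have hex : ∀ i, ∃ n, Q (p i).1 (p i).2 (T (p i).1 (p i).2 n) ∧
      ¬ ∫⁻ x in Ioo (0 : ℝ) 1, ENNReal.ofReal |d (p i).1 (T (p i).1 (p i).2 n) x - ρ x| <
        ENNReal.ofReal η := fun i => by
    obtain ⟨n, h1, h2⟩ := ((not_eventually.1 (hbad i).1).and_eventually
      (hT (p i).1 (p i).2 (hbad i).2)).exists
    exact ⟨n, h2, h1⟩
  choose n hQ hn using hex
  have hp1 : Tendsto (fun i => (p i).1) atTop atTop := tendsto_fst.comp hp
  have hp2 : Tendsto (fun i => (p i).2) atTop (𝓝 0) :=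
    (tendsto_snd.comp hp).mono_right nhdsWithin_le_nhds
  obtain ⟨i, hi⟩ := (hseq _ _ _ hp1 (fun i => (hbad i).2) hp2 hQ η hη).exists
  refine hn i ?_
  have hint : IntegrableOn (fun x => |d (p i).1 (T (p i).1 (p i).2 (n i)) x - ρ x|) (Ioo 0 1) :=
    ((hd _ _).sub hρ).abs
  rw [← ofReal_integral_eq_lintegral_ofReal hint
    (Eventually.of_forall fun x => abs_nonneg _)]
  exact (ENNReal.ofReal_lt_ofReal_iff hη).2 hi

/-- Two limits are within `2 η` of each other in `L¹` for every `η`, by comparison with a common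
empirical density. -/
lemma ConvergesTo.ae_eq {d : ℕ → ℝ → ℕ → ℝ → ℝ} {ρ σ : ℝ → ℝ}
    (hd : ∀ N ε n, IntegrableOn (d N ε n) (Ioo 0 1)) (hρ : IntegrableOn ρ (Ioo 0 1))
    (hσ : IntegrableOn σ (Ioo 0 1)) (h1 : ConvergesTo d ρ) (h2 : ConvergesTo d σ) :
    ∀ᵐ x, x ∈ Ioo (0 : ℝ) 1 → ρ x = σ x := by
  have key : ∀ η > 0, ∫⁻ x in Ioo (0 : ℝ) 1, ENNReal.ofReal |ρ x - σ x| ≤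
      ENNReal.ofReal η + ENNReal.ofReal η := by
    intro η hη
    obtain ⟨p, hp1, hp2⟩ := ((h1 η hη).and (h2 η hη)).exists
    obtain ⟨n, hn1, hn2⟩ := (hp1.and hp2).exists
    refine le_trans ?_ (add_le_add hn1.le hn2.le)
    have hint : IntegrableOn (fun x => |d p.1 p.2 n x - ρ x|) (Ioo 0 1) :=
      ((hd p.1 p.2 n).sub hρ).abs
    rw [← lintegral_add_left' hint.aestronglyMeasurable.aemeasurable.ennreal_ofReal]
    refine lintegral_mono fun x => ?_
    rw [← ENNReal.ofReal_add (abs_nonneg _) (abs_nonneg _)]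
    refine ENNReal.ofReal_le_ofReal ?_
    rw [abs_sub_comm (d p.1 p.2 n x) (ρ x)]
    exact abs_sub_le _ _ _
  have hzero : ∫⁻ x in Ioo (0 : ℝ) 1, ENNReal.ofReal |ρ x - σ x| = 0 := by
    have hlim : Tendsto (fun η : ℝ => ENNReal.ofReal η + ENNReal.ofReal η) (𝓝[>] 0) (𝓝 0) := by
      have := (ENNReal.continuous_ofReal.tendsto 0).mono_left (nhdsWithin_le_nhds (s := Ioi 0))
      simpa using this.add this
    exact le_antisymm (ge_of_tendsto hlim (by
      filter_upwards [self_mem_nhdsWithin] with η hη using key η hη)) bot_le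
  have hint : IntegrableOn (fun x => |ρ x - σ x|) (Ioo 0 1) := (hρ.sub hσ).abs
  rw [lintegral_eq_zero_iff' hint.aestronglyMeasurable.aemeasurable.ennreal_ofReal,
    EventuallyEq, ae_restrict_iff' measurableSet_Ioo] at hzero
  filter_upwards [hzero] with x hx hx1
  have := ENNReal.ofReal_eq_zero.1 (hx hx1)
  exact sub_eq_zero.1 (abs_nonpos_iff.1 this)

lemma bidThreshold_congr {Ω : Type*} [MeasurableSpace Ω] {μ : Measure Ω} {P : ℝ → ℝ} {init : Book}
    {order order' : ℕ → Ω → Order} (h : ∀ᵐ ω ∂μ, ∀ n, order n ω = order' n ω) :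
    bidThreshold μ P init order = bidThreshold μ P init order' := by
  unfold bidThreshold
  congr 1
  ext x
  refine and_congr_right fun _ => eventually_congr ?_
  filter_upwards [h] with ω hω
  simp only [hω]

lemma askThreshold_congr {Ω : Type*} [MeasurableSpace Ω] {μ : Measure Ω} {P : ℝ → ℝ} {init : Book}
    {order order' : ℕ → Ω → Order} (h : ∀ᵐ ω ∂μ, ∀ n, order n ω = order' n ω) :
    askThreshold μ P init order = askThreshold μ P init order' := by
  unfold askThreshold
  congr 1
  ext x
  refine and_congr_right fun _ => eventually_congr ?_
  filter_upwards [h] with ω hω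
  simp only [hω]

end

noncomputable section

/-! ### Sequences of binned books driven by the same arrivals -/

section Sequences

variable {Ω : Type*} [MeasurableSpace Ω] {μ : Measure Ω} [IsProbabilityMeasure μ] {fa fb : ℝ → ℝ}
  {m M : ℝ} {gap : ℕ → Ω → ℝ} {order : ℕ → Ω → Order} {P : ℕ → ℝ → ℝ} {init : ℕ → Book}

/-- Almost surely, the book is in a good state at late good times. -/
lemma ae_eventually_goodState (h : ∀ N, BookModel μ fa fb m M gap order (P N) (init N)) :
    ∀ᵐ ω ∂μ, ∀ N, ∀ ε > 0, ∀ T : ℕ → ℝ,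
      IsGoodTimes (P N) (init N) (fun i => gap i ω) (fun i => order i ω)
        (bidThreshold μ (P N) (init N) order) (askThreshold μ (P N) (init N) order) M ε T →
      ∀ᶠ n in atTop, GoodState fa fb (P N) (init N) (fun i => gap i ω) (fun i => order i ω)
        (bidThreshold μ (P N) (init N) order) (askThreshold μ (P N) (init N) order) M ε
        (ε + 2 * M * mesh (P N)) (T n) := by
  have h1 : ∀ᵐ ω ∂μ, ∀ N, _ := ae_all_iff.2 fun N => (h N).ae_bidLimits
  have h2 : ∀ᵐ ω ∂μ, ∀ N, _ := ae_all_iff.2 fun N => (h N).reflect.ae_bidLimits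
  filter_upwards [h1, h2] with ω h1 h2 N ε hε T hT
  have h3 := h2 N
  rw [(h N).bidThreshold_reflect] at h3
  exact eventually_goodState (h N).dens (h1 N) h3 hε hT

lemma BookModel.askThreshold_mem_Icc {P : ℝ → ℝ} {init : Book}
    (h : BookModel μ fa fb m M gap order P init) : askThreshold μ P init order ∈ Icc (0 : ℝ) 1 := by
  have := h.reflect.bidThreshold_mem
  rw [h.bidThreshold_reflect] at this
  exact ⟨by linarith [this.2], by linarith [this.1]⟩

variable {κb κa : ℝ} {A B : ℝ → ℝ}

/-- The thresholds of the binned books converge. -/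
theorem tendsto_thresholds (h : ∀ N, BookModel μ fa fb m M gap order (P N) (init N))
    (hsh : BinsShrink P) (hp : LimitPair fa fb κb κa A B) :
    Tendsto (fun N => bidThreshold μ (P N) (init N) order) atTop (𝓝 κb) ∧
      Tendsto (fun N => askThreshold μ (P N) (init N) order) atTop (𝓝 κa) := by
  have hgood : ∀ᵐ ω ∂μ, ∀ N, _ := ae_all_iff.2 fun N => (h N).exists_isGoodTimes
  -- The thresholds are deterministic, so a single path with the almost sure properties suffices.
  obtain ⟨ω, h1, h2⟩ := (hgood.and (ae_eventually_goodState h)).exists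
  have hex : ∀ N : ℕ, ∃ t, GoodState fa fb (P N) (init N) (fun i => gap i ω) (fun i => order i ω)
      (bidThreshold μ (P N) (init N) order) (askThreshold μ (P N) (init N) order) M
      (1 / ((N : ℝ) + 1)) (1 / ((N : ℝ) + 1) + 2 * M * mesh (P N)) t := fun N => by
    have hε : (0 : ℝ) < 1 / ((N : ℝ) + 1) := by positivity
    obtain ⟨T, hT⟩ := h1 N _ hε
    obtain ⟨n, hn⟩ := (h2 N _ hε T hT).exists
    exact ⟨T n, hn⟩
  choose t ht using hex
  exact (tendsto_of_goodState (h 0).dens hp (fun N => (h N).binned) hsh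
    (fun N => (h N).bidThreshold_mem) (fun N => (h N).askThreshold_mem_Icc)
    (fun N => (h N).cdf_bidThreshold) (fun N => by positivity)
    tendsto_one_div_add_atTop_nhds_zero_nat ht).1

/-- The empirical densities of the best bid and the best ask converge. -/
theorem ae_convergesTo (h : ∀ N, BookModel μ fa fb m M gap order (P N) (init N))
    (hsh : BinsShrink P) (hp : LimitPair fa fb κb κa A B) :
    ∀ᵐ ω ∂μ, ∀ T : ℕ → ℝ → ℕ → ℝ,
      (∀ N : ℕ, ∀ ε > 0,
        IsGoodTimes (P N) (init N) (fun i => gap i ω) (fun i => order i ω)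
          (bidThreshold μ (P N) (init N) order) (askThreshold μ (P N) (init N) order) M ε (T N ε)) →
      ConvergesTo (fun N ε n x => bidDensity (P N) (init N) (fun i => gap i ω)
          (fun i => order i ω) (T N ε n) x) (limitBid fa fb κb κa A) ∧
        ConvergesTo (fun N ε n x => askDensity (P N) (init N) (fun i => gap i ω)
          (fun i => order i ω) (T N ε n) x) (limitAsk fa fb κb κa B) := by
  filter_upwards [ae_eventually_goodState h] with ω hω T hT
  have hQ := fun N ε (hε : ε > 0) => hω N ε hε (T N ε) (hT N ε hε)
  have hseq := fun (N : ℕ → ℕ) (ε t : ℕ → ℝ) (hN : Tendsto N atTop atTop) (hε0 : ∀ i, 0 < ε i)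
      (hε : Tendsto ε atTop (𝓝 0))
      (hs : ∀ i, GoodState fa fb (P (N i)) (init (N i)) (fun i => gap i ω) (fun i => order i ω)
        (bidThreshold μ (P (N i)) (init (N i)) order)
        (askThreshold μ (P (N i)) (init (N i)) order) M (ε i)
        (ε i + 2 * M * mesh (P (N i))) (t i)) =>
    (tendsto_of_goodState (h 0).dens hp (fun i => (h (N i)).binned) (hsh.comp hN)
      (fun i => (h (N i)).bidThreshold_mem) (fun i => (h (N i)).askThreshold_mem_Icc)
      (fun i => (h (N i)).cdf_bidThreshold) hε0 hε hs).2
  exact ⟨convergesTo_of_sequences (fun N t => integrableOn_bidDensity (h N).binned t)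
      (hp.isDensityOn_bid (h 0).dens).integrable.integrableOn hQ
      fun N ε t hN hε0 hε hs => (hseq N ε t hN hε0 hε hs).1,
    convergesTo_of_sequences (fun N t => integrableOn_askDensity (h N).binned t)
      (hp.isDensityOn_ask (h 0).dens).integrable.integrableOn hQ
      fun N ε t hN hε0 hε hs => (hseq N ε t hN hε0 hε hs).2⟩

/-- The limits of the thresholds and of the empirical densities, for orders with prices which are
only almost surely in `(0,1)`. -/
theorem IsOrderFlow.convergence (hd : DensityPair fa fb m M)
    (hp : LimitPair fa fb κb κa A B) (hflow : IsOrderFlow μ fa fb gap order)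
    (hP : ∀ N, IsBinned (P N)) (hsh : BinsShrink P) (hinit : ∀ N, (init N).Admissible (P N)) :
    Tendsto (fun N => bidThreshold μ (P N) (init N) order) atTop (𝓝 κb) ∧
    Tendsto (fun N => askThreshold μ (P N) (init N) order) atTop (𝓝 κa) ∧
    ∀ᵐ ω ∂μ,
      (∀ N : ℕ, ∀ ε > 0, ∃ T : ℕ → ℝ,
        IsGoodTimes (P N) (init N) (fun i => gap i ω) (fun i => order i ω)
          (bidThreshold μ (P N) (init N) order) (askThreshold μ (P N) (init N) order) M ε T) ∧
      ∀ T : ℕ → ℝ → ℕ → ℝ,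
        (∀ N : ℕ, ∀ ε > 0,
          IsGoodTimes (P N) (init N) (fun i => gap i ω) (fun i => order i ω)
            (bidThreshold μ (P N) (init N) order) (askThreshold μ (P N) (init N) order) M ε
            (T N ε)) →
        (ConvergesTo (fun N ε n x => bidDensity (P N) (init N) (fun i => gap i ω)
            (fun i => order i ω) (T N ε n) x) (limitBid fa fb κb κa A) ∧
          ∀ ρ : ℝ → ℝ, IntegrableOn ρ (Ioo 0 1) →
            ConvergesTo (fun N ε n x => bidDensity (P N) (init N) (fun i => gap i ω)
              (fun i => order i ω) (T N ε n) x) ρ →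
            ∀ᵐ x, x ∈ Ioo (0 : ℝ) 1 → ρ x = limitBid fa fb κb κa A x) ∧
        (ConvergesTo (fun N ε n x => askDensity (P N) (init N) (fun i => gap i ω)
            (fun i => order i ω) (T N ε n) x) (limitAsk fa fb κb κa B) ∧
          ∀ ρ : ℝ → ℝ, IntegrableOn ρ (Ioo 0 1) →
            ConvergesTo (fun N ε n x => askDensity (P N) (init N) (fun i => gap i ω)
              (fun i => order i ω) (T N ε n) x) ρ →
            ∀ᵐ x, x ∈ Ioo (0 : ℝ) 1 → ρ x = limitAsk fa fb κb κa B x) := by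
  -- The book model requires prices in `(0,1)` on every path. Clamping changes the orders only on a
  -- null event, and hence neither the thresholds nor the almost sure statements.
  have hae : ∀ᵐ ω ∂μ, ∀ n, order n ω = clampOrder (order n ω) :=
    (hflow.ae_price_mem hd).mono fun ω hω n => (clampOrder_of_mem (hω n)).symm
  have hmodel : ∀ N, BookModel μ fa fb m M gap (fun n ω => clampOrder (order n ω)) (P N) (init N) :=
    fun N => ⟨hd, hflow.clamp hd, fun n ω => clampOrder_mem _, hP N, hinit N⟩
  simp only [bidThreshold_congr hae, askThreshold_congr hae]
  obtain ⟨h1, h2⟩ := tendsto_thresholds hmodel hsh hp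
  refine ⟨h1, h2, ?_⟩
  have hgood : ∀ᵐ ω ∂μ, ∀ N, _ := ae_all_iff.2 fun N => (hmodel N).exists_isGoodTimes
  filter_upwards [hae, hgood, ae_convergesTo hmodel hsh hp] with ω h3 h4 h5
  have e : (fun i => order i ω) = fun i => clampOrder (order i ω) := funext h3
  rw [e]
  refine ⟨h4, fun T hT => ?_⟩
  obtain ⟨h6, h7⟩ := h5 T hT
  exact ⟨⟨h6, fun ρ hρ hconv => hconv.ae_eq
      (fun N ε n => integrableOn_bidDensity (hP N) (T N ε n)) hρ
      (hp.isDensityOn_bid hd).integrable.integrableOn h6⟩,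
    ⟨h7, fun ρ hρ hconv => hconv.ae_eq
      (fun N ε n => integrableOn_askDensity (hP N) (T N ε n)) hρ
      (hp.isDensityOn_ask hd).integrable.integrableOn h7⟩⟩

end Sequences

end

end LOB
theorem mainTheorem5 (fa fb : ℝ → ℝ) (m M : ℝ) (hm : 0 < m)
    (hfa : LOB.IsPriceDensity fa m M) (hfb : LOB.IsPriceDensity fb m M) :
    ∃ (κb κa : ℝ) (πb πa ϖb ϖa : ℝ → ℝ),
      -- the limits, their normalizations, and the thresholds
      (0 < κb ∧ κb < κa ∧ κa < 1) ∧
      LOB.IsDensityOn κb κa πb ∧ LOB.IsDensityOn κb κa πa ∧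
      (ϖb = fun x => πb x / fb x) ∧ (ϖa = fun x => πa x / fa x) ∧
      -- the binned order books converge
      (∀ (Ω : Type*) [MeasurableSpace Ω] (μ : MeasureTheory.Measure Ω)
        [MeasureTheory.IsProbabilityMeasure μ]
        (gap : ℕ → Ω → ℝ) (order : ℕ → Ω → LOB.Order)
        (P : ℕ → ℝ → ℝ) (init : ℕ → LOB.Book),
        LOB.IsOrderFlow μ fa fb gap order →
        (∀ N, LOB.IsBinned (P N)) → LOB.BinsShrink P →
        (∀ N, (init N).Admissible (P N)) →
        -- convergence of the thresholds of the binned books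
        Filter.Tendsto (fun N => LOB.bidThreshold μ (P N) (init N) order)
          Filter.atTop (nhds κb) ∧
        Filter.Tendsto (fun N => LOB.askThreshold μ (P N) (init N) order)
          Filter.atTop (nhds κa) ∧
        ∀ᵐ ω ∂μ,
          -- there are such times
          (∀ N : ℕ, ∀ ε > 0, ∃ T : ℕ → ℝ,
            LOB.IsGoodTimes (P N) (init N) (fun i => gap i ω) (fun i => order i ω)
              (LOB.bidThreshold μ (P N) (init N) order)
              (LOB.askThreshold μ (P N) (init N) order) M ε T) ∧
          -- along all such times the empirical densities have a unique limit
          ∀ T : ℕ → ℝ → ℕ → ℝ,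
            (∀ N : ℕ, ∀ ε > 0,
              LOB.IsGoodTimes (P N) (init N) (fun i => gap i ω) (fun i => order i ω)
                (LOB.bidThreshold μ (P N) (init N) order)
                (LOB.askThreshold μ (P N) (init N) order) M ε (T N ε)) →
            (LOB.ConvergesTo (fun N ε n x => LOB.bidDensity (P N) (init N)
                (fun i => gap i ω) (fun i => order i ω) (T N ε n) x) πb ∧
              ∀ ρ : ℝ → ℝ, MeasureTheory.IntegrableOn ρ (Set.Ioo 0 1) →
                LOB.ConvergesTo (fun N ε n x => LOB.bidDensity (P N) (init N)
                  (fun i => gap i ω) (fun i => order i ω) (T N ε n) x) ρ →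
                ∀ᵐ x, x ∈ Set.Ioo (0 : ℝ) 1 → ρ x = πb x) ∧
            (LOB.ConvergesTo (fun N ε n x => LOB.askDensity (P N) (init N)
                (fun i => gap i ω) (fun i => order i ω) (T N ε n) x) πa ∧
              ∀ ρ : ℝ → ℝ, MeasureTheory.IntegrableOn ρ (Set.Ioo 0 1) →
                LOB.ConvergesTo (fun N ε n x => LOB.askDensity (P N) (init N)
                  (fun i => gap i ω) (fun i => order i ω) (T N ε n) x) ρ →
                ∀ᵐ x, x ∈ Set.Ioo (0 : ℝ) 1 → ρ x = πa x)) ∧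
      -- the integral equations
      LOB.BalanceEquations fa fb κb κa ϖb ϖa ∧
      -- the differential equations, in the Carathéodory sense, with their boundary conditions
      LOB.IsBidSolution fa fb κb κa ϖb ∧ LOB.IsAskSolution fa fb κb κa ϖa ∧
      -- the differential equations, classically
      (∀ x ∈ Set.Ioo κb κa, (∀ᶠ y in nhds x, HasDerivAt (LOB.cdf fa) (fa y) y) →
        HasDerivAt (LOB.cdf fb) (fb x) x → LOB.BidODEAt fa fb ϖb x) ∧
      (∀ x ∈ Set.Ioo κb κa, (∀ᶠ y in nhds x, HasDerivAt (LOB.cdf fb) (fb y) y) →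
        HasDerivAt (LOB.cdf fa) (fa x) x → LOB.AskODEAt fa fb ϖa x) ∧
      -- uniqueness of the solutions and of the thresholds
      (∀ (κb' κa' : ℝ) (w : ℝ → ℝ), 0 ≤ κb' → κb' < κa' → κa' ≤ 1 →
        LOB.IsBidSolution fa fb κb' κa' w →
        κb' = κb ∧ κa' = κa ∧ Set.EqOn w ϖb (Set.Ioo κb κa)) ∧
      (∀ (κb' κa' : ℝ) (w : ℝ → ℝ), 0 ≤ κb' → κb' < κa' → κa' ≤ 1 →
        LOB.IsAskSolution fa fb κb' κa' w →
        κb' = κb ∧ κa' = κa ∧ Set.EqOn w ϖa (Set.Ioo κb κa)) := by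
  have h : LOB.DensityPair fa fb m M := ⟨hm, hfa, hfb⟩
  -- The limits are constructed from the densities alone, before any book is considered, and so do
  -- not depend on the books.
  obtain ⟨κb, κa, A, B, hp⟩ := h.exists_limitPair
  refine ⟨κb, κa, LOB.limitBid fa fb κb κa A, LOB.limitAsk fa fb κb κa B, _, _,
    ⟨(hp.Icc_subset h hp.left_mem).1, hp.lt, (hp.Icc_subset h hp.right_mem).2⟩,
    hp.isDensityOn_bid h, hp.isDensityOn_ask h, rfl, rfl, ?_, hp.balanceEquations h,
    hp.isBidSolution h, hp.isAskSolution h, fun x hx => hp.bidODEAt h hx,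
    fun x hx => hp.askODEAt h hx, fun κb' κa' w => hp.bid_unique h, fun κb' κa' w => hp.ask_unique h⟩
  intro Ω _ μ _ gap order P init hflow hP hsh hinit
  exact hflow.convergence h hp hP hsh hinit
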